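/- **Setting.** Let $N\ge 2$ and $r\ge N+2$ be integers, $r^*=r-1$, $0<x<1$, $0<c<1$. Put $[a]_x=\frac{x^a-x^{-a}}{x-x^{-1}}$, $[a]_x^+=x^a+x^{-a}$, $\theta_m(y)=y$ for even $m$ and $\theta_m(y)=0$ for odd $m$, $(z;q)_\infty=\prod_{i\ge0}(1-q^iz)$, $(z;q_1,q_2)_\infty=\prod_{i,j\ge 0}(1-q_1^iq_2^jz)$, $$[z]_\infty=(z;x^{2N},x^{2r})_\infty,\quad [z]^*_\infty=(z;x^{2N},x^{2r^*})_\infty,\quad \{z\}_\infty=(z;x^{4N},x^{2r})_\infty,\quad \{z\}^*_\infty=(z;x^{4N},x^{2r^*})_\infty .$$ Let $\epsilon_1,\dots,\epsilon_N$ be the standard orthonormal basis of $\mathbb R^N$, $\bar\epsilon_\mu=\epsilon_\mu-\frac1N\sum_\nu\epsilon_\nu$, $\omega_\mu=\bar\epsilon_1+\dots+\bar\epsilon_\mu$, $\rho=\sum_{\mu=1}^{N-1}\omega_\mu$, and let $k=a+\rho$ where $a=\sum_{\mu=1}^{N-1} n_\mu\omega_\mu$ with integers $n_\mu\ge0$,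 $\sum_\mu n_\mu\le r-1-N$. Let $\pi_{\mu,\nu}$ be the value on $\mathcal F_{k,k}$ of the zero-mode operator $\pi_{\mu,\nu}=\sqrt{r(r-1)}\,(P_{\bar\epsilon_\mu}-P_{\bar\epsilon_\nu})$, where $P_\alpha$ acts on $\mathcal F_{l,k}$ as the scalar $\bigl(\alpha\,\big|\,\sqrt{\tfrac{r}{r-1}}\,l-\sqrt{\tfrac{r-1}{r}}\,k\bigr)$; thus $\pi_{\mu,\nu}=(\epsilon_\mu-\epsilon_\nu|k)$. **Bosons.** For $m,n\ne0$ and $1\le j,k\le N-1$ let $$[\beta_m^j,\beta_n^k]=\delta_{m+n,0}\,m\,\frac{[(r-1)m]_x}{[rm]_x}\times\begin{cases}\dfrac{[(N-1)m]_x}{[Nm]_x}& j=k,\\[2mm] -x^{Nm\,\mathrm{sgn}(j-k)}\dfrac{[m]_x}{[Nm]_x}& j\ne k,\end{cases}$$ define $\beta_m^N$ by $\sum_{j=1}^Nx^{-2jm}\beta_m^j=0$, and put $\alpha_m^j=x^{-jm}(\beta_m^j-\beta_m^{j+1})$. The Fock space $\mathcal F_{k,k}=\mathbb C[\beta_{-m}^j\,;\,m\ge1,1\le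 j\le N-1]\,|k,k\rangle$ has vacuum $|k,k\rangle$ killed by all $\beta_m^j$, $m>0$, and dual vacuum $\langle k,k|$ with $\langle k,k|\beta^j_{-m}=0$ $(m>0)$, $\langle k,k|k,k\rangle=1$. With $I_{j,l}(m)=I_{l,j}(m)=\frac{[jm]_x[(N-l)m]_x}{[m]_x[Nm]_x}$ for $j\le l$, let $$F=-\tfrac12\sum_{m>0}\sum_{j,l=1}^{N-1}\tfrac1m\tfrac{[rm]_x}{[(r-1)m]_x}I_{j,l}(m)\alpha_{-m}^j\alpha_{-m}^l+\sum_{m>0}\sum_{j=1}^{N-1}\tfrac1mD_j(m)\beta_{-m}^j,$$ $$G=-\tfrac12\sum_{m>0}\sum_{j,l=1}^{N-1}\tfrac{x^{2Nm}}m\tfrac{[rm]_x}{[(r-1)m]_x}I_{j,l}(m)\alpha_{m}^j\alpha_{m}^l+\sum_{m>0}\sum_{j=1}^{N-1}\tfrac1mE_j(m)\beta_{m}^j,$$ $$\begin{aligned}D_j(m)=&-\theta_m\Bigl(\tfrac{[(N-j)m/2]_x[rm/2]_x^+x^{(3j-N-1)m/2}}{[(r-1)m/2]_x}\Bigr)+\tfrac{x^{(j-1)m}[(-r+2\pi_{1,j}+2c-j+2)m]_x}{[(r-1)m]_x}\\&+\tfrac{[m]_xx^{(r-2c+2j-2)m}}{[(r-1)m]_x}\sum_{l=j+1}^{N-1}x^{-2m\pi_{1,l}}+\tfrac{x^{(2j-N)m}[(r-2\pi_{1,N}-2c+N-1)m]_x}{[(r-1)m]_x},\\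 E_j(m)=&\;\theta_m\Bigl(\tfrac{[(N-j)m/2]_x[rm/2]_x^+x^{(3N+1-3j)m/2}}{[(r-1)m/2]_x}\Bigr)-\tfrac{x^{(N+1-j)m}[(r-2c+N-j-2\pi_{1,j})m]_x}{[(r-1)m]_x}\\&-\tfrac{[m]_xx^{(r-2c+2N-2j)m}}{[(r-1)m]_x}\sum_{l=j+1}^{N-1}x^{-2m\pi_{1,l}}-\tfrac{x^{2(N-j)m}[(-r+2c+1+2\pi_{1,N})m]_x}{[(r-1)m]_x}.\end{aligned}$$ The boundary states are $|k\rangle_B=e^F|k,k\rangle$ and ${}_B\langle k|=\langle k,k|e^G$, and ${}_B\langle k|k\rangle_B=\langle k,k|e^Ge^F|k,k\rangle$ means the sum over $d=0,1,2,\dots$ of the contributions $\langle k,k|e^G\Pi_de^F|k,k\rangle$ of the subspaces of energy $d$ ($\beta_{-m}^j$ has energy $m$, $\Pi_d$ is the projection). Each contribution involves only finitely many modes and finitely many terms of the exponential series. **Theorem 3 (norm of the boundary state).** The sum defining ${}_B\langle k|k\rangle_B$ converges absolutely, and $$\begin{aligned} {}_B\langle k|k\rangle_B=\;&\frac{1}{(x^{2N};x^{2N})_\infty^{\frac{N-1}2}}\prod_{i=1}^{N-1}\left(\frac{\sqrt{(x^{4N-2-2i};x^{4N})_\infty(x^{4N+2-2i};x^{4N})_\infty}}{(x^{4N-2i};x^{4N})_\infty}\right)^{i(N-i)}\\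 &\times\prod_{i=1}^{N-1}\left(\frac{\{x^{4N-2-2i}\}^*_\infty\{x^{4N+2-2i}\}_\infty}{\{x^{4N+2-2i}\}^*_\infty\{x^{4N-2-2i}\}_\infty}\right)^{i(N-i)}\prod_{i=1}^N\prod_{j=1}^{N-i}\frac{[x^{-2+2i+2j}]^*_\infty}{[x^{-2+2i+2j}]_\infty}\prod_{i=1}^N\prod_{j=1}^{i-1}\frac{[x^{2N-2i+2j}]^*_\infty}{[x^{2N-2i+2j}]_\infty}\\ &\times\prod_{1\le i<j\le N}\frac{[x^{4c+2\pi_{1,i}+2\pi_{1,j}}]^*_\infty}{[x^{4c+2+2\pi_{1,i}+2\pi_{1,j}}]_\infty}\,\frac{1}{Q(2r-4c+2N-2-2\pi_{1,i}-2\pi_{1,j})}\,Q(2N+2\pi_{j,i})\,Q(2N+2\pi_{i,j})\\ &\times\prod_{i=1}^N\Bigl(\prod_{j=1}^{N-i}S_{i,j}\prod_{j=1}^{i-1}S_{i,j}\Bigr)\times\prod_{i=1}^{N-1}\prod_{j=1}^{i}\prod_{k=1}^{N-i}U_{i,j,k}V_{i,j,k}, \end{aligned}$$ where $Q(e)=[x^e]_\infty/[x^e]^*_\infty$,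 $R(e)=\{x^e\}_\infty/\{x^e\}^*_\infty$, $$S_{i,j}=\sqrt{Q(-2r+4c+2+2j+4\pi_{1,i})\,Q(2r-4c+2N-2+2j-4\pi_{1,i})},$$ $$U_{i,j,k}=\sqrt{\frac{R(4N+2r-4c-2+2i-2j-2k-4\pi_{1,i})\,R(2N-2r+4c+2+2i-2j-2k+4\pi_{1,i})}{R(4N+2r-4c+2+2i-2j-2k-4\pi_{1,i+1})\,R(2N-2r+4c+6+2i-2j-2k+4\pi_{1,i+1})}},$$ $$V_{i,j,k}=\sqrt{\frac{R(4N-2r+4c+2-2i-2j-2k+4\pi_{1,i+1})\,R(6N+2r-4c-2-2i-2j-2k-4\pi_{1,i+1})}{R(4N-2r+4c+6-2i-2j-2k+4\pi_{1,i})\,R(6N+2r-4c+2-2i-2j-2k-4\pi_{1,i})}}.$$ Here, where $[x^e]^*_\infty=0$ (respectively $\{x^e\}^*_\infty=0$), the quotient $Q(e)$ (respectively $R(e)$) is read with the common factor $(x^e;x^{2N})_\infty$ (respectively $(x^e;x^{4N})_\infty$) of numerator and denominator cancelled, i.e. as $[x^{e+2r}]_\infty/[x^{e+2r^*}]^*_\infty$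 (respectively $\{x^{e+2r}\}_\infty/\{x^{e+2r^*}\}^*_\infty$). -/

import Mathlib

open Finset Filter

noncomputable section

namespace BoundaryFace

/-! ### Notation -/

/-- The `q`-number `[a]_x = (x^a - x^{-a}) / (x - x^{-1})`. -/
def qnum (x a : ℝ) : ℝ := (x ^ a - x ^ (-a)) / (x - x⁻¹)

/-- The symbol `[a]_x^+ = x^a + x^{-a}`. -/
def qplus (x a : ℝ) : ℝ := x ^ a + x ^ (-a)

/-- `θ_m(y)`: equal to `y` for even `m` and to `0` for odd `m`. -/
def theta (m : ℕ) (y : ℝ) : ℝ := if Even m then y else 0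

/-- `(z; q)_∞ = ∏_{i ≥ 0} (1 - q^i z)`. -/
def poch (z q : ℝ) : ℝ := ∏' i : ℕ, (1 - q ^ i * z)

/-- `(z; q₁, q₂)_∞ = ∏_{i, j ≥ 0} (1 - q₁^i q₂^j z)`. -/
def poch₂ (z q₁ q₂ : ℝ) : ℝ := ∏' i : ℕ × ℕ, (1 - q₁ ^ i.1 * q₂ ^ i.2 * z)

/-! ### Weights of type `A_{N-1}`

Vectors of `ℝ^N` are written as functions on `ℕ`, of which only the coordinates `1, …, N` matter. -/

/-- The standard inner product of `ℝ^N`. -/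
def ip (N : ℕ) (u v : ℕ → ℝ) : ℝ := ∑ ν ∈ Icc 1 N, u ν * v ν

/-- The orthonormal basis vector `ε_μ`. -/
def eps (μ : ℕ) : ℕ → ℝ := Pi.single μ 1

/-- `ε̄_μ = ε_μ - (1/N) ∑_ν ε_ν`. -/
def epsBar (N μ : ℕ) : ℕ → ℝ := eps μ - (1 / (N : ℝ)) • ∑ ν ∈ Icc 1 N, eps ν

/-- The fundamental weight `ω_μ = ε̄_1 + ⋯ + ε̄_μ`. -/
def omega (N μ : ℕ) : ℕ → ℝ := ∑ ν ∈ Icc 1 μ, epsBar N ν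

/-- `ρ = ω_1 + ⋯ + ω_{N-1}`. -/
def rho (N : ℕ) : ℕ → ℝ := ∑ μ ∈ Icc 1 (N - 1), omega N μ

/-- The restricted dominant weights `P⁺_{s-N}`: all `∑ c_μ ω_μ` with integers `c_μ ≥ 0`,
`∑ c_μ ≤ s - N`. -/
def restrictedWeights (N s : ℕ) : Set (ℕ → ℝ) :=
  {a | ∃ n : ℕ → ℕ, (∑ μ ∈ Icc 1 (N - 1), n μ) + N ≤ s ∧
    a = ∑ μ ∈ Icc 1 (N - 1), (n μ : ℝ) • omega N μ}

/-- The eigenvalue of the zero mode `P_α` on `F_{l,k}`. -/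
def momentum (N r : ℕ) (l k α : ℕ → ℝ) : ℝ :=
  ip N α (√((r : ℝ) / ((r : ℝ) - 1)) • l - √(((r : ℝ) - 1) / (r : ℝ)) • k)

/-- The value of `π_{μ,ν} = √(r(r-1)) (P_{ε̄_μ} - P_{ε̄_ν})` on `F_{l,k}`. -/
def piVal (N r : ℕ) (l k : ℕ → ℝ) (μ ν : ℕ) : ℝ :=
  √((r : ℝ) * ((r : ℝ) - 1)) * momentum N r l k (epsBar N μ)
    - √((r : ℝ) * ((r : ℝ) - 1)) * momentum N r l k (epsBar N ν)

/-! ### The bosonic Fock space -/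

/-- Labels `(m, j)` of the creation operators `β_{-m}^j`, `m ≥ 1`, `1 ≤ j ≤ N - 1`. -/
abbrev Mode (N : ℕ) : Type := {p : ℕ × ℕ // 1 ≤ p.1 ∧ 1 ≤ p.2 ∧ p.2 < N}

/-- The Fock space `F_{l,k} = ℂ[β_{-m}^j] |l,k⟩`; the vacuum is `1`. The labels `l, k` enter only
through the values of the zero modes. -/
abbrev Fock (N : ℕ) : Type := MvPolynomial (Mode N) ℂ

/-- The scalar in `[β_m^j, β_n^k] = commCoef · δ_{m+n,0}`. -/
def commCoef (N r : ℕ) (x : ℝ) (m : ℤ) (j k : ℕ) : ℝ :=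
  if j = k then
    m * (qnum x ((r - 1) * m) / qnum x (r * m)) * (qnum x ((N - 1) * m) / qnum x (N * m))
  else
    -(m * x ^ ((N : ℝ) * m * (Int.sign ((j : ℤ) - (k : ℤ)) : ℝ)) *
      (qnum x ((r - 1) * m) / qnum x (r * m)) * (qnum x m / qnum x (N * m)))

/-- `β_n^j` for `1 ≤ j ≤ N - 1`, `n ≠ 0`: multiplication by the variable `β_n^j` if `n < 0`,
and, if `n > 0`, the derivation that kills the vacuum and sends the variable `β_{-m}^k` to
`[β_n^j, β_{-m}^k]`. -/
def betaGen (N r : ℕ) (x : ℝ) (n : ℤ) (j : ℕ) : Module.End ℂ (Fock N) :=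
  if h : n < 0 ∧ 1 ≤ j ∧ j < N then
    LinearMap.mulLeft ℂ (MvPolynomial.X ⟨(n.natAbs, j), by simp; omega⟩)
  else if 0 < n ∧ 1 ≤ j ∧ j < N then
    (MvPolynomial.mkDerivation ℂ (fun q : Mode N =>
      if (q.1.1 : ℤ) = n then (MvPolynomial.C ((commCoef N r x n j q.1.2 : ℝ) : ℂ) : Fock N)
      else 0) : Derivation ℂ (Fock N) (Fock N))
  else 0

/-- `β_n^j` for `1 ≤ j ≤ N`, where `β_n^N` is determined by `∑_{j=1}^N x^{-2jn} β_n^j = 0`. -/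
def beta (N r : ℕ) (x : ℝ) (n : ℤ) (j : ℕ) : Module.End ℂ (Fock N) :=
  if j = N then
    -(((x ^ (2 * (N : ℝ) * n) : ℝ) : ℂ) •
      ∑ i ∈ Icc 1 (N - 1), ((x ^ (-(2 * (i : ℝ) * n)) : ℝ) : ℂ) • betaGen N r x n i)
  else betaGen N r x n j

/-- `α_n^j = x^{-jn} (β_n^j - β_n^{j+1})`. -/
def alpha (N r : ℕ) (x : ℝ) (n : ℤ) (j : ℕ) : Module.End ℂ (Fock N) :=
  ((x ^ (-((j : ℝ) * n)) : ℝ) : ℂ) • (beta N r x n j - beta N r x n (j + 1))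

/-- `I_{j,k}(m) = [jm]_x [(N-k)m]_x / ([m]_x [Nm]_x)` for `j ≤ k`, symmetric in `j, k`. -/
def invCartan (N : ℕ) (x : ℝ) (m j k : ℕ) : ℝ :=
  qnum x ((min j k : ℕ) * m) * qnum x ((N - (max j k : ℕ)) * m) / (qnum x m * qnum x (N * m))

/-! ### The boundary state and its dual

In the rest, `p j` stands for the value of `π_{1,j}`. -/

/-- The coefficient `D_j(m)`. -/
def coefD (N r : ℕ) (x c : ℝ) (p : ℕ → ℝ) (j m : ℕ) : ℝ :=
  -theta m (qnum x ((N - j) * m / 2) * qplus x (r * m / 2) * x ^ ((3 * j - N - 1) * m / 2 : ℝ)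
      / qnum x ((r - 1) * m / 2))
  + x ^ (((j : ℝ) - 1) * m) * qnum x ((-r + 2 * p j + 2 * c - j + 2) * m) / qnum x ((r - 1) * m)
  + qnum x m * x ^ ((r - 2 * c + 2 * j - 2) * m) / qnum x ((r - 1) * m)
      * ∑ k ∈ Icc (j + 1) (N - 1), x ^ (-(2 * m * p k))
  + x ^ ((2 * (j : ℝ) - N) * m) * qnum x ((r - 2 * p N - 2 * c + N - 1) * m)
      / qnum x ((r - 1) * m)

/-- The coefficient `E_j(m)`. -/
def coefE (N r : ℕ) (x c : ℝ) (p : ℕ → ℝ) (j m : ℕ) : ℝ :=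
  theta m (qnum x ((N - j) * m / 2) * qplus x (r * m / 2) * x ^ ((3 * N + 1 - 3 * j) * m / 2 : ℝ)
      / qnum x ((r - 1) * m / 2))
  - x ^ (((N : ℝ) + 1 - j) * m) * qnum x ((r - 2 * c + N - j - 2 * p j) * m)
      / qnum x ((r - 1) * m)
  - qnum x m * x ^ ((r - 2 * c + 2 * N - 2 * j) * m) / qnum x ((r - 1) * m)
      * ∑ k ∈ Icc (j + 1) (N - 1), x ^ (-(2 * m * p k))
  - x ^ (2 * ((N : ℝ) - j) * m) * qnum x ((-r + 2 * c + 1 + 2 * p N) * m) / qnum x ((r - 1) * m)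

/-- The part of `F` in the modes `1 ≤ m ≤ M`. -/
def opF (N r : ℕ) (x c : ℝ) (p : ℕ → ℝ) (M : ℕ) : Module.End ℂ (Fock N) :=
  (-(1 / 2) : ℂ) • (∑ m ∈ Icc 1 M, ∑ j ∈ Icc 1 (N - 1), ∑ k ∈ Icc 1 (N - 1),
    ((1 / m * (qnum x (r * m) / qnum x ((r - 1) * m)) * invCartan N x m j k : ℝ) : ℂ) •
      (alpha N r x (-(m : ℤ)) j * alpha N r x (-(m : ℤ)) k))
  + ∑ m ∈ Icc 1 M, ∑ j ∈ Icc 1 (N - 1),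
    ((1 / m * coefD N r x c p j m : ℝ) : ℂ) • beta N r x (-(m : ℤ)) j

/-- The part of `G` in the modes `1 ≤ m ≤ M`. -/
def opG (N r : ℕ) (x c : ℝ) (p : ℕ → ℝ) (M : ℕ) : Module.End ℂ (Fock N) :=
  (-(1 / 2) : ℂ) • (∑ m ∈ Icc 1 M, ∑ j ∈ Icc 1 (N - 1), ∑ k ∈ Icc 1 (N - 1),
    ((x ^ (2 * (N : ℝ) * m) / m * (qnum x (r * m) / qnum x ((r - 1) * m)) * invCartan N x m j k :
        ℝ) : ℂ) •
      (alpha N r x (m : ℤ) j * alpha N r x (m : ℤ) k))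
  + ∑ m ∈ Icc 1 M, ∑ j ∈ Icc 1 (N - 1),
    ((1 / m * coefE N r x c p j m : ℝ) : ℂ) • beta N r x (m : ℤ) j

/-- The partial sum `∑_{n ≤ K} T^n / n!` of the exponential of an operator. -/
def expPartial {N : ℕ} (K : ℕ) (T : Module.End ℂ (Fock N)) : Module.End ℂ (Fock N) :=
  ∑ n ∈ range (K + 1), ((Nat.factorial n : ℂ)⁻¹) • T ^ n

/-- The projection of the Fock space onto its subspace of energy `d`, where `β_{-m}^j` has
energy `m`. -/
def level (N d : ℕ) : Module.End ℂ (Fock N) :=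
  MvPolynomial.weightedHomogeneousComponent (fun q : Mode N => q.1.1) d

/-- The dual vacuum `⟨l,k|`: it is `1` on the vacuum and vanishes on the range of every
`β_{-m}^j`, `m > 0`. -/
def dualVacuum (N : ℕ) : Fock N → ℂ := fun v => MvPolynomial.constantCoeff v

/-- `⟨k,k| e^G Π_d e^F |k,k⟩`, with `Π_d` the projection on energy `d`, where `F` and `G` are cut
off at the mode `M` and the exponential series at the order `K`. -/
def levelPairing (N r : ℕ) (x c : ℝ) (p : ℕ → ℝ) (M K d : ℕ) : ℂ :=
  dualVacuum N (expPartial K (opG N r x c p M)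
    (level N d (expPartial K (opF N r x c p M) 1)))

/-- `⟨k,k| e^G e^F |k,k⟩ = S`. In each energy `d` the contribution `L d` is the value at which the
cut-off matrix elements become stationary as both cut-offs grow, and the sum over all energies
converges (absolutely) to `S`. -/
def HasNorm (N r : ℕ) (x c : ℝ) (p : ℕ → ℝ) (S : ℂ) : Prop :=
  ∃ L : ℕ → ℂ,
    (∀ d, ∀ᶠ MK : ℕ × ℕ in atTop, levelPairing N r x c p MK.1 MK.2 d = L d) ∧ HasSum L S

/-! ### The double infinite products -/

/-- `(x^e; x^{2N}, x^{2s})_∞`: this is `[x^e]_∞` for `s = r` and `[x^e]_∞^*` for `s = r - 1`. -/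
def sq (N : ℕ) (x s e : ℝ) : ℝ := poch₂ (x ^ e) (x ^ (2 * (N : ℝ))) (x ^ (2 * s))

/-- `(x^e; x^{4N}, x^{2s})_∞`: this is `{x^e}_∞` for `s = r` and `{x^e}_∞^*` for `s = r - 1`. -/
def cu (N : ℕ) (x s e : ℝ) : ℝ := poch₂ (x ^ e) (x ^ (4 * (N : ℝ))) (x ^ (2 * s))

/-- The quotient `[z]_∞ / [z]_∞^*` at `z = x^e`. Both products contain the factor
`(z; x^{2N})_∞`; where the denominator vanishes, the quotient is read with that common factor
cancelled, `[x^{2r} z]_∞ / [x^{2r-2} z]_∞^*`. -/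
def sqQuot (N r : ℕ) (x e : ℝ) : ℝ :=
  if sq N x (r - 1) e = 0 then sq N x r (e + 2 * r) / sq N x (r - 1) (e + 2 * (r - 1))
  else sq N x r e / sq N x (r - 1) e

/-- The quotient `{z}_∞ / {z}_∞^*` at `z = x^e`, with the same convention (the common factor is
`(z; x^{4N})_∞`). -/
def cuQuot (N r : ℕ) (x e : ℝ) : ℝ :=
  if cu N x (r - 1) e = 0 then cu N x r (e + 2 * r) / cu N x (r - 1) (e + 2 * (r - 1))
  else cu N x r e / cu N x (r - 1) e

/-- The product formula for the norm. -/
def normProduct (N r : ℕ) (x c : ℝ) (p : ℕ → ℝ) : ℝ :=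
  1 / poch (x ^ (2 * (N : ℝ))) (x ^ (2 * (N : ℝ))) ^ (((N : ℝ) - 1) / 2)
  * (∏ i ∈ Icc 1 (N - 1),
      (√(poch (x ^ (4 * N - 2 - 2 * i : ℝ)) (x ^ (4 * (N : ℝ)))
          * poch (x ^ (4 * N + 2 - 2 * i : ℝ)) (x ^ (4 * (N : ℝ))))
        / poch (x ^ (4 * N - 2 * i : ℝ)) (x ^ (4 * (N : ℝ)))) ^ (i * (N - i)))
  * (∏ i ∈ Icc 1 (N - 1),
      (cu N x (r - 1) (4 * N - 2 - 2 * i) * cu N x r (4 * N + 2 - 2 * i)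
        / (cu N x (r - 1) (4 * N + 2 - 2 * i) * cu N x r (4 * N - 2 - 2 * i))) ^ (i * (N - i)))
  * (∏ i ∈ Icc 1 N, ∏ j ∈ Icc 1 (N - i),
      sq N x (r - 1) (-2 + 2 * i + 2 * j) / sq N x r (-2 + 2 * i + 2 * j))
  * (∏ i ∈ Icc 1 N, ∏ j ∈ Icc 1 (i - 1),
      sq N x (r - 1) (2 * N - 2 * i + 2 * j) / sq N x r (2 * N - 2 * i + 2 * j))
  * (∏ i ∈ Icc 1 N, ∏ j ∈ Icc (i + 1) N,
      sq N x (r - 1) (4 * c + 2 * p i + 2 * p j) / sq N x r (4 * c + 2 + 2 * p i + 2 * p j)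
        * (sqQuot N r x (2 * r - 4 * c + 2 * N - 2 - 2 * p i - 2 * p j))⁻¹
        * sqQuot N r x (2 * N + 2 * (p i - p j)) * sqQuot N r x (2 * N + 2 * (p j - p i)))
  * (∏ i ∈ Icc 1 N, ∏ j ∈ Icc 1 (N - i),
      √(sqQuot N r x (-2 * r + 4 * c + 2 + 2 * j + 4 * p i)
        * sqQuot N r x (2 * r - 4 * c + 2 * N - 2 + 2 * j - 4 * p i)))
  * (∏ i ∈ Icc 1 N, ∏ j ∈ Icc 1 (i - 1),
      √(sqQuot N r x (-2 * r + 4 * c + 2 + 2 * j + 4 * p i)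
        * sqQuot N r x (2 * r - 4 * c + 2 * N - 2 + 2 * j - 4 * p i)))
  * (∏ i ∈ Icc 1 (N - 1), ∏ j ∈ Icc 1 i, ∏ k ∈ Icc 1 (N - i),
      √(cuQuot N r x (4 * N + 2 * r - 4 * c - 2 + 2 * i - 2 * j - 2 * k - 4 * p i)
          * cuQuot N r x (2 * N - 2 * r + 4 * c + 2 + 2 * i - 2 * j - 2 * k + 4 * p i)
        / (cuQuot N r x (4 * N + 2 * r - 4 * c + 2 + 2 * i - 2 * j - 2 * k - 4 * p (i + 1))
          * cuQuot N r x (2 * N - 2 * r + 4 * c + 6 + 2 * i - 2 * j - 2 * k + 4 * p (i + 1))))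
      * √(cuQuot N r x (4 * N - 2 * r + 4 * c + 2 - 2 * i - 2 * j - 2 * k + 4 * p (i + 1))
          * cuQuot N r x (6 * N + 2 * r - 4 * c - 2 - 2 * i - 2 * j - 2 * k - 4 * p (i + 1))
        / (cuQuot N r x (4 * N - 2 * r + 4 * c + 6 - 2 * i - 2 * j - 2 * k + 4 * p i)
          * cuQuot N r x (6 * N + 2 * r - 4 * c + 2 - 2 * i - 2 * j - 2 * k - 4 * p i))))

end BoundaryFace

end

open Finset Filter

noncomputable section

namespace BoundaryFace

/-! `F` and `G` are quadratic plus linear in free bosons and modes of different energy commute, so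
the norm is a product of finite-dimensional Gaussian pairings, one for each energy m, and its
logarithm is a sum over m.

Put q = x^m. The commutator matrix of α_m^j with α_{-m}^k is B = κ C, with κ = m[(r-1)m]/[rm] and C
the q-Cartan matrix of type A_{N-1} (`annihAlpha_createAlpha`). The quadratic parts of `F` and `G`
are -J/2 and -γJ/2 with γ = q^{2N} and J = B⁻¹ (`sum_qCartan_invCartan`). If y and z are the
coefficients of the linear parts with respect to the α's, the energy m contributes (1-γ)^{-(N-1)/2}
exp((B(y,z) - (γ B(y,y) + B(z,z))/2) / (1-γ)). The norm is defined energy by energy, so this is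
proved as an identity of formal power series in a variable X that counts the energy
(`coeffwise_expSeries_gaussExponent`): commuting the creation operators through the dual state gives
linear equations for the first and second moments, and these turn into a differential equation for
the pairing. Summing over all energies is evaluation at X = 1, which is multiplicative and
continuous for the ℓ¹-norm of the coefficients and hence commutes with exp (`hasSum_expSeries_sum`).

What remains is to recognise the sum over m as the logarithm of the product. The determinants give
the power of (x^{2N}; x^{2N})_∞. The coefficients D_j and E_j refer to the β's, which satisfy one
linear relation; passing to the α's means solving a first-order recursion, and on its solutions
(`cartanVec`) the Cartan form is explicit. With a_j = q^{r-2c-2π_{1,j}} and b_j = 1/a_j, the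
exponent without the θ-terms becomes a sum of monomials in q, a, b times (1/m)(1/(1-q^{2r}) -
1/(1-q^{2r-2}))/(1-q^{2N}) (`pairingForm_state_eq`). Since log (z; p, s)_∞ = -∑
z^m/(m(1-p^m)(1-s^m)), each monomial is the m-th term of the logarithm of a quotient of [·]_∞ and
[·]_∞^*.

The θ-terms occur for m = 2k only and are computed in the base Q = x^k, where 1-γ becomes 1-Q^{4N};
this is the origin of the products {·}_∞. Their cross terms with the rest are rearranged by partial
summation into sums over rectangles j ≤ i, k ≤ N-i (`sum_rectSum_mul`), which are the factors U and
V. The pairing of the θ-part with itself splits by [r]^+[r-1]^+ = [r][r-1] + 2(Q+Q⁻¹) into the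
constant products with and without the level dependence. All of this is collected in
`kap_mul_pairingForm`.

Convergence rests on 0 ≤ π_{1,j} ≤ r-2-N+j (`piVal_bounds`) and 0 < c < 1: the exponents in the
quotients Q and R exceed -2(r-1), so after cancellation the quotients are positive with convergent
logarithmic series, and the quadratic forms in the exponents decay geometrically in m. -/

open PowerSeries in
/-- The exponential of a power series without constant term, truncated degree by degree. -/
def expSeries {R : Type*} [CommRing R] [Algebra ℂ R] (f : PowerSeries R) : PowerSeries R :=
  PowerSeries.mk fun d =>
    coeff d (∑ n ∈ range (d + 1), ((Nat.factorial n : ℂ)⁻¹) • f ^ n)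

/-! ### Exponentials of formal power series and the equation X F' = (X A') F. -/

section ExpSeries

open PowerSeries

theorem coeff_pow_eq_zero_of_lt {R : Type*} [CommRing R] {f : R⟦X⟧} (hf : constantCoeff f = 0)
    {d n : ℕ} (h : d < n) :
    coeff d (f ^ n) = 0 := by
  obtain ⟨g, rfl⟩ := X_dvd_iff.2 hf
  rw [mul_pow, coeff_X_pow_mul', if_neg (by omega)]

theorem coeff_mul_congr {R : Type*} [CommRing R] {f g h : R⟦X⟧} {d : ℕ}
    (H : ∀ e ≤ d, coeff e g = coeff e h) :
    coeff d (f * g) = coeff d (f * h) := by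
  rw [coeff_mul, coeff_mul]
  refine sum_congr rfl fun p hp => ?_
  rw [H _ (by have := mem_antidiagonal.1 hp; omega)]

theorem coeff_pow_congr {R : Type*} [CommRing R] {g h : R⟦X⟧} {d : ℕ}
    (H : ∀ e ≤ d, coeff e g = coeff e h) (n : ℕ) :
    ∀ e ≤ d, coeff e (g ^ n) = coeff e (h ^ n) := by
  induction n with
  | zero => simp
  | succ n ih =>
    intro e he
    rw [pow_succ, pow_succ, coeff_mul_congr fun e' h' => H e' (h'.trans he), mul_comm,
      coeff_mul_congr fun e' h' => ih e' (h'.trans he), mul_comm]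

variable {R : Type*} [CommRing R] [Algebra ℂ R]

/-- The power f^n starts in degree n, so lengthening the partial sum beyond order d changes nothing
in degree d. -/
theorem coeff_expSeries {f : R⟦X⟧} (hf : constantCoeff f = 0) {d K : ℕ} (h : d ≤ K) :
    coeff d (expSeries f) =
      coeff d (∑ n ∈ range (K + 1), ((Nat.factorial n : ℂ)⁻¹) • f ^ n) := by
  rw [expSeries, coeff_mk, map_sum, map_sum]
  refine sum_subset (range_mono (by omega)) fun n _ hn => ?_
  rw [mem_range, not_lt] at hn
  have := coeff_pow_eq_zero_of_lt hf (show d < n by omega)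
  rw [show ((Nat.factorial n : ℂ)⁻¹) • f ^ n
    = algebraMap ℂ R ((Nat.factorial n : ℂ)⁻¹) • f ^ n from (algebraMap_smul R _ _).symm]
  rw [map_smul, this, smul_zero]

theorem constantCoeff_expSeries {f : R⟦X⟧} (hf : constantCoeff f = 0) :
    constantCoeff (expSeries f) = 1 := by
  rw [← coeff_zero_eq_constantCoeff_apply, coeff_expSeries hf le_rfl]
  simp

theorem coeff_expSeries_congr {g h : R⟦X⟧} {d : ℕ} (H : ∀ e ≤ d, coeff e g = coeff e h) :
    coeff d (expSeries g) = coeff d (expSeries h) := by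
  simp only [expSeries, coeff_mk, map_sum]
  refine sum_congr rfl fun n _ => ?_
  simp only [← algebraMap_smul R ((Nat.factorial n : ℂ)⁻¹), map_smul]
  rw [coeff_pow_congr H n d le_rfl]

/-- A derivation of `R⟦X⟧` that acts coefficient by coefficient satisfies the chain rule for
the exponential. -/
theorem derivation_expSeries (δ : R⟦X⟧ →ₗ[ℂ] R⟦X⟧)
    (hmul : ∀ u v, δ (u * v) = δ u * v + u * δ v)
    (hloc : ∀ d v, coeff d v = 0 → coeff d (δ v) = 0)
    {f : R⟦X⟧} (hf : constantCoeff f = 0) : δ (expSeries f) = δ f * expSeries f := by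
  have h1 : δ 1 = 0 := by
    have := hmul 1 1
    simpa using this
  have hpow : ∀ n, δ (f ^ (n + 1)) = ((n + 1 : ℕ) : ℂ) • (δ f * f ^ n) := by
    intro n
    induction n with
    | zero => simp
    | succ n ih =>
      rw [pow_succ, hmul, ih, pow_succ]
      push_cast
      simp only [Algebra.smul_def, map_add, map_one]
      ring
  have hexp : ∀ K, δ (∑ n ∈ range (K + 2), ((Nat.factorial n : ℂ)⁻¹) • f ^ n)
      = δ f * ∑ n ∈ range (K + 1), ((Nat.factorial n : ℂ)⁻¹) • f ^ n := by
    intro K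
    rw [sum_range_succ', map_add, map_sum, mul_sum]
    simp only [Nat.factorial_zero, Nat.cast_one, inv_one, pow_zero, one_smul, h1, add_zero]
    refine sum_congr rfl fun n _ => ?_
    rw [map_smul, hpow, smul_smul, mul_smul_comm]
    congr 1
    rw [Nat.factorial_succ]
    push_cast
    have : (n : ℂ) + 1 ≠ 0 := by exact_mod_cast Nat.succ_ne_zero n
    have h3 : (Nat.factorial n : ℂ) ≠ 0 := by exact_mod_cast Nat.factorial_ne_zero n
    field_simp
  ext d
  -- Since δ acts coefficient by coefficient, the exponential may be replaced by a finite partial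
  -- sum before δ is applied. One extra term is kept because δ lowers the order of the sum by one.
  have h2 : coeff d (δ (expSeries f))
      = coeff d (δ (∑ n ∈ range (d + 2), ((Nat.factorial n : ℂ)⁻¹) • f ^ n)) := by
    have := hloc d (expSeries f - ∑ n ∈ range (d + 2), ((Nat.factorial n : ℂ)⁻¹) • f ^ n)
      (by rw [map_sub, coeff_expSeries hf (Nat.le_succ d), sub_self])
    rwa [map_sub, map_sub, sub_eq_zero] at this
  rw [h2, hexp]
  exact coeff_mul_congr fun e he => (coeff_expSeries hf he).symm

/-- The operator `X d/dX`. -/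
def euler : R⟦X⟧ →ₗ[ℂ] R⟦X⟧ where
  toFun v := PowerSeries.mk fun d => (d : R) * coeff d v
  map_add' u v := by ext d; simp [mul_add]
  map_smul' c v := by
    ext d
    simp only [coeff_mk, RingHom.id_apply]
    simp only [← algebraMap_smul R c, map_smul, coeff_mk, smul_eq_mul]
    ring

theorem coeff_euler (v : R⟦X⟧) (d : ℕ) : coeff d (euler v) = (d : R) * coeff d v := by
  simp [euler]

theorem euler_mul (u v : R⟦X⟧) : euler (u * v) = euler u * v + u * euler v := by
  ext d
  rw [map_add, coeff_euler, coeff_mul, coeff_mul, coeff_mul, mul_sum, ← sum_add_distrib]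
  refine sum_congr rfl fun p hp => ?_
  rw [coeff_euler, coeff_euler, ← mem_antidiagonal.1 hp]
  push_cast
  ring

theorem euler_expSeries {f : R⟦X⟧} (hf : constantCoeff f = 0) :
    euler (expSeries f) = euler f * expSeries f :=
  derivation_expSeries euler euler_mul (fun d v h => by rw [coeff_euler, h, mul_zero]) hf

/-- The equation is a recursion for the coefficients: `euler A` has no constant term, so degree d +
1 of the right side involves F only in lower degrees, while the left side multiplies that
coefficient by d + 1 ≠ 0. -/
theorem eq_expSeries_of_euler {F : ℂ⟦X⟧} {A : ℂ⟦X⟧} (hA : constantCoeff A = 0)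
    (h0 : constantCoeff F = 1) (hF : euler F = euler A * F) : F = expSeries A := by
  have hE := euler_expSeries (R := ℂ) hA
  have key : ∀ d, ∀ e ≤ d, coeff e F = coeff e (expSeries A) := by
    intro d
    induction d with
    | zero =>
      intro e he
      obtain rfl : e = 0 := by omega
      rw [coeff_zero_eq_constantCoeff_apply, coeff_zero_eq_constantCoeff_apply, h0,
        constantCoeff_expSeries hA]
    | succ d ih =>
      intro e he
      rcases Nat.lt_or_ge e (d + 1) with h | h
      · exact ih e (by omega)
      obtain rfl : e = d + 1 := by omega
      have h1 := congrArg (coeff (d + 1)) hF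
      have h2 := congrArg (coeff (d + 1)) hE
      have h3 : coeff (d + 1) (euler A * F) = coeff (d + 1) (euler A * expSeries A) := by
        rw [coeff_mul, coeff_mul]
        refine sum_congr rfl fun p hp => ?_
        rcases Nat.eq_zero_or_pos p.1 with h | h
        · rw [h, coeff_euler]; simp
        · rw [ih p.2 (by have := mem_antidiagonal.1 hp; omega)]
      rw [coeff_euler] at h1 h2
      have h4 : ((d + 1 : ℕ) : ℂ) ≠ 0 := by exact_mod_cast Nat.succ_ne_zero d
      exact mul_left_cancel₀ h4 (by rw [h1, h2, h3])
  ext d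
  exact key d d le_rfl

end ExpSeries

/-! ### Evaluation at X = 1 on series with absolutely summable coefficients. -/

section AbsSum

open PowerSeries

/-- The coefficients of `F` are absolutely summable, with sum `v`. -/
def HasAbsSum (F : ℂ⟦X⟧) (v : ℂ) : Prop :=
  Summable (fun d => ‖coeff d F‖) ∧ HasSum (fun d => coeff d F) v

theorem HasAbsSum.mul {F G : ℂ⟦X⟧} {v w : ℂ} (hF : HasAbsSum F v) (hG : HasAbsSum G w) :
    HasAbsSum (F * G) (v * w) := by
  have h1 := summable_norm_sum_mul_antidiagonal_of_summable_norm hF.1 hG.1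
  have h2 := tsum_mul_tsum_eq_tsum_sum_antidiagonal_of_summable_norm hF.1 hG.1
  simp only [← coeff_mul] at h1 h2
  rw [hF.2.tsum_eq, hG.2.tsum_eq] at h2
  exact ⟨h1, h2 ▸ h1.of_norm.hasSum⟩

theorem HasAbsSum.one : HasAbsSum 1 1 := by
  have : ∀ d : ℕ, d ≠ 0 → coeff d (1 : ℂ⟦X⟧) = 0 := fun d hd => by simp [coeff_one, hd]
  refine ⟨summable_of_ne_finset_zero (s := {0}) fun d hd => ?_, ?_⟩
  · rw [this d (by simpa using hd), norm_zero]
  · simpa using hasSum_single 0 this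

theorem HasAbsSum.pow {F : ℂ⟦X⟧} {v : ℂ} (hF : HasAbsSum F v) (n : ℕ) :
    HasAbsSum (F ^ n) (v ^ n) := by
  induction n with
  | zero => simpa using HasAbsSum.one
  | succ n ih => rw [pow_succ, pow_succ]; exact ih.mul hF

/-- The ℓ¹-norm is submultiplicative for the Cauchy product. This bound dominates the exponential
series below. -/
theorem HasAbsSum.tsum_norm_pow_le {F : ℂ⟦X⟧} {v : ℂ} (hF : HasAbsSum F v) (n : ℕ) :
    ∑' d, ‖coeff d (F ^ n)‖ ≤ (∑' d, ‖coeff d F‖) ^ n := by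
  induction n with
  | zero =>
    rw [pow_zero, pow_zero, tsum_eq_single 0 fun d hd => by simp [coeff_one, hd]]
    simp
  | succ n ih =>
    have h0 : Summable fun d => ‖‖coeff d (F ^ n)‖‖ := by simpa using (hF.pow n).1
    have h1 : Summable fun d => ‖‖coeff d F‖‖ := by simpa using hF.1
    have h2 := summable_norm_sum_mul_antidiagonal_of_summable_norm h0 h1
    have h3 := tsum_mul_tsum_eq_tsum_sum_antidiagonal_of_summable_norm h0 h1
    calc ∑' d, ‖coeff d (F ^ (n + 1))‖
        ≤ ∑' d, ∑ p ∈ antidiagonal d, ‖coeff p.1 (F ^ n)‖ * ‖coeff p.2 F‖ := by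
          refine (hF.pow (n + 1)).1.tsum_le_tsum (fun d => ?_) h2.of_norm
          rw [pow_succ, coeff_mul]
          refine (norm_sum_le _ _).trans (sum_le_sum fun p _ => ?_)
          rw [norm_mul]
      _ = (∑' d, ‖coeff d (F ^ n)‖) * ∑' d, ‖coeff d F‖ := h3.symm
      _ ≤ (∑' d, ‖coeff d F‖) ^ (n + 1) := by
          rw [pow_succ]
          exact mul_le_mul_of_nonneg_right ih (tsum_nonneg fun _ => norm_nonneg _)

/-- The double family of coefficients of F^n / n! is absolutely summable, being dominated by B^n /
n! with B the ℓ¹-norm of F. Summing over degrees inside gives ∑ v^n / n!, summing over n inside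
gives the coefficients of the exponential. -/
theorem HasAbsSum.expSeries {F : ℂ⟦X⟧} {v : ℂ} (hF : HasAbsSum F v)
    (h0 : constantCoeff F = 0) :
    HasSum (fun d => coeff d (expSeries F)) (Complex.exp v) := by
  set B := ∑' d, ‖coeff d F‖ with hB
  let g : ℕ × ℕ → ℂ := fun p => ((Nat.factorial p.1 : ℂ)⁻¹) * coeff p.2 (F ^ p.1)
  have hfac : ∀ n : ℕ, ‖((Nat.factorial n : ℂ)⁻¹)‖ = (Nat.factorial n : ℝ)⁻¹ := fun n => by simp
  have hg : Summable fun p => ‖g p‖ := by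
    rw [summable_prod_of_nonneg fun _ => norm_nonneg _]
    refine ⟨fun n => ?_, ?_⟩
    · simp only [g, norm_mul]
      exact (hF.pow n).1.mul_left _
    · simp only [g, norm_mul, tsum_mul_left]
      refine Summable.of_nonneg_of_le (fun n => by positivity) (fun n => ?_)
        (Real.summable_pow_div_factorial B)
      rw [hfac, div_eq_inv_mul]
      exact mul_le_mul_of_nonneg_left (hF.tsum_norm_pow_le n) (by positivity)
  have hs : HasSum g (Complex.exp v) := by
    have h1 := hg.of_norm.hasSum
    have h2 := h1.prod_fiberwise fun n => ((hF.pow n).2.mul_left ((Nat.factorial n : ℂ)⁻¹))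
    have h3 : HasSum (fun n : ℕ => ((Nat.factorial n : ℂ)⁻¹) * v ^ n) (Complex.exp v) := by
      have := NormedSpace.expSeries_div_hasSum_exp (𝔸 := ℂ) v
      rw [← Complex.exp_eq_exp_ℂ] at this
      simpa only [div_eq_inv_mul] using this
    rwa [h2.unique h3] at h1
  -- The same family, now to be summed over n for each fixed degree, where only n ≤ d contributes.
  have hs' : HasSum (fun p : ℕ × ℕ => g p.swap) (Complex.exp v) :=
    (Equiv.prodComm ℕ ℕ).hasSum_iff.2 hs
  refine hs'.prod_fiberwise fun d => ?_
  have : coeff d (BoundaryFace.expSeries F)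
      = ∑ n ∈ range (d + 1), ((Nat.factorial n : ℂ)⁻¹) * coeff d (F ^ n) := by
    rw [coeff_expSeries h0 le_rfl, map_sum]
    exact sum_congr rfl fun n _ => by rw [map_smul, smul_eq_mul]
  rw [this]
  refine hasSum_sum_of_ne_finset_zero fun n hn => ?_
  rw [mem_range, not_lt] at hn
  simp [g, coeff_pow_eq_zero_of_lt h0 (show d < n by omega)]

end AbsSum

/-! ### Wick's theorem as a formal power series identity in the energy variable. -/

section Wick

open PowerSeries

/-- The coefficientwise extension of a linear map to power series. -/
def coeffwise {R R' : Type*} [CommRing R] [Algebra ℂ R] [CommRing R'] [Algebra ℂ R']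
    (T : R →ₗ[ℂ] R') : R⟦X⟧ →ₗ[ℂ] R'⟦X⟧ where
  toFun v := PowerSeries.mk fun d => T (coeff d v)
  map_add' u v := by ext d; simp
  map_smul' c v := by
    ext d
    simp only [coeff_mk, RingHom.id_apply, ← algebraMap_smul R c, ← algebraMap_smul R' c, map_smul]
    simp only [algebraMap_smul, map_smul]

variable {R R' : Type*} [CommRing R] [Algebra ℂ R] [CommRing R'] [Algebra ℂ R']

theorem coeff_coeffwise (T : R →ₗ[ℂ] R') (v : R⟦X⟧) (d : ℕ) :
    coeff d (coeffwise T v) = T (coeff d v) := by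
  simp [coeffwise]

theorem coeffwise_X_pow_mul (T : R →ₗ[ℂ] R') (n : ℕ) (v : R⟦X⟧) :
    coeffwise T (X ^ n * v) = X ^ n * coeffwise T v := by
  ext d
  rw [coeff_coeffwise, coeff_X_pow_mul', coeff_X_pow_mul']
  split_ifs
  · rw [coeff_coeffwise]
  · rw [map_zero]

theorem coeffwise_C (T : R →ₗ[ℂ] R') (a : R) : coeffwise T (C a) = C (T a) := by
  ext d
  rw [coeff_coeffwise, coeff_C, coeff_C]
  split_ifs
  · rfl
  · rw [map_zero]

theorem coeffwise_C_algebraMap_mul (T : R →ₗ[ℂ] ℂ) (a : ℂ) (v : R⟦X⟧) :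
    coeffwise T (C (algebraMap ℂ R a) * v) = C a * coeffwise T v := by
  ext d
  rw [coeff_coeffwise, coeff_C_mul, coeff_C_mul, coeff_coeffwise, ← Algebra.smul_def, map_smul,
    smul_eq_mul]

theorem coeffwise_derivation_mul (δ : Derivation ℂ R R) (u v : R⟦X⟧) :
    coeffwise (δ : R →ₗ[ℂ] R) (u * v)
      = coeffwise (δ : R →ₗ[ℂ] R) u * v + u * coeffwise (δ : R →ₗ[ℂ] R) v := by
  ext d
  rw [map_add, coeff_coeffwise, coeff_mul, coeff_mul, coeff_mul, map_sum, ← sum_add_distrib]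
  refine sum_congr rfl fun p _ => ?_
  rw [coeff_coeffwise, coeff_coeffwise, Derivation.coeFn_coe, Derivation.leibniz]
  simp only [smul_eq_mul]
  ring

/-- `∑ γ^i X^{2 m i}`, the inverse of `1 - γ X^{2 m}`. -/
def geomSeries (γ : ℂ) (m : ℕ) : ℂ⟦X⟧ :=
  PowerSeries.mk fun d => if 2 * m ∣ d then γ ^ (d / (2 * m)) else 0

/-- `-log (1 - γ X^{2 m})`. -/
def neglogSeries (γ : ℂ) (m : ℕ) : ℂ⟦X⟧ :=
  PowerSeries.mk fun d => if 2 * m ∣ d then γ ^ (d / (2 * m)) / ((d / (2 * m) : ℕ) : ℂ) else 0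

theorem one_sub_mul_geomSeries (γ : ℂ) {m : ℕ} (hm : 1 ≤ m) :
    (1 - C γ * X ^ (2 * m)) * geomSeries γ m = 1 := by
  ext d
  rw [sub_mul, one_mul, map_sub, mul_assoc, coeff_C_mul, coeff_X_pow_mul', coeff_one, geomSeries,
    coeff_mk, coeff_mk]
  rcases Nat.eq_zero_or_pos d with rfl | hd
  · simp [show m ≠ 0 by omega]
  rw [if_neg (show d ≠ 0 by omega)]
  by_cases h : 2 * m ≤ d
  · rw [if_pos h]
    by_cases h2 : 2 * m ∣ d
    · obtain ⟨e, rfl⟩ := h2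
      obtain ⟨e, rfl⟩ : ∃ e', e = e' + 1 := ⟨e - 1, by
        rcases e with _ | e
        · simp at hd
        · simp⟩
      rw [if_pos (dvd_mul_right _ _), show 2 * m * (e + 1) - 2 * m = 2 * m * e by
        rw [mul_add, mul_one, Nat.add_sub_cancel], if_pos (dvd_mul_right _ _),
        Nat.mul_div_cancel_left _ (by omega), Nat.mul_div_cancel_left _ (by omega)]
      ring
    · rw [if_neg h2, if_neg (by rwa [Nat.dvd_sub_iff_left h dvd_rfl])]
      ring
  · rw [if_neg h, if_neg fun h2 => h (Nat.le_of_dvd hd h2)]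
    ring

theorem euler_neglogSeries (γ : ℂ) {m : ℕ} (hm : 1 ≤ m) :
    euler (neglogSeries γ m) = C (2 * m : ℂ) * (geomSeries γ m - 1) := by
  ext d
  rw [coeff_euler, coeff_C_mul, map_sub, coeff_one, neglogSeries, geomSeries, coeff_mk, coeff_mk]
  rcases Nat.eq_zero_or_pos d with rfl | hd
  · simp
  rw [if_neg (show d ≠ 0 by omega)]
  by_cases h2 : 2 * m ∣ d
  · obtain ⟨e, rfl⟩ := h2
    rw [if_pos (dvd_mul_right _ _), if_pos (dvd_mul_right _ _),
      Nat.mul_div_cancel_left _ (by omega)]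
    have : (e : ℂ) ≠ 0 := by
      rintro h
      rw [Nat.cast_eq_zero] at h
      simp [h] at hd
    push_cast
    field_simp
    ring
  · rw [if_neg h2, if_neg h2]
    simp

theorem euler_C_mul_X_pow (a : ℂ) (k : ℕ) :
    euler (C a * X ^ k : ℂ⟦X⟧) = C (k : ℂ) * (C a * X ^ k) := by
  ext d
  rw [coeff_euler, coeff_C_mul, coeff_C_mul, coeff_C_mul, coeff_X_pow]
  split_ifs with h
  · rw [h]
  · simp

theorem euler_one : euler (1 : ℂ⟦X⟧) = 0 := by
  ext d
  rw [coeff_euler, coeff_one]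
  split_ifs with h
  · simp [h]
  · simp

/-- The logarithm of the Gaussian pairing of a single energy `m`, graded by the energy. -/
def gaussLog (n s u γ : ℂ) (m : ℕ) : ℂ⟦X⟧ :=
  C (n / 2) * neglogSeries γ m + (C s * X ^ m - C (u / 2) * X ^ (2 * m)) * geomSeries γ m

theorem constantCoeff_gaussLog (n s u γ : ℂ) {m : ℕ} (hm : 1 ≤ m) :
    constantCoeff (gaussLog n s u γ m) = 0 := by
  -- In degree 0 the coefficient is γ^0 / 0, which is 0 by the convention for division.
  have h1 : constantCoeff (neglogSeries γ m) = 0 := by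
    rw [← coeff_zero_eq_constantCoeff_apply, neglogSeries, coeff_mk]
    simp
  simp [gaussLog, h1, show m ≠ 0 by omega]

/-- The logarithmic derivative cleared of the denominator (1 - γ X^{2m})², which is the form in
which the equations for the second moments deliver it. -/
theorem euler_gaussLog (n s u γ : ℂ) {m : ℕ} (hm : 1 ≤ m) :
    (1 - C γ * X ^ (2 * m)) ^ 2 * euler (gaussLog n s u γ m)
      = C (m : ℂ) * (C n * C γ * X ^ (2 * m) * (1 - C γ * X ^ (2 * m))
        + C s * X ^ m + C γ * C s * X ^ m * X ^ (2 * m) - C u * X ^ (2 * m)) := by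
  have hD := one_sub_mul_geomSeries γ hm
  have hE : euler ((1 - C γ * X ^ (2 * m)) * geomSeries γ m) = 0 := by rw [hD, euler_one]
  rw [euler_mul, map_sub, euler_one, euler_C_mul_X_pow] at hE
  have hL := euler_neglogSeries γ hm
  have hC : euler (C (n / 2) * neglogSeries γ m) = C (n / 2) * euler (neglogSeries γ m) := by
    rw [euler_mul]
    have := euler_C_mul_X_pow (n / 2) 0
    simp only [pow_zero, mul_one, Nat.cast_zero, map_zero, zero_mul] at this
    rw [this, zero_mul, zero_add]
  rw [gaussLog, map_add, hC, hL, euler_mul, map_sub, euler_C_mul_X_pow, euler_C_mul_X_pow]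
  have e1 : (C (n / 2) : ℂ⟦X⟧) * C (2 * m : ℂ) = C n * C (m : ℂ) := by
    rw [← map_mul, ← map_mul]; congr 1; ring
  have e2 : (C ((2 * m : ℕ) : ℂ) : ℂ⟦X⟧) = 2 * C (m : ℂ) := by
    push_cast
    rw [map_mul]
    rfl
  have e3 : (C u : ℂ⟦X⟧) = 2 * C (u / 2) := by
    rw [show (2 : ℂ⟦X⟧) = C 2 from rfl, ← map_mul]; congr 1; ring
  rw [e2] at hE ⊢
  rw [e3]
  set g := geomSeries γ m
  set W : ℂ⟦X⟧ := X ^ (2 * m)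
  set V : ℂ⟦X⟧ := X ^ m
  have hV : W = V ^ 2 := by simp only [W, V]; ring
  set D : ℂ⟦X⟧ := 1 - C γ * W with hDdef
  have hW : C γ * W = 1 - D := by rw [hDdef]; ring
  linear_combination (D ^ 2 * (g - 1)) * e1 + (C s * V - C (u / 2) * W) * D * hE
    + (C n * C (m : ℂ) * D
      + D * (C (m : ℂ) * (C s * V) - 2 * C (m : ℂ) * (C (u / 2) * W))
      + (C s * V - C (u / 2) * W) * 2 * C (m : ℂ) * (C γ * W)) * hD

theorem coeffwise_X_pow_mul_C (T : R →ₗ[ℂ] R') (n : ℕ) (a : R) :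
    coeffwise T (X ^ n * C a) = X ^ n * C (T a) := by
  rw [coeffwise_X_pow_mul, coeffwise_C]

theorem euler_X_pow_mul_C (n : ℕ) (a : R) :
    euler (X ^ n * C a : R⟦X⟧) = X ^ n * C ((n : R) * a) := by
  ext d
  rw [coeff_euler, coeff_X_pow_mul', coeff_X_pow_mul', coeff_C, coeff_C]
  split_ifs with h1 h2
  · rw [show d = n by omega]
  · simp
  · simp

/-- The graded exponent `∑_m (- X^{2 m}/2 ∑ J c c + X^m ∑ y c)`. -/
def gaussExponent (S : Finset ℕ) (M : ℕ) (c : ℕ → ℕ → R) (J : ℕ → ℕ → ℕ → ℂ)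
    (y : ℕ → ℕ → ℂ) : R⟦X⟧ :=
  ∑ m ∈ Icc 1 M, (X ^ (2 * m) * C ((-(1 / 2) : ℂ) • ∑ j ∈ S, ∑ k ∈ S, J m j k • (c m j * c m k))
    + X ^ m * C (∑ j ∈ S, y m j • c m j))

theorem constantCoeff_gaussExponent (S : Finset ℕ) (M : ℕ) (c : ℕ → ℕ → R)
    (J : ℕ → ℕ → ℕ → ℂ) (y : ℕ → ℕ → ℂ) : constantCoeff (gaussExponent S M c J y) = 0 := by
  rw [gaussExponent, map_sum]
  refine sum_eq_zero fun m hm => ?_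
  have : m ≠ 0 := by have := (mem_Icc.1 hm).1; omega
  simp [this]

/-- Wick's theorem: the pairing of two Gaussian states with independent energies. -/
theorem coeffwise_expSeries_gaussExponent (S : Finset ℕ) (M : ℕ) (c : ℕ → ℕ → R)
    (a : ℕ → ℕ → Derivation ℂ R R) (B J : ℕ → ℕ → ℕ → ℂ) (γ : ℕ → ℂ) (y z : ℕ → ℕ → ℂ)
    (hac : ∀ m ∈ Icc 1 M, ∀ n ∈ Icc 1 M, ∀ j ∈ S, ∀ k ∈ S,
      a m j (c n k) = if m = n then algebraMap ℂ R (B m j k) else 0)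
    (T : R →ₗ[ℂ] ℂ) (hT1 : T 1 = 1)
    (hT : ∀ m ∈ Icc 1 M, ∀ j ∈ S, ∀ v,
      T (c m j * v) = (∑ k ∈ S, B m j k * z m k) * T v - γ m * T (a m j v))
    (hBJ : ∀ m ∈ Icc 1 M, ∀ j ∈ S, ∀ l ∈ S,
      ∑ k ∈ S, B m j k * J m k l = if j = l then 1 else 0)
    (hB : ∀ m j k, B m j k = B m k j) (hJ : ∀ m j k, J m j k = J m k j) :
    coeffwise T (expSeries (gaussExponent S M c J y)) =
      expSeries (∑ m ∈ Icc 1 M, gaussLog (S.card : ℂ)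
        (∑ j ∈ S, ∑ k ∈ S, B m j k * y m j * z m k)
        (γ m * (∑ j ∈ S, ∑ k ∈ S, B m j k * y m j * y m k)
          + ∑ j ∈ S, ∑ k ∈ S, B m j k * z m j * z m k) (γ m) m) := by
  set f := gaussExponent S M c J y with hfdef
  have hf0 : constantCoeff f = 0 := constantCoeff_gaussExponent S M c J y
  set w := expSeries f with hw
  set Φ := coeffwise T w with hΦ
  let yt : ℕ → ℕ → ℂ := fun m j => ∑ k ∈ S, B m j k * y m k
  let zt : ℕ → ℕ → ℂ := fun m j => ∑ k ∈ S, B m j k * z m k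
  -- the annihilation operators act on the exponential as linear forms
  have haf : ∀ m ∈ Icc 1 M, ∀ j ∈ S, coeffwise (a m j : R →ₗ[ℂ] R) f
      = X ^ m * C (algebraMap ℂ R (yt m j)) - X ^ (2 * m) * C (c m j) := by
    intro m hm j hj
    have hlin : ∀ n ∈ Icc 1 M, a m j (∑ k ∈ S, y n k • c n k)
        = if m = n then algebraMap ℂ R (yt m j) else 0 := by
      intro n hn
      rw [map_sum]
      split_ifs with h
      · subst h
        rw [map_sum]
        refine sum_congr rfl fun k hk => ?_
        rw [Derivation.map_smul, hac m hm m hm j hj k hk, if_pos rfl, Algebra.smul_def, map_mul,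
          mul_comm]
      · refine sum_eq_zero fun k hk => ?_
        rw [Derivation.map_smul, hac m hm n hn j hj k hk, if_neg h, smul_zero]
    have hquad : ∀ n ∈ Icc 1 M, a m j ((-(1 / 2) : ℂ) • ∑ k ∈ S, ∑ l ∈ S,
        J n k l • (c n k * c n l)) = if m = n then -c m j else 0 := by
      intro n hn
      rw [Derivation.map_smul, map_sum]
      simp only [map_sum, Derivation.map_smul, Derivation.leibniz, smul_eq_mul]
      split_ifs with h
      · subst h
        have h1 : ∀ k ∈ S, ∀ l ∈ S, J m k l • (c m k * a m j (c m l) + c m l * a m j (c m k))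
            = (B m j l * J m l k) • c m k + (B m j k * J m k l) • c m l := by
          intro k hk l hl
          rw [hac m hm m hm j hj k hk, hac m hm m hm j hj l hl, if_pos rfl, if_pos rfl, hJ m l k]
          simp only [Algebra.smul_def, map_mul]
          ring
        have h2 : ∑ k ∈ S, ∑ l ∈ S, (B m j l * J m l k) • c m k = c m j := by
          have : ∀ k ∈ S, ∑ l ∈ S, (B m j l * J m l k) • c m k
              = (if j = k then (1 : ℂ) else 0) • c m k := by
            intro k hk
            rw [← sum_smul, hBJ m hm j hj k hk]
          rw [sum_congr rfl this]
          simp [hj]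
        rw [sum_congr rfl fun k hk => sum_congr rfl (h1 k hk)]
        simp only [sum_add_distrib]
        -- By the symmetry of J the two factors of the quadratic form contribute equally, which
        -- absorbs the factor 1/2.
        rw [h2, sum_comm, h2, ← two_smul ℂ, smul_smul]
        norm_num
      · rw [sum_eq_zero, smul_zero]
        intro k hk
        refine sum_eq_zero fun l hl => ?_
        rw [hac m hm n hn j hj k hk, hac m hm n hn j hj l hl, if_neg h, if_neg h]
        simp
    rw [hfdef, gaussExponent, map_sum]
    simp only [map_add (coeffwise _), coeffwise_X_pow_mul_C]
    rw [sum_eq_single_of_mem m hm]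
    · rw [Derivation.coeFn_coe, hlin m hm, hquad m hm, if_pos rfl, if_pos rfl, map_neg]
      ring
    · intro n hn hne
      rw [Derivation.coeFn_coe, hlin n hn, hquad n hn, if_neg hne.symm, if_neg hne.symm]
      simp
  have haw : ∀ m ∈ Icc 1 M, ∀ j ∈ S, coeffwise (a m j : R →ₗ[ℂ] R) w
      = (X ^ m * C (algebraMap ℂ R (yt m j)) - X ^ (2 * m) * C (c m j)) * w := by
    intro m hm j hj
    rw [hw, derivation_expSeries _ (coeffwise_derivation_mul _) (fun d v h => by
      rw [coeff_coeffwise, h, map_zero]) hf0, haf m hm j hj]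
  have hTc : ∀ m ∈ Icc 1 M, ∀ j ∈ S, ∀ v, coeffwise T (C (c m j) * v)
      = C (zt m j) * coeffwise T v - C (γ m) * coeffwise T (coeffwise (a m j : R →ₗ[ℂ] R) v) := by
    intro m hm j hj v
    ext d
    rw [coeff_coeffwise, coeff_C_mul, hT m hm j hj, map_sub, coeff_C_mul, coeff_C_mul,
      coeff_coeffwise, coeff_coeffwise, coeff_coeffwise, Derivation.coeFn_coe]
  -- `one` and `two` are the first and second moments of the creation variables in the pairing. They
  -- satisfy linear equations with the common denominator `D` and with the linear form `L` as
  -- source.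
  let L : ℕ → ℕ → ℂ⟦X⟧ := fun m j => C (zt m j) - C (γ m) * X ^ m * C (yt m j)
  let D : ℕ → ℂ⟦X⟧ := fun m => 1 - C (γ m) * X ^ (2 * m)
  let one : ℕ → ℕ → ℂ⟦X⟧ := fun m j => coeffwise T (C (c m j) * w)
  let two : ℕ → ℕ → ℕ → ℂ⟦X⟧ := fun m j k => coeffwise T (C (c m j * c m k) * w)
  -- Commuting c through the dual state produces -γ a, and a acts on w as X^m yt - X^{2m} c. The
  -- moment therefore reappears with the factor γ X^{2m}, and solving for it gives the factor `D`.
  have hone : ∀ m ∈ Icc 1 M, ∀ j ∈ S, D m * one m j = L m j * Φ := by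
    intro m hm j hj
    have h := hTc m hm j hj w
    rw [haw m hm j hj, sub_mul, map_sub, mul_assoc, mul_assoc, coeffwise_X_pow_mul,
      coeffwise_X_pow_mul, coeffwise_C_algebraMap_mul] at h
    simp only [D, L, one]
    linear_combination h
  -- The same argument, with one additional term from the contraction of a with the second variable.
  have htwo : ∀ m ∈ Icc 1 M, ∀ j ∈ S, ∀ k ∈ S,
      D m * two m j k = L m j * one m k - C (γ m) * C (B m j k) * Φ := by
    intro m hm j hj k hk
    have h := hTc m hm j hj (C (c m k) * w)
    rw [coeffwise_derivation_mul, coeffwise_C, Derivation.coeFn_coe,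
      hac m hm m hm j hj k hk, if_pos rfl, map_add, haw m hm j hj, coeffwise_C_algebraMap_mul,
      show C (c m k) * ((X ^ m * C (algebraMap ℂ R (yt m j)) - X ^ (2 * m) * C (c m j)) * w)
        = X ^ m * (C (algebraMap ℂ R (yt m j)) * (C (c m k) * w))
          - X ^ (2 * m) * (C (c m j * c m k) * w) by rw [map_mul]; ring,
      map_sub, coeffwise_X_pow_mul, coeffwise_X_pow_mul, coeffwise_C_algebraMap_mul,
      ← mul_assoc, ← map_mul] at h
    simp only [D, L, one, two]
    linear_combination h
  have hΦ0 : constantCoeff Φ = 1 := by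
    rw [← coeff_zero_eq_constantCoeff_apply, hΦ, coeff_coeffwise,
      coeff_zero_eq_constantCoeff_apply, hw, constantCoeff_expSeries hf0, hT1]
  have hD : ∀ m ∈ Icc 1 M, D m ≠ 0 := by
    intro m hm h
    have := congrArg constantCoeff h
    have hm' : m ≠ 0 := by have := (mem_Icc.1 hm).1; omega
    simp [D, hm'] at this
  refine eq_expSeries_of_euler ?_ hΦ0 ?_
  · rw [map_sum]
    exact sum_eq_zero fun m hm => constantCoeff_gaussLog _ _ _ _ (mem_Icc.1 hm).1
  -- T acts on the coefficients and the Euler operator on the degrees, so they commute. Hence the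
  -- derivative of the pairing is a combination of moments of order one and two.
  have hcomm : euler Φ = coeffwise T (euler w) := by
    ext d
    rw [coeff_euler, hΦ, coeff_coeffwise, coeff_coeffwise, coeff_euler, ← map_natCast (algebraMap ℂ R),
      ← Algebra.smul_def, map_smul, smul_eq_mul]
  have hef : euler f = ∑ m ∈ Icc 1 M,
      (X ^ (2 * m) * C (algebraMap ℂ R (-(m : ℂ))) * ∑ j ∈ S, ∑ k ∈ S,
          C (algebraMap ℂ R (J m j k)) * C (c m j * c m k)
        + X ^ m * C (algebraMap ℂ R (m : ℂ)) * ∑ j ∈ S, C (algebraMap ℂ R (y m j)) * C (c m j)) := by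
    rw [hfdef, gaussExponent, map_sum]
    refine sum_congr rfl fun m _ => ?_
    rw [map_add, euler_X_pow_mul_C, euler_X_pow_mul_C, mul_assoc, mul_assoc]
    congr 2
    · simp only [← map_mul, ← map_sum]
      congr 1
      simp only [Algebra.smul_def]
      rw [← mul_assoc, ← map_natCast (algebraMap ℂ R), ← map_mul]
      congr 2
      push_cast
      ring
    · simp only [← map_mul, ← map_sum]
      congr 1
      simp only [Algebra.smul_def]
      rw [map_natCast]
  rw [hcomm, hw, euler_expSeries hf0, ← hw, hef, map_sum, sum_mul, sum_mul, map_sum]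
  refine sum_congr rfl fun m hm => ?_
  have hterm : coeffwise T ((X ^ (2 * m) * C (algebraMap ℂ R (-(m : ℂ))) * ∑ j ∈ S, ∑ k ∈ S,
          C (algebraMap ℂ R (J m j k)) * C (c m j * c m k)
        + X ^ m * C (algebraMap ℂ R (m : ℂ)) * ∑ j ∈ S, C (algebraMap ℂ R (y m j)) * C (c m j)) * w)
      = X ^ (2 * m) * (C (-(m : ℂ)) * ∑ j ∈ S, ∑ k ∈ S, C (J m j k) * two m j k)
        + X ^ m * (C (m : ℂ) * ∑ j ∈ S, C (y m j) * one m j) := by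
    rw [add_mul, map_add]
    simp only [mul_assoc, coeffwise_X_pow_mul, coeffwise_C_algebraMap_mul, sum_mul, map_sum, two,
      one]
  rw [hterm]
  -- J inverts B, so contraction with J undoes the passage from y, z to `yt`, `zt`.
  have hJyt : ∀ k ∈ S, ∑ j ∈ S, J m j k * yt m j = y m k := by
    intro k hk
    simp only [yt, mul_sum]
    rw [sum_comm]
    have : ∀ l ∈ S, ∑ j ∈ S, J m j k * (B m j l * y m l)
        = (if l = k then (1 : ℂ) else 0) * y m l := by
      intro l hl
      rw [← hBJ m hm l hl k hk, sum_mul]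
      exact sum_congr rfl fun j _ => by rw [hB m j l]; ring
    rw [sum_congr rfl this]
    simp [hk]
  have hJzt : ∀ k ∈ S, ∑ j ∈ S, J m j k * zt m j = z m k := by
    intro k hk
    simp only [zt, mul_sum]
    rw [sum_comm]
    have : ∀ l ∈ S, ∑ j ∈ S, J m j k * (B m j l * z m l)
        = (if l = k then (1 : ℂ) else 0) * z m l := by
      intro l hl
      rw [← hBJ m hm l hl k hk, sum_mul]
      exact sum_congr rfl fun j _ => by rw [hB m j l]; ring
    rw [sum_congr rfl this]
    simp [hk]
  have hJB : ∑ j ∈ S, ∑ k ∈ S, J m j k * B m j k = (S.card : ℂ) := by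
    have : ∀ j ∈ S, ∑ k ∈ S, J m j k * B m j k = 1 := by
      intro j hj
      have := hBJ m hm j hj j hj
      rw [if_pos rfl] at this
      rw [← this]
      exact sum_congr rfl fun k _ => by rw [hJ m j k]; ring
    rw [sum_congr rfl this]
    simp
  have hYY : ∑ k ∈ S, yt m k * y m k = ∑ j ∈ S, ∑ k ∈ S, B m j k * y m j * y m k := by
    refine sum_congr rfl fun j _ => ?_
    simp only [yt, sum_mul]
    exact sum_congr rfl fun k _ => by ring
  have hYZ : ∑ k ∈ S, zt m k * y m k = ∑ j ∈ S, ∑ k ∈ S, B m j k * y m j * z m k := by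
    refine sum_congr rfl fun j _ => ?_
    simp only [zt, sum_mul]
    exact sum_congr rfl fun k _ => by ring
  have hZY : ∑ k ∈ S, yt m k * z m k = ∑ j ∈ S, ∑ k ∈ S, B m j k * y m j * z m k := by
    simp only [yt, sum_mul]
    rw [sum_comm]
    exact sum_congr rfl fun j _ => sum_congr rfl fun k _ => by rw [hB m k j]
  have hZZ : ∑ k ∈ S, zt m k * z m k = ∑ j ∈ S, ∑ k ∈ S, B m j k * z m j * z m k := by
    refine sum_congr rfl fun j _ => ?_
    simp only [zt, sum_mul]
    exact sum_congr rfl fun k _ => by ring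
  set Y := ∑ j ∈ S, ∑ k ∈ S, B m j k * y m j * y m k
  set s := ∑ j ∈ S, ∑ k ∈ S, B m j k * y m j * z m k
  set Z := ∑ j ∈ S, ∑ k ∈ S, B m j k * z m j * z m k
  -- contractions of the linear forms
  have hL1 : ∀ k ∈ S, ∑ j ∈ S, C (J m j k) * L m j = C (z m k) - C (γ m) * X ^ m * C (y m k) := by
    intro k hk
    rw [← hJyt k hk, ← hJzt k hk, map_sum, map_sum, mul_sum, ← sum_sub_distrib]
    refine sum_congr rfl fun j _ => ?_
    simp only [L, map_mul]
    ring
  have hyL : ∑ k ∈ S, C (y m k) * L m k = C s - C (γ m) * X ^ m * C Y := by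
    rw [← hYZ, ← hYY, map_sum, map_sum, mul_sum, ← sum_sub_distrib]
    refine sum_congr rfl fun j _ => ?_
    simp only [L, map_mul]
    ring
  have hzL : ∑ k ∈ S, C (z m k) * L m k = C Z - C (γ m) * X ^ m * C s := by
    rw [← hZZ, ← hZY, map_sum, map_sum, mul_sum, ← sum_sub_distrib]
    refine sum_congr rfl fun j _ => ?_
    simp only [L, map_mul]
    ring
  have hJLL : ∑ j ∈ S, ∑ k ∈ S, C (J m j k) * (L m j * L m k)
      = C Z - 2 * C (γ m) * X ^ m * C s + C (γ m) ^ 2 * X ^ (2 * m) * C Y := by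
    rw [sum_comm]
    have : ∀ k ∈ S, ∑ j ∈ S, C (J m j k) * (L m j * L m k)
        = C (z m k) * L m k - C (γ m) * X ^ m * (C (y m k) * L m k) := by
      intro k hk
      simp only [← mul_assoc]
      rw [← sum_mul, hL1 k hk]
      ring
    rw [sum_congr rfl this, sum_sub_distrib, ← mul_sum, hyL, hzL]
    ring
  have hJB' : ∑ j ∈ S, ∑ k ∈ S, C (J m j k) * C (B m j k) = (C (S.card : ℂ) : ℂ⟦X⟧) := by
    rw [← hJB]
    simp only [map_sum, map_mul]
  -- The square of `D` is needed because the equation for a second moment contains a first moment,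
  -- which carries a denominator of its own.
  have h2 : D m ^ 2 * ∑ j ∈ S, ∑ k ∈ S, C (J m j k) * two m j k
      = (C Z - 2 * C (γ m) * X ^ m * C s + C (γ m) ^ 2 * X ^ (2 * m) * C Y
        - C (γ m) * D m * C (S.card : ℂ)) * Φ := by
    rw [← hJLL, ← hJB', sub_mul, sum_mul, mul_sum, mul_sum, sum_mul, ← sum_sub_distrib]
    refine sum_congr rfl fun j hj => ?_
    rw [sum_mul, mul_sum, mul_sum, sum_mul, ← sum_sub_distrib]
    refine sum_congr rfl fun k hk => ?_
    linear_combination C (J m j k) * D m * htwo m hm j hj k hk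
      + C (J m j k) * L m j * hone m hm k hk
  have h1 : D m * ∑ j ∈ S, C (y m j) * one m j = (C s - C (γ m) * X ^ m * C Y) * Φ := by
    rw [← hyL, mul_sum, sum_mul]
    refine sum_congr rfl fun j hj => ?_
    linear_combination C (y m j) * hone m hm j hj
  have hE := euler_gaussLog (S.card : ℂ) s (γ m * Y + Z) (γ m) (mem_Icc.1 hm).1
  -- Power series over ℂ form a domain, so the differential equation may be checked after
  -- multiplication by the nonzero `D²`.
  refine mul_left_cancel₀ (pow_ne_zero 2 (hD m hm)) ?_
  have hCu : (C (γ m * Y + Z) : ℂ⟦X⟧) = C (γ m) * C Y + C Z := by rw [map_add, map_mul]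
  rw [hCu] at hE
  have hneg : (C (-(m : ℂ)) : ℂ⟦X⟧) = -C (m : ℂ) := map_neg _ _
  rw [hneg]
  have hX : (X ^ (2 * m) : ℂ⟦X⟧) = X ^ m * X ^ m := by rw [two_mul, pow_add]
  simp only [D, hX] at *
  linear_combination (-(X ^ m * X ^ m) * C (m : ℂ)) * h2
    + X ^ m * C (m : ℂ) * (1 - C (γ m) * (X ^ m * X ^ m)) * h1 - Φ * hE

end Wick

/-! ### The commutators of the β's, the q-Cartan matrix and its inverse. -/

section Brackets

theorem sum_Icc_pred_top {A : Type*} [AddCommMonoid A] (f : ℕ → A) {N : ℕ} (hN : 1 ≤ N) :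
    ∑ i ∈ Icc 1 N, f i = ∑ i ∈ Icc 1 (N - 1), f i + f N := by
  obtain ⟨n, rfl⟩ : ∃ n, N = n + 1 := ⟨N - 1, by omega⟩
  rw [Nat.add_sub_cancel, sum_Icc_succ_top (by omega)]

theorem rpow_intCast_mul {x : ℝ} (hx : 0 < x) (a : ℤ) (m : ℕ) :
    x ^ ((a : ℝ) * m) = (x ^ m) ^ a := by
  rw [mul_comm, Real.rpow_mul hx.le, Real.rpow_natCast, Real.rpow_intCast]

theorem rpow_natCast_mul {x : ℝ} (hx : 0 < x) (a m : ℕ) :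
    x ^ ((a : ℝ) * m) = (x ^ m) ^ a := by
  exact_mod_cast rpow_intCast_mul hx a m

theorem rpow_neg_natCast_mul {x : ℝ} (hx : 0 < x) (a m : ℕ) :
    x ^ (-((a : ℝ) * m)) = (x ^ m)⁻¹ ^ a := by
  rw [Real.rpow_neg hx.le, rpow_natCast_mul hx, inv_pow]

theorem qnum_div_qnum {x : ℝ} (hx : 0 < x) (hx1 : x < 1) (a b : ℝ) :
    qnum x a / qnum x b = (x ^ a - x ^ (-a)) / (x ^ b - x ^ (-b)) := by
  have : x - x⁻¹ ≠ 0 := by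
    have := (one_lt_inv₀ hx).2 hx1
    linarith
  rw [qnum, qnum, div_div_div_cancel_right₀ this]

theorem qnum_natCast_mul {x : ℝ} (hx : 0 < x) (a m : ℕ) :
    qnum x ((a : ℝ) * m) = ((x ^ m) ^ a - (x ^ m)⁻¹ ^ a) / (x - x⁻¹) := by
  rw [qnum, rpow_natCast_mul hx, rpow_neg_natCast_mul hx]

/-- The part of the commutators of the `β` independent of the constraint. -/
def stepForm (q : ℝ) (i k : ℕ) : ℝ :=
  (if i = k then q else 0) + (if i < k then q - q⁻¹ else 0)

/-- The normalized commutators `[β_m^i, β_{-m}^k]`, at `q = x^m`. -/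
def crossForm (N : ℕ) (q : ℝ) (i k : ℕ) : ℝ :=
  stepForm q i k - q ^ N * ((q - q⁻¹) / (q ^ N - q⁻¹ ^ N))

theorem sum_stepForm_left {q : ℝ} (hq : q ≠ 0) {k : ℕ} (hk : 1 ≤ k) (n : ℕ) :
    ∑ i ∈ Icc 1 n, q⁻¹ ^ (2 * i) * stepForm q i k =
      if n < k then q⁻¹ - q⁻¹ ^ (2 * n + 1) else q⁻¹ := by
  have hqp : q * q⁻¹ = 1 := mul_inv_cancel₀ hq
  induction n with
  | zero => simp [show 0 < k by omega]
  | succ n ih =>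
    rw [sum_Icc_succ_top (by omega), ih, stepForm]
    rcases lt_trichotomy (n + 1) k with h | h | h
    · simp only [if_pos h, if_pos (show n < k by omega), if_neg h.ne]
      linear_combination (q⁻¹ ^ (2 * n + 1)) * hqp
    · subst h
      simp only [lt_irrefl, if_false, if_true, if_pos (Nat.lt_succ_self n)]
      linear_combination (q⁻¹ ^ (2 * n + 1)) * hqp
    · simp only [if_neg h.not_gt, if_neg (show ¬ n < k by omega), if_neg h.ne']
      ring

theorem sum_stepForm_right {q : ℝ} (hq : q ≠ 0) {i : ℕ} (hi : 1 ≤ i) (n : ℕ) :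
    ∑ k ∈ Icc 1 n, q ^ (2 * k) * stepForm q i k = if n < i then 0 else q ^ (2 * n + 1) := by
  have hqp : q * q⁻¹ = 1 := mul_inv_cancel₀ hq
  induction n with
  | zero => simp [show 0 < i by omega]
  | succ n ih =>
    rw [sum_Icc_succ_top (by omega), ih, stepForm]
    rcases lt_trichotomy (n + 1) i with h | h | h
    · simp only [if_pos h, if_pos (show n < i by omega), if_neg h.ne', if_neg h.not_gt]
      ring
    · subst h
      simp only [lt_irrefl, if_false, if_true, if_pos (Nat.lt_succ_self n)]
      ring
    · simp only [if_pos h, if_neg h.not_gt, if_neg (show ¬ n < i by omega), if_neg h.ne]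
      linear_combination (-q ^ (2 * n + 1)) * hqp

theorem sum_inv_pow_two_mul {q : ℝ} (hq : q ≠ 0) (n : ℕ) :
    (q - q⁻¹) * ∑ i ∈ Icc 1 n, q⁻¹ ^ (2 * i) = q⁻¹ - q⁻¹ ^ (2 * n + 1) := by
  have hqp : q * q⁻¹ = 1 := mul_inv_cancel₀ hq
  induction n with
  | zero => simp
  | succ n ih =>
    rw [sum_Icc_succ_top (by omega), mul_add, ih]
    linear_combination (q⁻¹ ^ (2 * n + 1)) * hqp

theorem sum_pow_two_mul {q : ℝ} (hq : q ≠ 0) (n : ℕ) :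
    (q - q⁻¹) * ∑ i ∈ Icc 1 n, q ^ (2 * i) = q ^ (2 * n + 1) - q := by
  have hqp : q * q⁻¹ = 1 := mul_inv_cancel₀ hq
  induction n with
  | zero => simp
  | succ n ih =>
    rw [sum_Icc_succ_top (by omega), mul_add, ih]
    linear_combination (-q ^ (2 * n + 1)) * hqp

theorem pow_sub_inv_pow_ne_zero {q : ℝ} (hq : 0 < q) (hq1 : q < 1) {N : ℕ} (hN : 1 ≤ N) :
    q ^ N - q⁻¹ ^ N ≠ 0 := by
  have h1 : q ^ N < 1 := pow_lt_one₀ hq.le hq1 (by omega)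
  have h2 : 1 < q⁻¹ ^ N := one_lt_pow₀ ((one_lt_inv₀ hq).2 hq1) (by omega)
  linarith

/-- The sum of the step part is q⁻¹ for every k ≤ N, and the constant subtracted in `crossForm` is
exactly the one that cancels it. Consequently the commutator formula persists when the index N,
defined by the linear relation among the β's, is included. -/
theorem sum_crossForm_left {q : ℝ} (hq : 0 < q) (hq1 : q < 1) {N k : ℕ} (hk : 1 ≤ k)
    (hkN : k ≤ N) : ∑ i ∈ Icc 1 N, q⁻¹ ^ (2 * i) * crossForm N q i k = 0 := by
  have hqp : q * q⁻¹ = 1 := mul_inv_cancel₀ hq.ne'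
  have hqN : q ^ N * q⁻¹ ^ N = 1 := by rw [← mul_pow, hqp, one_pow]
  have hd := pow_sub_inv_pow_ne_zero hq hq1 (hk.trans hkN)
  have h1 := sum_stepForm_left hq.ne' hk N
  have h2 := sum_inv_pow_two_mul hq.ne' N
  rw [if_neg (by omega)] at h1
  simp only [crossForm, mul_sub, sum_sub_distrib, h1, ← sum_mul]
  rw [sub_eq_zero, mul_div_assoc', mul_div_assoc', eq_div_iff hd]
  linear_combination (-(q ^ N)) * h2 + q⁻¹ * q⁻¹ ^ N * hqN

theorem sum_crossForm_right {q : ℝ} (hq : 0 < q) (hq1 : q < 1) {N i : ℕ} (hi : 1 ≤ i)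
    (hiN : i ≤ N) : ∑ k ∈ Icc 1 N, q ^ (2 * k) * crossForm N q i k = 0 := by
  have hqp : q * q⁻¹ = 1 := mul_inv_cancel₀ hq.ne'
  have hqN : q ^ N * q⁻¹ ^ N = 1 := by rw [← mul_pow, hqp, one_pow]
  have hd := pow_sub_inv_pow_ne_zero hq hq1 (hi.trans hiN)
  have h1 := sum_stepForm_right hq.ne' hi N
  have h2 := sum_pow_two_mul hq.ne' N
  rw [if_neg (by omega)] at h1
  simp only [crossForm, mul_sub, sum_sub_distrib, h1, ← sum_mul]
  rw [sub_eq_zero, mul_div_assoc', mul_div_assoc', eq_div_iff hd]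
  linear_combination (-(q ^ N)) * h2 - q * q ^ N * hqN

/-- The scalar `m [(r-1)m]_x / [rm]_x`. -/
def kap (r : ℕ) (x : ℝ) (m : ℕ) : ℝ := m * (qnum x ((r - 1) * m) / qnum x (r * m))

/-- The two off-diagonal values -q^{∓N}[m]/[Nm] differ by q - q⁻¹, so the three cases of the
commutator are one constant plus a step function of the indices. -/
theorem commCoef_eq {N r : ℕ} {x : ℝ} (hN : 1 ≤ N) (hx : 0 < x) (hx1 : x < 1) {m : ℕ}
    (hm : 1 ≤ m) (i k : ℕ) :
    commCoef N r x m i k = kap r x m * crossForm N (x ^ m) i k := by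
  set q := x ^ m with hqdef
  have hq : 0 < q := pow_pos hx m
  have hq1 : q < 1 := pow_lt_one₀ hx.le hx1 (by omega)
  have hqp : q * q⁻¹ = 1 := mul_inv_cancel₀ hq.ne'
  have hqN : q ^ N * q⁻¹ ^ N = 1 := by rw [← mul_pow, hqp, one_pow]
  have hd := pow_sub_inv_pow_ne_zero hq hq1 hN
  have e0 : ((m : ℤ) : ℝ) = m := by push_cast; rfl
  have hω : qnum x m / qnum x (N * m) = (q - q⁻¹) / (q ^ N - q⁻¹ ^ N) := by
    rw [qnum_div_qnum hx hx1, rpow_natCast_mul hx, rpow_neg_natCast_mul hx, Real.rpow_neg hx.le,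
      Real.rpow_natCast]
  have hω1 : qnum x ((N - 1) * m) / qnum x (N * m)
      = q - q ^ N * ((q - q⁻¹) / (q ^ N - q⁻¹ ^ N)) := by
    have h1 : x ^ (((N : ℝ) - 1) * m) = q ^ N * q⁻¹ := by
      rw [sub_mul, one_mul, Real.rpow_sub hx, rpow_natCast_mul hx, Real.rpow_natCast, div_eq_mul_inv]
    have h2 : x ^ (-(((N : ℝ) - 1) * m)) = q⁻¹ ^ N * q := by
      rw [Real.rpow_neg hx.le, h1, mul_inv, inv_inv, inv_pow]
    rw [qnum_div_qnum hx hx1, rpow_natCast_mul hx, rpow_neg_natCast_mul hx, h1, h2,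
      div_eq_iff hd, sub_mul, mul_assoc, div_mul_cancel₀ _ hd]
    ring
  rw [commCoef, crossForm, stepForm, e0, kap]
  rcases lt_trichotomy i k with h | h | h
  · rw [if_neg h.ne, if_neg h.ne, if_pos h, hω, Int.sign_eq_neg_one_of_neg (by omega)]
    have : x ^ ((N : ℝ) * m * ((-1 : ℤ) : ℝ)) = q⁻¹ ^ N := by
      rw [← rpow_neg_natCast_mul hx]; congr 1; push_cast; ring
    have hω' : (q - q⁻¹) / (q ^ N - q⁻¹ ^ N) * (q ^ N - q⁻¹ ^ N) = q - q⁻¹ :=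
      div_mul_cancel₀ _ hd
    rw [this]
    linear_combination (m * (qnum x ((r - 1) * m) / qnum x (r * m))) * hω'
  · rw [if_pos h, if_pos h, if_neg h.not_lt, hω1]
    ring
  · rw [if_neg h.ne', if_neg h.ne', if_neg h.not_gt, hω, Int.sign_eq_one_of_pos (by omega)]
    have : x ^ ((N : ℝ) * m * ((1 : ℤ) : ℝ)) = q ^ N := by
      rw [← rpow_natCast_mul hx]; congr 1; push_cast; ring
    rw [this]
    ring

/-- The tridiagonal `q`-Cartan matrix. -/
def qCartan (q : ℝ) (j k : ℕ) : ℝ :=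
  if j = k then q + q⁻¹ else if k = j + 1 ∨ j = k + 1 then -1 else 0

/-- Differences in both indices remove the constant of `crossForm`, and only the jump of the step
function near the diagonal survives. This is why the α's have a tridiagonal commutator matrix. -/
theorem crossForm_second_difference {q : ℝ} (hq : q ≠ 0) (N j k : ℕ) :
    q⁻¹ ^ j * q ^ k * (crossForm N q j k - crossForm N q (j + 1) k
      - (crossForm N q j (k + 1) - crossForm N q (j + 1) (k + 1))) = qCartan q j k := by
  have hqp : q * q⁻¹ = 1 := mul_inv_cancel₀ hq
  have hqj : q ^ j * q⁻¹ ^ j = 1 := by rw [← mul_pow, hqp, one_pow]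
  have hqk : q ^ k * q⁻¹ ^ k = 1 := by rw [← mul_pow, hqp, one_pow]
  simp only [crossForm, stepForm, qCartan]
  rcases lt_trichotomy j k with h | h | h
  · rcases (show k = j + 1 ∨ j + 1 < k by omega) with rfl | h2
    · simp only [if_neg (show j ≠ j + 1 by omega), if_neg (show j ≠ j + 1 + 1 by omega),
        if_pos (show j < j + 1 + 1 by omega), if_pos (show j < j + 1 by omega), if_true,
        lt_irrefl, if_false, true_or, if_neg (show j + 1 ≠ j + 1 + 1 by omega),
        if_pos (show j + 1 < j + 1 + 1 by omega)]
      linear_combination -q * q⁻¹ * hqj - hqp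
    · simp only [if_neg h.ne, if_neg h2.ne, if_pos h, if_pos h2,
        if_neg (show j ≠ k + 1 by omega), if_neg (show j + 1 ≠ k + 1 by omega),
        if_pos (show j < k + 1 by omega), if_pos (show j + 1 < k + 1 by omega),
        if_neg (show ¬ (k = j + 1 ∨ j = k + 1) by omega)]
      ring
  · subst h
    simp only [if_neg (show j ≠ j + 1 by omega), if_neg (show j + 1 ≠ j by omega),
      if_pos (show j < j + 1 by omega), if_neg (show ¬ j + 1 < j by omega), if_true, lt_irrefl,
      if_false]
    linear_combination (q + q⁻¹) * hqj
  · rcases (show j = k + 1 ∨ k + 1 < j by omega) with rfl | h2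
    · simp only [if_neg (show k + 1 ≠ k by omega), if_neg (show k + 1 + 1 ≠ k by omega),
        if_neg (show ¬ k + 1 < k by omega), if_neg (show ¬ k + 1 + 1 < k by omega), if_true,
        lt_irrefl, if_false, or_true, if_neg (show k + 1 + 1 ≠ k + 1 by omega),
        if_neg (show ¬ k + 1 + 1 < k + 1 by omega)]
      linear_combination -q * q⁻¹ * hqk - hqp
    · simp only [if_neg h.ne', if_neg h2.ne', if_neg h.not_gt, if_neg h2.not_gt,
        if_neg (show ¬ j + 1 < k by omega), if_neg (show ¬ j + 1 = k by omega),
        if_neg (show ¬ j + 1 = k + 1 by omega), if_neg (show ¬ j + 1 < k + 1 by omega),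
        if_neg (show ¬ (k = j + 1 ∨ j = k + 1) by omega)]
      ring

/-- Zero boundary values at 0 and N supply the missing neighbours in the first and last rows, so the
matrix acts as a second-order difference operator in every row. -/
theorem sum_qCartan_mul (q : ℝ) {N j : ℕ} (hj : j ∈ Icc 1 (N - 1)) {v : ℕ → ℝ} (h0 : v 0 = 0)
    (hN : v N = 0) :
    ∑ k ∈ Icc 1 (N - 1), qCartan q j k * v k = (q + q⁻¹) * v j - v (j - 1) - v (j + 1) := by
  obtain ⟨hj1, hj2⟩ := mem_Icc.1 hj
  have hsplit : ∀ k, qCartan q j k * v k = (if k = j then (q + q⁻¹) * v j else 0)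
      - (if k = j - 1 then v (j - 1) else 0) - (if k = j + 1 then v (j + 1) else 0) := by
    intro k
    simp only [qCartan]
    rcases lt_trichotomy j k with h | h | h
    · rcases (show k = j + 1 ∨ j + 1 < k by omega) with rfl | h2
      · simp [show j + 1 ≠ j - 1 by omega]
      · simp [h.ne, h.ne', show k ≠ j + 1 by omega, show j ≠ k + 1 by omega,
          show k ≠ j - 1 by omega]
    · subst h
      simp [show j ≠ j - 1 by omega]
    · rcases (show j = k + 1 ∨ k + 1 < j by omega) with rfl | h2
      · simp [show k ≠ k + 1 + 1 by omega]
      · simp [h.ne, h.ne', show k ≠ j + 1 by omega, show j ≠ k + 1 by omega,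
          show k ≠ j - 1 by omega]
  simp only [hsplit, sum_sub_distrib, sum_ite_eq', hj, if_true]
  congr 1
  · congr 1
    split_ifs with h
    · rfl
    · rw [show j - 1 = 0 by rw [mem_Icc] at h; omega, h0]
  · split_ifs with h
    · rfl
    · rw [show j + 1 = N by rw [mem_Icc] at h; omega, hN]

theorem invCartan_comm (N : ℕ) (x : ℝ) (m j k : ℕ) : invCartan N x m j k = invCartan N x m k j := by
  rw [invCartan, invCartan, min_comm, max_comm]

/-- `invCartan` is the discrete Green function: on either side of the diagonal it is a solution of
v_{k-1} + v_{k+1} = (q + q⁻¹) v_k that vanishes at the nearer end, and the denominator [m][Nm]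
normalises the jump at the diagonal. -/
theorem sum_qCartan_invCartan {N : ℕ} {x : ℝ} (hx : 0 < x) (hx1 : x < 1) {m : ℕ} (hm : 1 ≤ m)
    {j l : ℕ} (hj : j ∈ Icc 1 (N - 1)) (hl : l ∈ Icc 1 (N - 1)) :
    ∑ k ∈ Icc 1 (N - 1), qCartan (x ^ m) j k * invCartan N x m k l = if j = l then 1 else 0 := by
  obtain ⟨hj1, hj2⟩ := mem_Icc.1 hj
  obtain ⟨hl1, hl2⟩ := mem_Icc.1 hl
  set q := x ^ m with hqdef
  have hq : 0 < q := pow_pos hx m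
  have hq1 : q < 1 := pow_lt_one₀ hx.le hx1 (by omega)
  have hx0 : x - x⁻¹ ≠ 0 := by
    have := (one_lt_inv₀ hx).2 hx1
    linarith
  have hI : ∀ a ≤ N, ∀ b ≤ N, a ≤ b → invCartan N x m a b
      = (q ^ a - q⁻¹ ^ a) * (q ^ (N - b) - q⁻¹ ^ (N - b))
        / ((q - q⁻¹) * (q ^ N - q⁻¹ ^ N)) := by
    intro a _ b hb hab
    have h1 := qnum_natCast_mul hx 1 m
    rw [Nat.cast_one, one_mul, pow_one, pow_one] at h1
    rw [invCartan, min_eq_left hab, max_eq_right hab, qnum_natCast_mul hx,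
      show ((N : ℝ) - (b : ℕ)) = ((N - b : ℕ) : ℝ) by rw [Nat.cast_sub hb], qnum_natCast_mul hx,
      qnum_natCast_mul hx, h1]
    rw [div_mul_div_comm, div_mul_div_comm, div_div_div_cancel_right₀ (mul_ne_zero hx0 hx0)]
  have hI' : ∀ a ≤ N, ∀ b ≤ N, b ≤ a → invCartan N x m a b
      = (q ^ b - q⁻¹ ^ b) * (q ^ (N - a) - q⁻¹ ^ (N - a))
        / ((q - q⁻¹) * (q ^ N - q⁻¹ ^ N)) := fun a ha b hb h => by
    rw [invCartan_comm, hI b hb a ha h]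
  have hqp : q * q⁻¹ = 1 := mul_inv_cancel₀ hq.ne'
  have hd := pow_sub_inv_pow_ne_zero hq hq1 (show 1 ≤ N by omega)
  have hd1 : q - q⁻¹ ≠ 0 := by simpa using pow_sub_inv_pow_ne_zero hq hq1 le_rfl
  rw [sum_qCartan_mul (v := fun k => invCartan N x m k l) q hj
    (by rw [hI 0 (by omega) l (by omega) (by omega)]; simp)
    (by rw [hI' N le_rfl l (by omega) (by omega)]; simp)]
  obtain ⟨i, rfl⟩ : ∃ i, j = i + 1 := ⟨j - 1, by omega⟩
  rw [Nat.add_sub_cancel]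
  rcases lt_trichotomy (i + 1) l with h | h | h
  · rw [if_neg h.ne, hI (i + 1) (by omega) l (by omega) (by omega), hI i (by omega) l (by omega)
      (by omega), hI (i + 1 + 1) (by omega) l (by omega) (by omega), mul_div_assoc', ← sub_div,
      ← sub_div, div_eq_zero_iff]
    left
    linear_combination (q ^ i - q⁻¹ ^ i) * (q ^ (N - l) - q⁻¹ ^ (N - l)) * hqp
  · obtain ⟨b, rfl⟩ : ∃ b, N = l + 1 + b := ⟨N - (l + 1), by omega⟩
    subst h
    rw [if_pos rfl, hI (i + 1) (by omega) (i + 1) (by omega) (by omega), hI i (by omega) (i + 1)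
      (by omega) (by omega), hI' (i + 1 + 1) (by omega) (i + 1) (by omega) (by omega),
      mul_div_assoc', ← sub_div, ← sub_div, div_eq_one_iff_eq (mul_ne_zero hd1 hd)]
    rw [show i + 1 + 1 + b - (i + 1) = b + 1 by omega,
      show i + 1 + 1 + b - (i + 1 + 1) = b by omega]
    linear_combination (2 * q ^ (i + b + 1) - q ^ (i + 1) * q⁻¹ ^ b - q ^ i * q⁻¹ ^ (b + 1)
      - q⁻¹ ^ i * q ^ (b + 1) - q⁻¹ ^ (i + 1) * q ^ b + 2 * q⁻¹ ^ (i + b + 1)) * hqp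
  · obtain ⟨b, rfl⟩ : ∃ b, N = i + 1 + 1 + b := ⟨N - (i + 1 + 1), by omega⟩
    rw [if_neg h.ne', hI' (i + 1) (by omega) l (by omega) (by omega), hI' i (by omega) l (by omega)
      (by omega), hI' (i + 1 + 1) (by omega) l (by omega) (by omega), mul_div_assoc', ← sub_div,
      ← sub_div, div_eq_zero_iff]
    left
    rw [show i + 1 + 1 + b - (i + 1 + 1) = b by omega, show i + 1 + 1 + b - (i + 1) = b + 1 by omega,
      show i + 1 + 1 + b - i = b + 2 by omega]
    linear_combination (q ^ l - q⁻¹ ^ l) * (q ^ b - q⁻¹ ^ b) * hqp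

end Brackets

/-! ### Operators on polynomial Fock spaces that lower the energy, and their exponentials. -/

section Polynomials

open MvPolynomial

variable {σ : Type*}

/-- Derivations whose values on the variables are constants. -/
def IsConstDer (δ : Derivation ℂ (MvPolynomial σ ℂ) (MvPolynomial σ ℂ)) : Prop :=
  ∀ i, ∃ c : ℂ, δ (X i) = C c

theorem IsConstDer.add {δ ε : Derivation ℂ (MvPolynomial σ ℂ) (MvPolynomial σ ℂ)}
    (hδ : IsConstDer δ) (hε : IsConstDer ε) : IsConstDer (δ + ε) := fun i => by
  obtain ⟨a, ha⟩ := hδ i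
  obtain ⟨b, hb⟩ := hε i
  exact ⟨a + b, by rw [Derivation.add_apply, ha, hb, map_add]⟩

theorem IsConstDer.smul {δ : Derivation ℂ (MvPolynomial σ ℂ) (MvPolynomial σ ℂ)}
    (hδ : IsConstDer δ) (t : ℂ) : IsConstDer (t • δ) := fun i => by
  obtain ⟨a, ha⟩ := hδ i
  exact ⟨t * a, by rw [Derivation.smul_apply, ha, smul_eq_C_mul, map_mul]⟩

theorem IsConstDer.neg {δ : Derivation ℂ (MvPolynomial σ ℂ) (MvPolynomial σ ℂ)}
    (hδ : IsConstDer δ) : IsConstDer (-δ) := fun i => by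
  obtain ⟨a, ha⟩ := hδ i
  exact ⟨-a, by rw [Derivation.neg_apply, ha, map_neg]⟩

theorem IsConstDer.zero : IsConstDer (0 : Derivation ℂ (MvPolynomial σ ℂ) (MvPolynomial σ ℂ)) :=
  fun _ => ⟨0, by simp⟩

theorem IsConstDer.sum {ι : Type*} (s : Finset ι)
    {δ : ι → Derivation ℂ (MvPolynomial σ ℂ) (MvPolynomial σ ℂ)}
    (hδ : ∀ i ∈ s, IsConstDer (δ i)) : IsConstDer (∑ i ∈ s, δ i) :=
  Finset.sum_induction _ IsConstDer (fun _ _ => IsConstDer.add) IsConstDer.zero hδ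

/-- The commutator is a derivation that kills every variable. -/
theorem IsConstDer.commute {δ ε : Derivation ℂ (MvPolynomial σ ℂ) (MvPolynomial σ ℂ)}
    (hδ : IsConstDer δ) (hε : IsConstDer ε) :
    Commute (δ : Module.End ℂ (MvPolynomial σ ℂ)) (ε : Module.End ℂ (MvPolynomial σ ℂ)) := by
  have h : ⁅δ, ε⁆ = 0 := derivation_ext fun i => by
    obtain ⟨a, ha⟩ := hδ i
    obtain ⟨b, hb⟩ := hε i
    rw [Derivation.commutator_apply, ha, hb]
    simp
  refine LinearMap.ext fun v => ?_
  have := congrArg (fun d => d v) h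
  simp only [Derivation.commutator_apply, Derivation.zero_apply, sub_eq_zero] at this
  exact this

/-- Polynomials all of whose monomials have weight less than `d`. -/
def weightFil (w : σ → ℕ) (d : ℕ) : Submodule ℂ (MvPolynomial σ ℂ) :=
  Submodule.span ℂ ((fun s => monomial s 1) '' {s : σ →₀ ℕ | Finsupp.weight w s < d})

theorem monomial_mem_weightFil {w : σ → ℕ} {d : ℕ} {s : σ →₀ ℕ} (h : Finsupp.weight w s < d)
    (a : ℂ) : monomial s a ∈ weightFil w d := by
  rw [show monomial s a = a • monomial s 1 by rw [smul_monomial, smul_eq_mul, mul_one]]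
  exact Submodule.smul_mem _ _ (Submodule.subset_span ⟨s, h, rfl⟩)

theorem weightFil_mono (w : σ → ℕ) {d e : ℕ} (h : d ≤ e) : weightFil w d ≤ weightFil w e :=
  Submodule.span_mono (Set.image_mono fun _ hs => lt_of_lt_of_le hs h)

theorem weightFil_zero (w : σ → ℕ) : weightFil w 0 = ⊥ := by
  simp [weightFil]

theorem exists_mem_weightFil (w : σ → ℕ) (v : MvPolynomial σ ℂ) : ∃ d, v ∈ weightFil w d := by
  induction v using MvPolynomial.induction_on' with
  | monomial s a => exact ⟨_, monomial_mem_weightFil (Nat.lt_succ_self _) a⟩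
  | add p q hp hq =>
    obtain ⟨d, hd⟩ := hp
    obtain ⟨e, he⟩ := hq
    exact ⟨max d e, Submodule.add_mem _ (weightFil_mono w (le_max_left d e) hd)
      (weightFil_mono w (le_max_right d e) he)⟩

theorem weightedHomogeneousComponent_mem_weightFil (w : σ → ℕ) (d : ℕ) (v : MvPolynomial σ ℂ) :
    weightedHomogeneousComponent w d v ∈ weightFil w (d + 1) := by
  rw [weightedHomogeneousComponent_apply]
  refine Submodule.sum_mem _ fun s hs => monomial_mem_weightFil ?_ _
  rw [(mem_filter.1 hs).2]
  exact Nat.lt_succ_self d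

/-- Operators that lower the weight. -/
def Lowers (w : σ → ℕ) (G : Module.End ℂ (MvPolynomial σ ℂ)) : Prop :=
  ∀ d, ∀ v ∈ weightFil w (d + 1), G v ∈ weightFil w d

theorem Lowers.add {w : σ → ℕ} {G H : Module.End ℂ (MvPolynomial σ ℂ)} (hG : Lowers w G)
    (hH : Lowers w H) : Lowers w (G + H) :=
  fun d v hv => Submodule.add_mem _ (hG d v hv) (hH d v hv)

theorem Lowers.smul {w : σ → ℕ} {G : Module.End ℂ (MvPolynomial σ ℂ)} (hG : Lowers w G) (t : ℂ) :
    Lowers w (t • G) :=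
  fun d v hv => Submodule.smul_mem _ t (hG d v hv)

theorem Lowers.sum {w : σ → ℕ} {ι : Type*} (s : Finset ι)
    {G : ι → Module.End ℂ (MvPolynomial σ ℂ)} (hG : ∀ i ∈ s, Lowers w (G i)) :
    Lowers w (∑ i ∈ s, G i) :=
  Finset.sum_induction _ (Lowers w) (fun _ _ => Lowers.add)
    (fun _ _ _ => Submodule.zero_mem _) hG

theorem Lowers.mul {w : σ → ℕ} {G H : Module.End ℂ (MvPolynomial σ ℂ)} (hG : Lowers w G)
    (hH : Lowers w H) : Lowers w (G * H) :=
  fun d v hv => hG d _ (weightFil_mono w (Nat.le_succ d) (hH d v hv))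

/-- Each term of the derivative of a monomial has one variable fewer, and every variable has weight
at least 1. -/
theorem IsConstDer.lowers {w : σ → ℕ} (hw : ∀ i, 1 ≤ w i)
    {δ : Derivation ℂ (MvPolynomial σ ℂ) (MvPolynomial σ ℂ)} (hδ : IsConstDer δ) :
    Lowers w (δ : Module.End ℂ (MvPolynomial σ ℂ)) := by
  have hmk : δ = mkDerivation ℂ fun i => δ (X i) := derivation_ext fun i => by
    rw [mkDerivation_X]
  intro d v hv
  have hmap : weightFil w (d + 1) ≤ (weightFil w d).comap (δ : Module.End ℂ (MvPolynomial σ ℂ)) := by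
    refine Submodule.span_le.2 ?_
    rintro _ ⟨s, hs, rfl⟩
    change δ (monomial s 1) ∈ weightFil w d
    rw [hmk, mkDerivation_monomial, one_smul]
    refine Submodule.sum_mem _ fun i hi => ?_
    obtain ⟨c, hc⟩ := hδ i
    have hi' : s i ≠ 0 := Finsupp.mem_support_iff.1 hi
    have h1 := Finsupp.weight_sub_single_add (w := w) hi'
    have hs' : Finsupp.weight w s < d + 1 := hs
    have h2 := hw i
    simp only [hc, smul_eq_mul]
    rw [mul_comm, C_mul_monomial]
    exact monomial_mem_weightFil (by omega) _
  exact hmap hv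

theorem Lowers.pow_apply_eq_zero {w : σ → ℕ} {G : Module.End ℂ (MvPolynomial σ ℂ)}
    (hG : Lowers w G) {d : ℕ} : ∀ v ∈ weightFil w d, ∀ n, d ≤ n → (G ^ n) v = 0 := by
  induction d with
  | zero =>
    intro v hv n _
    rw [weightFil_zero, Submodule.mem_bot] at hv
    rw [hv, map_zero]
  | succ d ih =>
    intro v hv n hn
    obtain ⟨n, rfl⟩ : ∃ k, n = k + 1 := ⟨n - 1, by omega⟩
    rw [pow_succ, Module.End.mul_apply]
    exact ih _ (hG d v hv) n (by omega)

/-- The exponential of an operator cut off at order `K`. -/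
def expCut (K : ℕ) (G : Module.End ℂ (MvPolynomial σ ℂ)) : Module.End ℂ (MvPolynomial σ ℂ) :=
  ∑ n ∈ range K, ((Nat.factorial n : ℂ)⁻¹) • G ^ n

theorem expCut_succ_apply (K : ℕ) (G : Module.End ℂ (MvPolynomial σ ℂ)) (v : MvPolynomial σ ℂ) :
    expCut (K + 1) G v = expCut K G v + ((Nat.factorial K : ℂ)⁻¹) • (G ^ K) v := by
  rw [expCut, sum_range_succ, ← expCut, LinearMap.add_apply, LinearMap.smul_apply]

theorem Lowers.expCut_apply {w : σ → ℕ} {G : Module.End ℂ (MvPolynomial σ ℂ)} (hG : Lowers w G)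
    {d : ℕ} {v : MvPolynomial σ ℂ} (hv : v ∈ weightFil w d) {K : ℕ} (hK : d ≤ K) :
    expCut K G v = expCut d G v := by
  induction K, hK using Nat.le_induction with
  | base => rfl
  | succ K hK ih => rw [expCut_succ_apply, ih, hG.pow_apply_eq_zero v hv K hK, smul_zero, add_zero]

/-- The functional `⟨0| e^G` for an operator `G` that lowers the weight. -/
def dualState (w : σ → ℕ) (G : Module.End ℂ (MvPolynomial σ ℂ)) : MvPolynomial σ ℂ →ₗ[ℂ] ℂ :=
  (basisMonomials σ ℂ).constr ℂ fun s =>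
    constantCoeff (expCut (Finsupp.weight w s + 1) G (monomial s 1))

/-- Below weight K the powers G^n with n ≥ K vanish, so the cut-off exponential is already exact and
the choice of K is immaterial. -/
theorem dualState_apply {w : σ → ℕ} {G : Module.End ℂ (MvPolynomial σ ℂ)} (hG : Lowers w G)
    {K : ℕ} {v : MvPolynomial σ ℂ} (hv : v ∈ weightFil w K) :
    dualState w G v = constantCoeff (expCut K G v) := by
  induction hv using Submodule.span_induction with
  | mem x hx =>
    obtain ⟨s, hs, rfl⟩ := hx
    have hs' : Finsupp.weight w s < K := hs
    have := (basisMonomials σ ℂ).constr_basis ℂ (fun s =>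
      constantCoeff (expCut (Finsupp.weight w s + 1) G (monomial s 1))) s
    rw [coe_basisMonomials] at this
    simp only
    rw [dualState, this, hG.expCut_apply (monomial_mem_weightFil (Nat.lt_succ_self _) 1) hs']
  | zero => simp
  | add x y _ _ hx hy => rw [map_add, map_add, map_add, hx, hy]
  | smul a x _ hx => rw [map_smul, map_smul, hx, smul_eq_C_mul, map_mul, constantCoeff_C, smul_eq_mul]

theorem dualState_one {w : σ → ℕ} {G : Module.End ℂ (MvPolynomial σ ℂ)} (hG : Lowers w G) :
    dualState w G 1 = 1 := by
  have h1 : (1 : MvPolynomial σ ℂ) ∈ weightFil w 1 := by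
    rw [← C_1, C_apply]
    exact monomial_mem_weightFil (by simp) 1
  rw [dualState_apply hG h1]
  simp [expCut]

theorem pow_apply_mul {G H : Module.End ℂ (MvPolynomial σ ℂ)} {c : MvPolynomial σ ℂ}
    (hc : ∀ v, G (c * v) = c * G v + H v) (hGH : Commute G H) (n : ℕ) (v : MvPolynomial σ ℂ) :
    (G ^ (n + 1)) (c * v) = c * (G ^ (n + 1)) v + ((n + 1 : ℕ) : ℂ) • (G ^ n) (H v) := by
  induction n with
  | zero => simp [hc]
  | succ n ih =>
    rw [pow_succ', Module.End.mul_apply, ih, map_add, hc, map_smul, ← Module.End.mul_apply,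
      ← Module.End.mul_apply, ← Module.End.mul_apply, ← pow_succ', ← pow_succ',
      ← (hGH.pow_left (n + 1)).eq, Module.End.mul_apply, add_assoc]
    congr 1
    push_cast
    simp only [add_smul, one_smul]
    abel

/-- The cut-off form of e^G c = c e^G + e^G H for [G, c] = H commuting with G. One power of G is
used up by the commutator, whence the shift of the cut-off in the last term. -/
theorem expCut_succ_apply_mul {G H : Module.End ℂ (MvPolynomial σ ℂ)} {c : MvPolynomial σ ℂ}
    (hc : ∀ v, G (c * v) = c * G v + H v) (hGH : Commute G H) (K : ℕ) (v : MvPolynomial σ ℂ) :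
    expCut (K + 1) G (c * v) = c * expCut (K + 1) G v + expCut K G (H v) := by
  induction K with
  | zero => simp [expCut]
  | succ K ih =>
    rw [expCut_succ_apply, ih, pow_apply_mul hc hGH, expCut_succ_apply (K + 1) G v,
      expCut_succ_apply K G (H v), Nat.factorial_succ]
    have h1 : ((K : ℂ) + 1) ≠ 0 := by exact_mod_cast Nat.succ_ne_zero K
    have h2 : (Nat.factorial K : ℂ) ≠ 0 := by exact_mod_cast Nat.factorial_ne_zero K
    rw [smul_add, smul_smul, mul_add, mul_smul_comm]
    have : (((K + 1) * Nat.factorial K : ℕ) : ℂ)⁻¹ * ((K + 1 : ℕ) : ℂ)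
        = (Nat.factorial K : ℂ)⁻¹ := by
      push_cast
      field_simp
    rw [this]
    rw [add_add_add_comm]

/-- When c is moved to the left of e^G it meets the dual vacuum and disappears, so only the
commutator term remains. -/
theorem dualState_mul {w : σ → ℕ} {G H : Module.End ℂ (MvPolynomial σ ℂ)} (hG : Lowers w G)
    {c : MvPolynomial σ ℂ} (hc0 : constantCoeff c = 0)
    (hc : ∀ v, G (c * v) = c * G v + H v) (hGH : Commute G H) (v : MvPolynomial σ ℂ) :
    dualState w G (c * v) = dualState w G (H v) := by
  obtain ⟨d, hd⟩ := exists_mem_weightFil w (c * v)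
  obtain ⟨e, he⟩ := exists_mem_weightFil w (H v)
  have h1 : c * v ∈ weightFil w (max d e + 1) := weightFil_mono w (by omega) hd
  have h2 : H v ∈ weightFil w (max d e) := weightFil_mono w (by omega) he
  rw [dualState_apply hG h1, dualState_apply hG h2, expCut_succ_apply_mul hc hGH, map_add, map_mul,
    hc0, zero_mul, zero_add]

/-- The algebra homomorphism that scales each variable by `X` to the power its weight. -/
def gradeHom (w : σ → ℕ) : MvPolynomial σ ℂ →ₐ[ℂ] PowerSeries (MvPolynomial σ ℂ) :=
  aeval fun i => PowerSeries.X ^ w i * PowerSeries.C (X i)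

theorem gradeHom_monomial (w : σ → ℕ) (s : σ →₀ ℕ) (a : ℂ) :
    gradeHom w (monomial s a)
      = PowerSeries.X ^ (Finsupp.weight w s) * PowerSeries.C (monomial s a) := by
  rw [gradeHom, aeval_monomial, Finsupp.weight_apply, Finsupp.sum, Finsupp.prod,
    monomial_eq, Finsupp.prod]
  simp only [mul_pow, prod_mul_distrib, ← pow_mul, smul_eq_mul, map_mul, map_prod, map_pow]
  rw [prod_pow_eq_pow_sum]
  have : (algebraMap ℂ (PowerSeries (MvPolynomial σ ℂ))) a = PowerSeries.C (C a) := PowerSeries.algebraMap_apply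
  rw [this]
  simp only [mul_comm (w _)]
  ring

/-- Projection on a fixed energy becomes extraction of a coefficient. As `gradeHom` is
multiplicative, the levels of e^F applied to the vacuum are the coefficients of an exponential of
power series. -/
theorem coeff_gradeHom (w : σ → ℕ) (v : MvPolynomial σ ℂ) (d : ℕ) :
    PowerSeries.coeff d (gradeHom w v) = weightedHomogeneousComponent w d v := by
  classical
  induction v using MvPolynomial.induction_on' with
  | monomial s a =>
    rw [gradeHom_monomial, PowerSeries.coeff_X_pow_mul', PowerSeries.coeff_C]
    ext t
    rw [coeff_weightedHomogeneousComponent, coeff_monomial]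
    by_cases h : s = t
    · subst h
      rw [if_pos rfl]
      split_ifs with h1 h2 h3 h4 h5
      · rw [coeff_monomial, if_pos rfl]
      · omega
      · omega
      · simp
      · omega
      · simp
    · rw [if_neg h]
      split_ifs <;> simp [coeff_monomial, h]
  | add p q hp hq => rw [map_add, map_add, map_add, hp, hq]

end Polynomials

/-! ### The bosons as constant-coefficient derivations and linear polynomials. -/

section Fock

open MvPolynomial

variable {N r : ℕ} {x : ℝ}

/-- The energy of a mode. -/
def modeWeight (N : ℕ) (q : Mode N) : ℕ := q.1.1

theorem one_le_modeWeight (q : Mode N) : 1 ≤ modeWeight N q := q.2.1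

/-- The derivation `β_m^j`, `m ≥ 1`, `1 ≤ j < N`. -/
def annihGen (N r : ℕ) (x : ℝ) (m j : ℕ) : Derivation ℂ (Fock N) (Fock N) :=
  mkDerivation ℂ fun q : Mode N =>
    if (q.1.1 : ℤ) = m then (C ((commCoef N r x m j q.1.2 : ℝ) : ℂ) : Fock N) else 0

/-- The derivation `β_m^j`, `m ≥ 1`, `1 ≤ j ≤ N`. -/
def annih (N r : ℕ) (x : ℝ) (m j : ℕ) : Derivation ℂ (Fock N) (Fock N) :=
  if j = N then
    -((((x ^ m) ^ (2 * N) : ℝ) : ℂ) • ∑ i ∈ Icc 1 (N - 1),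
      (((x ^ m)⁻¹ ^ (2 * i) : ℝ) : ℂ) • annihGen N r x m i)
  else annihGen N r x m j

/-- The variable `β_{-m}^j`, `m ≥ 1`, `1 ≤ j < N`. -/
def createGen (N m j : ℕ) : Fock N :=
  if h : 1 ≤ m ∧ 1 ≤ j ∧ j < N then X ⟨(m, j), h⟩ else 0

/-- The linear polynomial `β_{-m}^j`, `m ≥ 1`, `1 ≤ j ≤ N`. -/
def create (N : ℕ) (x : ℝ) (m j : ℕ) : Fock N :=
  if j = N then
    -((((x ^ m)⁻¹ ^ (2 * N) : ℝ) : ℂ) • ∑ i ∈ Icc 1 (N - 1),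
      (((x ^ m) ^ (2 * i) : ℝ) : ℂ) • createGen N m i)
  else createGen N m j

/-- The derivation `α_m^j`. -/
def annihAlpha (N r : ℕ) (x : ℝ) (m j : ℕ) : Derivation ℂ (Fock N) (Fock N) :=
  (((x ^ m)⁻¹ ^ j : ℝ) : ℂ) • (annih N r x m j - annih N r x m (j + 1))

/-- The linear polynomial `α_{-m}^j`. -/
def createAlpha (N : ℕ) (x : ℝ) (m j : ℕ) : Fock N :=
  (((x ^ m) ^ j : ℝ) : ℂ) • (create N x m j - create N x m (j + 1))

theorem betaGen_pos {m j : ℕ} (hm : 1 ≤ m) (hj : j ∈ Icc 1 (N - 1)) :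
    betaGen N r x m j = (annihGen N r x m j : Module.End ℂ (Fock N)) := by
  have := mem_Icc.1 hj
  rw [betaGen, dif_neg (by omega), if_pos (by omega)]
  rfl

theorem betaGen_neg {m j : ℕ} (hm : 1 ≤ m) (hj : j ∈ Icc 1 (N - 1)) :
    betaGen N r x (-(m : ℤ)) j = LinearMap.mulLeft ℂ (createGen N m j) := by
  have := mem_Icc.1 hj
  rw [betaGen, dif_pos (by omega), createGen, dif_pos (by omega)]
  simp

theorem beta_pos (hx : 0 < x) {m j : ℕ} (hm : 1 ≤ m) (hj : j ∈ Icc 1 N) :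
    beta N r x m j = (annih N r x m j : Module.End ℂ (Fock N)) := by
  have := mem_Icc.1 hj
  rw [beta, annih]
  split_ifs with h
  · have e1 : x ^ (2 * (N : ℝ) * ((m : ℤ) : ℝ)) = (x ^ m) ^ (2 * N) := by
      rw [← rpow_natCast_mul hx]; push_cast; rfl
    have e2 : ∀ i : ℕ, x ^ (-(2 * (i : ℝ) * ((m : ℤ) : ℝ))) = (x ^ m)⁻¹ ^ (2 * i) := fun i => by
      rw [← rpow_neg_natCast_mul hx]; push_cast; rfl
    refine LinearMap.ext fun v => ?_
    simp only [e1, e2, Derivation.coeFn_coe, LinearMap.neg_apply, LinearMap.smul_apply,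
      LinearMap.sum_apply, Derivation.neg_apply, Derivation.smul_apply]
    rw [← Derivation.coeFnAddMonoidHom_apply (∑ i ∈ Icc 1 (N - 1),
      (((x ^ m)⁻¹ ^ (2 * i) : ℝ) : ℂ) • annihGen N r x m i), map_sum, Finset.sum_apply]
    congr 2
    refine sum_congr rfl fun i hi => ?_
    rw [betaGen_pos hm hi]
    rfl
  · exact betaGen_pos hm (mem_Icc.2 (by omega))

theorem mulLeft_sub' (a b : Fock N) :
    LinearMap.mulLeft ℂ (a - b) = LinearMap.mulLeft ℂ a - LinearMap.mulLeft ℂ b :=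
  LinearMap.ext fun v => by simp [sub_mul]

theorem mulLeft_neg' (a : Fock N) : LinearMap.mulLeft ℂ (-a) = -LinearMap.mulLeft ℂ a :=
  LinearMap.ext fun v => by simp

theorem mulLeft_smul (t : ℂ) (a : Fock N) :
    LinearMap.mulLeft ℂ (t • a) = t • LinearMap.mulLeft ℂ a :=
  LinearMap.ext fun v => by simp

theorem mulLeft_add' (a b : Fock N) :
    LinearMap.mulLeft ℂ (a + b) = LinearMap.mulLeft ℂ a + LinearMap.mulLeft ℂ b :=
  LinearMap.ext fun v => by simp [add_mul]

theorem mulLeft_sum {ι : Type*} (s : Finset ι) (a : ι → Fock N) :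
    LinearMap.mulLeft ℂ (∑ i ∈ s, a i) = ∑ i ∈ s, LinearMap.mulLeft ℂ (a i) :=
  LinearMap.ext fun v => by simp [sum_mul, LinearMap.sum_apply]

theorem beta_neg (hx : 0 < x) {m j : ℕ} (hm : 1 ≤ m) (hj : j ∈ Icc 1 N) :
    beta N r x (-(m : ℤ)) j = LinearMap.mulLeft ℂ (create N x m j) := by
  have := mem_Icc.1 hj
  rw [beta, create]
  split_ifs with h
  · have e1 : x ^ (2 * (N : ℝ) * ((-(m : ℤ) : ℤ) : ℝ)) = (x ^ m)⁻¹ ^ (2 * N) := by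
      rw [← rpow_neg_natCast_mul hx]; congr 1; push_cast; ring
    have e2 : ∀ i : ℕ, x ^ (-(2 * (i : ℝ) * ((-(m : ℤ) : ℤ) : ℝ))) = (x ^ m) ^ (2 * i) :=
      fun i => by rw [← rpow_natCast_mul hx]; congr 1; push_cast; ring
    simp only [e1, e2]
    rw [mulLeft_neg', mulLeft_smul, mulLeft_sum]
    congr 2
    refine sum_congr rfl fun i hi => ?_
    rw [betaGen_neg hm hi, mulLeft_smul]
  · exact betaGen_neg hm (mem_Icc.2 (by omega))

theorem alpha_pos (hx : 0 < x) {m j : ℕ} (hm : 1 ≤ m) (hj : j ∈ Icc 1 (N - 1)) :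
    alpha N r x m j = (annihAlpha N r x m j : Module.End ℂ (Fock N)) := by
  have := mem_Icc.1 hj
  have e1 : x ^ (-((j : ℝ) * ((m : ℤ) : ℝ))) = (x ^ m)⁻¹ ^ j := by
    rw [← rpow_neg_natCast_mul hx]; push_cast; rfl
  rw [alpha, annihAlpha, beta_pos hx hm (mem_Icc.2 (by omega)),
    beta_pos hx hm (mem_Icc.2 (by omega)), e1]
  rfl

theorem alpha_neg (hx : 0 < x) {m j : ℕ} (hm : 1 ≤ m) (hj : j ∈ Icc 1 (N - 1)) :
    alpha N r x (-(m : ℤ)) j = LinearMap.mulLeft ℂ (createAlpha N x m j) := by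
  have := mem_Icc.1 hj
  have e1 : x ^ (-((j : ℝ) * ((-(m : ℤ) : ℤ) : ℝ))) = (x ^ m) ^ j := by
    rw [← rpow_natCast_mul hx]; congr 1; push_cast; ring
  rw [alpha, createAlpha, beta_neg hx hm (mem_Icc.2 (by omega)),
    beta_neg hx hm (mem_Icc.2 (by omega)), e1, mulLeft_smul, mulLeft_sub']

theorem annihGen_createGen (hx : 0 < x) (hx1 : x < 1) {m n i k : ℕ} (hm : 1 ≤ m) (hn : 1 ≤ n)
    (hk : k ∈ Icc 1 (N - 1)) :
    annihGen N r x m i (createGen N n k) =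
      if m = n then algebraMap ℂ (Fock N) ((kap r x m * crossForm N (x ^ m) i k : ℝ) : ℂ) else 0 := by
  have := mem_Icc.1 hk
  rw [createGen, dif_pos (by omega), annihGen, mkDerivation_X]
  simp only [Nat.cast_inj, commCoef_eq (r := r) (show 1 ≤ N by omega) hx hx1 hm]
  simp only [eq_comm (a := n)]
  rfl

theorem der_sum_apply {ι : Type*} (s : Finset ι) (δ : ι → Derivation ℂ (Fock N) (Fock N))
    (v : Fock N) : (∑ i ∈ s, δ i) v = ∑ i ∈ s, δ i v := by
  rw [← Derivation.coeFnAddMonoidHom_apply, map_sum, Finset.sum_apply]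
  rfl

/-- The case i = N is the linear relation solved for β^N, evaluated with `sum_crossForm_left`. -/
theorem annih_createGen (hN : 1 ≤ N) (hx : 0 < x) (hx1 : x < 1) {m n i k : ℕ} (hm : 1 ≤ m)
    (hn : 1 ≤ n) (hk : k ∈ Icc 1 (N - 1)) :
    annih N r x m i (createGen N n k) =
      if m = n then algebraMap ℂ (Fock N) ((kap r x m * crossForm N (x ^ m) i k : ℝ) : ℂ) else 0 := by
  have hk' := mem_Icc.1 hk
  have hq : 0 < x ^ m := pow_pos hx m
  have hq1 : x ^ m < 1 := pow_lt_one₀ hx.le hx1 (by omega)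
  rw [annih]
  split_ifs with hi hmn hmn
  · subst hi
    rw [Derivation.neg_apply, Derivation.smul_apply, der_sum_apply]
    simp only [Derivation.smul_apply, annihGen_createGen hx hx1 hm hn hk, if_pos hmn]
    simp only [Algebra.smul_def, ← map_mul, ← map_sum, ← map_neg]
    congr 1
    have h := sum_crossForm_left hq hq1 hk'.1 (show k ≤ i by omega)
    rw [sum_Icc_pred_top _ hN] at h
    have hpp : (x ^ m) ^ (2 * i) * (x ^ m)⁻¹ ^ (2 * i) = 1 := by
      rw [← mul_pow, mul_inv_cancel₀ hq.ne', one_pow]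
    rw [← Complex.ofReal_inj.2 (show -((x ^ m) ^ (2 * i) * ∑ j ∈ Icc 1 (i - 1),
      (x ^ m)⁻¹ ^ (2 * j) * (kap r x m * crossForm i (x ^ m) j k))
        = kap r x m * crossForm i (x ^ m) i k by
      have : ∑ j ∈ Icc 1 (i - 1), (x ^ m)⁻¹ ^ (2 * j) * (kap r x m * crossForm i (x ^ m) j k)
          = kap r x m * ∑ j ∈ Icc 1 (i - 1), (x ^ m)⁻¹ ^ (2 * j) * crossForm i (x ^ m) j k := by
        rw [mul_sum]
        exact sum_congr rfl fun j _ => by ring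
      rw [this]
      linear_combination (-(x ^ m) ^ (2 * i) * kap r x m) * h
        + kap r x m * crossForm i (x ^ m) i k * hpp)]
    push_cast
    rfl
  · rw [Derivation.neg_apply, Derivation.smul_apply, der_sum_apply]
    simp only [Derivation.smul_apply, annihGen_createGen hx hx1 hm hn hk, if_neg hmn]
    simp
  · rw [annihGen_createGen hx hx1 hm hn hk, if_pos hmn]
  · rw [annihGen_createGen hx hx1 hm hn hk, if_neg hmn]

/-- The extension to k = N is the mirror image, with the relation for negative modes and
`sum_crossForm_right`. -/
theorem annih_create (hN : 1 ≤ N) (hx : 0 < x) (hx1 : x < 1) {m n i k : ℕ} (hm : 1 ≤ m)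
    (hn : 1 ≤ n) (hi : i ∈ Icc 1 N) (hk : k ∈ Icc 1 N) :
    annih N r x m i (create N x n k) =
      if m = n then algebraMap ℂ (Fock N) ((kap r x m * crossForm N (x ^ m) i k : ℝ) : ℂ) else 0 := by
  have hk' := mem_Icc.1 hk
  have hi' := mem_Icc.1 hi
  have hq : 0 < x ^ m := pow_pos hx m
  have hq1 : x ^ m < 1 := pow_lt_one₀ hx.le hx1 (by omega)
  rw [create]
  split_ifs with hkN hmn hmn
  · subst hkN
    subst hmn
    rw [map_neg, Derivation.map_smul, map_sum]
    have h1 : ∀ j ∈ Icc 1 (k - 1), annih k r x m i ((((x ^ m) ^ (2 * j) : ℝ) : ℂ) • createGen k m j)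
        = algebraMap ℂ (Fock k)
          (((x ^ m) ^ (2 * j) * (kap r x m * crossForm k (x ^ m) i j) : ℝ) : ℂ) := by
      intro j hj
      rw [Derivation.map_smul, annih_createGen hN hx hx1 hm hn hj, if_pos rfl, Algebra.smul_def,
        ← map_mul, ← Complex.ofReal_mul]
    rw [sum_congr rfl h1, Algebra.smul_def, ← map_sum, ← map_mul, ← map_neg, ← Complex.ofReal_sum,
      ← Complex.ofReal_mul, ← Complex.ofReal_neg]
    congr 2
    have h := sum_crossForm_right hq hq1 hi'.1 hi'.2
    rw [sum_Icc_pred_top _ hN] at h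
    have hpp : (x ^ m) ^ (2 * k) * (x ^ m)⁻¹ ^ (2 * k) = 1 := by
      rw [← mul_pow, mul_inv_cancel₀ hq.ne', one_pow]
    have : ∑ j ∈ Icc 1 (k - 1), (x ^ m) ^ (2 * j) * (kap r x m * crossForm k (x ^ m) i j)
        = kap r x m * ∑ j ∈ Icc 1 (k - 1), (x ^ m) ^ (2 * j) * crossForm k (x ^ m) i j := by
      rw [mul_sum]
      exact sum_congr rfl fun j _ => by ring
    rw [this]
    linear_combination (-(x ^ m)⁻¹ ^ (2 * k) * kap r x m) * h
      + kap r x m * crossForm k (x ^ m) i k * hpp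
  · rw [map_neg, Derivation.map_smul, map_sum, sum_eq_zero, smul_zero, neg_zero]
    intro j hj
    rw [Derivation.map_smul, annih_createGen hN hx hx1 hm hn hj, if_neg hmn, smul_zero]
  · rw [annih_createGen hN hx hx1 hm hn (mem_Icc.2 (by omega)), if_pos hmn]
  · rw [annih_createGen hN hx hx1 hm hn (mem_Icc.2 (by omega)), if_neg hmn]

theorem annihAlpha_createAlpha (hx : 0 < x) (hx1 : x < 1) {m n j k : ℕ} (hm : 1 ≤ m)
    (hn : 1 ≤ n) (hj : j ∈ Icc 1 (N - 1)) (hk : k ∈ Icc 1 (N - 1)) :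
    annihAlpha N r x m j (createAlpha N x n k) =
      if m = n then algebraMap ℂ (Fock N) ((kap r x m * qCartan (x ^ m) j k : ℝ) : ℂ) else 0 := by
  have hk' := mem_Icc.1 hk
  have hj' := mem_Icc.1 hj
  have hq : 0 < x ^ m := pow_pos hx m
  have hN : 1 ≤ N := by omega
  rw [annihAlpha, createAlpha, Derivation.smul_apply, Derivation.sub_apply, Derivation.map_smul,
    Derivation.map_smul, map_sub, map_sub,
    annih_create hN hx hx1 hm hn (mem_Icc.2 (by omega)) (mem_Icc.2 (by omega)),
    annih_create hN hx hx1 hm hn (mem_Icc.2 (by omega)) (mem_Icc.2 (by omega)),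
    annih_create hN hx hx1 hm hn (mem_Icc.2 (by omega)) (mem_Icc.2 (by omega)),
    annih_create hN hx hx1 hm hn (mem_Icc.2 (by omega)) (mem_Icc.2 (by omega))]
  split_ifs with hmn
  · subst hmn
    simp only [Algebra.smul_def, ← map_mul, ← map_sub, ← Complex.ofReal_mul, ← Complex.ofReal_sub]
    congr 2
    rw [← crossForm_second_difference hq.ne' N]
    ring
  · simp

theorem isConstDer_annihAlpha (m j : ℕ) : IsConstDer (annihAlpha N r x m j) := by
  have h1 : ∀ i, IsConstDer (annihGen N r x m i) := fun i q => by
    rw [annihGen, mkDerivation_X]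
    split_ifs
    · exact ⟨_, rfl⟩
    · exact ⟨0, by simp⟩
  have h2 : ∀ i, IsConstDer (annih N r x m i) := fun i => by
    rw [annih]
    split_ifs
    · exact ((IsConstDer.sum _ fun i _ => (h1 i).smul _).smul _).neg
    · exact h1 i
  rw [annihAlpha, sub_eq_add_neg, ← neg_one_smul ℂ (annih N r x m (j + 1))]
  exact ((h2 j).add ((h2 (j + 1)).smul _)).smul _

theorem gradeHom_createAlpha (m j : ℕ) :
    gradeHom (modeWeight N) (createAlpha N x m j)
      = PowerSeries.X ^ m * PowerSeries.C (createAlpha N x m j) := by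
  let P : Fock N → Prop := fun v =>
    gradeHom (modeWeight N) v = PowerSeries.X ^ m * PowerSeries.C v
  have hadd : ∀ u v, P u → P v → P (u + v) := fun u v hu hv => by
    simp only [P] at *
    rw [map_add, hu, hv, map_add, mul_add]
  have hsmul : ∀ (t : ℂ) v, P v → P (t • v) := fun t v hv => by
    simp only [P] at *
    rw [map_smul, hv, smul_eq_C_mul, map_mul, Algebra.smul_def, PowerSeries.algebraMap_apply,
      algebraMap_eq]
    ring
  have hgen : ∀ i, P (createGen N m i) := fun i => by
    simp only [P, createGen]
    split_ifs with h
    · rw [gradeHom, aeval_X]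
      rfl
    · simp
  have h0 : P 0 := by simp [P]
  have hcr : ∀ i, P (create N x m i) := fun i => by
    rw [create]
    split_ifs
    · rw [← neg_smul]
      exact hsmul _ _ (Finset.sum_induction _ P hadd h0 fun i _ => hsmul _ _ (hgen i))
    · exact hgen i
  have : P (createAlpha N x m j) := by
    rw [createAlpha, sub_eq_add_neg, ← neg_one_smul ℂ (create N x m (j + 1))]
    exact hsmul _ _ (hadd _ _ (hcr _) (hsmul _ _ (hcr _)))
  exact this

theorem constantCoeff_createAlpha {m j : ℕ} (hm : 1 ≤ m) :
    constantCoeff (createAlpha N x m j) = 0 := by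
  have h := gradeHom_createAlpha (N := N) (x := x) m j
  have h1 := congrArg (PowerSeries.coeff 0) h
  rw [coeff_gradeHom, PowerSeries.coeff_X_pow_mul', if_neg (by omega)] at h1
  have h2 := congrArg (MvPolynomial.coeff 0) h1
  classical
  rw [coeff_weightedHomogeneousComponent, map_zero, if_pos rfl] at h2
  exact h2

end Fock

/-! ### The pairing of Gaussian states on the Fock space, level by level. -/

section Pairing

open MvPolynomial

/-- A quadratic plus linear expression in commuting annihilation operators. -/
def gaussOp {N : ℕ} (S : Finset ℕ) (M : ℕ) (a : ℕ → ℕ → Derivation ℂ (Fock N) (Fock N))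
    (J : ℕ → ℕ → ℕ → ℂ) (γ : ℕ → ℂ) (z : ℕ → ℕ → ℂ) : Module.End ℂ (Fock N) :=
  (-(1 / 2) : ℂ) • (∑ m ∈ Icc 1 M, ∑ j ∈ S, ∑ k ∈ S, (γ m * J m j k) •
    ((a m j : Module.End ℂ (Fock N)) * (a m k : Module.End ℂ (Fock N))))
  + ∑ m ∈ Icc 1 M, ∑ j ∈ S, z m j • (a m j : Module.End ℂ (Fock N))

variable {N : ℕ} {S : Finset ℕ} {M : ℕ} {a : ℕ → ℕ → Derivation ℂ (Fock N) (Fock N)}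
  {J : ℕ → ℕ → ℕ → ℂ} {γ : ℕ → ℂ} {z : ℕ → ℕ → ℂ}

theorem lowers_gaussOp (ha : ∀ m j, IsConstDer (a m j)) :
    Lowers (modeWeight N) (gaussOp S M a J γ z) := by
  have h1 : ∀ m j, Lowers (modeWeight N) (a m j : Module.End ℂ (Fock N)) := fun m j =>
    (ha m j).lowers one_le_modeWeight
  exact ((Lowers.sum _ fun m _ => Lowers.sum _ fun j _ => Lowers.sum _ fun k _ =>
    ((h1 m j).mul (h1 m k)).smul _).smul _).add
    (Lowers.sum _ fun m _ => Lowers.sum _ fun j _ => (h1 m j).smul _)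

theorem commute_gaussOp (ha : ∀ m j, IsConstDer (a m j)) (m j : ℕ) :
    Commute (gaussOp S M a J γ z) (a m j : Module.End ℂ (Fock N)) := by
  have h1 : ∀ n k, Commute (a n k : Module.End ℂ (Fock N)) (a m j : Module.End ℂ (Fock N)) :=
    fun n k => (ha n k).commute (ha m j)
  refine Commute.add_left (Commute.smul_left (Commute.sum_left _ _ _ fun n _ =>
    Commute.sum_left _ _ _ fun k _ => Commute.sum_left _ _ _ fun l _ =>
      Commute.smul_left ((h1 n k).mul_left (h1 n l)) _) _)
    (Commute.sum_left _ _ _ fun n _ => Commute.sum_left _ _ _ fun k _ =>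
      Commute.smul_left (h1 n k) _)

theorem gaussOp_apply (v : Fock N) : gaussOp S M a J γ z v =
    (-(1 / 2) : ℂ) • (∑ m ∈ Icc 1 M, ∑ j ∈ S, ∑ k ∈ S, (γ m * J m j k) • a m j (a m k v))
      + ∑ m ∈ Icc 1 M, ∑ j ∈ S, z m j • a m j v := by
  simp only [gaussOp, LinearMap.add_apply, LinearMap.smul_apply, LinearMap.sum_apply,
    Module.End.mul_apply, Derivation.coeFn_coe]

/-- The commutator of the Gaussian exponent with a creation variable: the linear part contributes
the scalar ∑ B z, and in the quadratic part the two equal contractions cancel the factor 1/2 while B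
J = 1 leaves the single operator -γ a. This is the hypothesis on T in Wick's theorem. -/
theorem gaussOp_mul {c : ℕ → ℕ → Fock N} {B : ℕ → ℕ → ℕ → ℂ}
    (hac : ∀ m ∈ Icc 1 M, ∀ n ∈ Icc 1 M, ∀ j ∈ S, ∀ k ∈ S,
      a m j (c n k) = if m = n then algebraMap ℂ (Fock N) (B m j k) else 0)
    (hBJ : ∀ m ∈ Icc 1 M, ∀ j ∈ S, ∀ l ∈ S,
      ∑ k ∈ S, B m j k * J m k l = if j = l then 1 else 0)
    (hB : ∀ m j k, B m j k = B m k j) (hJ : ∀ m j k, J m j k = J m k j)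
    {m j : ℕ} (hm : m ∈ Icc 1 M) (hj : j ∈ S) (v : Fock N) :
    gaussOp S M a J γ z (c m j * v) = c m j * gaussOp S M a J γ z v
      + ((∑ k ∈ S, B m j k * z m k) • (1 : Module.End ℂ (Fock N))
        - γ m • (a m j : Module.End ℂ (Fock N))) v := by
  have e1 : ∀ n ∈ Icc 1 M, ∀ k ∈ S, a n k (c m j) = (if n = m then B n k j else 0) • (1 : Fock N) := by
    intro n hn k hk
    rw [hac n hn m hm k hk j hj]
    split_ifs
    · rw [Algebra.algebraMap_eq_smul_one]
    · rw [zero_smul]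
  have e2 : ∀ n ∈ Icc 1 M, ∀ k ∈ S, ∀ v, a n k (c m j * v)
      = c m j * a n k v + (if n = m then B n k j else 0) • v := by
    intro n hn k hk v
    rw [Derivation.leibniz, e1 n hn k hk]
    simp
  have e3 : ∀ n ∈ Icc 1 M, ∀ k ∈ S, ∀ l ∈ S, (γ n * J n k l) • a n k (a n l (c m j * v))
      = c m j * ((γ n * J n k l) • a n k (a n l v))
        + if n = m then (γ n * (B n k j * J n k l)) • a n l v
          + (γ n * (B n l j * J n k l)) • a n k v else 0 := by
    intro n hn k hk l hl
    rw [e2 n hn l hl, map_add, e2 n hn k hk, Derivation.map_smul]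
    split_ifs
    · rw [smul_add, smul_add, smul_smul, smul_smul, mul_smul_comm, add_assoc]
      congr 2
      · congr 1; ring
      · congr 1; ring
    · simp
  have e4 : ∑ k ∈ S, ∑ l ∈ S, (γ m * (B m k j * J m k l)) • a m l v = γ m • a m j v := by
    rw [sum_comm]
    have : ∀ l ∈ S, ∑ k ∈ S, (γ m * (B m k j * J m k l)) • a m l v
        = (γ m * (if j = l then 1 else 0)) • a m l v := by
      intro l hl
      rw [← hBJ m hm j hj l hl, ← sum_smul, mul_sum]
      congr 1
      exact sum_congr rfl fun k _ => by rw [hB m k j]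
    rw [sum_congr rfl this]
    simp [hj]
  have e5 : ∑ k ∈ S, ∑ l ∈ S, (γ m * (B m l j * J m k l)) • a m k v = γ m • a m j v := by
    rw [← e4, sum_comm]
    exact sum_congr rfl fun l _ => sum_congr rfl fun k _ => by rw [hJ m k l]
  rw [gaussOp_apply, gaussOp_apply]
  rw [sum_congr rfl fun n hn => sum_congr rfl fun k hk => sum_congr rfl (e3 n hn k hk),
    sum_congr rfl fun n hn => sum_congr rfl fun k hk => congrArg (z n k • ·) (e2 n hn k hk v)]
  have e6 : ∑ n ∈ Icc 1 M, ∑ k ∈ S, ∑ l ∈ S, (if n = m then (γ n * (B n k j * J n k l)) • a n l v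
          + (γ n * (B n l j * J n k l)) • a n k v else 0) = (2 * γ m) • a m j v := by
    rw [sum_eq_single_of_mem m hm]
    · simp only [if_true, sum_add_distrib]
      rw [e4, e5, ← two_smul ℂ, smul_smul]
    · intro n _ hne
      simp [hne]
  have e7 : ∑ n ∈ Icc 1 M, ∑ k ∈ S, z n k • ((if n = m then B n k j else 0) • v)
      = (∑ k ∈ S, B m j k * z m k) • v := by
    rw [sum_eq_single_of_mem m hm]
    · simp only [if_true, smul_smul, ← sum_smul]
      congr 1
      exact sum_congr rfl fun k _ => by rw [hB m k j]; ring
    · intro n _ hne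
      simp [hne]
  simp only [smul_add, sum_add_distrib, e6, e7]
  rw [mul_add, smul_smul, LinearMap.sub_apply, LinearMap.smul_apply, LinearMap.smul_apply,
    Module.End.one_apply, Derivation.coeFn_coe, show (-(1 / 2) : ℂ) * (2 * γ m) = -γ m by ring,
    neg_smul]
  simp only [mul_sum, mul_smul_comm, neg_smul, mul_neg]
  abel

theorem smul_X_pow_mul_C (t : ℂ) (n : ℕ) (u : Fock N) :
    t • (PowerSeries.X ^ n * PowerSeries.C u) = PowerSeries.X ^ n * PowerSeries.C (t • u) := by
  rw [smul_eq_C_mul, map_mul, Algebra.smul_def, PowerSeries.algebraMap_apply, algebraMap_eq]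
  ring

theorem gradeHom_gauss {c : ℕ → ℕ → Fock N} {y : ℕ → ℕ → ℂ}
    (hcg : ∀ m j, gradeHom (modeWeight N) (c m j) = PowerSeries.X ^ m * PowerSeries.C (c m j)) :
    gradeHom (modeWeight N) ((-(1 / 2) : ℂ) • (∑ m ∈ Icc 1 M, ∑ j ∈ S, ∑ k ∈ S,
        J m j k • (c m j * c m k)) + ∑ m ∈ Icc 1 M, ∑ j ∈ S, y m j • c m j)
      = gaussExponent S M c J y := by
  have h1 : ∀ m j k, gradeHom (modeWeight N) (J m j k • (c m j * c m k))
      = PowerSeries.X ^ (2 * m) * PowerSeries.C (J m j k • (c m j * c m k)) := by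
    intro m j k
    rw [map_smul, map_mul, hcg, hcg, ← smul_X_pow_mul_C, map_mul]
    refine congrArg (J m j k • ·) ?_
    ring
  have h2 : ∀ m j, gradeHom (modeWeight N) (y m j • c m j)
      = PowerSeries.X ^ m * PowerSeries.C (y m j • c m j) := by
    intro m j
    rw [map_smul, hcg, smul_X_pow_mul_C]
  rw [map_add, map_smul, map_sum, map_sum, smul_sum, ← sum_add_distrib, gaussExponent]
  refine sum_congr rfl fun m _ => ?_
  simp only [map_sum, h1, h2]
  simp only [← mul_sum, ← map_sum]
  rw [smul_X_pow_mul_C]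

/-- The pairing of two Gaussian states on the Fock space, projected on a fixed energy. -/
theorem pairing_eq_coeff {c : ℕ → ℕ → Fock N} {B : ℕ → ℕ → ℕ → ℂ} {y : ℕ → ℕ → ℂ}
    (ha : ∀ m j, IsConstDer (a m j))
    (hc0 : ∀ m, 1 ≤ m → ∀ j, constantCoeff (c m j) = 0)
    (hcg : ∀ m j, gradeHom (modeWeight N) (c m j) = PowerSeries.X ^ m * PowerSeries.C (c m j))
    (hac : ∀ m ∈ Icc 1 M, ∀ n ∈ Icc 1 M, ∀ j ∈ S, ∀ k ∈ S,
      a m j (c n k) = if m = n then algebraMap ℂ (Fock N) (B m j k) else 0)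
    (hBJ : ∀ m ∈ Icc 1 M, ∀ j ∈ S, ∀ l ∈ S,
      ∑ k ∈ S, B m j k * J m k l = if j = l then 1 else 0)
    (hB : ∀ m j k, B m j k = B m k j) (hJ : ∀ m j k, J m j k = J m k j)
    {F : Fock N} (hF : F = (-(1 / 2) : ℂ) • (∑ m ∈ Icc 1 M, ∑ j ∈ S, ∑ k ∈ S,
        J m j k • (c m j * c m k)) + ∑ m ∈ Icc 1 M, ∑ j ∈ S, y m j • c m j)
    {K d : ℕ} (hK : d ≤ K) :
    dualVacuum N (expPartial K (gaussOp S M a J γ z)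
      (level N d (expPartial K (LinearMap.mulLeft ℂ F) 1))) =
      PowerSeries.coeff d (expSeries (∑ m ∈ Icc 1 M, gaussLog (S.card : ℂ)
        (∑ j ∈ S, ∑ k ∈ S, B m j k * y m j * z m k)
        (γ m * (∑ j ∈ S, ∑ k ∈ S, B m j k * y m j * y m k)
          + ∑ j ∈ S, ∑ k ∈ S, B m j k * z m j * z m k) (γ m) m)) := by
  set G := gaussOp S M a J γ z with hG
  have hlow : Lowers (modeWeight N) G := lowers_gaussOp ha
  have hgrade := gradeHom_gauss (S := S) (M := M) (J := J) (y := y) hcg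
  rw [← hF] at hgrade
  have hstate : level N d (expPartial K (LinearMap.mulLeft ℂ F) 1)
      = PowerSeries.coeff d (expSeries (gaussExponent S M c J y)) := by
    have h1 : expPartial K (LinearMap.mulLeft ℂ F) 1
        = ∑ n ∈ range (K + 1), ((Nat.factorial n : ℂ)⁻¹) • F ^ n := by
      rw [expPartial, LinearMap.sum_apply]
      refine sum_congr rfl fun n _ => ?_
      rw [LinearMap.smul_apply, LinearMap.pow_mulLeft, LinearMap.mulLeft_apply, mul_one]
    rw [coeff_expSeries (constantCoeff_gaussExponent S M c J y) hK, ← hgrade, level,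
      show (fun q : Mode N => q.1.1) = modeWeight N from rfl, ← coeff_gradeHom, h1]
    simp only [map_sum, map_smul, map_pow]
  -- A vector of energy d ≤ K is killed by all powers of G beyond K, so cutting the dual exponential
  -- at order K loses nothing.
  have hmem : level N d (expPartial K (LinearMap.mulLeft ℂ F) 1)
      ∈ weightFil (modeWeight N) (K + 1) :=
    weightFil_mono _ (by omega) (weightedHomogeneousComponent_mem_weightFil (modeWeight N) d _)
  have hdual := dualState_apply hlow hmem
  have hw := coeffwise_expSeries_gaussExponent S M c a B J γ y z hac
    (dualState (modeWeight N) G) (dualState_one hlow) (fun m hm j hj v => by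
      rw [dualState_mul hlow (hc0 m (mem_Icc.1 hm).1 j) (gaussOp_mul hac hBJ hB hJ hm hj) ?_ v]
      · rw [LinearMap.sub_apply, LinearMap.smul_apply, LinearMap.smul_apply, map_sub, map_smul,
          map_smul]
        rfl
      · exact (Commute.smul_right (Commute.one_right _) _).sub_right
          ((commute_gaussOp ha m j).smul_right _)) hBJ hB hJ
  rw [← hw, coeff_coeffwise, ← hstate, hdual]
  rfl

end Pairing

/-! ### The energy-d contribution to the norm as a coefficient of an exponential. -/

section LevelPairing

variable {N r : ℕ} {x c : ℝ} {p : ℕ → ℝ}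

theorem kap_pos (hr : 2 ≤ r) (hx : 0 < x) (hx1 : x < 1) {m : ℕ} (hm : 1 ≤ m) : 0 < kap r x m := by
  have hm0 : (0 : ℝ) < m := by exact_mod_cast hm
  have hneg : ∀ a : ℝ, 0 < a → x ^ a - x ^ (-a) < 0 := fun a ha => by
    have h1 : x ^ a < 1 := Real.rpow_lt_one hx.le hx1 ha
    have h2 : 1 < x ^ (-a) := Real.one_lt_rpow_of_pos_of_lt_one_of_neg hx hx1 (by linarith)
    linarith
  have hr0 : (2 : ℝ) ≤ r := by exact_mod_cast hr
  rw [kap, qnum_div_qnum hx hx1]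
  exact mul_pos hm0 (div_pos_of_neg_of_neg (hneg _ (mul_pos (by linarith) hm0))
    (hneg _ (mul_pos (by linarith) hm0)))

theorem qCartan_comm (q : ℝ) (j k : ℕ) : qCartan q j k = qCartan q k j := by
  simp only [qCartan, eq_comm (a := k) (b := j), or_comm (a := j = k + 1)]

/-- The invariant form on vectors, at `q`. -/
def cartanForm (N : ℕ) (q : ℝ) (u v : ℕ → ℝ) : ℝ :=
  ∑ j ∈ Icc 1 (N - 1), ∑ k ∈ Icc 1 (N - 1), qCartan q j k * u j * v k

/-- The logarithm of the contribution of all modes of energy `m`. -/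
def modeLog (N r : ℕ) (x : ℝ) (y z : ℕ → ℕ → ℝ) (m : ℕ) : PowerSeries ℂ :=
  gaussLog ((N - 1 : ℕ) : ℂ) ((kap r x m * cartanForm N (x ^ m) (y m) (z m) : ℝ) : ℂ)
    ((kap r x m * ((x ^ m) ^ (2 * N) * cartanForm N (x ^ m) (y m) (y m)
      + cartanForm N (x ^ m) (z m) (z m)) : ℝ) : ℂ) (((x ^ m) ^ (2 * N) : ℝ) : ℂ) m

/-- The hypotheses rewrite the linear parts of F and G in terms of the α's. Both exponents are then
Gaussian in one and the same family of oscillators and Wick's theorem applies. -/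
theorem levelPairing_eq (hr : 2 ≤ r) (hx : 0 < x) (hx1 : x < 1) {y z : ℕ → ℕ → ℝ}
    (hy : ∀ m, 1 ≤ m → ∑ j ∈ Icc 1 (N - 1), ((1 / m * coefD N r x c p j m : ℝ) : ℂ) • create N x m j
      = ∑ j ∈ Icc 1 (N - 1), (y m j : ℂ) • createAlpha N x m j)
    (hz : ∀ m, 1 ≤ m → ∑ j ∈ Icc 1 (N - 1), ((1 / m * coefE N r x c p j m : ℝ) : ℂ) • annih N r x m j
      = ∑ j ∈ Icc 1 (N - 1), (z m j : ℂ) • annihAlpha N r x m j)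
    (M : ℕ) {K d : ℕ} (hK : d ≤ K) :
    levelPairing N r x c p M K d
      = PowerSeries.coeff d (expSeries (∑ m ∈ Icc 1 M, modeLog N r x y z m)) := by
  -- The prefactor [rm]/(m[(r-1)m]) of the quadratic terms is the inverse of the scalar in the
  -- commutators, so J and B are inverse matrices; γ is the factor x^{2Nm} by which the quadratic
  -- part of G differs from that of F.
  let J : ℕ → ℕ → ℕ → ℂ := fun m j k => (((kap r x m)⁻¹ * invCartan N x m j k : ℝ) : ℂ)
  let B : ℕ → ℕ → ℕ → ℂ := fun m j k => ((kap r x m * qCartan (x ^ m) j k : ℝ) : ℂ)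
  let γ : ℕ → ℂ := fun m => (((x ^ m) ^ (2 * N) : ℝ) : ℂ)
  have hkinv : ∀ m : ℕ, 1 / (m : ℝ) * (qnum x (r * m) / qnum x ((r - 1) * m)) = (kap r x m)⁻¹ := by
    intro m
    rw [kap, mul_inv, inv_div, one_div]
  have hG : opG N r x c p M = gaussOp (Icc 1 (N - 1)) M (annihAlpha N r x) J γ
      (fun m j => (z m j : ℂ)) := by
    have q1 : ∀ m ∈ Icc 1 M, ∀ j ∈ Icc 1 (N - 1), ∀ k ∈ Icc 1 (N - 1),
        ((x ^ (2 * (N : ℝ) * m) / m * (qnum x (r * m) / qnum x ((r - 1) * m)) * invCartan N x m j k :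
          ℝ) : ℂ) • (alpha N r x (m : ℤ) j * alpha N r x (m : ℤ) k)
        = (γ m * J m j k) • ((annihAlpha N r x m j : Module.End ℂ (Fock N))
          * (annihAlpha N r x m k : Module.End ℂ (Fock N))) := by
      intro m hm j hj k hk
      rw [alpha_pos hx (mem_Icc.1 hm).1 hj, alpha_pos hx (mem_Icc.1 hm).1 hk]
      refine congrArg (· • _) ?_
      simp only [γ, J]
      rw [← Complex.ofReal_mul, ← hkinv]
      refine congrArg _ ?_
      have : x ^ (2 * (N : ℝ) * m) = (x ^ m) ^ (2 * N) := by
        rw [← rpow_natCast_mul hx]; push_cast; rfl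
      rw [this]
      ring
    have q2 : ∀ m ∈ Icc 1 M, ∑ j ∈ Icc 1 (N - 1),
        ((1 / m * coefE N r x c p j m : ℝ) : ℂ) • beta N r x (m : ℤ) j
        = ∑ j ∈ Icc 1 (N - 1), (z m j : ℂ) • (annihAlpha N r x m j : Module.End ℂ (Fock N)) := by
      intro m hm
      refine LinearMap.ext fun v => ?_
      have h2 := congrArg (fun δ : Derivation ℂ (Fock N) (Fock N) => δ v) (hz m (mem_Icc.1 hm).1)
      simp only [der_sum_apply, Derivation.smul_apply] at h2
      rw [LinearMap.sum_apply, LinearMap.sum_apply]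
      simp only [LinearMap.smul_apply, Derivation.coeFn_coe]
      rw [← h2]
      refine sum_congr rfl fun j hj => ?_
      have hj' := mem_Icc.1 hj
      rw [beta_pos hx (mem_Icc.1 hm).1 (mem_Icc.2 (by omega))]
      rfl
    rw [opG, gaussOp, sum_congr rfl q2,
      sum_congr rfl fun m hm => sum_congr rfl fun j hj => sum_congr rfl fun k hk => q1 m hm j hj k hk]
  have hF : opF N r x c p M = LinearMap.mulLeft ℂ ((-(1 / 2) : ℂ) • (∑ m ∈ Icc 1 M,
      ∑ j ∈ Icc 1 (N - 1), ∑ k ∈ Icc 1 (N - 1), J m j k • (createAlpha N x m j * createAlpha N x m k))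
        + ∑ m ∈ Icc 1 M, ∑ j ∈ Icc 1 (N - 1), (y m j : ℂ) • createAlpha N x m j) := by
    have q1 : ∀ m ∈ Icc 1 M, ∀ j ∈ Icc 1 (N - 1), ∀ k ∈ Icc 1 (N - 1),
        ((1 / m * (qnum x (r * m) / qnum x ((r - 1) * m)) * invCartan N x m j k : ℝ) : ℂ) •
          (alpha N r x (-(m : ℤ)) j * alpha N r x (-(m : ℤ)) k)
        = LinearMap.mulLeft ℂ (J m j k • (createAlpha N x m j * createAlpha N x m k)) := by
      intro m hm j hj k hk
      rw [alpha_neg hx (mem_Icc.1 hm).1 hj, alpha_neg hx (mem_Icc.1 hm).1 hk, mulLeft_smul,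
        LinearMap.mulLeft_mul, hkinv]
      rfl
    have q2 : ∀ m ∈ Icc 1 M, ∑ j ∈ Icc 1 (N - 1),
        ((1 / m * coefD N r x c p j m : ℝ) : ℂ) • beta N r x (-(m : ℤ)) j
        = LinearMap.mulLeft ℂ (∑ j ∈ Icc 1 (N - 1), (y m j : ℂ) • createAlpha N x m j) := by
      intro m hm
      rw [← hy m (mem_Icc.1 hm).1, mulLeft_sum]
      refine sum_congr rfl fun j hj => ?_
      have hj' := mem_Icc.1 hj
      rw [beta_neg hx (mem_Icc.1 hm).1 (mem_Icc.2 (by omega)), mulLeft_smul]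
    rw [opF, mulLeft_add', mulLeft_smul, mulLeft_sum, mulLeft_sum, sum_congr rfl q2,
      sum_congr rfl fun m hm => sum_congr rfl fun j hj => sum_congr rfl fun k hk => q1 m hm j hj k hk]
    simp only [mulLeft_sum]
  have hBJ : ∀ m ∈ Icc 1 M, ∀ j ∈ Icc 1 (N - 1), ∀ l ∈ Icc 1 (N - 1),
      ∑ k ∈ Icc 1 (N - 1), B m j k * J m k l = if j = l then 1 else 0 := by
    intro m hm j hj l hl
    have hk := (kap_pos hr hx hx1 (mem_Icc.1 hm).1).ne'
    have h := sum_qCartan_invCartan hx hx1 (mem_Icc.1 hm).1 hj hl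
    have h2 : ∑ k ∈ Icc 1 (N - 1), B m j k * J m k l = ((∑ k ∈ Icc 1 (N - 1),
        qCartan (x ^ m) j k * invCartan N x m k l : ℝ) : ℂ) := by
      rw [Complex.ofReal_sum]
      refine sum_congr rfl fun k _ => ?_
      simp only [B, J]
      rw [← Complex.ofReal_mul]
      refine congrArg _ ?_
      field_simp
    rw [h2, h]
    split_ifs <;> simp
  have hB : ∀ m j k, B m j k = B m k j := fun m j k => by
    simp only [B]
    rw [qCartan_comm]
  have hJ : ∀ m j k, J m j k = J m k j := fun m j k => by
    simp only [J]
    rw [invCartan_comm]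
  have hac : ∀ m ∈ Icc 1 M, ∀ n ∈ Icc 1 M, ∀ j ∈ Icc 1 (N - 1), ∀ k ∈ Icc 1 (N - 1),
      annihAlpha N r x m j (createAlpha N x n k)
        = if m = n then algebraMap ℂ (Fock N) (B m j k) else 0 := fun m hm n hn j hj k hk =>
    annihAlpha_createAlpha hx hx1 (mem_Icc.1 hm).1 (mem_Icc.1 hn).1 hj hk
  have key := pairing_eq_coeff (γ := γ) (z := fun m j => (z m j : ℂ))
    (y := fun m j => (y m j : ℂ)) (fun m j => isConstDer_annihAlpha (N := N) (r := r) (x := x) m j)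
    (fun m hm j => constantCoeff_createAlpha (N := N) (x := x) hm)
    (fun m j => gradeHom_createAlpha (N := N) (x := x) m j) hac hBJ hB hJ rfl hK
  rw [levelPairing, hG, hF, key]
  refine congrArg (fun A => PowerSeries.coeff d (expSeries A)) (sum_congr rfl fun m _ => ?_)
  rw [modeLog, Nat.card_Icc, Nat.add_sub_cancel]
  have hform : ∀ u v : ℕ → ℝ, ∑ j ∈ Icc 1 (N - 1), ∑ k ∈ Icc 1 (N - 1),
      B m j k * (u j : ℂ) * (v k : ℂ) = ((kap r x m * cartanForm N (x ^ m) u v : ℝ) : ℂ) := by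
    intro u v
    simp only [B, cartanForm, mul_sum, Complex.ofReal_sum]
    refine sum_congr rfl fun j _ => sum_congr rfl fun k _ => ?_
    push_cast
    ring
  rw [hform, hform, hform]
  refine congrArg (fun u => gaussLog _ _ u _ m) ?_
  simp only [γ]
  push_cast
  ring

end LevelPairing

/-! ### Summation over all energies. -/

section NormSeries

open PowerSeries

theorem HasAbsSum.tsum_norm_mul_le {F G : ℂ⟦X⟧} {v w : ℂ} (hF : HasAbsSum F v)
    (hG : HasAbsSum G w) :
    ∑' d, ‖coeff d (F * G)‖ ≤ (∑' d, ‖coeff d F‖) * ∑' d, ‖coeff d G‖ := by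
  have h0 : Summable fun d => ‖‖coeff d F‖‖ := by simpa using hF.1
  have h1 : Summable fun d => ‖‖coeff d G‖‖ := by simpa using hG.1
  have h2 := summable_norm_sum_mul_antidiagonal_of_summable_norm h0 h1
  rw [tsum_mul_tsum_eq_tsum_sum_antidiagonal_of_summable_norm h0 h1]
  refine (hF.mul hG).1.tsum_le_tsum (fun d => ?_) h2.of_norm
  rw [coeff_mul]
  refine (norm_sum_le _ _).trans (sum_le_sum fun p _ => ?_)
  rw [norm_mul]

/-- Absolutely summable coefficients with sum `v` and `ℓ¹`-norm at most `b`. -/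
def HasAbsSumLE (F : ℂ⟦X⟧) (v : ℂ) (b : ℝ) : Prop :=
  HasAbsSum F v ∧ ∑' d, ‖coeff d F‖ ≤ b

theorem HasAbsSumLE.mul {F G : ℂ⟦X⟧} {v w : ℂ} {a b : ℝ} (hF : HasAbsSumLE F v a)
    (hG : HasAbsSumLE G w b) : HasAbsSumLE (F * G) (v * w) (a * b) :=
  ⟨hF.1.mul hG.1, (hF.1.tsum_norm_mul_le hG.1).trans
    (mul_le_mul hF.2 hG.2 (tsum_nonneg fun _ => norm_nonneg _)
      ((tsum_nonneg fun _ => norm_nonneg _).trans hF.2))⟩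

theorem HasAbsSumLE.add {F G : ℂ⟦X⟧} {v w : ℂ} {a b : ℝ} (hF : HasAbsSumLE F v a)
    (hG : HasAbsSumLE G w b) : HasAbsSumLE (F + G) (v + w) (a + b) := by
  have hn : ∀ d, ‖coeff d (F + G)‖ ≤ ‖coeff d F‖ + ‖coeff d G‖ := fun d => by
    rw [map_add]
    exact norm_add_le _ _
  have hs := hF.1.1.add hG.1.1
  have h1 := Summable.of_nonneg_of_le (fun d => norm_nonneg (coeff d (F + G))) hn hs
  refine ⟨⟨h1, by simpa using hF.1.2.add hG.1.2⟩, ?_⟩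
  refine (h1.tsum_le_tsum hn hs).trans ?_
  rw [hF.1.1.tsum_add hG.1.1]
  exact add_le_add hF.2 hG.2

theorem hasAbsSumLE_C_mul_X_pow (a : ℂ) (n : ℕ) : HasAbsSumLE (C a * X ^ n) a ‖a‖ := by
  have h0 : ∀ d, d ≠ n → coeff d (C a * X ^ n : ℂ⟦X⟧) = 0 := fun d hd => by
    rw [coeff_C_mul_X_pow, if_neg hd]
  have h1 : coeff n (C a * X ^ n : ℂ⟦X⟧) = a := by rw [coeff_C_mul_X_pow, if_pos rfl]
  have h2 : HasSum (fun d => ‖coeff d (C a * X ^ n : ℂ⟦X⟧)‖) ‖a‖ := by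
    have := hasSum_single (f := fun d => ‖coeff d (C a * X ^ n : ℂ⟦X⟧)‖) n
      fun d hd => by rw [h0 d hd, norm_zero]
    simpa only [h1] using this
  refine ⟨⟨h2.summable, ?_⟩, h2.tsum_eq.le⟩
  have := hasSum_single (f := fun d => coeff d (C a * X ^ n : ℂ⟦X⟧)) n h0
  simpa only [h1] using this

theorem hasAbsSumLE_C (a : ℂ) : HasAbsSumLE (C a) a ‖a‖ := by
  simpa using hasAbsSumLE_C_mul_X_pow a 0

theorem hasAbsSumLE_of_comp {F : ℂ⟦X⟧} {m : ℕ} (hm : 1 ≤ m)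
    (h0 : ∀ d, ¬ 2 * m ∣ d → coeff d F = 0) {f : ℕ → ℂ} {v : ℂ} {b : ℝ}
    (hf : ∀ i, coeff (2 * m * i) F = f i) (hv : HasSum f v) (hb : HasSum (fun i => ‖f i‖) b) :
    HasAbsSumLE F v b := by
  have hinj : Function.Injective fun i : ℕ => 2 * m * i := fun i j h =>
    Nat.eq_of_mul_eq_mul_left (by omega) h
  have hrange : ∀ d, d ∉ Set.range (fun i : ℕ => 2 * m * i) → coeff d F = 0 := fun d hd =>
    h0 d fun ⟨i, hi⟩ => hd ⟨i, hi.symm⟩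
  have e1 : (fun d => coeff d F) ∘ (fun i : ℕ => 2 * m * i) = f := funext hf
  have e2 : (fun d => ‖coeff d F‖) ∘ (fun i : ℕ => 2 * m * i) = fun i => ‖f i‖ :=
    funext fun i => by simp [hf]
  have h1 : HasSum (fun d => coeff d F) v := (hinj.hasSum_iff hrange).1 (by rwa [e1])
  have h2 : HasSum (fun d => ‖coeff d F‖) b :=
    (hinj.hasSum_iff fun d hd => by rw [hrange d hd, norm_zero]).1 (by rwa [e2])
  exact ⟨⟨h2.summable, h1⟩, h2.tsum_eq.le⟩

theorem hasAbsSumLE_geomSeries {γ : ℝ} (h0 : 0 ≤ γ) (h1 : γ < 1) {m : ℕ} (hm : 1 ≤ m) :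
    HasAbsSumLE (geomSeries γ m) (1 - (γ : ℂ))⁻¹ (1 - γ)⁻¹ := by
  refine hasAbsSumLE_of_comp hm (f := fun i => (γ : ℂ) ^ i) (fun d hd => ?_) (fun i => ?_) ?_ ?_
  · rw [geomSeries, coeff_mk, if_neg hd]
  · rw [geomSeries, coeff_mk, if_pos (dvd_mul_right _ _), Nat.mul_div_cancel_left _ (by omega)]
  · refine hasSum_geometric_of_norm_lt_one ?_
    rwa [Complex.norm_real, Real.norm_of_nonneg h0]
  · simp only [norm_pow, Complex.norm_real, Real.norm_of_nonneg h0]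
    exact hasSum_geometric_of_lt_one h0 h1

/-- This is log t ≤ t - 1 at t = 1/(1 - γ). It makes the ℓ¹-norm of the logarithmic series at most a
multiple of γ, hence summable over the modes. -/
theorem neg_log_one_sub_le {γ : ℝ} (h1 : γ < 1) :
    -Real.log (1 - γ) ≤ γ * (1 - γ)⁻¹ := by
  have h2 : 0 < 1 - γ := by linarith
  have := Real.log_le_sub_one_of_pos (inv_pos.2 h2)
  rw [Real.log_inv] at this
  have h3 : (1 - γ)⁻¹ - 1 = γ * (1 - γ)⁻¹ := by field_simp; ring
  linarith

theorem hasAbsSumLE_neglogSeries {γ : ℝ} (h0 : 0 ≤ γ) (h1 : γ < 1) {m : ℕ} (hm : 1 ≤ m) :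
    HasAbsSumLE (neglogSeries γ m) ((-Real.log (1 - γ) : ℝ) : ℂ) (γ * (1 - γ)⁻¹) := by
  have hlog : HasSum (fun i : ℕ => γ ^ i / i) (-Real.log (1 - γ)) := by
    have := Real.hasSum_pow_div_log_of_abs_lt_one (x := γ) (by rwa [abs_of_nonneg h0])
    -- The term i = 0 is 1 / 0 = 0, so the sum may start at 1.
    rw [← hasSum_nat_add_iff' 1]
    simpa using this
  have h2 : HasAbsSumLE (neglogSeries γ m) ((-Real.log (1 - γ) : ℝ) : ℂ) (-Real.log (1 - γ)) := by
    refine hasAbsSumLE_of_comp hm (f := fun i => ((γ ^ i / i : ℝ) : ℂ)) (fun d hd => ?_)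
      (fun i => ?_) ?_ ?_
    · rw [neglogSeries, coeff_mk, if_neg hd]
    · rw [neglogSeries, coeff_mk, if_pos (dvd_mul_right _ _),
        Nat.mul_div_cancel_left _ (by omega)]
      push_cast
      rfl
    · exact Complex.hasSum_ofReal.2 hlog
    · have : ∀ i : ℕ, ‖((γ ^ i / i : ℝ) : ℂ)‖ = γ ^ i / i := fun i => by
        rw [Complex.norm_real, Real.norm_of_nonneg (by positivity)]
      simpa only [this] using hlog
  exact ⟨h2.1, h2.2.trans (neg_log_one_sub_le h1)⟩

theorem hasAbsSumLE_gaussLog {n : ℕ} {s u γ : ℝ} (h0 : 0 ≤ γ) (h1 : γ < 1) {m : ℕ}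
    (hm : 1 ≤ m) :
    HasAbsSumLE (gaussLog (n : ℂ) (s : ℂ) (u : ℂ) (γ : ℂ) m)
      ((-(n / 2 : ℝ) * Real.log (1 - γ) + (s - u / 2) / (1 - γ) : ℝ) : ℂ)
      ((n / 2 * γ + (|s| + |u| / 2)) * (1 - γ)⁻¹) := by
  have hg := hasAbsSumLE_geomSeries h0 h1 hm
  have hl := (hasAbsSumLE_C ((n : ℂ) / 2)).mul (hasAbsSumLE_neglogSeries h0 h1 hm)
  have hs := hasAbsSumLE_C_mul_X_pow (s : ℂ) m
  have hu := hasAbsSumLE_C_mul_X_pow (-((u : ℂ) / 2)) (2 * m)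
  have h := hl.add ((hs.add hu).mul hg)
  have e1 : gaussLog (n : ℂ) (s : ℂ) (u : ℂ) (γ : ℂ) m = C ((n : ℂ) / 2) * neglogSeries γ m
      + (C (s : ℂ) * X ^ m + C (-((u : ℂ) / 2)) * X ^ (2 * m)) * geomSeries γ m := by
    rw [gaussLog, map_neg]
    ring
  have e2 : ‖(n : ℂ) / 2‖ = (n / 2 : ℝ) := by simp
  have e3 : ‖-((u : ℂ) / 2)‖ = |u| / 2 := by simp
  have e4 : ‖(s : ℂ)‖ = |s| := by simp
  rw [e2, e3, e4] at h
  rw [e1]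
  refine ⟨?_, ?_⟩
  · convert h.1 using 1
    push_cast
    rw [div_eq_mul_inv]
    ring
  · refine h.2.trans (le_of_eq ?_)
    ring

/-- The lowest energy in the contribution of mode m is m itself, reached by the term s X^m. Hence
only finitely many modes reach a given energy. -/
theorem coeff_gaussLog_eq_zero (n s u γ : ℂ) {m e : ℕ} (h : e < m) :
    coeff e (gaussLog n s u γ m) = 0 := by
  have h1 : coeff e (neglogSeries γ m) = 0 := by
    rw [neglogSeries, coeff_mk]
    split_ifs with hd
    · rw [Nat.eq_zero_of_dvd_of_lt hd (by omega)]
      simp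
    · rfl
  rw [gaussLog, map_add, coeff_C_mul, h1, mul_zero, zero_add, sub_mul, map_sub, mul_assoc,
    mul_assoc, coeff_C_mul, coeff_C_mul, coeff_X_pow_mul', coeff_X_pow_mul', if_neg (by omega),
    if_neg (by omega)]
  simp

/-- Since G m starts in degree m, the infinite sum A of all G m exists coefficient by coefficient
and agrees up to degree d with the sum over m ≤ d. Summability of the ℓ¹-norms permits exchanging
modes and degrees, so A takes the value V at X = 1 and its exponential takes the value exp V. -/
theorem hasSum_expSeries_sum {G : ℕ → ℂ⟦X⟧} (hG0 : G 0 = 0)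
    (hG : ∀ m e, e < m → coeff e (G m) = 0) {v : ℕ → ℂ} {b : ℕ → ℝ}
    (hrow : ∀ m, HasAbsSumLE (G m) (v m) (b m)) (hb : Summable b) {V : ℂ} (hV : HasSum v V) :
    HasSum (fun d => coeff d (expSeries (∑ m ∈ Icc 1 d, G m))) (Complex.exp V) := by
  have hGout : ∀ e m, m ∉ Icc 1 e → coeff e (G m) = 0 := by
    intro e m hm
    rcases Nat.eq_zero_or_pos m with h1 | h1
    · rw [h1, hG0, map_zero]
    · exact hG m e (by rw [mem_Icc] at hm; omega)
  let A : ℂ⟦X⟧ := PowerSeries.mk fun e => ∑ m ∈ Icc 1 e, coeff e (G m)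
  have hAc : ∀ e, coeff e A = ∑ m ∈ Icc 1 e, coeff e (G m) := fun e => coeff_mk _ _
  have hA : ∀ d, ∀ e ≤ d, coeff e (∑ m ∈ Icc 1 d, G m) = coeff e A := by
    intro d e he
    rw [hAc, map_sum]
    exact (sum_subset (Icc_subset_Icc_right he) fun m _ hm => hGout e m hm).symm
  have hsum : Summable fun q : ℕ × ℕ => ‖coeff q.2 (G q.1)‖ := by
    rw [summable_prod_of_nonneg fun _ => norm_nonneg _]
    exact ⟨fun m => (hrow m).1.1, Summable.of_nonneg_of_le
      (fun m => tsum_nonneg fun _ => norm_nonneg _) (fun m => (hrow m).2) hb⟩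
  have htot : HasSum (fun q : ℕ × ℕ => coeff q.2 (G q.1)) V := by
    have h1 := hsum.of_norm.hasSum
    have h2 := h1.prod_fiberwise fun m => (hrow m).1.2
    rwa [h2.unique hV] at h1
  have hcol : ∀ e, HasSum (fun m => coeff e (G m)) (coeff e A) := fun e => by
    rw [hAc]
    exact hasSum_sum_of_ne_finset_zero fun m hm => hGout e m hm
  have hcoln : ∀ e, HasSum (fun m => ‖coeff e (G m)‖) (∑ m ∈ Icc 1 e, ‖coeff e (G m)‖) := fun e =>
    hasSum_sum_of_ne_finset_zero fun m hm => by rw [hGout e m hm, norm_zero]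
  have hswap : HasSum (fun q : ℕ × ℕ => coeff q.1 (G q.2)) V :=
    (Equiv.prodComm ℕ ℕ).hasSum_iff.2 htot
  have hswapn : Summable fun q : ℕ × ℕ => ‖coeff q.1 (G q.2)‖ :=
    (Equiv.prodComm ℕ ℕ).summable_iff.2 hsum
  have hAsum : HasAbsSum A V := by
    refine ⟨?_, hswap.prod_fiberwise hcol⟩
    refine Summable.of_nonneg_of_le (fun _ => norm_nonneg _) (fun e => ?_)
      (hswapn.hasSum.prod_fiberwise hcoln).summable
    rw [hAc]
    exact norm_sum_le _ _
  have hA0 : constantCoeff A = 0 := by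
    rw [← coeff_zero_eq_constantCoeff_apply, hAc]
    simp
  have h := hAsum.expSeries hA0
  have heq : (fun d => coeff d (BoundaryFace.expSeries A))
      = fun d => coeff d (BoundaryFace.expSeries (∑ m ∈ Icc 1 d, G m)) :=
    funext fun d => (coeff_expSeries_congr fun e he => hA d e he).symm
  rwa [heq] at h

/-- The uniform bound g < 1 keeps 1/(1 - γ m) bounded, so the ℓ¹-norms are dominated by γ, s and u.
The guard 1 ≤ m is needed because in the application γ 0 = 1. -/
theorem hasSum_expSeries_gaussLog {n : ℕ} {s u γ : ℕ → ℝ} (hγ0 : ∀ m, 1 ≤ m → 0 ≤ γ m)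
    {g : ℝ} (hg : g < 1) (hγ1 : ∀ m, 1 ≤ m → γ m ≤ g) (hγs : Summable γ)
    (hs : Summable fun m => |s m|) (hu : Summable fun m => |u m|) {V : ℝ}
    (hV : HasSum (fun m : ℕ => if 1 ≤ m then
      -(n / 2 : ℝ) * Real.log (1 - γ m) + (s m - u m / 2) / (1 - γ m) else 0) V) :
    HasSum (fun d => coeff d (expSeries (∑ m ∈ Icc 1 d,
      gaussLog (n : ℂ) (s m : ℂ) (u m : ℂ) (γ m : ℂ) m))) (Complex.exp V) := by
  have h1g : 0 < 1 - g := by linarith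
  have hrow : ∀ m, HasAbsSumLE
      (if 1 ≤ m then gaussLog (n : ℂ) (s m : ℂ) (u m : ℂ) (γ m : ℂ) m else 0)
      ((if 1 ≤ m then -(n / 2 : ℝ) * Real.log (1 - γ m)
      + (s m - u m / 2) / (1 - γ m) else 0 : ℝ) : ℂ)
      ((n / 2 * |γ m| + (|s m| + |u m| / 2)) * (1 - g)⁻¹) := by
    intro m
    split_ifs with hm
    · have h := hasAbsSumLE_gaussLog (n := n) (s := s m) (u := u m) (hγ0 m hm)
        ((hγ1 m hm).trans_lt hg) hm
      refine ⟨h.1, h.2.trans ?_⟩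
      rw [abs_of_nonneg (hγ0 m hm)]
      have h2 := hγ0 m hm
      have h3 : 0 ≤ n / 2 * γ m + (|s m| + |u m| / 2) := by positivity
      exact mul_le_mul_of_nonneg_left (inv_anti₀ h1g (by linarith [hγ1 m hm])) h3
    · have h := hasAbsSumLE_C (0 : ℂ)
      rw [map_zero, norm_zero] at h
      refine ⟨by simpa using h.1, h.2.trans ?_⟩
      positivity
  have hb : Summable fun m => (n / 2 * |γ m| + (|s m| + |u m| / 2)) * (1 - g)⁻¹ :=
    ((hγs.abs.mul_left _).add (hs.add (hu.div_const 2))).mul_right _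
  have h := hasSum_expSeries_sum (by simp) (fun m e h => by
    rw [if_pos (by omega), coeff_gaussLog_eq_zero _ _ _ _ h]) hrow hb (Complex.hasSum_ofReal.2 hV)
  have heq : ∀ d, ∑ m ∈ Icc 1 d,
      (if 1 ≤ m then gaussLog (n : ℂ) (s m : ℂ) (u m : ℂ) (γ m : ℂ) m else 0)
      = ∑ m ∈ Icc 1 d, gaussLog (n : ℂ) (s m : ℂ) (u m : ℂ) (γ m : ℂ) m := fun d =>
    sum_congr rfl fun m hm => if_pos (mem_Icc.1 hm).1
  simpa only [heq] using h

theorem hasNorm_of_hasSum {N r : ℕ} {x c : ℝ} {p : ℕ → ℝ} (hN : 1 ≤ N) (hr : 2 ≤ r) (hx : 0 < x)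
    (hx1 : x < 1) {y z : ℕ → ℕ → ℝ}
    (hy : ∀ m, 1 ≤ m → ∑ j ∈ Icc 1 (N - 1), ((1 / m * coefD N r x c p j m : ℝ) : ℂ) • create N x m j
      = ∑ j ∈ Icc 1 (N - 1), (y m j : ℂ) • createAlpha N x m j)
    (hz : ∀ m, 1 ≤ m → ∑ j ∈ Icc 1 (N - 1), ((1 / m * coefE N r x c p j m : ℝ) : ℂ) • annih N r x m j
      = ∑ j ∈ Icc 1 (N - 1), (z m j : ℂ) • annihAlpha N r x m j)
    (hs : Summable fun m => |kap r x m * cartanForm N (x ^ m) (y m) (z m)|)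
    (hu : Summable fun m => |kap r x m * ((x ^ m) ^ (2 * N) * cartanForm N (x ^ m) (y m) (y m)
      + cartanForm N (x ^ m) (z m) (z m))|) {V : ℝ}
    (hV : HasSum (fun m : ℕ => if 1 ≤ m then
      -((N - 1 : ℕ) / 2 : ℝ) * Real.log (1 - (x ^ m) ^ (2 * N))
        + (kap r x m * cartanForm N (x ^ m) (y m) (z m)
          - kap r x m * ((x ^ m) ^ (2 * N) * cartanForm N (x ^ m) (y m) (y m)
            + cartanForm N (x ^ m) (z m) (z m)) / 2) / (1 - (x ^ m) ^ (2 * N)) else 0) V) :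
    HasNorm N r x c p ((Real.exp V : ℝ) : ℂ) := by
  have hpow : ∀ m, (x ^ m) ^ (2 * N) = (x ^ (2 * N)) ^ m := fun m => by
    rw [← pow_mul, ← pow_mul, mul_comm]
  have hxN : x ^ (2 * N) < 1 := pow_lt_one₀ hx.le hx1 (by omega)
  have hsum := hasSum_expSeries_gaussLog (γ := fun m => (x ^ m) ^ (2 * N))
    (fun m _ => by positivity) hxN (fun m hm => by
      rw [hpow]
      calc (x ^ (2 * N)) ^ m ≤ (x ^ (2 * N)) ^ 1 :=
            pow_le_pow_of_le_one (by positivity) hxN.le hm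
        _ = x ^ (2 * N) := pow_one _)
    (by simp only [hpow]; exact summable_geometric_of_lt_one (by positivity) hxN) hs hu hV
  refine ⟨_, fun d => ?_, by rw [Complex.ofReal_exp]; exact hsum⟩
  -- Energy d involves no mode above d and no term of the exponential series of order above d, so
  -- the matrix element is stationary from (d, d) on.
  filter_upwards [eventually_ge_atTop (d, d)] with MK hMK
  obtain ⟨hM, hK⟩ := Prod.le_def.1 hMK
  rw [levelPairing_eq hr hx hx1 hy hz MK.1 hK]
  refine coeff_expSeries_congr fun e he => ?_
  rw [map_sum, map_sum]
  refine (sum_subset (Icc_subset_Icc_right hM) fun m hm hm' => ?_).symm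
  refine coeff_gaussLog_eq_zero _ _ _ _ ?_
  rw [mem_Icc] at hm hm'
  simp only at hM
  omega

end NormSeries

/-! ### Logarithms of infinite products as power sums. -/

section LogSeries

/-- `P > 0` and `log P = ∑ f(m) / m`. -/
def LogSeries (P : ℝ) (f : ℕ → ℝ) : Prop :=
  0 < P ∧ HasSum (fun m : ℕ => f m / m) (Real.log P)

theorem LogSeries.one : LogSeries 1 0 :=
  ⟨one_pos, by simp⟩

theorem LogSeries.mul {P Q : ℝ} {f g : ℕ → ℝ} (hP : LogSeries P f) (hQ : LogSeries Q g) :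
    LogSeries (P * Q) (f + g) :=
  ⟨mul_pos hP.1 hQ.1, by
    rw [Real.log_mul hP.1.ne' hQ.1.ne']
    simpa [add_div] using hP.2.add hQ.2⟩

theorem LogSeries.inv {P : ℝ} {f : ℕ → ℝ} (hP : LogSeries P f) : LogSeries P⁻¹ (-f) :=
  ⟨inv_pos.2 hP.1, by
    rw [Real.log_inv]
    simpa [neg_div] using hP.2.neg⟩

theorem LogSeries.div {P Q : ℝ} {f g : ℕ → ℝ} (hP : LogSeries P f) (hQ : LogSeries Q g) :
    LogSeries (P / Q) (f - g) := by
  rw [div_eq_mul_inv, sub_eq_add_neg]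
  exact hP.mul hQ.inv

theorem LogSeries.rpow {P : ℝ} {f : ℕ → ℝ} (hP : LogSeries P f) (t : ℝ) :
    LogSeries (P ^ t) (t • f) :=
  ⟨Real.rpow_pos_of_pos hP.1 t, by
    rw [Real.log_rpow hP.1]
    simpa [mul_div_assoc] using hP.2.mul_left t⟩

theorem LogSeries.pow {P : ℝ} {f : ℕ → ℝ} (hP : LogSeries P f) (n : ℕ) :
    LogSeries (P ^ n) ((n : ℝ) • f) := by
  rw [← Real.rpow_natCast]
  exact hP.rpow n

theorem LogSeries.sqrt {P : ℝ} {f : ℕ → ℝ} (hP : LogSeries P f) :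
    LogSeries (√P) ((1 / 2 : ℝ) • f) := by
  rw [Real.sqrt_eq_rpow]
  exact hP.rpow _

theorem LogSeries.prod {ι : Type*} {s : Finset ι} {P : ι → ℝ} {f : ι → ℕ → ℝ}
    (h : ∀ i ∈ s, LogSeries (P i) (f i)) : LogSeries (∏ i ∈ s, P i) (∑ i ∈ s, f i) := by
  classical
  induction s using Finset.induction_on with
  | empty => simpa using LogSeries.one
  | insert a s ha ih =>
    rw [prod_insert ha, sum_insert ha]
    exact (h a (mem_insert_self a s)).mul (ih fun i hi => h i (mem_insert_of_mem hi))

theorem LogSeries.congr {P : ℝ} {f g : ℕ → ℝ} (hP : LogSeries P f)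
    (h : ∀ m, 1 ≤ m → f m = g m) : LogSeries P g := by
  refine ⟨hP.1, ?_⟩
  have : (fun m : ℕ => g m / m) = fun m : ℕ => f m / m := by
    funext m
    rcases Nat.eq_zero_or_pos m with rfl | hm
    · simp
    · rw [h m hm]
  rw [this]
  exact hP.2

/-- Expand -log(1 - t i) = ∑ (t i)^m / m and exchange the sums; all terms are nonnegative, so
summability in one order suffices. -/
theorem logSeries_tprod {ι : Type*} {t : ι → ℝ} (h0 : ∀ i, 0 ≤ t i) (h1 : ∀ i, t i < 1)
    {S : ℕ → ℝ} (hS : ∀ m, 1 ≤ m → HasSum (fun i => t i ^ m) (S m))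
    (hsum : Summable fun m : ℕ => S m / m) : LogSeries (∏' i, (1 - t i)) (fun m => -S m) := by
  let g : ℕ × ι → ℝ := fun q => t q.2 ^ q.1 / q.1
  have hg0 : ∀ q, 0 ≤ g q := fun q => div_nonneg (pow_nonneg (h0 _) _) (Nat.cast_nonneg _)
  have hrow : ∀ m, HasSum (fun i => g (m, i)) (S m / m) := by
    intro m
    rcases Nat.eq_zero_or_pos m with rfl | hm
    · simp only [g, Nat.cast_zero, div_zero]
      exact hasSum_zero
    · exact (hS m hm).div_const _
  have hg : Summable g := by
    rw [summable_prod_of_nonneg hg0]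
    refine ⟨fun m => (hrow m).summable, ?_⟩
    simpa only [(hrow _).tsum_eq] using hsum
  have htot : HasSum g (∑' m : ℕ, S m / m) := by
    have h1 := hg.hasSum
    have h2 := h1.prod_fiberwise hrow
    rwa [← h2.tsum_eq] at h1
  have hswap : HasSum (fun q : ι × ℕ => g (q.2, q.1)) (∑' m : ℕ, S m / m) :=
    (Equiv.prodComm ι ℕ).hasSum_iff.2 htot
  have hlog : ∀ i, HasSum (fun m : ℕ => g (m, i)) (-Real.log (1 - t i)) := by
    intro i
    have := Real.hasSum_pow_div_log_of_abs_lt_one (x := t i) (by rw [abs_of_nonneg (h0 i)]; exact h1 i)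
    rw [← hasSum_nat_add_iff' 1]
    simpa [g] using this
  have hcol := (hswap.prod_fiberwise hlog).neg
  simp only [neg_neg] at hcol
  have hprod := Real.hasProd_of_hasSum_log (fun i => sub_pos.2 (h1 i)) hcol
  rw [hprod.tprod_eq]
  refine ⟨Real.exp_pos _, ?_⟩
  rw [Real.log_exp]
  simpa [neg_div] using hsum.hasSum.neg

theorem pow_le_of_one_le {q : ℝ} (h0 : 0 ≤ q) (h1 : q < 1) {m : ℕ} (hm : 1 ≤ m) : q ^ m ≤ q := by
  simpa using pow_le_pow_of_le_one h0 h1.le hm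

theorem logSeries_poch {z q : ℝ} (hz0 : 0 ≤ z) (hz1 : z < 1) (hq0 : 0 ≤ q) (hq1 : q < 1) :
    LogSeries (poch z q) (fun m => -(z ^ m / (1 - q ^ m))) := by
  have hd : ∀ m : ℕ, 1 ≤ m → 1 - q ≤ 1 - q ^ m := fun m hm => by
    linarith [pow_le_of_one_le hq0 hq1 hm]
  have hqp : 0 < 1 - q := by linarith
  refine logSeries_tprod (fun i => by positivity) (fun i => ?_) (fun m hm => ?_) ?_
  · exact (mul_le_of_le_one_left hz0 (pow_le_one₀ hq0 hq1.le)).trans_lt hz1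
  · have h := (hasSum_geometric_of_lt_one (pow_nonneg hq0 m)
      (pow_lt_one₀ hq0 hq1 (by omega))).mul_right (z ^ m)
    rw [div_eq_inv_mul]
    refine h.congr_fun fun i => ?_
    rw [mul_pow, ← pow_mul, ← pow_mul, mul_comm, mul_comm i, mul_comm]
  · refine Summable.of_norm_bounded (g := fun m => z ^ m * (1 - q)⁻¹)
      ((summable_geometric_of_lt_one hz0 hz1).mul_right _) fun m => ?_
    rcases Nat.eq_zero_or_pos m with rfl | hm
    · simp; linarith
    · have h1 := hd m hm
      have h1' : 0 < 1 - q ^ m := by linarith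
      have hm' : (1 : ℝ) ≤ m := by exact_mod_cast hm
      rw [Real.norm_of_nonneg (by positivity), div_eq_mul_inv]
      refine (div_le_self (by positivity) hm').trans ?_
      exact mul_le_mul_of_nonneg_left (inv_anti₀ hqp h1) (by positivity)

theorem logSeries_poch₂ {z q₁ q₂ : ℝ} (hz0 : 0 ≤ z) (hz1 : z < 1) (h10 : 0 ≤ q₁) (h11 : q₁ < 1)
    (h20 : 0 ≤ q₂) (h21 : q₂ < 1) :
    LogSeries (poch₂ z q₁ q₂) (fun m => -(z ^ m / ((1 - q₁ ^ m) * (1 - q₂ ^ m)))) := by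
  have hd : ∀ q : ℝ, 0 ≤ q → q < 1 → ∀ m : ℕ, 1 ≤ m → 1 - q ≤ 1 - q ^ m := fun q h h' m hm => by
    linarith [pow_le_of_one_le h h' hm]
  have hp1 : 0 < 1 - q₁ := by linarith
  have hp2 : 0 < 1 - q₂ := by linarith
  refine logSeries_tprod (fun i => by positivity) (fun i => ?_) (fun m hm => ?_) ?_
  · refine (mul_le_of_le_one_left hz0 ?_).trans_lt hz1
    exact mul_le_one₀ (pow_le_one₀ h10 h11.le) (by positivity) (pow_le_one₀ h20 h21.le)
  · have h1 := hasSum_geometric_of_lt_one (pow_nonneg h10 m) (pow_lt_one₀ h10 h11 (by omega))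
    have h2 := hasSum_geometric_of_lt_one (pow_nonneg h20 m) (pow_lt_one₀ h20 h21 (by omega))
    have h := (h1.mul h2 (h1.summable.mul_of_nonneg h2.summable
      (fun _ => by positivity) (fun _ => by positivity))).mul_right (z ^ m)
    rw [div_eq_inv_mul, mul_inv]
    refine h.congr_fun fun i => ?_
    simp only [mul_pow, ← pow_mul, mul_comm m]
  · refine Summable.of_norm_bounded (g := fun m => z ^ m * ((1 - q₁)⁻¹ * (1 - q₂)⁻¹))
      ((summable_geometric_of_lt_one hz0 hz1).mul_right _) fun m => ?_
    rcases Nat.eq_zero_or_pos m with rfl | hm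
    · simp; positivity
    · have h1 := hd q₁ h10 h11 m hm
      have h2 := hd q₂ h20 h21 m hm
      have h1' : 0 < 1 - q₁ ^ m := by linarith
      have h2' : 0 < 1 - q₂ ^ m := by linarith
      have hm' : (1 : ℝ) ≤ m := by exact_mod_cast hm
      rw [Real.norm_of_nonneg (by positivity), div_eq_mul_inv (z ^ m), mul_inv]
      refine (div_le_self (by positivity) hm').trans ?_
      refine mul_le_mul_of_nonneg_left ?_ (by positivity)
      exact mul_le_mul (inv_anti₀ hp1 h1) (inv_anti₀ hp2 h2) (by positivity) (by positivity)

/-- The factors in which q₂ has exponent 0 form the single product. It does not depend on q₂, so it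
is common to the products at the two levels. -/
theorem poch₂_eq_mul {z q₁ q₂ : ℝ} (h10 : 0 ≤ q₁) (h11 : q₁ < 1) (h20 : 0 ≤ q₂) (h21 : q₂ < 1) :
    poch₂ z q₁ q₂ = poch z q₁ * poch₂ (q₂ * z) q₁ q₂ := by
  have hs1 := summable_geometric_of_lt_one h10 h11
  have hs2 := summable_geometric_of_lt_one h20 h21
  have hsum : ∀ w : ℝ, Multipliable fun i : ℕ × ℕ => 1 - q₁ ^ i.1 * q₂ ^ i.2 * w := fun w => by
    have h := ((hs1.mul_of_nonneg hs2 (fun _ => by positivity)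
      (fun _ => by positivity)).mul_right w).neg
    simpa [sub_eq_add_neg] using Real.multipliable_one_add_of_summable h
  have hsum1 : Multipliable fun i : ℕ => 1 - q₁ ^ i * z := by
    simpa [sub_eq_add_neg] using Real.multipliable_one_add_of_summable (hs1.mul_right z).neg
  let f : ℕ × ℕ → ℝ := fun i => 1 - q₁ ^ i.1 * q₂ ^ i.2 * z
  have hg : HasProd (fun i : ℕ × ℕ => if i.2 = 0 then f i else 1) (poch z q₁) := by
    have hinj : Function.Injective fun i : ℕ => ((i, 0) : ℕ × ℕ) := fun i j h => by simpa using h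
    refine (hinj.hasProd_iff fun i hi => ?_).1 ?_
    · rw [if_neg]
      intro h
      exact hi ⟨i.1, by simp [← h]⟩
    · simpa [Function.comp_def, f, poch] using hsum1.hasProd
  have hh : HasProd (fun i : ℕ × ℕ => if i.2 = 0 then 1 else f i) (poch₂ (q₂ * z) q₁ q₂) := by
    have hinj : Function.Injective fun i : ℕ × ℕ => ((i.1, i.2 + 1) : ℕ × ℕ) := fun i j h => by
      simp only [Prod.mk.injEq, Nat.add_right_cancel_iff] at h
      exact Prod.ext h.1 h.2
    refine (hinj.hasProd_iff fun i hi => ?_).1 ?_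
    · rw [if_pos]
      by_contra h
      exact hi ⟨(i.1, i.2 - 1), Prod.ext rfl (by simp only; omega)⟩
    · have h := (hsum (q₂ * z)).hasProd
      refine h.congr_fun fun i => ?_
      simp only [Function.comp, if_neg (Nat.succ_ne_zero _), f]
      ring
  have h := hg.mul hh
  refine HasProd.tprod_eq (h.congr_fun fun i => ?_)
  split_ifs <;> simp [f]

end LogSeries

/-! ### Logarithmic series of the quotients at the two levels r and r - 1. -/

section QuotSeries

theorem rpow_pow_comm {x : ℝ} (hx : 0 ≤ x) (e : ℝ) (m : ℕ) : (x ^ e) ^ m = (x ^ m) ^ e := by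
  rw [← Real.rpow_natCast, ← Real.rpow_mul hx, mul_comm, Real.rpow_mul hx, Real.rpow_natCast]

theorem logSeries_poch_rpow {x e b : ℝ} (hx : 0 < x) (hx1 : x < 1) (he : 0 < e) (hb : 0 < b) :
    LogSeries (poch (x ^ e) (x ^ b)) (fun m => -((x ^ m) ^ e / (1 - (x ^ m) ^ b))) := by
  simpa only [rpow_pow_comm hx.le] using
    logSeries_poch (Real.rpow_nonneg hx.le e) (Real.rpow_lt_one hx.le hx1 he)
      (Real.rpow_nonneg hx.le b) (Real.rpow_lt_one hx.le hx1 hb)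

theorem logSeries_poch₂_rpow {x e b s : ℝ} (hx : 0 < x) (hx1 : x < 1) (he : 0 < e) (hb : 0 < b)
    (hs : 0 < s) :
    LogSeries (poch₂ (x ^ e) (x ^ b) (x ^ s))
      (fun m => -((x ^ m) ^ e / (1 - (x ^ m) ^ b) * (1 / (1 - (x ^ m) ^ s)))) := by
  have h := logSeries_poch₂ (Real.rpow_nonneg hx.le e) (Real.rpow_lt_one hx.le hx1 he)
      (Real.rpow_nonneg hx.le b) (Real.rpow_lt_one hx.le hx1 hb)
      (Real.rpow_nonneg hx.le s) (Real.rpow_lt_one hx.le hx1 hs)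
  simp only [rpow_pow_comm hx.le] at h
  refine h.congr fun m _ => ?_
  rw [div_mul_div_comm, mul_one]

/-- The quotient of two double products which share the factor `(x^e; x^b)_∞`, with that factor
cancelled. -/
theorem logSeries_poch₂_quot {x e b s t : ℝ} (hx : 0 < x) (hx1 : x < 1) (hb : 0 < b)
    (hs : 0 < s) (ht : 0 < t) (hes : 0 < e + s) (het : 0 < e + t) :
    LogSeries (if poch₂ (x ^ e) (x ^ b) (x ^ s) = 0 then
        poch₂ (x ^ (e + t)) (x ^ b) (x ^ t) / poch₂ (x ^ (e + s)) (x ^ b) (x ^ s)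
      else poch₂ (x ^ e) (x ^ b) (x ^ t) / poch₂ (x ^ e) (x ^ b) (x ^ s))
      (fun m => -((x ^ m) ^ e / (1 - (x ^ m) ^ b) *
        (1 / (1 - (x ^ m) ^ t) - 1 / (1 - (x ^ m) ^ s)))) := by
  have hfac : ∀ u : ℝ, 0 < u → poch₂ (x ^ e) (x ^ b) (x ^ u) =
      poch (x ^ e) (x ^ b) * poch₂ (x ^ (e + u)) (x ^ b) (x ^ u) := fun u hu => by
    rw [add_comm, Real.rpow_add hx]
    exact poch₂_eq_mul (Real.rpow_nonneg hx.le b) (Real.rpow_lt_one hx.le hx1 hb)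
      (Real.rpow_nonneg hx.le u) (Real.rpow_lt_one hx.le hx1 hu)
  -- If the denominator is nonzero then so is the common factor, which cancels. Both branches thus
  -- equal the shifted quotient, and only e + s and e + t have to be positive for its logarithm to
  -- be expanded.
  have hval : (if poch₂ (x ^ e) (x ^ b) (x ^ s) = 0 then
        poch₂ (x ^ (e + t)) (x ^ b) (x ^ t) / poch₂ (x ^ (e + s)) (x ^ b) (x ^ s)
      else poch₂ (x ^ e) (x ^ b) (x ^ t) / poch₂ (x ^ e) (x ^ b) (x ^ s)) =
      poch₂ (x ^ (e + t)) (x ^ b) (x ^ t) / poch₂ (x ^ (e + s)) (x ^ b) (x ^ s) := by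
    split_ifs with h
    · rfl
    · rw [hfac s hs] at h
      rw [hfac s hs, hfac t ht, mul_div_mul_left _ _ (left_ne_zero_of_mul h)]
  rw [hval]
  refine ((logSeries_poch₂_rpow hx hx1 het hb ht).div
    (logSeries_poch₂_rpow hx hx1 hes hb hs)).congr fun m hm => ?_
  have hxm : 0 < x ^ m := pow_pos hx m
  have hlt : ∀ u : ℝ, 0 < u → (1 - (x ^ m) ^ u) ≠ 0 := fun u hu => by
    have := Real.rpow_lt_one hxm.le (pow_lt_one₀ hx.le hx1 (by omega)) hu
    linarith
  have h1 := hlt t ht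
  have h2 := hlt s hs
  have h3 := hlt b hb
  simp only [Pi.sub_apply, Real.rpow_add hxm]
  field_simp
  ring

variable {N r : ℕ} {x : ℝ}

theorem logSeries_sq (hN : 1 ≤ N) (hx : 0 < x) (hx1 : x < 1) {s e : ℝ} (hs : 0 < s) (he : 0 < e) :
    LogSeries (sq N x s e) (fun m => -((x ^ m) ^ e / (1 - (x ^ m) ^ (2 * (N : ℝ))) *
      (1 / (1 - (x ^ m) ^ (2 * s))))) := by
  have hN' : (0 : ℝ) < N := by exact_mod_cast hN
  exact logSeries_poch₂_rpow hx hx1 he (by positivity) (by positivity)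

theorem logSeries_cu (hN : 1 ≤ N) (hx : 0 < x) (hx1 : x < 1) {s e : ℝ} (hs : 0 < s) (he : 0 < e) :
    LogSeries (cu N x s e) (fun m => -((x ^ m) ^ e / (1 - (x ^ m) ^ (4 * (N : ℝ))) *
      (1 / (1 - (x ^ m) ^ (2 * s))))) := by
  have hN' : (0 : ℝ) < N := by exact_mod_cast hN
  exact logSeries_poch₂_rpow hx hx1 he (by positivity) (by positivity)

/-- `1 / (1 - q^{2 r}) - 1 / (1 - q^{2(r-1)})`. -/
def levelGap (r : ℕ) (q : ℝ) : ℝ := 1 / (1 - q ^ (2 * (r : ℝ))) - 1 / (1 - q ^ (2 * ((r : ℝ) - 1)))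

/-- The exponent e itself may be negative or zero: the difference of the two levels behaves as if
both series converged separately. -/
theorem logSeries_sqQuot (hN : 1 ≤ N) (hr : 2 ≤ r) (hx : 0 < x) (hx1 : x < 1) {e : ℝ}
    (he : 0 < e + 2 * (r - 1)) :
    LogSeries (sqQuot N r x e)
      (fun m => -((x ^ m) ^ e / (1 - (x ^ m) ^ (2 * (N : ℝ))) * levelGap r (x ^ m))) := by
  have hN' : (0 : ℝ) < N := by exact_mod_cast hN
  have hr' : (2 : ℝ) ≤ r := by exact_mod_cast hr
  exact logSeries_poch₂_quot hx hx1 (by positivity) (by linarith) (by linarith) he (by linarith)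

theorem logSeries_cuQuot (hN : 1 ≤ N) (hr : 2 ≤ r) (hx : 0 < x) (hx1 : x < 1) {e : ℝ}
    (he : 0 < e + 2 * (r - 1)) :
    LogSeries (cuQuot N r x e)
      (fun m => -((x ^ m) ^ e / (1 - (x ^ m) ^ (4 * (N : ℝ))) * levelGap r (x ^ m))) := by
  have hN' : (0 : ℝ) < N := by exact_mod_cast hN
  have hr' : (2 : ℝ) ≤ r := by exact_mod_cast hr
  exact logSeries_poch₂_quot hx hx1 (by positivity) (by linarith) (by linarith) he (by linarith)

/-- `log (q; q)_∞ = ∑_{m ≥ 1} log (1 - q^m)`. -/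
theorem hasSum_log_poch_self {q : ℝ} (h0 : 0 < q) (h1 : q < 1) :
    0 < poch q q ∧
      HasSum (fun m : ℕ => if 1 ≤ m then Real.log (1 - q ^ m) else 0) (Real.log (poch q q)) := by
  have hlt : ∀ m : ℕ, q ^ m * q < 1 := fun m =>
    (mul_le_of_le_one_left h0.le (pow_le_one₀ h0.le h1.le)).trans_lt h1
  have hs : Summable fun m : ℕ => -(q ^ m * q) :=
    ((summable_geometric_of_lt_one h0.le h1).mul_right q).neg
  have hl : Summable fun m : ℕ => Real.log (1 - q ^ m * q) := by
    simpa [sub_eq_add_neg] using Real.summable_log_one_add_of_summable hs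
  have hp := Real.hasProd_of_hasSum_log (fun m => sub_pos.2 (hlt m)) hl.hasSum
  have he : poch q q = Real.exp (∑' m : ℕ, Real.log (1 - q ^ m * q)) := hp.tprod_eq
  rw [he]
  refine ⟨Real.exp_pos _, ?_⟩
  rw [Real.log_exp, ← hasSum_nat_add_iff' 1]
  simpa [pow_succ] using hl.hasSum

end QuotSeries

/-! ### Explicit values of the q-Cartan form. -/

section CartanVectors

variable {N : ℕ} {q : ℝ}

theorem cartanForm_comm (q : ℝ) (y z : ℕ → ℝ) : cartanForm N q y z = cartanForm N q z y := by
  unfold cartanForm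
  rw [sum_comm]
  refine sum_congr rfl fun j _ => sum_congr rfl fun k _ => ?_
  rw [qCartan_comm]
  ring

theorem cartanForm_linear (q : ℝ) (s t : ℝ) (u v z : ℕ → ℝ) :
    cartanForm N q (fun j => s * u j + t * v j) z =
      s * cartanForm N q u z + t * cartanForm N q v z := by
  simp only [cartanForm, mul_sum, ← sum_add_distrib]
  refine sum_congr rfl fun j _ => sum_congr rfl fun k _ => ?_
  ring

theorem cartanForm_linear_right (q : ℝ) (s t : ℝ) (u v z : ℕ → ℝ) :
    cartanForm N q z (fun j => s * u j + t * v j) =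
      s * cartanForm N q z u + t * cartanForm N q z v := by
  simp only [cartanForm_comm q z, cartanForm_linear]

theorem cartanForm_eq_sum_apply (y : ℕ → ℝ) {z : ℕ → ℝ} (hz0 : z 0 = 0) (hzN : z N = 0) :
    cartanForm N q y z =
      ∑ j ∈ Icc 1 (N - 1), y j * ((q + q⁻¹) * z j - z (j - 1) - z (j + 1)) := by
  unfold cartanForm
  refine sum_congr rfl fun j hj => ?_
  rw [← sum_qCartan_mul q hj hz0 hzN, mul_sum]
  refine sum_congr rfl fun k _ => ?_
  ring

/-- The second-order difference operator factors into two first-order ones; summation by parts moves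
one of them to y, and the boundary values kill the remainder. For y = z it exhibits the form as a
sum of squares. -/
theorem cartanForm_eq_sum (hq : q ≠ 0) {y z : ℕ → ℝ} (hy0 : y 0 = 0) (hyN : y N = 0)
    (hz0 : z 0 = 0) (hzN : z N = 0) :
    cartanForm N q y z = ∑ j ∈ Icc 1 N, (y j - q⁻¹ * y (j - 1)) * (q * z j - z (j - 1)) := by
  have key : ∀ n : ℕ, ∑ j ∈ Icc 1 n, (y j - q⁻¹ * y (j - 1)) * (q * z j - z (j - 1)) =
      ∑ j ∈ Icc 1 n, y j * ((q + q⁻¹) * z j - z (j - 1) - z (j + 1)) +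
        y n * (z (n + 1) - q⁻¹ * z n) := by
    intro n
    induction n with
    | zero => simp [hy0]
    | succ n ih =>
      rw [sum_Icc_succ_top (by omega), sum_Icc_succ_top (by omega), ih]
      simp only [Nat.add_sub_cancel]
      field_simp
      ring
  rw [cartanForm_eq_sum_apply y hz0 hzN, key N, hyN, zero_mul, add_zero]
  rcases Nat.eq_zero_or_pos N with rfl | h
  · simp
  · obtain ⟨n, rfl⟩ : ∃ n, N = n + 1 := ⟨N - 1, by omega⟩
    rw [sum_Icc_succ_top (by omega), hyN]
    simp

/-- The vector `y` vanishing at `0` and `N` with `q^j y_j - q^{j-1} y_{j-1} = u_j - λ q^{2 j}`. -/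
def cartanVec (N : ℕ) (q : ℝ) (u : ℕ → ℝ) (j : ℕ) : ℝ :=
  (q ^ j)⁻¹ * (∑ l ∈ Icc 1 j, u l -
    (∑ l ∈ Icc 1 N, u l) / (∑ l ∈ Icc 1 N, q ^ (2 * l)) * ∑ l ∈ Icc 1 j, q ^ (2 * l))

theorem sum_pow_pos (hN : 1 ≤ N) (hq : 0 < q) : 0 < ∑ l ∈ Icc 1 N, q ^ (2 * l) :=
  sum_pos (fun l _ => pow_pos hq _) ⟨1, by simp [hN]⟩

theorem cartanVec_zero (u : ℕ → ℝ) : cartanVec N q u 0 = 0 := by simp [cartanVec]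

theorem cartanVec_self (hN : 1 ≤ N) (hq : 0 < q) (u : ℕ → ℝ) : cartanVec N q u N = 0 := by
  rw [cartanVec, div_mul_cancel₀ _ (sum_pow_pos hN hq).ne', sub_self, mul_zero]

theorem sum_Icc_sub_one_add (u : ℕ → ℝ) {j : ℕ} (hj : 1 ≤ j) :
    ∑ l ∈ Icc 1 j, u l = ∑ l ∈ Icc 1 (j - 1), u l + u j := by
  obtain ⟨n, rfl⟩ : ∃ n, j = n + 1 := ⟨j - 1, by omega⟩
  rw [sum_Icc_succ_top (by omega), Nat.add_sub_cancel]

theorem cartanVec_step (hq : 0 < q) (u : ℕ → ℝ) {j : ℕ} (hj : 1 ≤ j) :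
    q ^ j * cartanVec N q u j - q ^ (j - 1) * cartanVec N q u (j - 1) =
      u j - (∑ l ∈ Icc 1 N, u l) / (∑ l ∈ Icc 1 N, q ^ (2 * l)) * q ^ (2 * j) := by
  unfold cartanVec
  rw [mul_inv_cancel_left₀ (pow_pos hq _).ne', mul_inv_cancel_left₀ (pow_pos hq _).ne',
    sum_Icc_sub_one_add _ hj, sum_Icc_sub_one_add _ hj]
  ring

/-- The multiple of q^{2j} in the steps of `cartanVec` pairs with z to a telescoping sum ending in z
N = 0, so u may be used as if it were the exact step. -/
theorem cartanForm_cartanVec (hN : 1 ≤ N) (hq : 0 < q) (u : ℕ → ℝ) {z : ℕ → ℝ} (hz0 : z 0 = 0)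
    (hzN : z N = 0) :
    cartanForm N q (cartanVec N q u) z =
      ∑ j ∈ Icc 1 N, u j * ((q ^ j)⁻¹ * (q * z j - z (j - 1))) := by
  rw [cartanForm_eq_sum hq.ne' (cartanVec_zero u) (cartanVec_self hN hq u) hz0 hzN]
  set c := (∑ l ∈ Icc 1 N, u l) / (∑ l ∈ Icc 1 N, q ^ (2 * l)) with hc
  have htel : ∀ n : ℕ, ∑ j ∈ Icc 1 n, q ^ j * (q * z j - z (j - 1)) = q ^ (n + 1) * z n := by
    intro n
    induction n with
    | zero => simp [hz0]
    | succ n ih =>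
      rw [sum_Icc_succ_top (by omega), ih, Nat.add_sub_cancel]
      ring
  have hstep : ∀ j ∈ Icc 1 N, (cartanVec N q u j - q⁻¹ * cartanVec N q u (j - 1)) *
      (q * z j - z (j - 1)) = u j * ((q ^ j)⁻¹ * (q * z j - z (j - 1))) -
        c * (q ^ j * (q * z j - z (j - 1))) := by
    intro j hj
    have hj1 := (mem_Icc.1 hj).1
    have h := cartanVec_step (N := N) hq u hj1
    rw [← hc] at h
    obtain ⟨n, rfl⟩ : ∃ n, j = n + 1 := ⟨j - 1, by omega⟩
    rw [Nat.add_sub_cancel] at h ⊢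
    have hqn : q ^ n ≠ 0 := (pow_pos hq n).ne'
    have h' : u (n + 1) = q ^ (n + 1) * cartanVec N q u (n + 1) - q ^ n * cartanVec N q u n +
      c * q ^ (2 * (n + 1)) := by linarith
    rw [h']
    have := hq.ne'
    field_simp
    ring
  rw [sum_congr rfl hstep, sum_sub_distrib, ← mul_sum, htel, hzN]
  ring

theorem cartanForm_inv (q : ℝ) (y z : ℕ → ℝ) : cartanForm N q⁻¹ y z = cartanForm N q y z := by
  unfold cartanForm
  refine sum_congr rfl fun j _ => sum_congr rfl fun k _ => ?_
  congr 2
  simp only [qCartan, inv_inv, add_comm]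

/-- `(q - q⁻¹) / (q^{2 N} - 1) = q^{-N} [1] / [N]`. -/
def cartanWeight (N : ℕ) (q : ℝ) : ℝ := (q - q⁻¹) / (q ^ (2 * N) - 1)

theorem div_sum_pow (hN : 1 ≤ N) (hq : 0 < q) (hq1 : q ≠ 1) :
    q / ∑ l ∈ Icc 1 N, q ^ (2 * l) = cartanWeight N q := by
  have h := sum_pow_two_mul hq.ne' N
  have hS := sum_pow_pos hN hq
  have h1 : q ^ (2 * N) - 1 ≠ 0 := by
    rw [sub_ne_zero]
    intro h0
    exact hq1 ((pow_eq_one_iff_of_nonneg hq.le (by omega)).1 h0)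
  rw [cartanWeight, div_eq_div_iff hS.ne' h1, h]
  ring

theorem cartanWeight_inv (hN : 1 ≤ N) (hq : 0 < q) (hq1 : q ≠ 1) :
    cartanWeight N q⁻¹ = q ^ (2 * N) * cartanWeight N q := by
  have h1 : q ^ (2 * N) - 1 ≠ 0 := by
    rw [sub_ne_zero]
    intro h0
    exact hq1 ((pow_eq_one_iff_of_nonneg hq.le (by omega)).1 h0)
  have h2 : 1 - q ^ (2 * N) ≠ 0 := by
    rw [← neg_sub]; exact neg_ne_zero.2 h1
  have hq0 := hq.ne'
  unfold cartanWeight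
  rw [inv_inv, inv_pow]
  field_simp
  ring

/-- A diagonal form, with a rank-one correction from the constraint at the end N. -/
theorem cartanForm_vec_vec (hN : 1 ≤ N) (hq : 0 < q) (hq1 : q ≠ 1) (u v : ℕ → ℝ) :
    cartanForm N q (cartanVec N q u) (cartanVec N q v) =
      ∑ j ∈ Icc 1 N, q * (q ^ (2 * j))⁻¹ * (u j * v j) -
        cartanWeight N q * ((∑ j ∈ Icc 1 N, u j) * ∑ j ∈ Icc 1 N, v j) := by
  rw [cartanForm_cartanVec hN hq u (cartanVec_zero v) (cartanVec_self hN hq v),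
    ← div_sum_pow hN hq hq1]
  set S := ∑ l ∈ Icc 1 N, q ^ (2 * l) with hS
  set V := ∑ l ∈ Icc 1 N, v l with hV
  have hS0 : S ≠ 0 := (sum_pow_pos hN hq).ne'
  rw [show q / S * ((∑ j ∈ Icc 1 N, u j) * V) = ∑ j ∈ Icc 1 N, q / S * V * u j by
    rw [← mul_sum]; ring, ← sum_sub_distrib]
  refine sum_congr rfl fun j hj => ?_
  have hj1 := (mem_Icc.1 hj).1
  have h := cartanVec_step (N := N) hq v hj1
  rw [← hS, ← hV] at h
  obtain ⟨n, rfl⟩ : ∃ n, j = n + 1 := ⟨j - 1, by omega⟩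
  rw [Nat.add_sub_cancel] at h ⊢
  have hqn : q ^ n ≠ 0 := (pow_pos hq n).ne'
  have hq0 := hq.ne'
  have h' : v (n + 1) = q ^ (n + 1) * cartanVec N q v (n + 1) - q ^ n * cartanVec N q v n +
      V / S * q ^ (2 * (n + 1)) := by linarith
  rw [h']
  field_simp
  ring

/-- The q-Cartan matrix is invariant under q ↦ q⁻¹, so this is the previous evaluation at the
inverse base. -/
theorem cartanForm_dual_dual (hN : 1 ≤ N) (hq : 0 < q) (hq1 : q ≠ 1) (u v : ℕ → ℝ) :
    cartanForm N q (cartanVec N q⁻¹ u) (cartanVec N q⁻¹ v) =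
      ∑ j ∈ Icc 1 N, q⁻¹ * q ^ (2 * j) * (u j * v j) -
        q ^ (2 * N) * cartanWeight N q * ((∑ j ∈ Icc 1 N, u j) * ∑ j ∈ Icc 1 N, v j) := by
  have h := cartanForm_vec_vec hN (inv_pos.2 hq) (by simpa using hq1) u v
  rw [cartanForm_inv] at h
  rw [h, cartanWeight_inv hN hq hq1]
  simp only [inv_pow, inv_inv]

theorem cartanVec_dual_step (hq : 0 < q) (v : ℕ → ℝ) {j : ℕ} (hj : 1 ≤ j) :
    (q ^ j)⁻¹ * (q * cartanVec N q⁻¹ v j - cartanVec N q⁻¹ v (j - 1)) =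
      q * v j + (q - q⁻¹) * ∑ l ∈ Icc 1 (j - 1), v l -
        q⁻¹ / (∑ l ∈ Icc 1 N, q⁻¹ ^ (2 * l)) * ∑ l ∈ Icc 1 N, v l := by
  set S := ∑ l ∈ Icc 1 N, q⁻¹ ^ (2 * l) with hS
  set V := ∑ l ∈ Icc 1 N, v l with hV
  obtain ⟨n, rfl⟩ : ∃ n, j = n + 1 := ⟨j - 1, by omega⟩
  have hqn : q ^ n ≠ 0 := (pow_pos hq n).ne'
  have hq0 := hq.ne'
  have hg := sum_inv_pow_two_mul hq.ne' n
  rw [Nat.add_sub_cancel, cartanVec, cartanVec, ← hS, ← hV, sum_Icc_succ_top (by omega),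
    sum_Icc_succ_top (by omega)]
  set T := ∑ l ∈ Icc 1 n, q⁻¹ ^ (2 * l)
  set W := ∑ l ∈ Icc 1 n, v l
  simp only [inv_pow, inv_inv] at hg ⊢
  have hT : q * (q * T) = 1 + T - (q ^ (2 * n))⁻¹ := by
    calc q * (q * T) = T + q * ((q - q⁻¹) * T) := by field_simp; ring
      _ = 1 + T - (q ^ (2 * n))⁻¹ := by rw [hg]; field_simp; ring
  have e1 : (q ^ (n + 1))⁻¹ * (q * (q ^ (n + 1) * (W + v (n + 1) -
      V / S * (T + (q ^ (2 * (n + 1)))⁻¹))) - q ^ n * (W - V / S * T)) =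
      q * (W + v (n + 1)) - q⁻¹ * W - V / S * (q⁻¹ * (q * (q * T) - T + (q ^ (2 * n))⁻¹)) := by
    field_simp
    ring
  rw [e1, hT]
  ring

/-- For opposite bases the form is no longer diagonal but triangular: the steps of the second
vector, weighted for the first base, contain its partial sums. -/
theorem cartanForm_vec_dual (hN : 1 ≤ N) (hq : 0 < q) (hq1 : q ≠ 1) (u v : ℕ → ℝ) :
    cartanForm N q (cartanVec N q u) (cartanVec N q⁻¹ v) =
      ∑ j ∈ Icc 1 N, u j * (q * v j + (q - q⁻¹) * ∑ l ∈ Icc 1 (j - 1), v l) -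
        q ^ (2 * N) * cartanWeight N q * ((∑ j ∈ Icc 1 N, u j) * ∑ j ∈ Icc 1 N, v j) := by
  have hi := inv_pos.2 hq
  rw [cartanForm_cartanVec hN hq u (cartanVec_zero v) (cartanVec_self hN hi v),
    ← cartanWeight_inv hN hq hq1, ← div_sum_pow hN hi (by simpa using hq1),
    show ∀ X Y : ℝ, X * ((∑ j ∈ Icc 1 N, u j) * Y) = ∑ j ∈ Icc 1 N, X * Y * u j by
      intros; rw [← mul_sum]; ring, ← sum_sub_distrib]
  refine sum_congr rfl fun j hj => ?_
  rw [cartanVec_dual_step hq v (mem_Icc.1 hj).1]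
  ring

end CartanVectors

/-! ### The Gaussian exponent of the boundary states without the θ-terms. -/

section ModeForms

variable {N : ℕ} {q : ℝ}

theorem sum_mul_sum_split (u v : ℕ → ℝ) (n : ℕ) :
    (∑ j ∈ Icc 1 n, u j) * ∑ j ∈ Icc 1 n, v j =
      ∑ j ∈ Icc 1 n, (u j * v j + u j * ∑ l ∈ Icc 1 (j - 1), v l +
        v j * ∑ l ∈ Icc 1 (j - 1), u l) := by
  induction n with
  | zero => simp
  | succ n ih =>
    rw [sum_Icc_succ_top (by omega), sum_Icc_succ_top (by omega), sum_Icc_succ_top (by omega), ← ih,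
      Nat.add_sub_cancel]
    ring

/-- The linear part of the boundary state without its `θ`-term, up to normalisation. -/
def stateVec (N : ℕ) (q : ℝ) (a b : ℕ → ℝ) (j : ℕ) : ℝ :=
  q * cartanVec N q b j + -q⁻¹ * cartanVec N q⁻¹ a j

/-- The linear part of the dual boundary state without its `θ`-term, up to normalisation. -/
def dualStateVec (N : ℕ) (q : ℝ) (a b : ℕ → ℝ) (j : ℕ) : ℝ :=
  q * cartanVec N q⁻¹ b j + -(q ^ (2 * N) * q⁻¹) * cartanVec N q a j

/-- The exponent of the Gaussian pairing of `y` and `z`. -/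
def pairingForm (N : ℕ) (q : ℝ) (y z : ℕ → ℝ) : ℝ :=
  cartanForm N q y z - (q ^ (2 * N) * cartanForm N q y y + cartanForm N q z z) / 2

/-- With A = ∑ a and B = ∑ b, the rank-one contributions in A² and B² cancel. Those in A B combine
to the weight times q^{2N} - 1, that is q - q⁻¹, so no denominator is left. -/
theorem pairingForm_state (hN : 1 ≤ N) (hq : 0 < q) (hq1 : q < 1) (a b : ℕ → ℝ) :
    pairingForm N q (stateVec N q a b) (dualStateVec N q a b) =
      ∑ j ∈ Icc 1 N,
        ((q - (q⁻¹ * q ^ (2 * j) + q ^ (2 * N) * q * (q ^ (2 * j))⁻¹) / 2) *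
            (q ^ (2 * N) * (q ^ 2)⁻¹ * (a j * a j) + q ^ 2 * (b j * b j)) +
          (2 * q ^ (2 * N) * q⁻¹ - q⁻¹ * q ^ (2 * j) - q ^ (2 * N) * q * (q ^ (2 * j))⁻¹) *
            (a j * b j) +
          (q - q⁻¹) * (q ^ (2 * N) * (q ^ 2)⁻¹ * (a j * ∑ l ∈ Icc 1 (j - 1), a l) +
            q ^ 2 * (b j * ∑ l ∈ Icc 1 (j - 1), b l) -
            q ^ (2 * N) * (a j * ∑ l ∈ Icc 1 (j - 1), b l + b j * ∑ l ∈ Icc 1 (j - 1), a l))) := by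
  have hq0 := hq.ne'
  have hw : cartanWeight N q * (q ^ (2 * N) - 1) = q - q⁻¹ := by
    rw [cartanWeight, div_mul_cancel₀]
    exact (sub_neg.2 (pow_lt_one₀ hq.le hq1 (by omega))).ne
  have hdv : ∀ u v, cartanForm N q (cartanVec N q⁻¹ u) (cartanVec N q v) =
      cartanForm N q (cartanVec N q v) (cartanVec N q⁻¹ u) := fun u v => cartanForm_comm q _ _
  have hS : ∀ f g : ℕ → ℝ, stateVec N q f g =
      fun j => q * cartanVec N q g j + -q⁻¹ * cartanVec N q⁻¹ f j := fun _ _ => rfl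
  have hD : ∀ f g : ℕ → ℝ, dualStateVec N q f g =
      fun j => q * cartanVec N q⁻¹ g j + -(q ^ (2 * N) * q⁻¹) * cartanVec N q f j := fun _ _ => rfl
  have hAB := sum_mul_sum_split a b N
  rw [pairingForm, hS, hD]
  simp only [cartanForm_linear, cartanForm_linear_right, hdv]
  simp only [cartanForm_vec_vec hN hq hq1.ne, cartanForm_dual_dual hN hq hq1.ne,
    cartanForm_vec_dual hN hq hq1.ne]
  set A := ∑ j ∈ Icc 1 N, a j
  set B := ∑ j ∈ Icc 1 N, b j
  set γ := q ^ (2 * N)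
  set w := cartanWeight N q
  have key : ∀ (X1 X2 X3 X4 X5 X6 X7 X8 X9 X10 : ℝ),
      q * (q * (X1 - γ * w * (B * B)) + -q⁻¹ * (X3 - γ * w * (A * B))) +
        -(γ * q⁻¹) * (q * (X2 - w * (B * A)) + -q⁻¹ * (X4 - γ * w * (A * A))) -
      (γ * (q * (q * (X5 - w * (B * B)) + -q⁻¹ * (X6 - γ * w * (B * A))) +
          -q⁻¹ * (q * (X6 - γ * w * (B * A)) + -q⁻¹ * (X7 - γ * w * (A * A)))) +
        (q * (q * (X8 - γ * w * (B * B)) + -(γ * q⁻¹) * (X9 - γ * w * (A * B))) +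
          -(γ * q⁻¹) * (q * (X9 - γ * w * (A * B)) + -(γ * q⁻¹) * (X10 - w * (A * A))))) / 2 =
      q ^ 2 * X1 - γ * X2 - X3 + γ * (q ^ 2)⁻¹ * X4 - (γ * q ^ 2 * X5 - 2 * γ * X6 +
        γ * (q ^ 2)⁻¹ * X7 + q ^ 2 * X8 - 2 * γ * X9 + γ ^ 2 * (q ^ 2)⁻¹ * X10) / 2
        - 2 * γ * (w * (γ - 1)) * (A * B) := by
    intros
    field_simp
    ring
  rw [key, hw, hAB]
  obtain ⟨A', hA'⟩ : ∃ A' : ℕ → ℝ, ∀ j, ∑ l ∈ Icc 1 (j - 1), a l = A' j := ⟨_, fun _ => rfl⟩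
  obtain ⟨B', hB'⟩ : ∃ B' : ℕ → ℝ, ∀ j, ∑ l ∈ Icc 1 (j - 1), b l = B' j := ⟨_, fun _ => rfl⟩
  simp only [hA', hB', mul_sum, sum_div, ← sum_add_distrib, ← sum_sub_distrib]
  refine sum_congr rfl fun j _ => ?_
  have hqj : q ^ (2 * j) ≠ 0 := (pow_pos hq _).ne'
  field_simp
  ring

theorem sum_sum_pred (f : ℕ → ℕ → ℝ) (n : ℕ) :
    ∑ j ∈ Icc 1 n, ∑ l ∈ Icc 1 (j - 1), f l j = ∑ i ∈ Icc 1 n, ∑ j ∈ Icc (i + 1) n, f i j :=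
  sum_comm' fun j l => by simp only [mem_Icc]; omega

/-- The relation a_j b_j = 1 turns the mixed diagonal terms into constants. Every diagonal
coefficient is then q - q⁻¹ times geometric sums of lengths N - i and i - 1, which accounts for the
index ranges of the products. -/
theorem pairingForm_state_eq (hN : 1 ≤ N) (hq : 0 < q) (hq1 : q < 1) {a b : ℕ → ℝ}
    (hab : ∀ j, a j * b j = 1) :
    pairingForm N q (stateVec N q a b) (dualStateVec N q a b) =
      (q - q⁻¹) * (
        ∑ i ∈ Icc 1 N, ∑ j ∈ Icc 1 (N - i), (q ^ 2)⁻¹ * q ^ (2 * i) * q ^ (2 * j) +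
        ∑ i ∈ Icc 1 N, ∑ j ∈ Icc 1 (i - 1), q ^ (2 * N) * (q ^ (2 * i))⁻¹ * q ^ (2 * j) +
        ∑ i ∈ Icc 1 N, ∑ j ∈ Icc (i + 1) N, (q ^ 2 * (b i * b j) +
          q ^ (2 * N) * (q ^ 2)⁻¹ * (a i * a j) - q ^ (2 * N) * (a i * b j) -
          q ^ (2 * N) * (a j * b i)) -
        (∑ i ∈ Icc 1 N, ∑ j ∈ Icc 1 (N - i), (q ^ 2 * q ^ (2 * j) * (b i * b i) +
          q ^ (2 * N) * (q ^ 2)⁻¹ * q ^ (2 * j) * (a i * a i)) / 2 +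
        ∑ i ∈ Icc 1 N, ∑ j ∈ Icc 1 (i - 1), (q ^ 2 * q ^ (2 * j) * (b i * b i) +
          q ^ (2 * N) * (q ^ 2)⁻¹ * q ^ (2 * j) * (a i * a i)) / 2)) := by
  have hq0 := hq.ne'
  rw [pairingForm_state hN hq hq1, ← sum_sum_pred, ← sum_add_distrib, ← sum_add_distrib,
    ← sum_add_distrib, ← sum_sub_distrib, mul_sum]
  refine sum_congr rfl fun j hj => ?_
  obtain ⟨hj1, hjN⟩ := mem_Icc.1 hj
  simp only [sum_add_distrib, sum_sub_distrib, ← mul_sum, ← sum_mul, ← sum_div]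
  have h1 := sum_pow_two_mul hq0 (N - j)
  have h2 := sum_pow_two_mul hq0 (j - 1)
  obtain ⟨n, rfl⟩ : ∃ n, j = n + 1 := ⟨j - 1, by omega⟩
  obtain ⟨k, rfl⟩ : ∃ k, N = n + 1 + k := ⟨N - (n + 1), by omega⟩
  rw [show n + 1 + k - (n + 1) = k by omega] at h1 ⊢
  rw [Nat.add_sub_cancel] at h2 ⊢
  generalize ∑ l ∈ Icc 1 n, a l = A'
  generalize ∑ l ∈ Icc 1 n, b l = B'
  generalize ∑ l ∈ Icc 1 k, q ^ (2 * l) = S1 at h1 ⊢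
  generalize ∑ l ∈ Icc 1 n, q ^ (2 * l) = S2 at h2 ⊢
  have e : ∀ (u1 u2 u3 u4 u5 R : ℝ), (q - q⁻¹) * (u1 * S1 + u2 * S2 + R -
      (((u3 * S1 * (b (n + 1) * b (n + 1)) + u4 * S1 * (a (n + 1) * a (n + 1))) / 2 +
      (u3 * S2 * (b (n + 1) * b (n + 1)) + u4 * S2 * (a (n + 1) * a (n + 1))) / 2))) =
      u1 * ((q - q⁻¹) * S1) + u2 * ((q - q⁻¹) * S2) + (q - q⁻¹) * R -
      (((u3 * ((q - q⁻¹) * S1) * (b (n + 1) * b (n + 1)) +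
        u4 * ((q - q⁻¹) * S1) * (a (n + 1) * a (n + 1))) / 2 +
      (u3 * ((q - q⁻¹) * S2) * (b (n + 1) * b (n + 1)) +
        u4 * ((q - q⁻¹) * S2) * (a (n + 1) * a (n + 1))) / 2)) := by
    intros
    ring
  rw [e _ _ _ _ 0, h1, h2, hab]
  have hn : q ^ n ≠ 0 := (pow_pos hq _).ne'
  have hk : q ^ k ≠ 0 := (pow_pos hq _).ne'
  field_simp
  ring

end ModeForms

/-! ### The vector of the θ-terms and its pairings. -/

section ThetaVector

variable {N : ℕ} {Q : ℝ}

/-- `[j] [N - j] / ([1] [N]^+)` to the base `Q`. -/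
def thetaVec (N : ℕ) (Q : ℝ) (j : ℕ) : ℝ :=
  (Q ^ N + (Q ^ N)⁻¹ - Q ^ N * (Q ^ (2 * j))⁻¹ - (Q ^ N)⁻¹ * Q ^ (2 * j)) /
    ((Q - Q⁻¹) * (Q ^ N + (Q ^ N)⁻¹))

theorem sub_inv_ne_zero (hQ : 0 < Q) (hQ1 : Q < 1) : Q - Q⁻¹ ≠ 0 := by
  have := (one_lt_inv₀ hQ).2 hQ1
  linarith

theorem thetaVec_zero (N : ℕ) (Q : ℝ) : thetaVec N Q 0 = 0 := by
  rw [thetaVec]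
  simp

theorem thetaVec_self (hQ : 0 < Q) : thetaVec N Q N = 0 := by
  have h : Q ^ N ≠ 0 := (pow_pos hQ N).ne'
  rw [thetaVec, two_mul, pow_add]
  convert zero_div _ using 2
  field_simp
  ring

theorem thetaVec_mul (hQ : 0 < Q) (hQ1 : Q < 1) (j : ℕ) :
    thetaVec N Q j * ((Q - Q⁻¹) * (Q ^ N + (Q ^ N)⁻¹)) =
      Q ^ N + (Q ^ N)⁻¹ - Q ^ N * (Q ^ (2 * j))⁻¹ - (Q ^ N)⁻¹ * Q ^ (2 * j) :=
  div_mul_cancel₀ _ (mul_ne_zero (sub_inv_ne_zero hQ hQ1) (by positivity))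

theorem thetaVec_step (hQ : 0 < Q) (hQ1 : Q < 1) {j : ℕ} (hj : 1 ≤ j) :
    ((Q ^ 2) ^ j)⁻¹ * (Q ^ 2 * thetaVec N Q j - thetaVec N Q (j - 1)) =
      Q * (Q ^ (2 * j))⁻¹ - (Q ^ N)⁻¹ * (Q + Q⁻¹) / (Q ^ N + (Q ^ N)⁻¹) := by
  obtain ⟨n, rfl⟩ : ∃ n, j = n + 1 := ⟨j - 1, by omega⟩
  have h1 := sub_inv_ne_zero hQ hQ1
  have h2 : Q ^ N + (Q ^ N)⁻¹ ≠ 0 := by positivity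
  have h3 : Q ≠ 0 := hQ.ne'
  have t1 := thetaVec_mul (N := N) hQ hQ1 (n + 1)
  have t0 := thetaVec_mul (N := N) hQ hQ1 n
  have tB : (Q ^ N)⁻¹ * (Q + Q⁻¹) / (Q ^ N + (Q ^ N)⁻¹) * ((Q - Q⁻¹) * (Q ^ N + (Q ^ N)⁻¹)) =
      (Q ^ N)⁻¹ * (Q + Q⁻¹) * (Q - Q⁻¹) := by
    rw [mul_comm (Q - Q⁻¹), ← mul_assoc, div_mul_cancel₀ _ h2]
  refine mul_right_cancel₀ (mul_ne_zero h1 h2) ?_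
  generalize hD : (Q - Q⁻¹) * (Q ^ N + (Q ^ N)⁻¹) = D at t1 t0 tB ⊢
  rw [Nat.add_sub_cancel, sub_mul, tB, mul_assoc, sub_mul, mul_assoc (Q ^ 2), t1, t0, ← hD]
  field_simp
  ring

theorem thetaVec_dual_step (hQ : 0 < Q) (hQ1 : Q < 1) {j : ℕ} (hj : 1 ≤ j) :
    (((Q ^ 2)⁻¹) ^ j)⁻¹ * ((Q ^ 2)⁻¹ * thetaVec N Q j - thetaVec N Q (j - 1)) =
      Q ^ N * (Q + Q⁻¹) / (Q ^ N + (Q ^ N)⁻¹) - Q⁻¹ * Q ^ (2 * j) := by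
  obtain ⟨n, rfl⟩ : ∃ n, j = n + 1 := ⟨j - 1, by omega⟩
  have h1 := sub_inv_ne_zero hQ hQ1
  have h2 : Q ^ N + (Q ^ N)⁻¹ ≠ 0 := by positivity
  have h3 : Q ≠ 0 := hQ.ne'
  have t1 := thetaVec_mul (N := N) hQ hQ1 (n + 1)
  have t0 := thetaVec_mul (N := N) hQ hQ1 n
  have tB : Q ^ N * (Q + Q⁻¹) / (Q ^ N + (Q ^ N)⁻¹) * ((Q - Q⁻¹) * (Q ^ N + (Q ^ N)⁻¹)) =
      Q ^ N * (Q + Q⁻¹) * (Q - Q⁻¹) := by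
    rw [mul_comm (Q - Q⁻¹), ← mul_assoc, div_mul_cancel₀ _ h2]
  refine mul_right_cancel₀ (mul_ne_zero h1 h2) ?_
  generalize hD : (Q - Q⁻¹) * (Q ^ N + (Q ^ N)⁻¹) = D at t1 t0 tB ⊢
  rw [Nat.add_sub_cancel, sub_mul, tB, mul_assoc, sub_mul, mul_assoc (Q ^ 2)⁻¹, t1, t0, ← hD,
    inv_pow (Q ^ 2), inv_inv]
  field_simp
  ring

/-- Two summations by parts: the weight i(M - i) has constant second difference -2. -/
theorem sum_mul_second_difference (M : ℝ) (h : ℕ → ℝ) (n : ℕ) :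
    ∑ i ∈ Icc 1 n, (i * (M - i)) * (h (i - 1) - 2 * h i + h (i + 1)) =
      (M - 1) * h 0 + n * (M - n) * h (n + 1) - (n + 1) * (M - n - 1) * h n
        - 2 * ∑ i ∈ Icc 1 n, h i := by
  induction n with
  | zero => simp
  | succ n ih =>
    rw [sum_Icc_succ_top (by omega), sum_Icc_succ_top (by omega), ih, Nat.add_sub_cancel]
    push_cast
    ring

/-- The second difference of Q^{N-2i} is (Q - Q⁻¹)² Q^{N-2i}, so the weight i(N - i) can be traded
for a plain sum. This is the source of the exponents i(N - i) in the product. -/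
theorem sum_thetaVec (hN : 1 ≤ N) (hQ : 0 < Q) (hQ1 : Q < 1) :
    (∑ j ∈ Icc 1 (N - 1), thetaVec N Q j) * ((Q - Q⁻¹) * (Q ^ N + (Q ^ N)⁻¹)) =
      (Q - Q⁻¹) ^ 2 * ∑ i ∈ Icc 1 (N - 1), (i * (N - i) : ℝ) * (Q ^ N * (Q ^ (2 * i))⁻¹) := by
  have h3 : Q ≠ 0 := hQ.ne'
  -- Reflection j ↦ N - j exchanges the two powers.
  have hrefl : ∑ j ∈ Icc 1 (N - 1), (Q ^ N)⁻¹ * Q ^ (2 * j) =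
      ∑ j ∈ Icc 1 (N - 1), Q ^ N * (Q ^ (2 * j))⁻¹ := by
    refine sum_nbij' (fun j => N - j) (fun j => N - j) ?_ ?_ ?_ ?_ ?_
    · intro j hj; simp only [mem_Icc] at hj ⊢; omega
    · intro j hj; simp only [mem_Icc] at hj ⊢; omega
    · intro j hj; simp only [mem_Icc] at hj ⊢; omega
    · intro j hj; simp only [mem_Icc] at hj ⊢; omega
    · intro j hj
      simp only [mem_Icc] at hj
      obtain ⟨k, rfl⟩ : ∃ k, N = j + k := ⟨N - j, by omega⟩
      rw [show j + k - j = k by omega]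
      field_simp
      ring
  have hsd := sum_mul_second_difference N (fun i => Q ^ N * (Q ^ (2 * i))⁻¹) (N - 1)
  have hterm : ∀ i ∈ Icc 1 (N - 1), (i * (N - i) : ℝ) * (Q ^ N * (Q ^ (2 * (i - 1)))⁻¹ -
      2 * (Q ^ N * (Q ^ (2 * i))⁻¹) + Q ^ N * (Q ^ (2 * (i + 1)))⁻¹) =
      (Q - Q⁻¹) ^ 2 * ((i * (N - i) : ℝ) * (Q ^ N * (Q ^ (2 * i))⁻¹)) := by
    intro i hi
    obtain ⟨n, rfl⟩ : ∃ n, i = n + 1 := ⟨i - 1, by have := (mem_Icc.1 hi).1; omega⟩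
    rw [Nat.add_sub_cancel]
    field_simp
    ring
  rw [sum_congr rfl hterm, ← mul_sum] at hsd
  rw [hsd, sum_mul, sum_congr rfl fun j _ => thetaVec_mul hQ hQ1 j, sum_sub_distrib,
    sum_sub_distrib, hrefl]
  obtain ⟨n, rfl⟩ : ∃ n, N = n + 1 := ⟨N - 1, by omega⟩
  simp only [Nat.add_sub_cancel, sum_const, Nat.card_Icc, nsmul_eq_mul]
  push_cast
  field_simp
  ring

/-- The Cartan operator in base Q² annihilates the powers Q^{±(N-2j)} and so maps `thetaVec` to the
constant vector Q - Q⁻¹. The form reduces to the sum of the entries. -/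
theorem cartanForm_theta (hN : 1 ≤ N) (hQ : 0 < Q) (hQ1 : Q < 1) :
    cartanForm N (Q ^ 2) (thetaVec N Q) (thetaVec N Q) * (Q ^ N + (Q ^ N)⁻¹) =
      (Q - Q⁻¹) ^ 2 * ∑ i ∈ Icc 1 (N - 1), (i * (N - i) : ℝ) * (Q ^ N * (Q ^ (2 * i))⁻¹) := by
  have h3 : Q ≠ 0 := hQ.ne'
  rw [← sum_thetaVec hN hQ hQ1, cartanForm_eq_sum_apply _ (thetaVec_zero N Q) (thetaVec_self hQ),
    ← mul_assoc, sum_mul (a := Q - Q⁻¹)]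
  congr 1
  refine sum_congr rfl fun j hj => ?_
  congr 1
  obtain ⟨n, rfl⟩ : ∃ n, j = n + 1 := ⟨j - 1, by have := (mem_Icc.1 hj).1; omega⟩
  have t2 := thetaVec_mul (N := N) hQ hQ1 (n + 1 + 1)
  have t1 := thetaVec_mul (N := N) hQ hQ1 (n + 1)
  have t0 := thetaVec_mul (N := N) hQ hQ1 n
  refine mul_right_cancel₀ (mul_ne_zero (sub_inv_ne_zero hQ hQ1)
    (show Q ^ N + (Q ^ N)⁻¹ ≠ 0 by positivity)) ?_
  rw [Nat.add_sub_cancel, sub_mul, sub_mul, mul_assoc (_ + _), t2, t1, t0]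
  field_simp
  ring

theorem cartanForm_vec_theta (hN : 1 ≤ N) (hQ : 0 < Q) (hQ1 : Q < 1) (u : ℕ → ℝ) :
    cartanForm N (Q ^ 2) (cartanVec N (Q ^ 2) u) (thetaVec N Q) =
      ∑ j ∈ Icc 1 N, u j *
        (Q * (Q ^ (2 * j))⁻¹ - (Q ^ N)⁻¹ * (Q + Q⁻¹) / (Q ^ N + (Q ^ N)⁻¹)) := by
  rw [cartanForm_cartanVec hN (by positivity) u (thetaVec_zero N Q) (thetaVec_self hQ)]
  exact sum_congr rfl fun j hj => by rw [thetaVec_step hQ hQ1 (mem_Icc.1 hj).1]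

theorem cartanForm_dual_theta (hN : 1 ≤ N) (hQ : 0 < Q) (hQ1 : Q < 1) (u : ℕ → ℝ) :
    cartanForm N (Q ^ 2) (cartanVec N (Q ^ 2)⁻¹ u) (thetaVec N Q) =
      ∑ j ∈ Icc 1 N, u j *
        (Q ^ N * (Q + Q⁻¹) / (Q ^ N + (Q ^ N)⁻¹) - Q⁻¹ * Q ^ (2 * j)) := by
  rw [← cartanForm_inv,
    cartanForm_cartanVec hN (by positivity) u (thetaVec_zero N Q) (thetaVec_self hQ)]
  exact sum_congr rfl fun j hj => by rw [thetaVec_dual_step hQ hQ1 (mem_Icc.1 hj).1]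

end ThetaVector

/-! ### Cross terms between the θ-part and the rest. -/

section ThetaPairing

variable {N : ℕ} {Q : ℝ}

/-- The θ-part enters the state with the factor -1 and its dual with q^N. With these factors only
the combination of z and -q^N y is paired with v. -/
theorem pairingForm_add_theta (N : ℕ) (q s t : ℝ) (y z v : ℕ → ℝ) :
    pairingForm N q (fun j => s * y j + -t * v j) (fun j => s * z j + q ^ N * t * v j) =
      s ^ 2 * pairingForm N q y z -
        s * t * ((1 + q ^ N) * (cartanForm N q z v - q ^ N * cartanForm N q y v)) -
        q ^ N * (1 + q ^ N) * t ^ 2 * cartanForm N q v v := by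
  simp only [pairingForm, cartanForm_linear, cartanForm_linear_right, cartanForm_comm q v]
  ring

/-- The coefficient of the cross term between the `θ`-part and the rest. -/
def thetaCoef (N : ℕ) (Q : ℝ) (j : ℕ) : ℝ :=
  2 * (Q ^ N * (Q + Q⁻¹) / (Q ^ N + (Q ^ N)⁻¹)) - Q⁻¹ * Q ^ (2 * j) -
    Q ^ (2 * N) * Q * (Q ^ (2 * j))⁻¹

theorem cartanForm_state_theta (hN : 1 ≤ N) (hQ : 0 < Q) (hQ1 : Q < 1) (a b : ℕ → ℝ) :
    cartanForm N (Q ^ 2) (dualStateVec N (Q ^ 2) a b) (thetaVec N Q) -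
        (Q ^ 2) ^ N * cartanForm N (Q ^ 2) (stateVec N (Q ^ 2) a b) (thetaVec N Q) =
      Q ^ 2 * ∑ j ∈ Icc 1 N, (b j + Q ^ (2 * N) * (Q ^ 4)⁻¹ * a j) * thetaCoef N Q j := by
  have hS : stateVec N (Q ^ 2) a b = fun j => Q ^ 2 * cartanVec N (Q ^ 2) b j +
    -(Q ^ 2)⁻¹ * cartanVec N (Q ^ 2)⁻¹ a j := rfl
  have hD : dualStateVec N (Q ^ 2) a b = fun j => Q ^ 2 * cartanVec N (Q ^ 2)⁻¹ b j +
    -((Q ^ 2) ^ (2 * N) * (Q ^ 2)⁻¹) * cartanVec N (Q ^ 2) a j := rfl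
  rw [hS, hD, cartanForm_linear, cartanForm_linear]
  simp only [cartanForm_vec_theta hN hQ hQ1, cartanForm_dual_theta hN hQ hQ1, mul_sum,
    ← sum_add_distrib, ← sum_sub_distrib]
  refine sum_congr rfl fun j _ => ?_
  rw [thetaCoef]
  have h3 := hQ.ne'
  have h2 : Q ^ N + (Q ^ N)⁻¹ ≠ 0 := by positivity
  rw [show (Q ^ N)⁻¹ * (Q + Q⁻¹) / (Q ^ N + (Q ^ N)⁻¹) =
    (Q ^ (2 * N))⁻¹ * (Q ^ N * (Q + Q⁻¹) / (Q ^ N + (Q ^ N)⁻¹)) by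
      rw [mul_div_assoc', ← mul_assoc]; congr 2; rw [two_mul, pow_add]; field_simp]
  generalize Q ^ N * (Q + Q⁻¹) / (Q ^ N + (Q ^ N)⁻¹) = t
  field_simp
  ring

/-- `∑_{j ≤ i} ∑_{k ≤ N - i} Q^{-2 j - 2 k}`. -/
def rectSum (N : ℕ) (Q : ℝ) (i : ℕ) : ℝ :=
  ∑ j ∈ Icc 1 i, ∑ k ∈ Icc 1 (N - i), (Q ^ (2 * j))⁻¹ * (Q ^ (2 * k))⁻¹

theorem rectSum_mul (hQ : 0 < Q) (i : ℕ) :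
    rectSum N Q i * (Q - Q⁻¹) ^ 2 =
      (Q⁻¹ - (Q ^ (2 * i + 1))⁻¹) * (Q⁻¹ - (Q ^ (2 * (N - i) + 1))⁻¹) := by
  have h1 := sum_inv_pow_two_mul hQ.ne' i
  have h2 := sum_inv_pow_two_mul hQ.ne' (N - i)
  simp only [inv_pow] at h1 h2
  rw [← h1, ← h2, rectSum, ← sum_mul_sum]
  ring

/-- By regrouping, the coefficient of c i comes from the two neighbouring rectangles i × (N-i) and
(i-1) × (N-i+1), which are products of geometric sums. The combination is `thetaCoef` freed of its
denominator; read backwards, the cross terms become rectangle sums of pure monomials. -/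
theorem sum_rectSum_mul (hN : 1 ≤ N) (hQ : 0 < Q) (hQ1 : Q < 1) (c : ℕ → ℝ) :
    (Q - Q⁻¹) * ∑ i ∈ Icc 1 (N - 1), rectSum N Q i *
      (c i * (Q ^ (2 * N + 2) * Q ^ (2 * i) - Q ^ (4 * N + 6) * (Q ^ (2 * i))⁻¹) +
        c (i + 1) * (Q ^ (4 * N + 2) * (Q ^ (2 * i))⁻¹ - Q ^ (2 * N + 6) * Q ^ (2 * i))) =
      (1 + (Q ^ 2) ^ N) * (Q ^ 2 * ∑ i ∈ Icc 1 N, c i * thetaCoef N Q i) := by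
  have hreg : ∀ (n : ℕ) (g α β : ℕ → ℝ), g 0 = 0 →
      ∑ i ∈ Icc 1 n, g i * (c i * α i + c (i + 1) * β i) =
        ∑ i ∈ Icc 1 n, c i * (g i * α i + g (i - 1) * β (i - 1)) + c (n + 1) * (g n * β n) := by
    intro n g α β h0
    induction n with
    | zero => simp [h0]
    | succ n ih =>
      rw [sum_Icc_succ_top (by omega), sum_Icc_succ_top (by omega), ih, Nat.add_sub_cancel]
      ring
  have h3 := hQ.ne'
  have hd := sub_inv_ne_zero hQ hQ1
  have hT : Q ^ N + (Q ^ N)⁻¹ ≠ 0 := by positivity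
  obtain ⟨n, rfl⟩ : ∃ n, N = n + 1 := ⟨N - 1, by omega⟩
  -- The rectangle at i = N is empty, so the leftover boundary term takes the same shape as all the
  -- others.
  have hlast : rectSum (n + 1) Q (n + 1) = 0 := by simp [rectSum]
  rw [Nat.add_sub_cancel, hreg n _ _ _ (by simp [rectSum]),
    show ∀ X : ℝ, X * (rectSum (n + 1) Q n * (Q ^ (4 * (n + 1) + 2) * (Q ^ (2 * n))⁻¹ -
      Q ^ (2 * (n + 1) + 6) * Q ^ (2 * n))) = X * (rectSum (n + 1) Q (n + 1) *
        (Q ^ (2 * (n + 1) + 2) * Q ^ (2 * (n + 1)) -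
          Q ^ (4 * (n + 1) + 6) * (Q ^ (2 * (n + 1)))⁻¹) + rectSum (n + 1) Q n *
        (Q ^ (4 * (n + 1) + 2) * (Q ^ (2 * n))⁻¹ - Q ^ (2 * (n + 1) + 6) * Q ^ (2 * n))) by
      intro X; rw [hlast]; ring]
  have htop := sum_Icc_succ_top (show 1 ≤ n + 1 by omega) fun i => c i *
    (rectSum (n + 1) Q i * (Q ^ (2 * (n + 1) + 2) * Q ^ (2 * i) -
      Q ^ (4 * (n + 1) + 6) * (Q ^ (2 * i))⁻¹) + rectSum (n + 1) Q (i - 1) *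
        (Q ^ (4 * (n + 1) + 2) * (Q ^ (2 * (i - 1)))⁻¹ -
          Q ^ (2 * (n + 1) + 6) * Q ^ (2 * (i - 1))))
  simp only [Nat.add_sub_cancel] at htop
  rw [← htop, mul_sum, mul_sum, mul_sum]
  refine sum_congr rfl fun i hi => ?_
  obtain ⟨hi1, hi2⟩ := mem_Icc.1 hi
  obtain ⟨l, rfl⟩ : ∃ l, i = l + 1 := ⟨i - 1, by omega⟩
  obtain ⟨k, rfl⟩ : ∃ k, n = l + k := ⟨n - l, by omega⟩
  have e1 := rectSum_mul (N := l + k + 1) hQ (l + 1)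
  have e2 := rectSum_mul (N := l + k + 1) hQ l
  rw [show l + k + 1 - (l + 1) = k by omega] at e1
  rw [show l + k + 1 - l = k + 1 by omega] at e2
  rw [Nat.add_sub_cancel, thetaCoef]
  refine mul_right_cancel₀ hd ?_
  set g1 := rectSum (l + k + 1) Q (l + 1)
  set g0 := rectSum (l + k + 1) Q l
  set C := c (l + 1)
  have hL : ∀ X Y : ℝ, (Q - Q⁻¹) * (C * (g1 * X + g0 * Y)) * (Q - Q⁻¹) =
      C * (g1 * (Q - Q⁻¹) ^ 2 * X + g0 * (Q - Q⁻¹) ^ 2 * Y) := by intros; ring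
  have hR : ∀ X Y : ℝ, (1 + (Q ^ 2) ^ (l + k + 1)) * (Q ^ 2 * (C *
      (2 * (Q ^ (l + k + 1) * (Q + Q⁻¹) / (Q ^ (l + k + 1) + (Q ^ (l + k + 1))⁻¹)) - X - Y))) =
      C * Q ^ 2 * (2 * Q ^ (2 * (l + k + 1)) * (Q + Q⁻¹) -
        (1 + Q ^ (2 * (l + k + 1))) * (X + Y)) := by
    intro X Y
    have : (1 + (Q ^ 2) ^ (l + k + 1)) *
        (Q ^ (l + k + 1) * (Q + Q⁻¹) / (Q ^ (l + k + 1) + (Q ^ (l + k + 1))⁻¹)) =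
        Q ^ (2 * (l + k + 1)) * (Q + Q⁻¹) := by
      rw [mul_div_assoc', div_eq_iff hT]
      field_simp
      ring
    rw [← pow_mul] at this ⊢
    linear_combination 2 * Q ^ 2 * C * this
  rw [hL, hR, e1, e2]
  field_simp
  ring

end ThetaPairing

/-! ### Passing from the β's to the α's. -/

section Coordinates

variable {N : ℕ}

/-- Summation by parts expresses the right side through the v j with the steps of y as coefficients.
Because of the relation among the v j, these coefficients matter only modulo multiples of q^{2j}:
one multiple, μ, appears in the recursion for y, another removes v N. -/
theorem sum_smul_alpha {M : Type*} [AddCommGroup M] [Module ℂ M] (hN : 1 ≤ N) {q : ℝ} (hq : 0 < q)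
    {v : ℕ → M} (hv : ∑ j ∈ Icc 1 N, ((q ^ (2 * j) : ℝ) : ℂ) • v j = 0) {y f d : ℕ → ℝ} {μ : ℝ}
    (hy0 : y 0 = 0) (hyN : y N = 0)
    (hstep : ∀ j ∈ Icc 1 N, q ^ j * y j - q ^ (j - 1) * y (j - 1) = f j - μ * q ^ (2 * j))
    (hd : ∀ j ∈ Icc 1 (N - 1), d j = f j - f N / q ^ (2 * N) * q ^ (2 * j)) :
    ∑ j ∈ Icc 1 (N - 1), (d j : ℂ) • v j =
      ∑ j ∈ Icc 1 (N - 1), (y j : ℂ) • (((q ^ j : ℝ) : ℂ) • (v j - v (j + 1))) := by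
  have hparts : ∀ n, ∑ j ∈ Icc 1 n, (y j : ℂ) • (((q ^ j : ℝ) : ℂ) • (v j - v (j + 1))) =
      ∑ j ∈ Icc 1 n, ((q ^ j * y j - q ^ (j - 1) * y (j - 1) : ℝ) : ℂ) • v j -
        ((q ^ n * y n : ℝ) : ℂ) • v (n + 1) := by
    intro n
    induction n with
    | zero => simp [hy0]
    | succ n ih =>
      rw [sum_Icc_succ_top (by omega), sum_Icc_succ_top (by omega), ih, Nat.add_sub_cancel]
      push_cast
      module
  have hext : ∀ g : ℕ → M, ∑ j ∈ Icc 1 N, g j = ∑ j ∈ Icc 1 (N - 1), g j + g N := by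
    intro g
    obtain ⟨n, rfl⟩ : ∃ n, N = n + 1 := ⟨N - 1, by omega⟩
    rw [sum_Icc_succ_top (by omega), Nat.add_sub_cancel]
  have h1 : ∑ j ∈ Icc 1 (N - 1), (y j : ℂ) • (((q ^ j : ℝ) : ℂ) • (v j - v (j + 1))) =
      ∑ j ∈ Icc 1 N, (y j : ℂ) • (((q ^ j : ℝ) : ℂ) • (v j - v (j + 1))) := by
    rw [hext]
    simp [hyN]
  have hshift : ∀ t : ℝ, ∑ j ∈ Icc 1 N, ((f j - t * q ^ (2 * j) : ℝ) : ℂ) • v j =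
      ∑ j ∈ Icc 1 N, (f j : ℂ) • v j := by
    intro t
    have : ∀ j, ((f j - t * q ^ (2 * j) : ℝ) : ℂ) • v j =
        (f j : ℂ) • v j - (t : ℂ) • (((q ^ (2 * j) : ℝ) : ℂ) • v j) := by
      intro j
      push_cast
      module
    simp only [this, sum_sub_distrib, ← smul_sum, hv, smul_zero, sub_zero]
  have hstep' : ∑ j ∈ Icc 1 N, ((q ^ j * y j - q ^ (j - 1) * y (j - 1) : ℝ) : ℂ) • v j =
      ∑ j ∈ Icc 1 N, ((f j - μ * q ^ (2 * j) : ℝ) : ℂ) • v j :=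
    sum_congr rfl fun j hj => by rw [hstep j hj]
  rw [h1, hparts, hyN, mul_zero, Complex.ofReal_zero, zero_smul, sub_zero,
    hstep', hshift μ, ← hshift (f N / q ^ (2 * N)), hext,
    div_mul_cancel₀ _ (pow_pos hq _).ne', sub_self, Complex.ofReal_zero, zero_smul, add_zero]
  exact sum_congr rfl fun j hj => by rw [hd j hj]

theorem sum_smul_create (hN : 1 ≤ N) {x : ℝ} (hx : 0 < x) (m : ℕ) :
    ∑ j ∈ Icc 1 N, (((x ^ m) ^ (2 * j) : ℝ) : ℂ) • create N x m j = 0 := by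
  have hq : x ^ m ≠ 0 := (pow_pos hx m).ne'
  have h : ∑ j ∈ Icc 1 (N - 1), (((x ^ m) ^ (2 * j) : ℝ) : ℂ) • create N x m j =
      ∑ j ∈ Icc 1 (N - 1), (((x ^ m) ^ (2 * j) : ℝ) : ℂ) • createGen N m j :=
    sum_congr rfl fun j hj => by
      rw [create, if_neg (by have := mem_Icc.1 hj; omega)]
  rw [sum_Icc_pred_top _ hN, h]
  conv_lhs => rw [create, if_pos rfl]
  rw [smul_neg, smul_smul, ← Complex.ofReal_mul, ← mul_pow, mul_inv_cancel₀ hq, one_pow,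
    Complex.ofReal_one, one_smul, add_neg_cancel]

theorem sum_smul_annih (hN : 1 ≤ N) (r : ℕ) {x : ℝ} (hx : 0 < x) (m : ℕ) :
    ∑ j ∈ Icc 1 N, (((x ^ m)⁻¹ ^ (2 * j) : ℝ) : ℂ) • annih N r x m j = 0 := by
  have hq : x ^ m ≠ 0 := (pow_pos hx m).ne'
  have h : ∑ j ∈ Icc 1 (N - 1), (((x ^ m)⁻¹ ^ (2 * j) : ℝ) : ℂ) • annih N r x m j =
      ∑ j ∈ Icc 1 (N - 1), (((x ^ m)⁻¹ ^ (2 * j) : ℝ) : ℂ) • annihGen N r x m j :=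
    sum_congr rfl fun j hj => by
      rw [annih, if_neg (by have := mem_Icc.1 hj; omega)]
  rw [sum_Icc_pred_top _ hN, h]
  conv_lhs => rw [annih, if_pos rfl]
  rw [smul_neg, smul_smul, ← Complex.ofReal_mul, ← mul_pow, inv_mul_cancel₀ hq, one_pow,
    Complex.ofReal_one, one_smul, add_neg_cancel]

/-- The coordinates of `stateVec` modulo multiples of `q^{2 j}`. -/
def stateCoord (q : ℝ) (a b : ℕ → ℝ) (j : ℕ) : ℝ :=
  q * b j - (q ^ 2)⁻¹ * q ^ (2 * j) * (q * a j + (q - q⁻¹) * ∑ l ∈ Icc 1 (j - 1), a l)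

/-- The coordinates of `dualStateVec` modulo multiples of `q^{-2 j}`. -/
def dualStateCoord (N : ℕ) (q : ℝ) (a b : ℕ → ℝ) (j : ℕ) : ℝ :=
  q * b j - q ^ (2 * N) * (q ^ (2 * j))⁻¹ *
    (q⁻¹ * a j - (q - q⁻¹) * ∑ l ∈ Icc 1 (j - 1), a l)

theorem pow_mul_sub_eq {q : ℝ} (hq : 0 < q) (y : ℕ → ℝ) {j : ℕ} (hj : 1 ≤ j) :
    q ^ j * y j - q ^ (j - 1) * y (j - 1) =
      q⁻¹ * q ^ (2 * j) * ((q ^ j)⁻¹ * (q * y j - y (j - 1))) := by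
  obtain ⟨n, rfl⟩ : ∃ n, j = n + 1 := ⟨j - 1, by omega⟩
  rw [Nat.add_sub_cancel]
  have := hq.ne'
  field_simp
  ring

theorem stateVec_step {q : ℝ} (hq : 0 < q) (a b : ℕ → ℝ) :
    ∃ μ, ∀ j, 1 ≤ j → q ^ j * stateVec N q a b j - q ^ (j - 1) * stateVec N q a b (j - 1) =
      stateCoord q a b j - μ * q ^ (2 * j) := by
  refine ⟨q * ((∑ l ∈ Icc 1 N, b l) / (∑ l ∈ Icc 1 N, q ^ (2 * l))) -
    (q ^ 2)⁻¹ * (q⁻¹ / (∑ l ∈ Icc 1 N, q⁻¹ ^ (2 * l)) * ∑ l ∈ Icc 1 N, a l), fun j hj => ?_⟩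
  have h1 := cartanVec_step (N := N) hq b hj
  have h2 := pow_mul_sub_eq hq (cartanVec N q⁻¹ a) hj
  rw [cartanVec_dual_step hq a hj] at h2
  rw [stateVec, stateVec, stateCoord]
  have hq2 : (q ^ 2)⁻¹ = q⁻¹ * q⁻¹ := by rw [pow_two, mul_inv]
  rw [hq2]
  linear_combination q * h1 - q⁻¹ * h2

theorem dualStateVec_step {q : ℝ} (hq : 0 < q) (a b : ℕ → ℝ) :
    ∃ μ, ∀ j, 1 ≤ j →
      q⁻¹ ^ j * dualStateVec N q a b j - q⁻¹ ^ (j - 1) * dualStateVec N q a b (j - 1) =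
        dualStateCoord N q a b j - μ * q⁻¹ ^ (2 * j) := by
  have hi := inv_pos.2 hq
  have hq0 := hq.ne'
  refine ⟨q * ((∑ l ∈ Icc 1 N, b l) / (∑ l ∈ Icc 1 N, q⁻¹ ^ (2 * l))) -
    q ^ (2 * N) * (q / (∑ l ∈ Icc 1 N, q ^ (2 * l)) * ∑ l ∈ Icc 1 N, a l), fun j hj => ?_⟩
  have h1 := cartanVec_step (N := N) hi b hj
  have h2 := pow_mul_sub_eq hi (cartanVec N q a) hj
  have h3 := cartanVec_dual_step (N := N) hi a hj
  simp only [inv_inv] at h3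
  rw [h3] at h2
  rw [dualStateVec, dualStateVec, dualStateCoord, ← inv_pow]
  generalize q⁻¹ ^ j = u at *
  generalize q⁻¹ ^ (j - 1) = u' at *
  generalize q⁻¹ ^ (2 * j) = w at *
  have hqq : q * q⁻¹ = 1 := mul_inv_cancel₀ hq0
  rw [inv_inv] at h2
  have h2' := congrArg (fun t => q⁻¹ * t) h2
  rw [show ∀ X : ℝ, q⁻¹ * (q * w * X) = w * X by intro X; field_simp] at h2'
  linear_combination q * h1 - q ^ (2 * N) * h2'

theorem thetaVec_coord {Q : ℝ} (hQ : 0 < Q) (hQ1 : Q < 1) :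
    ∃ μ, ∀ j, 1 ≤ j →
      (Q ^ 2) ^ j * thetaVec N Q j - (Q ^ 2) ^ (j - 1) * thetaVec N Q (j - 1) =
        Q⁻¹ * Q ^ (2 * j) - μ * (Q ^ 2) ^ (2 * j) := by
  refine ⟨(Q ^ 2)⁻¹ * ((Q ^ N)⁻¹ * (Q + Q⁻¹) / (Q ^ N + (Q ^ N)⁻¹)), fun j hj => ?_⟩
  rw [pow_mul_sub_eq (by positivity) _ hj, thetaVec_step hQ hQ1 hj]
  generalize (Q ^ N)⁻¹ * (Q + Q⁻¹) / (Q ^ N + (Q ^ N)⁻¹) = t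
  have := hQ.ne'
  rw [pow_mul' (Q ^ 2), ← pow_mul Q]
  field_simp

theorem thetaVec_dual_coord {Q : ℝ} (hQ : 0 < Q) (hQ1 : Q < 1) :
    ∃ μ, ∀ j, 1 ≤ j →
      (Q ^ 2)⁻¹ ^ j * thetaVec N Q j - (Q ^ 2)⁻¹ ^ (j - 1) * thetaVec N Q (j - 1) =
        -(Q * (Q ^ (2 * j))⁻¹) - μ * (Q ^ 2)⁻¹ ^ (2 * j) := by
  refine ⟨-(Q ^ 2 * (Q ^ N * (Q + Q⁻¹) / (Q ^ N + (Q ^ N)⁻¹))), fun j hj => ?_⟩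
  rw [pow_mul_sub_eq (by positivity) _ hj, thetaVec_dual_step hQ hQ1 hj]
  generalize Q ^ N * (Q + Q⁻¹) / (Q ^ N + (Q ^ N)⁻¹) = t
  have := hQ.ne'
  rw [inv_inv, inv_pow]
  field_simp
  ring

end Coordinates

/-! ### Identification of D_j and E_j with step coordinates. -/

section BoundaryCoefficients

set_option linter.unusedSimpArgs false
set_option linter.unusedTactic false

theorem sum_Icc_add_sum_Icc_succ (f : ℕ → ℝ) {j n : ℕ} (hj : j ≤ n) :
    ∑ l ∈ Icc 1 j, f l + ∑ l ∈ Icc (j + 1) n, f l = ∑ l ∈ Icc 1 n, f l := by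
  rw [← sum_union]
  · congr 1
    ext l
    simp only [mem_union, mem_Icc]
    omega
  · rw [disjoint_left]
    intro l h1 h2
    simp only [mem_Icc] at h1 h2
    omega

variable {N r : ℕ} {x c : ℝ} {p : ℕ → ℝ}

/-- `q^{r - 2 c - 2 π_{1,j}}`. -/
def levPow (r : ℕ) (c : ℝ) (p : ℕ → ℝ) (q : ℝ) (j : ℕ) : ℝ := q ^ ((r : ℝ) - 2 * c - 2 * p j)

/-- `q^{-(r - 2 c - 2 π_{1,j})}`. -/
def levInv (r : ℕ) (c : ℝ) (p : ℕ → ℝ) (q : ℝ) (j : ℕ) : ℝ := q ^ (-((r : ℝ) - 2 * c - 2 * p j))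

theorem levPow_mul_levInv {q : ℝ} (hq : 0 < q) (j : ℕ) :
    levPow r c p q j * levInv r c p q j = 1 := by
  rw [levPow, levInv, ← Real.rpow_add hq, add_neg_cancel, Real.rpow_zero]

/-- `q^s - q^{-s}`. -/
def bracket (q s : ℝ) : ℝ := q ^ s - q ^ (-s)

/-- `q^s + q^{-s}`. -/
def plusBracket (q s : ℝ) : ℝ := q ^ s + q ^ (-s)

theorem bracket_ne_zero {q s : ℝ} (hq : 0 < q) (hq1 : q < 1) (hs : 0 < s) : bracket q s ≠ 0 := by
  have h1 := Real.rpow_lt_one hq.le hq1 hs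
  have h2 := Real.one_lt_rpow_of_pos_of_lt_one_of_neg hq hq1 (neg_lt_zero.2 hs)
  rw [bracket]
  linarith

/-- `x^{m/2}`. -/
def halfPow (x : ℝ) (m : ℕ) : ℝ := x ^ ((m : ℝ) / 2)

theorem halfPow_sq (hx : 0 < x) (m : ℕ) : halfPow x m ^ 2 = x ^ m := by
  rw [halfPow, ← Real.rpow_natCast, ← Real.rpow_mul hx.le, ← Real.rpow_natCast]
  congr 1
  push_cast
  ring

theorem halfPow_pos (hx : 0 < x) (m : ℕ) : 0 < halfPow x m := Real.rpow_pos_of_pos hx _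

theorem halfPow_lt_one (hx : 0 < x) (hx1 : x < 1) {m : ℕ} (hm : 1 ≤ m) : halfPow x m < 1 := by
  have : (0 : ℝ) < m := by exact_mod_cast hm
  exact Real.rpow_lt_one hx.le hx1 (by positivity)

/-- The coefficient `[r/2]^+ / [(r-1)/2]` of the `θ`-terms. -/
def thetaWeight (r : ℕ) (x : ℝ) (m : ℕ) : ℝ :=
  theta m (plusBracket (halfPow x m) r / bracket (halfPow x m) (r - 1))

theorem theta_mul (m : ℕ) (y t : ℝ) : theta m (y * t) = theta m y * t := by
  unfold theta
  split_ifs <;> simp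

/-- D_j is the coordinate representative whose N-th entry is zero, obtained by subtracting a
multiple of q^{2j}. After this subtraction the partial sum over l < j in `stateCoord` turns into the
sum over j < l < N in D_j. -/
theorem coefD_eq (hr : 2 ≤ r) (hx : 0 < x) (hx1 : x < 1) {m : ℕ} (hm : 1 ≤ m) {j : ℕ}
    (hj : j ∈ Icc 1 (N - 1)) :
    coefD N r x c p j m = 1 / bracket (x ^ m) (r - 1) *
      (stateCoord (x ^ m) (levPow r c p (x ^ m)) (levInv r c p (x ^ m)) j -
        stateCoord (x ^ m) (levPow r c p (x ^ m)) (levInv r c p (x ^ m)) N / (x ^ m) ^ (2 * N) *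
          (x ^ m) ^ (2 * j)) -
      thetaWeight r x m * ((halfPow x m)⁻¹ * halfPow x m ^ (2 * j) -
        (halfPow x m)⁻¹ * halfPow x m ^ (2 * N) / (x ^ m) ^ (2 * N) * (x ^ m) ^ (2 * j)) := by
  obtain ⟨hj1, hjN⟩ := mem_Icc.1 hj
  have hQ := halfPow_pos hx m
  have hq : 0 < x ^ m := pow_pos hx m
  have hr' : (2 : ℝ) ≤ r := by exact_mod_cast hr
  have hR : bracket (x ^ m) (r - 1) ≠ 0 :=
    bracket_ne_zero hq (pow_lt_one₀ hx.le hx1 (by omega)) (by linarith)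
  have hQR : bracket (halfPow x m) (r - 1) ≠ 0 :=
    bracket_ne_zero hQ (halfPow_lt_one hx hx1 hm) (by linarith)
  have hθ : theta m (qnum x ((N - j) * m / 2) * qplus x (r * m / 2) *
      x ^ ((3 * j - N - 1) * m / 2 : ℝ) / qnum x ((r - 1) * m / 2)) =
      thetaWeight r x m * ((halfPow x m)⁻¹ * halfPow x m ^ (2 * j) -
        (halfPow x m)⁻¹ * halfPow x m ^ (2 * N) / (x ^ m) ^ (2 * N) * (x ^ m) ^ (2 * j)) := by
    rw [thetaWeight, ← theta_mul]
    congr 1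
    rw [mul_right_comm, mul_assoc, mul_div_right_comm, qnum_div_qnum hx hx1, ← halfPow_sq hx]
    have e1 : x ^ (((N : ℝ) - j) * m / 2) = halfPow x m ^ N * (halfPow x m ^ j)⁻¹ := by
      -- With x = exp L an identity between products of powers becomes a polynomial identity between
      -- exponents.
      obtain ⟨L, rfl⟩ : ∃ L, x = Real.exp L := ⟨_, (Real.exp_log hx).symm⟩
      simp only [halfPow, ← Real.exp_mul, ← Real.exp_nat_mul, ← Real.exp_neg, ← Real.exp_add]
      congr 1
      push_cast
      ring
    have e2 : x ^ (-(((N : ℝ) - j) * m / 2)) = (halfPow x m ^ N)⁻¹ * (halfPow x m ^ j) := by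
      obtain ⟨L, rfl⟩ : ∃ L, x = Real.exp L := ⟨_, (Real.exp_log hx).symm⟩
      simp only [halfPow, ← Real.exp_mul, ← Real.exp_nat_mul, ← Real.exp_neg, ← Real.exp_add]
      congr 1
      push_cast
      ring
    have e3 : x ^ ((3 * j - N - 1) * m / 2 : ℝ) =
      halfPow x m ^ (3 * j) * (halfPow x m ^ N)⁻¹ * (halfPow x m)⁻¹ := by
      obtain ⟨L, rfl⟩ : ∃ L, x = Real.exp L := ⟨_, (Real.exp_log hx).symm⟩
      simp only [halfPow, ← Real.exp_mul, ← Real.exp_nat_mul, ← Real.exp_neg, ← Real.exp_add]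
      congr 1
      push_cast
      ring
    have e4 : x ^ ((r - 1) * m / 2 : ℝ) - x ^ (-((r - 1) * m / 2 : ℝ)) =
      bracket (halfPow x m) (r - 1) := by
      obtain ⟨L, rfl⟩ : ∃ L, x = Real.exp L := ⟨_, (Real.exp_log hx).symm⟩
      simp only [bracket, halfPow, ← Real.exp_mul, ← Real.exp_nat_mul, ← Real.exp_neg, ← Real.exp_add]
      congr 2 <;> ring
    have e5 : qplus x (r * m / 2) = plusBracket (halfPow x m) r := by
      obtain ⟨L, rfl⟩ : ∃ L, x = Real.exp L := ⟨_, (Real.exp_log hx).symm⟩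
      simp only [qplus, plusBracket, halfPow, ← Real.exp_mul, ← Real.exp_nat_mul, ← Real.exp_neg, ← Real.exp_add]
      congr 2 <;> ring
    rw [e1, e2, e3, e4, e5]
    field_simp
    ring
  rw [coefD, hθ]
  clear hθ
  have hR' : x ^ (((r : ℝ) - 1) * m) - x ^ (-(((r : ℝ) - 1) * m)) = bracket (x ^ m) (r - 1) := by
    obtain ⟨L, rfl⟩ : ∃ L, x = Real.exp L := ⟨_, (Real.exp_log hx).symm⟩
    simp only [bracket, ← Real.exp_mul, ← Real.exp_nat_mul, ← Real.exp_neg, ← Real.exp_add]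
    congr 2 <;> ring
  have h1 : x ^ (((j : ℝ) - 1) * m) =
      (x ^ m)⁻¹ * (x ^ m) ^ j := by
    obtain ⟨L, rfl⟩ : ∃ L, x = Real.exp L := ⟨_, (Real.exp_log hx).symm⟩
    simp only [levPow, levInv, ← Real.exp_mul, ← Real.exp_nat_mul, ← Real.exp_neg, ← Real.exp_add]
    congr 1
    push_cast
    ring
  have h2 : x ^ ((-r + 2 * p j + 2 * c - j + 2) * m : ℝ) =
      levInv r c p (x ^ m) j * ((x ^ m) ^ j)⁻¹ * (x ^ m) ^ 2 := by
    obtain ⟨L, rfl⟩ : ∃ L, x = Real.exp L := ⟨_, (Real.exp_log hx).symm⟩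
    simp only [levPow, levInv, ← Real.exp_mul, ← Real.exp_nat_mul, ← Real.exp_neg, ← Real.exp_add]
    congr 1
    push_cast
    ring
  have h2' : x ^ (-((-r + 2 * p j + 2 * c - j + 2) * m : ℝ)) =
      levPow r c p (x ^ m) j * (x ^ m) ^ j * ((x ^ m) ^ 2)⁻¹ := by
    obtain ⟨L, rfl⟩ : ∃ L, x = Real.exp L := ⟨_, (Real.exp_log hx).symm⟩
    simp only [levPow, levInv, ← Real.exp_mul, ← Real.exp_nat_mul, ← Real.exp_neg, ← Real.exp_add]
    congr 1
    push_cast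
    ring
  have h3 : ∀ l, x ^ ((r - 2 * c + 2 * j - 2) * m : ℝ) * x ^ (-(2 * m * p l)) =
      ((x ^ m) ^ 2)⁻¹ * (x ^ m) ^ (2 * j) * levPow r c p (x ^ m) l := by
    intro l
    obtain ⟨L, rfl⟩ : ∃ L, x = Real.exp L := ⟨_, (Real.exp_log hx).symm⟩
    simp only [levPow, levInv, ← Real.exp_mul, ← Real.exp_nat_mul, ← Real.exp_neg, ← Real.exp_add]
    congr 1
    push_cast
    ring
  have h4 : x ^ ((2 * (j : ℝ) - N) * m) =
      (x ^ m) ^ (2 * j) * ((x ^ m) ^ N)⁻¹ := by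
    obtain ⟨L, rfl⟩ : ∃ L, x = Real.exp L := ⟨_, (Real.exp_log hx).symm⟩
    simp only [levPow, levInv, ← Real.exp_mul, ← Real.exp_nat_mul, ← Real.exp_neg, ← Real.exp_add]
    congr 1
    push_cast
    ring
  have h5 : x ^ ((r - 2 * p N - 2 * c + N - 1) * m : ℝ) =
      levPow r c p (x ^ m) N * (x ^ m) ^ N * (x ^ m)⁻¹ := by
    obtain ⟨L, rfl⟩ : ∃ L, x = Real.exp L := ⟨_, (Real.exp_log hx).symm⟩
    simp only [levPow, levInv, ← Real.exp_mul, ← Real.exp_nat_mul, ← Real.exp_neg, ← Real.exp_add]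
    congr 1
    push_cast
    ring
  have h5' : x ^ (-((r - 2 * p N - 2 * c + N - 1) * m : ℝ)) =
      levInv r c p (x ^ m) N * ((x ^ m) ^ N)⁻¹ * x ^ m := by
    obtain ⟨L, rfl⟩ : ∃ L, x = Real.exp L := ⟨_, (Real.exp_log hx).symm⟩
    simp only [levPow, levInv, ← Real.exp_mul, ← Real.exp_nat_mul, ← Real.exp_neg, ← Real.exp_add]
    congr 1
    push_cast
    ring
  have hone : qnum x m / qnum x ((r - 1) * m) =
      (x ^ m - (x ^ m)⁻¹) / bracket (x ^ m) (r - 1) := by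
    rw [qnum_div_qnum hx hx1, hR', Real.rpow_neg hx.le, Real.rpow_natCast]
  have t2 : x ^ (((j : ℝ) - 1) * m) * qnum x ((-r + 2 * p j + 2 * c - j + 2) * m) /
      qnum x ((r - 1) * m) = (x ^ m)⁻¹ * (x ^ m) ^ j *
      ((levInv r c p (x ^ m) j * ((x ^ m) ^ j)⁻¹ * (x ^ m) ^ 2 -
        levPow r c p (x ^ m) j * (x ^ m) ^ j * ((x ^ m) ^ 2)⁻¹) / bracket (x ^ m) (r - 1)) := by
    rw [mul_div_assoc, qnum_div_qnum hx hx1, hR', h1, h2, h2']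
  have t3 : qnum x m * x ^ ((r - 2 * c + 2 * j - 2) * m : ℝ) / qnum x ((r - 1) * m) *
      ∑ k ∈ Icc (j + 1) (N - 1), x ^ (-(2 * m * p k)) =
      (x ^ m - (x ^ m)⁻¹) / bracket (x ^ m) (r - 1) * (((x ^ m) ^ 2)⁻¹ * (x ^ m) ^ (2 * j) *
        ∑ k ∈ Icc (j + 1) (N - 1), levPow r c p (x ^ m) k) := by
    rw [mul_div_right_comm, hone, mul_assoc, mul_sum]
    simp only [h3]
    rw [← mul_sum]
  have t4 : x ^ ((2 * (j : ℝ) - N) * m) * qnum x ((r - 2 * p N - 2 * c + N - 1) * m) /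
      qnum x ((r - 1) * m) = (x ^ m) ^ (2 * j) * ((x ^ m) ^ N)⁻¹ *
      ((levPow r c p (x ^ m) N * (x ^ m) ^ N * (x ^ m)⁻¹ -
        levInv r c p (x ^ m) N * ((x ^ m) ^ N)⁻¹ * x ^ m) / bracket (x ^ m) (r - 1)) := by
    rw [mul_div_assoc, qnum_div_qnum hx hx1, hR', h4, h5, h5']
  have hsplit : ∑ l ∈ Icc 1 (N - 1), levPow r c p (x ^ m) l =
      ∑ l ∈ Icc 1 (j - 1), levPow r c p (x ^ m) l + levPow r c p (x ^ m) j +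
        ∑ l ∈ Icc (j + 1) (N - 1), levPow r c p (x ^ m) l := by
    rw [← sum_Icc_sub_one_add _ hj1]
    exact (sum_Icc_add_sum_Icc_succ _ hjN).symm
  rw [t2, t3, t4, stateCoord, stateCoord, hsplit]
  generalize ∑ l ∈ Icc 1 (j - 1), levPow r c p (x ^ m) l = A1
  generalize ∑ l ∈ Icc (j + 1) (N - 1), levPow r c p (x ^ m) l = A2
  generalize thetaWeight r x m * _ = T
  field_simp
  ring

/-- The dual analogue: the annihilation operators satisfy the relation with q⁻¹, so multiples of
q^{-2j} are free and the dual vectors are built on the inverse base. -/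
theorem coefE_eq (hr : 2 ≤ r) (hx : 0 < x) (hx1 : x < 1) {m : ℕ} (hm : 1 ≤ m) {j : ℕ}
    (hj : j ∈ Icc 1 (N - 1)) :
    coefE N r x c p j m = 1 / bracket (x ^ m) (r - 1) *
      (dualStateCoord N (x ^ m) (levPow r c p (x ^ m)) (levInv r c p (x ^ m)) j -
        dualStateCoord N (x ^ m) (levPow r c p (x ^ m)) (levInv r c p (x ^ m)) N /
          (x ^ m)⁻¹ ^ (2 * N) * (x ^ m)⁻¹ ^ (2 * j)) +
      (x ^ m) ^ N * thetaWeight r x m * (-(halfPow x m * (halfPow x m ^ (2 * j))⁻¹) -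
        -(halfPow x m * (halfPow x m ^ (2 * N))⁻¹) / (x ^ m)⁻¹ ^ (2 * N) *
          (x ^ m)⁻¹ ^ (2 * j)) := by
  obtain ⟨hj1, hjN⟩ := mem_Icc.1 hj
  have hQ := halfPow_pos hx m
  have hq : 0 < x ^ m := pow_pos hx m
  have hr' : (2 : ℝ) ≤ r := by exact_mod_cast hr
  have hR : bracket (x ^ m) (r - 1) ≠ 0 :=
    bracket_ne_zero hq (pow_lt_one₀ hx.le hx1 (by omega)) (by linarith)
  have hQR : bracket (halfPow x m) (r - 1) ≠ 0 :=
    bracket_ne_zero hQ (halfPow_lt_one hx hx1 hm) (by linarith)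
  have hθ : theta m (qnum x ((N - j) * m / 2) * qplus x (r * m / 2) *
      x ^ ((3 * N + 1 - 3 * j) * m / 2 : ℝ) / qnum x ((r - 1) * m / 2)) =
      thetaWeight r x m * ((x ^ m) ^ N * (-(halfPow x m * (halfPow x m ^ (2 * j))⁻¹) -
        -(halfPow x m * (halfPow x m ^ (2 * N))⁻¹) / (x ^ m)⁻¹ ^ (2 * N) *
          (x ^ m)⁻¹ ^ (2 * j))) := by
    rw [thetaWeight, ← theta_mul]
    congr 1
    rw [mul_right_comm, mul_assoc, mul_div_right_comm, qnum_div_qnum hx hx1, ← halfPow_sq hx,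
      inv_pow, inv_pow]
    have e1 : x ^ (((N : ℝ) - j) * m / 2) = halfPow x m ^ N * (halfPow x m ^ j)⁻¹ := by
      obtain ⟨L, rfl⟩ : ∃ L, x = Real.exp L := ⟨_, (Real.exp_log hx).symm⟩
      simp only [halfPow, ← Real.exp_mul, ← Real.exp_nat_mul, ← Real.exp_neg, ← Real.exp_add]
      congr 1
      push_cast
      ring
    have e2 : x ^ (-(((N : ℝ) - j) * m / 2)) = (halfPow x m ^ N)⁻¹ * (halfPow x m ^ j) := by
      obtain ⟨L, rfl⟩ : ∃ L, x = Real.exp L := ⟨_, (Real.exp_log hx).symm⟩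
      simp only [halfPow, ← Real.exp_mul, ← Real.exp_nat_mul, ← Real.exp_neg, ← Real.exp_add]
      congr 1
      push_cast
      ring
    have e3 : x ^ ((3 * N + 1 - 3 * j) * m / 2 : ℝ) =
      halfPow x m ^ (3 * N) * (halfPow x m ^ (3 * j))⁻¹ * halfPow x m := by
      obtain ⟨L, rfl⟩ : ∃ L, x = Real.exp L := ⟨_, (Real.exp_log hx).symm⟩
      simp only [halfPow, ← Real.exp_mul, ← Real.exp_nat_mul, ← Real.exp_neg, ← Real.exp_add]
      congr 1
      push_cast
      ring
    have e4 : x ^ ((r - 1) * m / 2 : ℝ) - x ^ (-((r - 1) * m / 2 : ℝ)) =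
      bracket (halfPow x m) (r - 1) := by
      obtain ⟨L, rfl⟩ : ∃ L, x = Real.exp L := ⟨_, (Real.exp_log hx).symm⟩
      simp only [bracket, halfPow, ← Real.exp_mul, ← Real.exp_nat_mul, ← Real.exp_neg, ← Real.exp_add]
      congr 2 <;> ring
    have e5 : qplus x (r * m / 2) = plusBracket (halfPow x m) r := by
      obtain ⟨L, rfl⟩ : ∃ L, x = Real.exp L := ⟨_, (Real.exp_log hx).symm⟩
      simp only [qplus, plusBracket, halfPow, ← Real.exp_mul, ← Real.exp_nat_mul, ← Real.exp_neg, ← Real.exp_add]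
      congr 2 <;> ring
    rw [e1, e2, e3, e4, e5]
    field_simp
    ring
  rw [coefE, hθ]
  clear hθ
  have hR' : x ^ (((r : ℝ) - 1) * m) - x ^ (-(((r : ℝ) - 1) * m)) = bracket (x ^ m) (r - 1) := by
    obtain ⟨L, rfl⟩ : ∃ L, x = Real.exp L := ⟨_, (Real.exp_log hx).symm⟩
    simp only [bracket, ← Real.exp_mul, ← Real.exp_nat_mul, ← Real.exp_neg, ← Real.exp_add]
    congr 2 <;> ring
  have h1 : x ^ (((N : ℝ) + 1 - j) * m) =
      (x ^ m) ^ N * x ^ m * ((x ^ m) ^ j)⁻¹ := by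
    obtain ⟨L, rfl⟩ : ∃ L, x = Real.exp L := ⟨_, (Real.exp_log hx).symm⟩
    simp only [levPow, levInv, ← Real.exp_mul, ← Real.exp_nat_mul, ← Real.exp_neg, ← Real.exp_add]
    congr 1
    push_cast
    ring
  have h2 : x ^ ((r - 2 * c + N - j - 2 * p j) * m : ℝ) =
      levPow r c p (x ^ m) j * (x ^ m) ^ N * ((x ^ m) ^ j)⁻¹ := by
    obtain ⟨L, rfl⟩ : ∃ L, x = Real.exp L := ⟨_, (Real.exp_log hx).symm⟩
    simp only [levPow, levInv, ← Real.exp_mul, ← Real.exp_nat_mul, ← Real.exp_neg, ← Real.exp_add]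
    congr 1
    push_cast
    ring
  have h2' : x ^ (-((r - 2 * c + N - j - 2 * p j) * m : ℝ)) =
      levInv r c p (x ^ m) j * ((x ^ m) ^ N)⁻¹ * (x ^ m) ^ j := by
    obtain ⟨L, rfl⟩ : ∃ L, x = Real.exp L := ⟨_, (Real.exp_log hx).symm⟩
    simp only [levPow, levInv, ← Real.exp_mul, ← Real.exp_nat_mul, ← Real.exp_neg, ← Real.exp_add]
    congr 1
    push_cast
    ring
  have h3 : ∀ l, x ^ ((r - 2 * c + 2 * N - 2 * j) * m : ℝ) * x ^ (-(2 * m * p l)) =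
      (x ^ m) ^ (2 * N) * ((x ^ m) ^ (2 * j))⁻¹ * levPow r c p (x ^ m) l := by
    intro l
    obtain ⟨L, rfl⟩ : ∃ L, x = Real.exp L := ⟨_, (Real.exp_log hx).symm⟩
    simp only [levPow, levInv, ← Real.exp_mul, ← Real.exp_nat_mul, ← Real.exp_neg, ← Real.exp_add]
    congr 1
    push_cast
    ring
  have h4 : x ^ (2 * ((N : ℝ) - j) * m) =
      (x ^ m) ^ (2 * N) * ((x ^ m) ^ (2 * j))⁻¹ := by
    obtain ⟨L, rfl⟩ : ∃ L, x = Real.exp L := ⟨_, (Real.exp_log hx).symm⟩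
    simp only [levPow, levInv, ← Real.exp_mul, ← Real.exp_nat_mul, ← Real.exp_neg, ← Real.exp_add]
    congr 1
    push_cast
    ring
  have h5 : x ^ ((-r + 2 * c + 1 + 2 * p N) * m : ℝ) =
      levInv r c p (x ^ m) N * x ^ m := by
    obtain ⟨L, rfl⟩ : ∃ L, x = Real.exp L := ⟨_, (Real.exp_log hx).symm⟩
    simp only [levPow, levInv, ← Real.exp_mul, ← Real.exp_nat_mul, ← Real.exp_neg, ← Real.exp_add]
    congr 1
    push_cast
    ring
  have h5' : x ^ (-((-r + 2 * c + 1 + 2 * p N) * m : ℝ)) =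
      levPow r c p (x ^ m) N * (x ^ m)⁻¹ := by
    obtain ⟨L, rfl⟩ : ∃ L, x = Real.exp L := ⟨_, (Real.exp_log hx).symm⟩
    simp only [levPow, levInv, ← Real.exp_mul, ← Real.exp_nat_mul, ← Real.exp_neg, ← Real.exp_add]
    congr 1
    push_cast
    ring
  have hone : qnum x m / qnum x ((r - 1) * m) =
      (x ^ m - (x ^ m)⁻¹) / bracket (x ^ m) (r - 1) := by
    rw [qnum_div_qnum hx hx1, hR', Real.rpow_neg hx.le, Real.rpow_natCast]
  have t2 : x ^ (((N : ℝ) + 1 - j) * m) * qnum x ((r - 2 * c + N - j - 2 * p j) * m) /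
      qnum x ((r - 1) * m) = (x ^ m) ^ N * x ^ m * ((x ^ m) ^ j)⁻¹ *
      ((levPow r c p (x ^ m) j * (x ^ m) ^ N * ((x ^ m) ^ j)⁻¹ -
        levInv r c p (x ^ m) j * ((x ^ m) ^ N)⁻¹ * (x ^ m) ^ j) / bracket (x ^ m) (r - 1)) := by
    rw [mul_div_assoc, qnum_div_qnum hx hx1, hR', h1, h2, h2']
  have t3 : qnum x m * x ^ ((r - 2 * c + 2 * N - 2 * j) * m : ℝ) / qnum x ((r - 1) * m) *
      ∑ k ∈ Icc (j + 1) (N - 1), x ^ (-(2 * m * p k)) =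
      (x ^ m - (x ^ m)⁻¹) / bracket (x ^ m) (r - 1) * ((x ^ m) ^ (2 * N) * ((x ^ m) ^ (2 * j))⁻¹ *
        ∑ k ∈ Icc (j + 1) (N - 1), levPow r c p (x ^ m) k) := by
    rw [mul_div_right_comm, hone, mul_assoc, mul_sum]
    simp only [h3]
    rw [← mul_sum]
  have t4 : x ^ (2 * ((N : ℝ) - j) * m) * qnum x ((-r + 2 * c + 1 + 2 * p N) * m) /
      qnum x ((r - 1) * m) = (x ^ m) ^ (2 * N) * ((x ^ m) ^ (2 * j))⁻¹ *
      ((levInv r c p (x ^ m) N * x ^ m - levPow r c p (x ^ m) N * (x ^ m)⁻¹) /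
        bracket (x ^ m) (r - 1)) := by
    rw [mul_div_assoc, qnum_div_qnum hx hx1, hR', h4, h5, h5']
  have hsplit : ∑ l ∈ Icc 1 (N - 1), levPow r c p (x ^ m) l =
      ∑ l ∈ Icc 1 (j - 1), levPow r c p (x ^ m) l + levPow r c p (x ^ m) j +
        ∑ l ∈ Icc (j + 1) (N - 1), levPow r c p (x ^ m) l := by
    rw [← sum_Icc_sub_one_add _ hj1]
    exact (sum_Icc_add_sum_Icc_succ _ hjN).symm
  rw [t2, t3, t4, dualStateCoord, dualStateCoord, hsplit,
    inv_pow, inv_pow]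
  generalize ∑ l ∈ Icc 1 (j - 1), levPow r c p (x ^ m) l = A1
  generalize ∑ l ∈ Icc (j + 1) (N - 1), levPow r c p (x ^ m) l = A2
  generalize -(halfPow x m * (halfPow x m ^ (2 * j))⁻¹) - _ = T
  generalize thetaWeight r x m = t
  field_simp
  ring

end BoundaryCoefficients

/-! ### The contribution of one energy in closed form. -/

section ModeValues

variable {N r : ℕ} {x c : ℝ} {p : ℕ → ℝ}

/-- The coefficients of the linear part of `F` with respect to the `α_{-m}^j`. -/
def linPart (N r : ℕ) (x c : ℝ) (p : ℕ → ℝ) (m j : ℕ) : ℝ :=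
  1 / (m * bracket (x ^ m) (r - 1)) *
      stateVec N (x ^ m) (levPow r c p (x ^ m)) (levInv r c p (x ^ m)) j +
    -(thetaWeight r x m / m) * thetaVec N (halfPow x m) j

/-- The coefficients of the linear part of `G` with respect to the `α_m^j`. -/
def dualLinPart (N r : ℕ) (x c : ℝ) (p : ℕ → ℝ) (m j : ℕ) : ℝ :=
  1 / (m * bracket (x ^ m) (r - 1)) *
      dualStateVec N (x ^ m) (levPow r c p (x ^ m)) (levInv r c p (x ^ m)) j +
    (x ^ m) ^ N * (thetaWeight r x m / m) * thetaVec N (halfPow x m) j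

theorem stateVec_zero (q : ℝ) (a b : ℕ → ℝ) : stateVec N q a b 0 = 0 := by
  simp [stateVec, cartanVec_zero]

theorem stateVec_self (hN : 1 ≤ N) {q : ℝ} (hq : 0 < q) (a b : ℕ → ℝ) : stateVec N q a b N = 0 := by
  simp [stateVec, cartanVec_self hN hq, cartanVec_self hN (inv_pos.2 hq)]

theorem dualStateVec_zero (q : ℝ) (a b : ℕ → ℝ) : dualStateVec N q a b 0 = 0 := by
  simp [dualStateVec, cartanVec_zero]

theorem dualStateVec_self (hN : 1 ≤ N) {q : ℝ} (hq : 0 < q) (a b : ℕ → ℝ) :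
    dualStateVec N q a b N = 0 := by
  simp [dualStateVec, cartanVec_self hN hq, cartanVec_self hN (inv_pos.2 hq)]

theorem sum_coefD_smul_create (hN : 1 ≤ N) (hr : 2 ≤ r) (hx : 0 < x) (hx1 : x < 1) {m : ℕ}
    (hm : 1 ≤ m) :
    ∑ j ∈ Icc 1 (N - 1), ((1 / m * coefD N r x c p j m : ℝ) : ℂ) • create N x m j =
      ∑ j ∈ Icc 1 (N - 1), (linPart N r x c p m j : ℂ) • createAlpha N x m j := by
  have hq : 0 < x ^ m := pow_pos hx m
  have hQ := halfPow_pos hx m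
  have hQ1 := halfPow_lt_one hx hx1 hm
  obtain ⟨μ, hμ⟩ := stateVec_step (N := N) hq (levPow r c p (x ^ m)) (levInv r c p (x ^ m))
  obtain ⟨ν, hν⟩ := thetaVec_coord (N := N) hQ hQ1
  rw [halfPow_sq hx] at hν
  refine sum_smul_alpha hN hq (sum_smul_create hN hx m) (y := linPart N r x c p m)
    (d := fun j => 1 / m * coefD N r x c p j m)
    (f := fun j => 1 / (m * bracket (x ^ m) (r - 1)) *
      stateCoord (x ^ m) (levPow r c p (x ^ m)) (levInv r c p (x ^ m)) j -
      thetaWeight r x m / m * ((halfPow x m)⁻¹ * halfPow x m ^ (2 * j)))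
    (μ := 1 / (m * bracket (x ^ m) (r - 1)) * μ - thetaWeight r x m / m * ν) ?_ ?_ ?_ ?_
  · simp [linPart, stateVec_zero, thetaVec_zero]
  · simp [linPart, stateVec_self hN hq, thetaVec_self hQ]
  · intro j hj
    have h1 := hμ j (mem_Icc.1 hj).1
    have h2 := hν j (mem_Icc.1 hj).1
    simp only [linPart]
    linear_combination 1 / (m * bracket (x ^ m) (r - 1)) * h1 - thetaWeight r x m / m * h2
  · intro j hj
    rw [coefD_eq hr hx hx1 hm hj, one_div, one_div, one_div, mul_inv]
    ring

theorem sum_coefE_smul_annih (hN : 1 ≤ N) (hr : 2 ≤ r) (hx : 0 < x) (hx1 : x < 1) {m : ℕ}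
    (hm : 1 ≤ m) :
    ∑ j ∈ Icc 1 (N - 1), ((1 / m * coefE N r x c p j m : ℝ) : ℂ) • annih N r x m j =
      ∑ j ∈ Icc 1 (N - 1), (dualLinPart N r x c p m j : ℂ) • annihAlpha N r x m j := by
  have hq : 0 < x ^ m := pow_pos hx m
  have hQ := halfPow_pos hx m
  have hQ1 := halfPow_lt_one hx hx1 hm
  obtain ⟨μ, hμ⟩ := dualStateVec_step (N := N) hq (levPow r c p (x ^ m)) (levInv r c p (x ^ m))
  obtain ⟨ν, hν⟩ := thetaVec_dual_coord (N := N) hQ hQ1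
  rw [halfPow_sq hx] at hν
  refine sum_smul_alpha hN (inv_pos.2 hq) (sum_smul_annih hN r hx m)
    (y := dualLinPart N r x c p m)
    (d := fun j => 1 / m * coefE N r x c p j m)
    (f := fun j => 1 / (m * bracket (x ^ m) (r - 1)) *
      dualStateCoord N (x ^ m) (levPow r c p (x ^ m)) (levInv r c p (x ^ m)) j +
      (x ^ m) ^ N * (thetaWeight r x m / m) * -(halfPow x m * (halfPow x m ^ (2 * j))⁻¹))
    (μ := 1 / (m * bracket (x ^ m) (r - 1)) * μ + (x ^ m) ^ N * (thetaWeight r x m / m) * ν)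
    ?_ ?_ ?_ ?_
  · simp [dualLinPart, dualStateVec_zero, thetaVec_zero]
  · simp [dualLinPart, dualStateVec_self hN hq, thetaVec_self hQ]
  · intro j hj
    have h1 := hμ j (mem_Icc.1 hj).1
    have h2 := hν j (mem_Icc.1 hj).1
    simp only [dualLinPart]
    linear_combination 1 / (m * bracket (x ^ m) (r - 1)) * h1 +
      (x ^ m) ^ N * (thetaWeight r x m / m) * h2
  · intro j hj
    rw [coefE_eq hr hx hx1 hm hj, one_div, one_div, one_div, mul_inv]
    ring

theorem kap_eq (hx : 0 < x) (hx1 : x < 1) (m : ℕ) :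
    kap r x m = m * (bracket (x ^ m) (r - 1) / bracket (x ^ m) r) := by
  have h : ∀ s : ℝ, x ^ (s * m) = (x ^ m) ^ s := fun s => by
    rw [mul_comm, Real.rpow_mul hx.le, Real.rpow_natCast]
  rw [kap, qnum_div_qnum hx hx1, ← neg_mul, ← neg_mul, h, h, h, h, bracket, bracket]

theorem bracket_sq {q : ℝ} (hq : 0 < q) (s : ℝ) :
    bracket (q ^ 2) s = bracket q s * plusBracket q s := by
  rw [bracket, bracket, plusBracket, ← rpow_pow_comm hq.le, ← rpow_pow_comm hq.le]
  ring

/-- Divided by [s][s-1] at s = r, the first term gives the level-independent products (z; x^{4N})_∞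
and the second the quotients of {·}_∞ and {·}_∞^*. -/
theorem plusBracket_mul {q : ℝ} (hq : 0 < q) (s : ℝ) :
    plusBracket q s * plusBracket q (s - 1) = bracket q s * bracket q (s - 1) + 2 * (q + q⁻¹) := by
  have hu : q ^ (s - 1) = q ^ s / q := by rw [Real.rpow_sub hq, Real.rpow_one]
  have hu0 : q ^ s ≠ 0 := (Real.rpow_pos_of_pos hq _).ne'
  have := hq.ne'
  rw [bracket, bracket, plusBracket, plusBracket, Real.rpow_neg hq.le, Real.rpow_neg hq.le, hu]
  field_simp
  ring

/-- The denominator [r][r-1] of the Gaussian exponent is, up to q - q⁻¹, a difference of the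
geometric series at the two levels. This is why the answer consists of quotients of products at r
and r - 1. -/
theorem levelGap_mul {q : ℝ} (hr : 2 ≤ r) (hq : 0 < q) (hq1 : q < 1) :
    levelGap r q * (bracket q r * bracket q (r - 1)) = q - q⁻¹ := by
  have hr' : (2 : ℝ) ≤ r := by exact_mod_cast hr
  have h1 := Real.rpow_lt_one hq.le hq1 (show 0 < 2 * (r : ℝ) by linarith)
  have h2 := Real.rpow_lt_one hq.le hq1 (show 0 < 2 * ((r : ℝ) - 1) by linarith)
  have e : ∀ s : ℝ, q ^ (2 * s) = q ^ s * q ^ s := fun s => by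
    rw [two_mul, Real.rpow_add hq]
  rw [e] at h1 h2
  have hu : q ^ ((r : ℝ) - 1) = q ^ (r : ℝ) / q := by rw [Real.rpow_sub hq, Real.rpow_one]
  have hu0 : 0 < q ^ (r : ℝ) := Real.rpow_pos_of_pos hq _
  rw [levelGap, bracket, bracket, e, e, Real.rpow_neg hq.le, Real.rpow_neg hq.le]
  rw [hu] at h2 ⊢
  generalize q ^ (r : ℝ) = u at *
  have d1 : 1 - u * u ≠ 0 := by linarith
  have d2 : 1 - u / q * (u / q) ≠ 0 := by linarith
  have hu' := hu0.ne'
  have hq' := hq.ne'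
  have d3 : q ^ 2 - u ^ 2 ≠ 0 := by
    intro h
    apply d2
    have : u / q * (u / q) = u ^ 2 / q ^ 2 := by ring
    rw [this, sub_eq_zero, eq_comm, div_eq_one_iff_eq (pow_ne_zero 2 hq')]
    linarith
  have d1' : 1 - u ^ 2 ≠ 0 := by rwa [pow_two]
  rw [show 1 - u / q * (u / q) = (q ^ 2 - u ^ 2) / q ^ 2 by field_simp,
    show 1 - u * u = 1 - u ^ 2 by ring]
  field_simp
  ring

/-- The bracketed sum of `pairingForm_state_eq`. -/
def squareSum (N : ℕ) (q : ℝ) (a b : ℕ → ℝ) : ℝ :=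
  ∑ i ∈ Icc 1 N, ∑ j ∈ Icc 1 (N - i), (q ^ 2)⁻¹ * q ^ (2 * i) * q ^ (2 * j) +
  ∑ i ∈ Icc 1 N, ∑ j ∈ Icc 1 (i - 1), q ^ (2 * N) * (q ^ (2 * i))⁻¹ * q ^ (2 * j) +
  ∑ i ∈ Icc 1 N, ∑ j ∈ Icc (i + 1) N, (q ^ 2 * (b i * b j) +
    q ^ (2 * N) * (q ^ 2)⁻¹ * (a i * a j) - q ^ (2 * N) * (a i * b j) -
    q ^ (2 * N) * (a j * b i)) -
  (∑ i ∈ Icc 1 N, ∑ j ∈ Icc 1 (N - i), (q ^ 2 * q ^ (2 * j) * (b i * b i) +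
    q ^ (2 * N) * (q ^ 2)⁻¹ * q ^ (2 * j) * (a i * a i)) / 2 +
  ∑ i ∈ Icc 1 N, ∑ j ∈ Icc 1 (i - 1), (q ^ 2 * q ^ (2 * j) * (b i * b i) +
    q ^ (2 * N) * (q ^ 2)⁻¹ * q ^ (2 * j) * (a i * a i)) / 2)

/-- The series of the products `[z]_∞`. -/
def squareSeries (N r : ℕ) (c : ℝ) (p : ℕ → ℝ) (q : ℝ) : ℝ :=
  levelGap r q / (1 - q ^ (2 * N)) * squareSum N q (levPow r c p q) (levInv r c p q)

/-- The sum over rectangles which gives the cross terms with the `θ`-part. -/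
def curlySum (N : ℕ) (Q : ℝ) (c : ℕ → ℝ) : ℝ :=
  ∑ i ∈ Icc 1 (N - 1), rectSum N Q i *
      (c i * (Q ^ (2 * N + 2) * Q ^ (2 * i) - Q ^ (4 * N + 6) * (Q ^ (2 * i))⁻¹) +
        c (i + 1) * (Q ^ (4 * N + 2) * (Q ^ (2 * i))⁻¹ - Q ^ (2 * N + 6) * Q ^ (2 * i)))

/-- `∑ i (N - i) Q^{4 N-2 i}`. -/
def weightSum (N : ℕ) (Q : ℝ) : ℝ :=
  ∑ i ∈ Icc 1 (N - 1), (i * (N - i) : ℝ) * (Q ^ (4 * N) * (Q ^ (2 * i))⁻¹)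

/-- The series of the products `{z}_∞` and `(z; x^{4 N})_∞`. -/
def curlySeries (N r : ℕ) (c : ℝ) (p : ℕ → ℝ) (Q : ℝ) : ℝ :=
  levelGap r Q / (1 - Q ^ (4 * N)) * (-(1 / 2) * curlySum N Q (fun i => levInv r c p (Q ^ 2) i +
      Q ^ (2 * N) * (Q ^ 4)⁻¹ * levPow r c p (Q ^ 2) i)) +
    levelGap r Q / (1 - Q ^ (4 * N)) * (((Q ^ 2)⁻¹ - Q ^ 2) * weightSum N Q) -
    1 / 2 * ((Q - Q⁻¹) ^ 2 * weightSum N Q) / (1 - Q ^ (4 * N))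

theorem halfPow_two_mul (x : ℝ) (k : ℕ) : halfPow x (2 * k) = x ^ k := by
  rw [halfPow, ← Real.rpow_natCast]
  congr 1
  push_cast
  ring

/-- The normalisation 1/(m[r-1]) of the linear parts and the scalar in the commutators combine to
1/(m[r][r-1]), which is the level gap over m(q - q⁻¹). The terms without θ give the square series
for every m; the others exist for even m only. -/
theorem kap_mul_pairingForm (hN : 1 ≤ N) (hr : 2 ≤ r) (hx : 0 < x) (hx1 : x < 1) {m : ℕ}
    (hm : 1 ≤ m) :
    kap r x m * pairingForm N (x ^ m) (linPart N r x c p m) (dualLinPart N r x c p m) /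
        (1 - (x ^ m) ^ (2 * N)) =
      squareSeries N r c p (x ^ m) / m +
        if Even m then curlySeries N r c p (x ^ (m / 2)) / (m / 2 : ℕ) else 0 := by
  have hq : 0 < x ^ m := pow_pos hx m
  have hq1 : x ^ m < 1 := pow_lt_one₀ hx.le hx1 (by omega)
  have hr' : (2 : ℝ) ≤ r := by exact_mod_cast hr
  have hm0 : (m : ℝ) ≠ 0 := by exact_mod_cast (show m ≠ 0 by omega)
  have hR : bracket (x ^ m) (r - 1) ≠ 0 := bracket_ne_zero hq hq1 (by linarith)
  have hS : bracket (x ^ m) r ≠ 0 := bracket_ne_zero hq hq1 (by linarith)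
  have hγ : 1 - (x ^ m) ^ (2 * N) ≠ 0 := (sub_pos.2 (pow_lt_one₀ hq.le hq1 (by omega))).ne'
  have hgap := levelGap_mul hr hq hq1
  have hlin : linPart N r x c p m = fun j => 1 / (m * bracket (x ^ m) (r - 1)) *
      stateVec N (x ^ m) (levPow r c p (x ^ m)) (levInv r c p (x ^ m)) j +
    -(thetaWeight r x m / m) * thetaVec N (halfPow x m) j := rfl
  have hdlin : dualLinPart N r x c p m = fun j => 1 / (m * bracket (x ^ m) (r - 1)) *
      dualStateVec N (x ^ m) (levPow r c p (x ^ m)) (levInv r c p (x ^ m)) j +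
    (x ^ m) ^ N * (thetaWeight r x m / m) * thetaVec N (halfPow x m) j := rfl
  rw [hlin, hdlin, pairingForm_add_theta, kap_eq hx hx1,
    pairingForm_state_eq hN hq hq1 (fun j => levPow_mul_levInv hq j), ← squareSum, ← hgap,
    squareSeries]
  have hmain : ∀ X Y Z : ℝ, m * (bracket (x ^ m) (r - 1) / bracket (x ^ m) r) *
      ((1 / (m * bracket (x ^ m) (r - 1))) ^ 2 * (levelGap r (x ^ m) *
        (bracket (x ^ m) r * bracket (x ^ m) (r - 1)) * X) - Y - Z) / (1 - (x ^ m) ^ (2 * N)) =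
      levelGap r (x ^ m) / (1 - (x ^ m) ^ (2 * N)) * X / m -
      m * (bracket (x ^ m) (r - 1) / bracket (x ^ m) r) * (Y + Z) / (1 - (x ^ m) ^ (2 * N)) := by
    intro X Y Z
    field_simp
    ring
  rw [hmain, sub_eq_add_neg]
  congr 1
  split_ifs with he
  -- For m = 2k the base of the θ-terms is Q = x^k, with q = Q².
  · obtain ⟨k, hk⟩ := he.two_dvd
    subst hk
    have hk1 : 1 ≤ k := by omega
    rw [show 2 * k / 2 = k by omega, halfPow_two_mul]
    have hθ : thetaWeight r x (2 * k) = plusBracket (x ^ k) r / bracket (x ^ k) (r - 1) := by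
      rw [thetaWeight, theta, if_pos he, halfPow_two_mul]
    rw [hθ]
    have hxk : x ^ (2 * k) = (x ^ k) ^ 2 := by rw [← pow_mul, mul_comm]
    have hQ : 0 < x ^ k := pow_pos hx k
    have hQ1 : x ^ k < 1 := pow_lt_one₀ hx.le hx1 (by omega)
    rw [hxk] at hR hS hγ ⊢
    have hgap' := levelGap_mul hr hQ hQ1
    generalize x ^ k = Q at *
    have hk0 : (k : ℝ) ≠ 0 := by exact_mod_cast (show k ≠ 0 by omega)
    rw [cartanForm_state_theta hN hQ hQ1, ← sum_rectSum_mul hN hQ hQ1, ← curlySum]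
    have hthth : (Q ^ 2) ^ N * (1 + (Q ^ 2) ^ N) * cartanForm N (Q ^ 2) (thetaVec N Q) (thetaVec N Q)
        = (Q - Q⁻¹) ^ 2 * weightSum N Q := by
      have h := cartanForm_theta hN hQ hQ1
      have hN0 : Q ^ N ≠ 0 := (pow_pos hQ N).ne'
      have h1 : (Q ^ 2) ^ N * (1 + (Q ^ 2) ^ N) = Q ^ (3 * N) * (Q ^ N + (Q ^ N)⁻¹) := by
        rw [← pow_mul]
        field_simp
        ring
      rw [h1, mul_assoc, mul_comm (_ + _), h, weightSum, mul_left_comm, mul_sum]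
      congr 1
      refine sum_congr rfl fun i _ => ?_
      ring
    rw [mul_right_comm _ (_ ^ 2) (cartanForm _ _ _ _), hthth]
    -- Brackets in base Q² factor as [s][s]^+ in base Q, and the plus factors meet those in the
    -- weight of the θ-terms.
    rw [bracket_sq hQ] at hS hR ⊢
    rw [bracket_sq hQ]
    rw [curlySeries, show (Q ^ 2) ^ (2 * N) = Q ^ (4 * N) by rw [← pow_mul]; ring_nf]
    have hB := left_ne_zero_of_mul hS
    have hP := right_ne_zero_of_mul hS
    have hB' := left_ne_zero_of_mul hR
    have hP' := right_ne_zero_of_mul hR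
    have hPP := plusBracket_mul hQ (r : ℝ)
    have hγ' : 1 - Q ^ (4 * N) ≠ 0 := (sub_pos.2 (pow_lt_one₀ hQ.le hQ1 (by omega))).ne'
    have hLg : levelGap r Q = (Q - Q⁻¹) / (bracket Q r * bracket Q (r - 1)) := by
      rw [eq_div_iff (mul_ne_zero hB hB'), hgap']
    have hQ2 : (Q ^ 2)⁻¹ - Q ^ 2 = -((Q - Q⁻¹) * (Q + Q⁻¹)) := by
      have := hQ.ne'
      field_simp
      ring
    rw [hLg, hQ2]
    push_cast
    generalize curlySum N Q _ = C
    generalize weightSum N Q = W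
    generalize 1 - Q ^ (4 * N) = g at *
    generalize Q - Q⁻¹ = D at *
    generalize Q + Q⁻¹ = S at *
    have h2 : (2 : ℝ) * k * (bracket Q (r - 1) * plusBracket Q (r - 1) /
        (bracket Q r * plusBracket Q r)) * (1 / (2 * k * (bracket Q (r - 1) *
          plusBracket Q (r - 1))) * (plusBracket Q r / bracket Q (r - 1) / (2 * k)) * (D * C) +
        D ^ 2 * W * (plusBracket Q r / bracket Q (r - 1) / (2 * k)) ^ 2) / g =
        (D * C + D ^ 2 * W * (plusBracket Q r * plusBracket Q (r - 1))) /
          (2 * k * (bracket Q r * bracket Q (r - 1)) * g) := by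
      field_simp
    rw [h2, hPP]
    field_simp
    ring
  · rw [thetaWeight, theta, if_neg he]
    simp

end ModeValues

/-! ### The factors built from [z]_∞ and [z]_∞^*. -/

section SquareProducts

set_option linter.unusedSimpArgs false

variable {N r : ℕ} {x c : ℝ} {p : ℕ → ℝ}

theorem LogSeries.prod_mul {ι : Type*} {s : Finset ι} {P : ι → ℝ} {K : ℕ → ℝ} {g : ι → ℕ → ℝ}
    (h : ∀ i ∈ s, LogSeries (P i) (fun m => K m * g i m)) :
    LogSeries (∏ i ∈ s, P i) (fun m => K m * ∑ i ∈ s, g i m) := by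
  refine (LogSeries.prod h).congr fun m _ => ?_
  rw [Finset.sum_apply, mul_sum]

theorem LogSeries.mul_mul {P P' : ℝ} {K g g' : ℕ → ℝ} (h : LogSeries P (fun m => K m * g m))
    (h' : LogSeries P' (fun m => K m * g' m)) :
    LogSeries (P * P') (fun m => K m * (g m + g' m)) :=
  (h.mul h').congr fun m _ => by simp only [Pi.add_apply]; ring

theorem rpow_two_mul_natCast (q : ℝ) (N : ℕ) : q ^ (2 * (N : ℝ)) = q ^ (2 * N) := by
  rw [← Real.rpow_natCast]
  push_cast
  rfl

theorem rpow_four_mul_natCast (q : ℝ) (N : ℕ) : q ^ (4 * (N : ℝ)) = q ^ (4 * N) := by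
  rw [← Real.rpow_natCast]
  push_cast
  rfl

/-- The common factor of the series of the products `[z]_∞ / [z]_∞^*`. -/
def squareWeight (N r : ℕ) (x : ℝ) (m : ℕ) : ℝ := levelGap r (x ^ m) / (1 - (x ^ m) ^ (2 * N))

theorem logSeries_sqQuot' (hN : 1 ≤ N) (hr : 2 ≤ r) (hx : 0 < x) (hx1 : x < 1) {e : ℝ}
    (he : 0 < e + 2 * (r - 1)) :
    LogSeries (sqQuot N r x e) (fun m => squareWeight N r x m * -(x ^ m) ^ e) := by
  refine (logSeries_sqQuot hN hr hx hx1 he).congr fun m _ => ?_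
  rw [squareWeight, rpow_two_mul_natCast]
  ring

theorem logSeries_sq_div (hN : 1 ≤ N) (hr : 2 ≤ r) (hx : 0 < x) (hx1 : x < 1) {e : ℝ}
    (he : 0 < e) :
    LogSeries (sq N x (r - 1) e / sq N x r e) (fun m => squareWeight N r x m * (x ^ m) ^ e) := by
  have hr' : (2 : ℝ) ≤ r := by exact_mod_cast hr
  refine ((logSeries_sq hN hx hx1 (by linarith) he).div
    (logSeries_sq hN hx hx1 (by linarith) he)).congr fun m _ => ?_
  rw [Pi.sub_apply, squareWeight, rpow_two_mul_natCast, levelGap]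
  ring

theorem gap_shift {q : ℝ} (hr : 2 ≤ r) (hq : 0 < q) (hq1 : q < 1) :
    1 / (1 - q ^ (2 * ((r : ℝ) - 1))) - q ^ 2 * (1 / (1 - q ^ (2 * (r : ℝ)))) =
      -(q ^ 2 * q ^ (-(2 * (r : ℝ))) * levelGap r q) := by
  have hr' : (2 : ℝ) ≤ r := by exact_mod_cast hr
  have h1 := Real.rpow_lt_one hq.le hq1 (show 0 < 2 * (r : ℝ) by linarith)
  have h2 := Real.rpow_lt_one hq.le hq1 (show 0 < 2 * ((r : ℝ) - 1) by linarith)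
  have e : q ^ (2 * (r : ℝ)) = q ^ (2 * ((r : ℝ) - 1)) * q ^ 2 := by
    rw [← Real.rpow_natCast, ← Real.rpow_add hq]
    congr 1
    push_cast
    ring
  have h0 := Real.rpow_pos_of_pos hq (2 * ((r : ℝ) - 1))
  rw [levelGap, Real.rpow_neg hq.le]
  rw [e] at h1 ⊢
  generalize q ^ (2 * ((r : ℝ) - 1)) = u at *
  have d1 : 1 - u * q ^ 2 ≠ 0 := by linarith
  have d2 : 1 - u ≠ 0 := by linarith
  have := hq.ne'
  field_simp
  ring

/-- The two levels differ by the factor x² in the base, which compensates the shift of the exponent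
by 2. The quotient again carries the level gap, at the exponent e + 2 - 2r, although numerator and
denominator have different arguments. -/
theorem logSeries_sq_div_shift (hN : 1 ≤ N) (hr : 2 ≤ r) (hx : 0 < x) (hx1 : x < 1) {e : ℝ}
    (he : 0 < e) :
    LogSeries (sq N x (r - 1) e / sq N x r (e + 2))
      (fun m => squareWeight N r x m * (x ^ m) ^ (e + 2 - 2 * r)) := by
  have hr' : (2 : ℝ) ≤ r := by exact_mod_cast hr
  refine ((logSeries_sq hN hx hx1 (by linarith) he).div
    (logSeries_sq hN hx hx1 (by linarith) (by linarith))).congr fun m hm => ?_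
  have hq : 0 < x ^ m := pow_pos hx m
  have h := gap_shift hr hq (pow_lt_one₀ hx.le hx1 (by omega))
  have e1 : (x ^ m) ^ (e + 2) = (x ^ m) ^ e * (x ^ m) ^ 2 := by
    rw [Real.rpow_add hq]
    norm_cast
  rw [Pi.sub_apply, squareWeight, rpow_two_mul_natCast, sub_eq_add_neg (e + 2),
    Real.rpow_add hq _ (-(2 * (r : ℝ))), e1]
  linear_combination -((x ^ m) ^ e / (1 - (x ^ m) ^ (2 * N))) * h

theorem logSeries_constSquare (hN : 1 ≤ N) (hr : 2 ≤ r) (hx : 0 < x) (hx1 : x < 1) :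
    LogSeries (∏ i ∈ Icc 1 N, ∏ j ∈ Icc 1 (N - i),
        sq N x (r - 1) (-2 + 2 * i + 2 * j) / sq N x r (-2 + 2 * i + 2 * j))
      (fun m => squareWeight N r x m *
        ∑ i ∈ Icc 1 N, ∑ j ∈ Icc 1 (N - i), ((x ^ m) ^ 2)⁻¹ * (x ^ m) ^ (2 * i) * (x ^ m) ^ (2 * j)) := by
  refine LogSeries.prod_mul fun i hi => LogSeries.prod_mul fun j hj => ?_
  have hi1 : (1 : ℝ) ≤ i := by exact_mod_cast (mem_Icc.1 hi).1
  have hj1 : (1 : ℝ) ≤ j := by exact_mod_cast (mem_Icc.1 hj).1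
  refine (logSeries_sq_div hN hr hx hx1 (by linarith)).congr fun m _ => ?_
  congr 1
  obtain ⟨L, rfl⟩ : ∃ L, x = Real.exp L := ⟨_, (Real.exp_log hx).symm⟩
  simp only [← Real.exp_mul, ← Real.exp_nat_mul, ← Real.exp_neg, ← Real.exp_add]
  congr 1
  push_cast
  ring

theorem logSeries_constSquare' (hN : 1 ≤ N) (hr : 2 ≤ r) (hx : 0 < x) (hx1 : x < 1) :
    LogSeries (∏ i ∈ Icc 1 N, ∏ j ∈ Icc 1 (i - 1),
        sq N x (r - 1) (2 * N - 2 * i + 2 * j) / sq N x r (2 * N - 2 * i + 2 * j))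
      (fun m => squareWeight N r x m * ∑ i ∈ Icc 1 N, ∑ j ∈ Icc 1 (i - 1),
        (x ^ m) ^ (2 * N) * ((x ^ m) ^ (2 * i))⁻¹ * (x ^ m) ^ (2 * j)) := by
  refine LogSeries.prod_mul fun i hi => LogSeries.prod_mul fun j hj => ?_
  have hi1 : (i : ℝ) ≤ N := by exact_mod_cast (mem_Icc.1 hi).2
  have hj1 : (1 : ℝ) ≤ j := by exact_mod_cast (mem_Icc.1 hj).1
  refine (logSeries_sq_div hN hr hx hx1 (by linarith)).congr fun m _ => ?_
  congr 1
  obtain ⟨L, rfl⟩ : ∃ L, x = Real.exp L := ⟨_, (Real.exp_log hx).symm⟩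
  simp only [← Real.exp_mul, ← Real.exp_nat_mul, ← Real.exp_neg, ← Real.exp_add]
  congr 1
  push_cast
  ring

/-- The four factors match b_i b_j, a_i a_j, a_i b_j and a_j b_i. Positivity of c makes the first
argument admissible; the upper bounds on the π's keep the other exponents above -2(r-1). -/
theorem logSeries_pairSquare (hN : 1 ≤ N) (hr : 2 ≤ r) (hx : 0 < x) (hx1 : x < 1) (hc0 : 0 < c)
    (hc1 : c < 1) (hp0 : ∀ j ∈ Icc 1 N, 0 ≤ p j) (hp1 : ∀ j ∈ Icc 1 N, p j ≤ r - 2 - N + j) :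
    LogSeries (∏ i ∈ Icc 1 N, ∏ j ∈ Icc (i + 1) N,
        sq N x (r - 1) (4 * c + 2 * p i + 2 * p j) / sq N x r (4 * c + 2 + 2 * p i + 2 * p j)
          * (sqQuot N r x (2 * r - 4 * c + 2 * N - 2 - 2 * p i - 2 * p j))⁻¹
          * sqQuot N r x (2 * N + 2 * (p i - p j)) * sqQuot N r x (2 * N + 2 * (p j - p i)))
      (fun m => squareWeight N r x m * ∑ i ∈ Icc 1 N, ∑ j ∈ Icc (i + 1) N,
        ((x ^ m) ^ 2 * (levInv r c p (x ^ m) i * levInv r c p (x ^ m) j) +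
          (x ^ m) ^ (2 * N) * ((x ^ m) ^ 2)⁻¹ * (levPow r c p (x ^ m) i * levPow r c p (x ^ m) j) -
          (x ^ m) ^ (2 * N) * (levPow r c p (x ^ m) i * levInv r c p (x ^ m) j) -
          (x ^ m) ^ (2 * N) * (levPow r c p (x ^ m) j * levInv r c p (x ^ m) i))) := by
  refine LogSeries.prod_mul fun i hi => LogSeries.prod_mul fun j hj => ?_
  have hj' : j ∈ Icc 1 N := by
    simp only [mem_Icc] at hj ⊢
    omega
  have hiN : (i : ℝ) ≤ N := by exact_mod_cast (mem_Icc.1 hi).2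
  have hjN : (j : ℝ) ≤ N := by exact_mod_cast (mem_Icc.1 hj').2
  have hN' : (1 : ℝ) ≤ N := by exact_mod_cast hN
  have a1 := hp0 i hi
  have a2 := hp0 j hj'
  have b1 := hp1 i hi
  have b2 := hp1 j hj'
  have s1 := logSeries_sq_div_shift (N := N) hN hr hx hx1
    (show 0 < 4 * c + 2 * p i + 2 * p j by linarith)
  have s2 := (logSeries_sqQuot' (N := N) (e := 2 * r - 4 * c + 2 * N - 2 - 2 * p i - 2 * p j)
    hN hr hx hx1 (by linarith)).inv
  have s3 := logSeries_sqQuot' (N := N) (e := 2 * N + 2 * (p i - p j)) hN hr hx hx1 (by linarith)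
  have s4 := logSeries_sqQuot' (N := N) (e := 2 * N + 2 * (p j - p i)) hN hr hx hx1 (by linarith)
  rw [show 4 * c + 2 + 2 * p i + 2 * p j = 4 * c + 2 * p i + 2 * p j + 2 by ring]
  refine (((s1.mul s2).mul s3).mul s4).congr fun m _ => ?_
  have e1 : (x ^ m) ^ (4 * c + 2 * p i + 2 * p j + 2 - 2 * r) =
      (x ^ m) ^ 2 * (levInv r c p (x ^ m) i * levInv r c p (x ^ m) j) := by
    obtain ⟨L, rfl⟩ : ∃ L, x = Real.exp L := ⟨_, (Real.exp_log hx).symm⟩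
    simp only [levInv, ← Real.exp_mul, ← Real.exp_nat_mul, ← Real.exp_neg, ← Real.exp_add]
    congr 1
    push_cast
    ring
  have e2 : (x ^ m) ^ (2 * r - 4 * c + 2 * N - 2 - 2 * p i - 2 * p j) =
      (x ^ m) ^ (2 * N) * ((x ^ m) ^ 2)⁻¹ *
        (levPow r c p (x ^ m) i * levPow r c p (x ^ m) j) := by
    obtain ⟨L, rfl⟩ : ∃ L, x = Real.exp L := ⟨_, (Real.exp_log hx).symm⟩
    simp only [levPow, ← Real.exp_mul, ← Real.exp_nat_mul, ← Real.exp_neg, ← Real.exp_add]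
    congr 1
    push_cast
    ring
  have e3 : ∀ i j, (x ^ m) ^ (2 * N + 2 * (p i - p j)) =
      (x ^ m) ^ (2 * N) * (levPow r c p (x ^ m) j * levInv r c p (x ^ m) i) := by
    intro i j
    obtain ⟨L, rfl⟩ : ∃ L, x = Real.exp L := ⟨_, (Real.exp_log hx).symm⟩
    simp only [levPow, levInv, ← Real.exp_mul, ← Real.exp_nat_mul, ← Real.exp_neg, ← Real.exp_add]
    congr 1
    push_cast
    ring
  simp only [Pi.add_apply, Pi.neg_apply]
  rw [e1, e2, e3, e3]
  ring

/-- The squares b_i² and a_i² occur with the coefficient 1/2, hence the square roots. The bound `B`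
serves both index ranges, N - i and i - 1. -/
theorem logSeries_sqrtSquare (hN : 1 ≤ N) (hr : 2 ≤ r) (hx : 0 < x) (hx1 : x < 1) (hc0 : 0 < c)
    (hc1 : c < 1) (hp0 : ∀ j ∈ Icc 1 N, 0 ≤ p j) (hp1 : ∀ j ∈ Icc 1 N, p j ≤ r - 2 - N + j)
    (B : ℕ → ℕ) :
    LogSeries (∏ i ∈ Icc 1 N, ∏ j ∈ Icc 1 (B i),
        √(sqQuot N r x (-2 * r + 4 * c + 2 + 2 * j + 4 * p i)
          * sqQuot N r x (2 * r - 4 * c + 2 * N - 2 + 2 * j - 4 * p i)))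
      (fun m => squareWeight N r x m * -∑ i ∈ Icc 1 N, ∑ j ∈ Icc 1 (B i),
        ((x ^ m) ^ 2 * (x ^ m) ^ (2 * j) * (levInv r c p (x ^ m) i * levInv r c p (x ^ m) i) +
          (x ^ m) ^ (2 * N) * ((x ^ m) ^ 2)⁻¹ * (x ^ m) ^ (2 * j) *
            (levPow r c p (x ^ m) i * levPow r c p (x ^ m) i)) / 2) := by
  simp only [← sum_neg_distrib]
  refine LogSeries.prod_mul fun i hi => LogSeries.prod_mul fun j hj => ?_
  have hiN : (i : ℝ) ≤ N := by exact_mod_cast (mem_Icc.1 hi).2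
  have hj1 : (1 : ℝ) ≤ j := by exact_mod_cast (mem_Icc.1 hj).1
  have hN' : (1 : ℝ) ≤ N := by exact_mod_cast hN
  have a1 := hp0 i hi
  have b1 := hp1 i hi
  have s1 := logSeries_sqQuot' (N := N) (e := -2 * r + 4 * c + 2 + 2 * j + 4 * p i) hN hr hx hx1
    (by linarith)
  have s2 := logSeries_sqQuot' (N := N) (e := 2 * r - 4 * c + 2 * N - 2 + 2 * j - 4 * p i)
    hN hr hx hx1 (by linarith)
  refine ((s1.mul s2).sqrt).congr fun m _ => ?_
  have e1 : (x ^ m) ^ (-2 * r + 4 * c + 2 + 2 * j + 4 * p i) =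
      (x ^ m) ^ 2 * (x ^ m) ^ (2 * j) * (levInv r c p (x ^ m) i * levInv r c p (x ^ m) i) := by
    obtain ⟨L, rfl⟩ : ∃ L, x = Real.exp L := ⟨_, (Real.exp_log hx).symm⟩
    simp only [levInv, ← Real.exp_mul, ← Real.exp_nat_mul, ← Real.exp_neg, ← Real.exp_add]
    congr 1
    push_cast
    ring
  have e2 : (x ^ m) ^ (2 * r - 4 * c + 2 * N - 2 + 2 * j - 4 * p i) =
      (x ^ m) ^ (2 * N) * ((x ^ m) ^ 2)⁻¹ * (x ^ m) ^ (2 * j) *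
        (levPow r c p (x ^ m) i * levPow r c p (x ^ m) i) := by
    obtain ⟨L, rfl⟩ : ∃ L, x = Real.exp L := ⟨_, (Real.exp_log hx).symm⟩
    simp only [levPow, ← Real.exp_mul, ← Real.exp_nat_mul, ← Real.exp_neg, ← Real.exp_add]
    congr 1
    push_cast
    ring
  simp only [Pi.add_apply, Pi.smul_apply, smul_eq_mul]
  rw [e1, e2]
  ring

/-- The factors of `normProduct` built from `[z]_∞` and `[z]_∞^*`. -/
def squareProduct (N r : ℕ) (x c : ℝ) (p : ℕ → ℝ) : ℝ :=
  (∏ i ∈ Icc 1 N, ∏ j ∈ Icc 1 (N - i),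
      sq N x (r - 1) (-2 + 2 * i + 2 * j) / sq N x r (-2 + 2 * i + 2 * j))
  * (∏ i ∈ Icc 1 N, ∏ j ∈ Icc 1 (i - 1),
      sq N x (r - 1) (2 * N - 2 * i + 2 * j) / sq N x r (2 * N - 2 * i + 2 * j))
  * (∏ i ∈ Icc 1 N, ∏ j ∈ Icc (i + 1) N,
      sq N x (r - 1) (4 * c + 2 * p i + 2 * p j) / sq N x r (4 * c + 2 + 2 * p i + 2 * p j)
        * (sqQuot N r x (2 * r - 4 * c + 2 * N - 2 - 2 * p i - 2 * p j))⁻¹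
        * sqQuot N r x (2 * N + 2 * (p i - p j)) * sqQuot N r x (2 * N + 2 * (p j - p i)))
  * (∏ i ∈ Icc 1 N, ∏ j ∈ Icc 1 (N - i),
      √(sqQuot N r x (-2 * r + 4 * c + 2 + 2 * j + 4 * p i)
        * sqQuot N r x (2 * r - 4 * c + 2 * N - 2 + 2 * j - 4 * p i)))
  * (∏ i ∈ Icc 1 N, ∏ j ∈ Icc 1 (i - 1),
      √(sqQuot N r x (-2 * r + 4 * c + 2 + 2 * j + 4 * p i)
        * sqQuot N r x (2 * r - 4 * c + 2 * N - 2 + 2 * j - 4 * p i)))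

theorem logSeries_squareProduct (hN : 1 ≤ N) (hr : 2 ≤ r) (hx : 0 < x) (hx1 : x < 1) (hc0 : 0 < c)
    (hc1 : c < 1) (hp0 : ∀ j ∈ Icc 1 N, 0 ≤ p j) (hp1 : ∀ j ∈ Icc 1 N, p j ≤ r - 2 - N + j) :
    LogSeries (squareProduct N r x c p) (fun m => squareSeries N r c p (x ^ m)) := by
  refine (((((logSeries_constSquare hN hr hx hx1).mul_mul
    (logSeries_constSquare' hN hr hx hx1)).mul_mul
    (logSeries_pairSquare hN hr hx hx1 hc0 hc1 hp0 hp1)).mul_mul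
    (logSeries_sqrtSquare hN hr hx hx1 hc0 hc1 hp0 hp1 (fun i => N - i))).mul_mul
    (logSeries_sqrtSquare hN hr hx hx1 hc0 hc1 hp0 hp1 (fun i => i - 1))).congr fun m _ => ?_
  simp only [squareSeries, squareSum, squareWeight]
  ring

end SquareProducts

/-! ### The factors built from {z}_∞, {z}_∞^* and (z; x^{4N})_∞. -/

section CurlyProducts

set_option linter.unusedSimpArgs false

variable {N r : ℕ} {x c : ℝ} {p : ℕ → ℝ}

/-- The common factor of the series of the products `{z}_∞ / {z}_∞^*`. -/
def curlyWeight (N r : ℕ) (x : ℝ) (m : ℕ) : ℝ := levelGap r (x ^ m) / (1 - (x ^ m) ^ (4 * N))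

theorem logSeries_cuQuot' (hN : 1 ≤ N) (hr : 2 ≤ r) (hx : 0 < x) (hx1 : x < 1) {e : ℝ}
    (he : 0 < e + 2 * (r - 1)) :
    LogSeries (cuQuot N r x e) (fun m => curlyWeight N r x m * -(x ^ m) ^ e) := by
  refine (logSeries_cuQuot hN hr hx hx1 he).congr fun m _ => ?_
  rw [curlyWeight, rpow_four_mul_natCast]
  ring

theorem natCast_mul_sub {i : ℕ} (hi : i ∈ Icc 1 (N - 1)) :
    ((i * (N - i) : ℕ) : ℝ) = i * (N - i) := by
  rw [Nat.cast_mul, Nat.cast_sub (by have := mem_Icc.1 hi; omega)]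

/-- The exponents shifted by ±2 under the square root against the unshifted one give -(Q² + Q⁻²)/2 +
1 = -(Q - Q⁻¹)²/2. -/
theorem logSeries_sqrtPoch (hx : 0 < x) (hx1 : x < 1) :
    LogSeries (∏ i ∈ Icc 1 (N - 1),
      (√(poch (x ^ (4 * N - 2 - 2 * i : ℝ)) (x ^ (4 * (N : ℝ)))
          * poch (x ^ (4 * N + 2 - 2 * i : ℝ)) (x ^ (4 * (N : ℝ))))
        / poch (x ^ (4 * N - 2 * i : ℝ)) (x ^ (4 * (N : ℝ)))) ^ (i * (N - i)))
      (fun m => -(1 / 2) * (x ^ m - (x ^ m)⁻¹) ^ 2 / (1 - (x ^ m) ^ (4 * N)) *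
        weightSum N (x ^ m)) := by
  refine LogSeries.prod_mul fun i hi => ?_
  have hiN : (i : ℝ) + 1 ≤ N := by exact_mod_cast (show i + 1 ≤ N by have := mem_Icc.1 hi; omega)
  have hi1 : (1 : ℝ) ≤ i := by exact_mod_cast (mem_Icc.1 hi).1
  have hb : 0 < 4 * (N : ℝ) := by linarith
  refine ((((logSeries_poch_rpow hx hx1 (show 0 < (4 * N - 2 - 2 * i : ℝ) by linarith) hb).mul
    (logSeries_poch_rpow hx hx1 (show 0 < (4 * N + 2 - 2 * i : ℝ) by linarith) hb)).sqrt.div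
    (logSeries_poch_rpow hx hx1 (show 0 < (4 * N - 2 * i : ℝ) by linarith) hb)).pow
      (i * (N - i))).congr fun m _ => ?_
  have hq : x ^ m ≠ 0 := (pow_pos hx m).ne'
  have e0 : (x ^ m) ^ (4 * N - 2 * i : ℝ) = (x ^ m) ^ (4 * N) * ((x ^ m) ^ (2 * i))⁻¹ := by
    obtain ⟨L, rfl⟩ : ∃ L, x = Real.exp L := ⟨_, (Real.exp_log hx).symm⟩
    simp only [← Real.exp_mul, ← Real.exp_nat_mul, ← Real.exp_neg, ← Real.exp_add]
    congr 1
    push_cast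
    ring
  have e1 : (x ^ m) ^ (4 * N - 2 - 2 * i : ℝ) =
      ((x ^ m) ^ 2)⁻¹ * ((x ^ m) ^ (4 * N) * ((x ^ m) ^ (2 * i))⁻¹) := by
    obtain ⟨L, rfl⟩ : ∃ L, x = Real.exp L := ⟨_, (Real.exp_log hx).symm⟩
    simp only [← Real.exp_mul, ← Real.exp_nat_mul, ← Real.exp_neg, ← Real.exp_add]
    congr 1
    push_cast
    ring
  have e2 : (x ^ m) ^ (4 * N + 2 - 2 * i : ℝ) =
      (x ^ m) ^ 2 * ((x ^ m) ^ (4 * N) * ((x ^ m) ^ (2 * i))⁻¹) := by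
    obtain ⟨L, rfl⟩ : ∃ L, x = Real.exp L := ⟨_, (Real.exp_log hx).symm⟩
    simp only [← Real.exp_mul, ← Real.exp_nat_mul, ← Real.exp_neg, ← Real.exp_add]
    congr 1
    push_cast
    ring
  simp only [Pi.add_apply, Pi.sub_apply, Pi.smul_apply, smul_eq_mul]
  rw [natCast_mul_sub hi, rpow_four_mul_natCast, e0, e1, e2]
  generalize (x ^ m) ^ (4 * N) * ((x ^ m) ^ (2 * i))⁻¹ = u
  have e3 : (x ^ m - (x ^ m)⁻¹) ^ 2 = (x ^ m) ^ 2 - 2 + ((x ^ m) ^ 2)⁻¹ := by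
    field_simp
    ring
  rw [e3]
  ring

theorem logSeries_constCurly (hN : 1 ≤ N) (hr : 2 ≤ r) (hx : 0 < x) (hx1 : x < 1) :
    LogSeries (∏ i ∈ Icc 1 (N - 1),
      (cu N x (r - 1) (4 * N - 2 - 2 * i) * cu N x r (4 * N + 2 - 2 * i)
        / (cu N x (r - 1) (4 * N + 2 - 2 * i) * cu N x r (4 * N - 2 - 2 * i))) ^ (i * (N - i)))
      (fun m => curlyWeight N r x m * ((((x ^ m) ^ 2)⁻¹ - (x ^ m) ^ 2) * weightSum N (x ^ m))) := by
  refine LogSeries.congr (f := fun m => curlyWeight N r x m * ∑ i ∈ Icc 1 (N - 1),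
    (((x ^ m) ^ 2)⁻¹ - (x ^ m) ^ 2) * ((i * (N - i) : ℝ) *
      ((x ^ m) ^ (4 * N) * ((x ^ m) ^ (2 * i))⁻¹))) (LogSeries.prod_mul fun i hi => ?_)
    fun m _ => by simp only [weightSum, mul_sum]
  have hr' : (2 : ℝ) ≤ r := by exact_mod_cast hr
  have hiN : (i : ℝ) + 1 ≤ N := by exact_mod_cast (show i + 1 ≤ N by have := mem_Icc.1 hi; omega)
  have hi1 : (1 : ℝ) ≤ i := by exact_mod_cast (mem_Icc.1 hi).1
  have h1 := fun {s : ℝ} (hs : 0 < s) => logSeries_cu (N := N) hN hx hx1 hs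
    (show 0 < (4 * N - 2 - 2 * i : ℝ) by linarith)
  have h2 := fun {s : ℝ} (hs : 0 < s) => logSeries_cu (N := N) hN hx hx1 hs
    (show 0 < (4 * N + 2 - 2 * i : ℝ) by linarith)
  have ha : (0 : ℝ) < r - 1 := by linarith
  have hb : (0 : ℝ) < r := by linarith
  refine ((((h1 ha).mul (h2 hb)).div ((h2 ha).mul (h1 hb))).pow (i * (N - i))).congr fun m _ => ?_
  have e1 : (x ^ m) ^ (4 * N - 2 - 2 * i : ℝ) =
      ((x ^ m) ^ 2)⁻¹ * ((x ^ m) ^ (4 * N) * ((x ^ m) ^ (2 * i))⁻¹) := by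
    obtain ⟨L, rfl⟩ : ∃ L, x = Real.exp L := ⟨_, (Real.exp_log hx).symm⟩
    simp only [← Real.exp_mul, ← Real.exp_nat_mul, ← Real.exp_neg, ← Real.exp_add]
    congr 1
    push_cast
    ring
  have e2 : (x ^ m) ^ (4 * N + 2 - 2 * i : ℝ) =
      (x ^ m) ^ 2 * ((x ^ m) ^ (4 * N) * ((x ^ m) ^ (2 * i))⁻¹) := by
    obtain ⟨L, rfl⟩ : ∃ L, x = Real.exp L := ⟨_, (Real.exp_log hx).symm⟩
    simp only [← Real.exp_mul, ← Real.exp_nat_mul, ← Real.exp_neg, ← Real.exp_add]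
    congr 1
    push_cast
    ring
  simp only [Pi.add_apply, Pi.sub_apply, Pi.smul_apply, smul_eq_mul]
  rw [natCast_mul_sub hi, rpow_four_mul_natCast, e1, e2, curlyWeight, levelGap]
  ring

/-- The eight quotients in U and V are the eight monomials of a rectangle term: two powers of Q for
each of a_i, a_{i+1}, b_i, b_{i+1}, with the sign deciding between numerator and denominator. The
ranges of j and k keep all eight exponents admissible. -/
theorem logSeries_rectCurly (hN : 1 ≤ N) (hr : 2 ≤ r) (hx : 0 < x) (hx1 : x < 1) (hc0 : 0 < c)
    (hc1 : c < 1) (hp0 : ∀ j ∈ Icc 1 N, 0 ≤ p j) (hp1 : ∀ j ∈ Icc 1 N, p j ≤ r - 2 - N + j) :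
    LogSeries (∏ i ∈ Icc 1 (N - 1), ∏ j ∈ Icc 1 i, ∏ k ∈ Icc 1 (N - i),
      √(cuQuot N r x (4 * N + 2 * r - 4 * c - 2 + 2 * i - 2 * j - 2 * k - 4 * p i)
          * cuQuot N r x (2 * N - 2 * r + 4 * c + 2 + 2 * i - 2 * j - 2 * k + 4 * p i)
        / (cuQuot N r x (4 * N + 2 * r - 4 * c + 2 + 2 * i - 2 * j - 2 * k - 4 * p (i + 1))
          * cuQuot N r x (2 * N - 2 * r + 4 * c + 6 + 2 * i - 2 * j - 2 * k + 4 * p (i + 1))))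
      * √(cuQuot N r x (4 * N - 2 * r + 4 * c + 2 - 2 * i - 2 * j - 2 * k + 4 * p (i + 1))
          * cuQuot N r x (6 * N + 2 * r - 4 * c - 2 - 2 * i - 2 * j - 2 * k - 4 * p (i + 1))
        / (cuQuot N r x (4 * N - 2 * r + 4 * c + 6 - 2 * i - 2 * j - 2 * k + 4 * p i)
          * cuQuot N r x (6 * N + 2 * r - 4 * c + 2 - 2 * i - 2 * j - 2 * k - 4 * p i))))
      (fun m => curlyWeight N r x m * (-(1 / 2) * curlySum N (x ^ m) (fun i =>
        levInv r c p ((x ^ m) ^ 2) i + (x ^ m) ^ (2 * N) * ((x ^ m) ^ 4)⁻¹ *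
          levPow r c p ((x ^ m) ^ 2) i))) := by
  refine LogSeries.congr (f := fun m => curlyWeight N r x m * ∑ i ∈ Icc 1 (N - 1),
    ∑ j ∈ Icc 1 i, ∑ k ∈ Icc 1 (N - i), -(1 / 2) * (((x ^ m) ^ (2 * j))⁻¹ * ((x ^ m) ^ (2 * k))⁻¹ *
      ((levInv r c p ((x ^ m) ^ 2) i + (x ^ m) ^ (2 * N) * ((x ^ m) ^ 4)⁻¹ *
          levPow r c p ((x ^ m) ^ 2) i) * ((x ^ m) ^ (2 * N + 2) * (x ^ m) ^ (2 * i) -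
            (x ^ m) ^ (4 * N + 6) * ((x ^ m) ^ (2 * i))⁻¹) +
        (levInv r c p ((x ^ m) ^ 2) (i + 1) + (x ^ m) ^ (2 * N) * ((x ^ m) ^ 4)⁻¹ *
          levPow r c p ((x ^ m) ^ 2) (i + 1)) * ((x ^ m) ^ (4 * N + 2) * ((x ^ m) ^ (2 * i))⁻¹ -
            (x ^ m) ^ (2 * N + 6) * (x ^ m) ^ (2 * i)))))
    (LogSeries.prod_mul fun i hi => LogSeries.prod_mul fun j hj => LogSeries.prod_mul
      fun k hk => ?_) fun m _ => by simp only [curlySum, rectSum, sum_mul, mul_sum]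
  have hi' := mem_Icc.1 hi
  have hj' := mem_Icc.1 hj
  have hk' := mem_Icc.1 hk
  have hiN : (i : ℝ) + 1 ≤ N := by exact_mod_cast (show i + 1 ≤ N by omega)
  have hi1 : (1 : ℝ) ≤ i := by exact_mod_cast hi'.1
  have hji : (j : ℝ) ≤ i := by exact_mod_cast hj'.2
  have hki : (k : ℝ) + i ≤ N := by exact_mod_cast (show k + i ≤ N by omega)
  have a1 := hp0 i (mem_Icc.2 (by omega))
  have a2 := hp0 (i + 1) (mem_Icc.2 (by omega))
  have b1 := hp1 i (mem_Icc.2 (by omega))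
  have b2 := hp1 (i + 1) (mem_Icc.2 (by omega))
  push_cast at b2
  have Lc := fun {e : ℝ} (he : 0 < e + 2 * ((r : ℝ) - 1)) => logSeries_cuQuot' hN hr hx hx1 he
  have u1 := Lc (e := 4 * N + 2 * r - 4 * c - 2 + 2 * i - 2 * j - 2 * k - 4 * p i) (by linarith)
  have u2 := Lc (e := 2 * N - 2 * r + 4 * c + 2 + 2 * i - 2 * j - 2 * k + 4 * p i) (by linarith)
  have u3 := Lc (e := 4 * N + 2 * r - 4 * c + 2 + 2 * i - 2 * j - 2 * k - 4 * p (i + 1))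
    (by linarith)
  have u4 := Lc (e := 2 * N - 2 * r + 4 * c + 6 + 2 * i - 2 * j - 2 * k + 4 * p (i + 1))
    (by linarith)
  have v1 := Lc (e := 4 * N - 2 * r + 4 * c + 2 - 2 * i - 2 * j - 2 * k + 4 * p (i + 1))
    (by linarith)
  have v2 := Lc (e := 6 * N + 2 * r - 4 * c - 2 - 2 * i - 2 * j - 2 * k - 4 * p (i + 1))
    (by linarith)
  have v3 := Lc (e := 4 * N - 2 * r + 4 * c + 6 - 2 * i - 2 * j - 2 * k + 4 * p i) (by linarith)
  have v4 := Lc (e := 6 * N + 2 * r - 4 * c + 2 - 2 * i - 2 * j - 2 * k - 4 * p i) (by linarith)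
  refine ((((u1.mul u2).div (u3.mul u4)).sqrt).mul
    (((v1.mul v2).div (v3.mul v4)).sqrt)).congr fun m _ => ?_
  simp only [Pi.add_apply, Pi.sub_apply, Pi.smul_apply, smul_eq_mul]
  have hq : 0 < x ^ m := pow_pos hx m
  have eb : ∀ (l : ℕ) (n : ℤ) (e : ℝ), e = -2 * r + 4 * c + 4 * p l + n →
      (x ^ m) ^ e = levInv r c p ((x ^ m) ^ 2) l * (x ^ m) ^ n := by
    intro l n e he
    rw [he, Real.rpow_add hq, Real.rpow_intCast, levInv, ← rpow_pow_comm hq.le,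
      pow_two, ← Real.rpow_add hq]
    congr 2
    ring
  have ea : ∀ (l : ℕ) (n : ℤ) (e : ℝ), e = 2 * r - 4 * c - 4 * p l + n →
      (x ^ m) ^ e = levPow r c p ((x ^ m) ^ 2) l * (x ^ m) ^ n := by
    intro l n e he
    rw [he, Real.rpow_add hq, Real.rpow_intCast, levPow, ← rpow_pow_comm hq.le,
      pow_two, ← Real.rpow_add hq]
    congr 2
    ring
  rw [ea i (4 * N - 2 + 2 * i - 2 * j - 2 * k) (4 * N + 2 * r - 4 * c - 2 + 2 * i - 2 * j - 2 * k - 4 * p i)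
      (by push_cast; ring),
    eb i (2 * N + 2 + 2 * i - 2 * j - 2 * k) (2 * N - 2 * r + 4 * c + 2 + 2 * i - 2 * j - 2 * k + 4 * p i)
      (by push_cast; ring),
    ea (i + 1) (4 * N + 2 + 2 * i - 2 * j - 2 * k)
      (4 * N + 2 * r - 4 * c + 2 + 2 * i - 2 * j - 2 * k - 4 * p (i + 1)) (by push_cast; ring),
    eb (i + 1) (2 * N + 6 + 2 * i - 2 * j - 2 * k)
      (2 * N - 2 * r + 4 * c + 6 + 2 * i - 2 * j - 2 * k + 4 * p (i + 1)) (by push_cast; ring),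
    eb (i + 1) (4 * N + 2 - 2 * i - 2 * j - 2 * k)
      (4 * N - 2 * r + 4 * c + 2 - 2 * i - 2 * j - 2 * k + 4 * p (i + 1)) (by push_cast; ring),
    ea (i + 1) (6 * N - 2 - 2 * i - 2 * j - 2 * k)
      (6 * N + 2 * r - 4 * c - 2 - 2 * i - 2 * j - 2 * k - 4 * p (i + 1)) (by push_cast; ring),
    eb i (4 * N + 6 - 2 * i - 2 * j - 2 * k)
      (4 * N - 2 * r + 4 * c + 6 - 2 * i - 2 * j - 2 * k + 4 * p i) (by push_cast; ring),
    ea i (6 * N + 2 - 2 * i - 2 * j - 2 * k)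
      (6 * N + 2 * r - 4 * c + 2 - 2 * i - 2 * j - 2 * k - 4 * p i) (by push_cast; ring)]
  have hz : ∀ (n : ℤ) (a b : ℕ), n = a - b → (x ^ m) ^ n = (x ^ m) ^ a * ((x ^ m) ^ b)⁻¹ := by
    intro n a b h
    rw [h, zpow_sub₀ hq.ne', zpow_natCast, zpow_natCast, div_eq_mul_inv]
  rw [hz (4 * N - 2 + 2 * i - 2 * j - 2 * k) (4 * N + 2 * i) (2 + 2 * j + 2 * k) (by push_cast; ring),
    hz (2 * N + 2 + 2 * i - 2 * j - 2 * k) (2 * N + 2 + 2 * i) (2 * j + 2 * k) (by push_cast; ring),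
    hz (4 * N + 2 + 2 * i - 2 * j - 2 * k) (4 * N + 2 + 2 * i) (2 * j + 2 * k) (by push_cast; ring),
    hz (2 * N + 6 + 2 * i - 2 * j - 2 * k) (2 * N + 6 + 2 * i) (2 * j + 2 * k) (by push_cast; ring),
    hz (4 * N + 2 - 2 * i - 2 * j - 2 * k) (4 * N + 2) (2 * i + 2 * j + 2 * k) (by push_cast; ring),
    hz (6 * N - 2 - 2 * i - 2 * j - 2 * k) (6 * N) (2 + 2 * i + 2 * j + 2 * k) (by push_cast; ring),
    hz (4 * N + 6 - 2 * i - 2 * j - 2 * k) (4 * N + 6) (2 * i + 2 * j + 2 * k) (by push_cast; ring),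
    hz (6 * N + 2 - 2 * i - 2 * j - 2 * k) (6 * N + 2) (2 * i + 2 * j + 2 * k) (by push_cast; ring)]
  generalize levPow r c p ((x ^ m) ^ 2) i = a1
  generalize levPow r c p ((x ^ m) ^ 2) (i + 1) = a2
  generalize levInv r c p ((x ^ m) ^ 2) i = b1
  generalize levInv r c p ((x ^ m) ^ 2) (i + 1) = b2
  generalize curlyWeight N r x m = K
  generalize x ^ m = Q at *
  have := hq.ne'
  field_simp
  ring

/-- The factors of `normProduct` built from `{z}_∞`, `{z}_∞^*` and `(z; x^{4 N})_∞`. -/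
def curlyProduct (N r : ℕ) (x c : ℝ) (p : ℕ → ℝ) : ℝ :=
  (∏ i ∈ Icc 1 (N - 1),
      (√(poch (x ^ (4 * N - 2 - 2 * i : ℝ)) (x ^ (4 * (N : ℝ)))
          * poch (x ^ (4 * N + 2 - 2 * i : ℝ)) (x ^ (4 * (N : ℝ))))
        / poch (x ^ (4 * N - 2 * i : ℝ)) (x ^ (4 * (N : ℝ)))) ^ (i * (N - i)))
  * (∏ i ∈ Icc 1 (N - 1),
      (cu N x (r - 1) (4 * N - 2 - 2 * i) * cu N x r (4 * N + 2 - 2 * i)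
        / (cu N x (r - 1) (4 * N + 2 - 2 * i) * cu N x r (4 * N - 2 - 2 * i))) ^ (i * (N - i)))
  * (∏ i ∈ Icc 1 (N - 1), ∏ j ∈ Icc 1 i, ∏ k ∈ Icc 1 (N - i),
      √(cuQuot N r x (4 * N + 2 * r - 4 * c - 2 + 2 * i - 2 * j - 2 * k - 4 * p i)
          * cuQuot N r x (2 * N - 2 * r + 4 * c + 2 + 2 * i - 2 * j - 2 * k + 4 * p i)
        / (cuQuot N r x (4 * N + 2 * r - 4 * c + 2 + 2 * i - 2 * j - 2 * k - 4 * p (i + 1))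
          * cuQuot N r x (2 * N - 2 * r + 4 * c + 6 + 2 * i - 2 * j - 2 * k + 4 * p (i + 1))))
      * √(cuQuot N r x (4 * N - 2 * r + 4 * c + 2 - 2 * i - 2 * j - 2 * k + 4 * p (i + 1))
          * cuQuot N r x (6 * N + 2 * r - 4 * c - 2 - 2 * i - 2 * j - 2 * k - 4 * p (i + 1))
        / (cuQuot N r x (4 * N - 2 * r + 4 * c + 6 - 2 * i - 2 * j - 2 * k + 4 * p i)
          * cuQuot N r x (6 * N + 2 * r - 4 * c + 2 - 2 * i - 2 * j - 2 * k - 4 * p i))))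

theorem logSeries_curlyProduct (hN : 1 ≤ N) (hr : 2 ≤ r) (hx : 0 < x) (hx1 : x < 1) (hc0 : 0 < c)
    (hc1 : c < 1) (hp0 : ∀ j ∈ Icc 1 N, 0 ≤ p j) (hp1 : ∀ j ∈ Icc 1 N, p j ≤ r - 2 - N + j) :
    LogSeries (curlyProduct N r x c p) (fun m => curlySeries N r c p (x ^ m)) := by
  refine (((logSeries_sqrtPoch hx hx1).mul (logSeries_constCurly hN hr hx hx1)).mul
    (logSeries_rectCurly hN hr hx hx1 hc0 hc1 hp0 hp1)).congr fun m _ => ?_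
  simp only [curlySeries, curlyWeight, Pi.add_apply]
  ring

end CurlyProducts

/-! ### Positivity and size of the quadratic forms. -/

section Summability

set_option linter.unusedSimpArgs false

variable {N r : ℕ} {x c : ℝ} {p : ℕ → ℝ}

theorem cartanForm_nonneg {q : ℝ} (hq : 0 < q) {y : ℕ → ℝ} (hy0 : y 0 = 0) (hyN : y N = 0) :
    0 ≤ cartanForm N q y y := by
  rw [cartanForm_eq_sum hq.ne' hy0 hyN hy0 hyN]
  refine sum_nonneg fun j _ => ?_
  have : (y j - q⁻¹ * y (j - 1)) * (q * y j - y (j - 1)) = q * (y j - q⁻¹ * y (j - 1)) ^ 2 := by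
    have := hq.ne'
    field_simp
  rw [this]
  positivity

/-- The parallelogram inequality for a positive semidefinite form. -/
theorem cartanForm_add_le {q : ℝ} (hq : 0 < q) {u v : ℕ → ℝ} (hu0 : u 0 = 0) (huN : u N = 0)
    (hv0 : v 0 = 0) (hvN : v N = 0) (s t : ℝ) :
    cartanForm N q (fun j => s * u j + t * v j) (fun j => s * u j + t * v j) ≤
      2 * s ^ 2 * cartanForm N q u u + 2 * t ^ 2 * cartanForm N q v v := by
  have h := cartanForm_nonneg (N := N) hq (y := fun j => s * u j + -t * v j) (by simp [hu0, hv0])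
    (by simp [huN, hvN])
  simp only [cartanForm_linear, cartanForm_linear_right, cartanForm_comm q v u] at h ⊢
  linarith

theorem cartanWeight_nonneg {q : ℝ} (hq : 0 < q) (hq1 : q < 1) : 0 ≤ cartanWeight N q := by
  rw [cartanWeight]
  refine div_nonneg_of_nonpos ?_ ?_
  · have := (one_lt_inv₀ hq).2 hq1
    linarith
  · have := pow_le_one₀ (n := 2 * N) hq.le hq1.le
    linarith

/-- The rank-one correction has a favourable sign and is dropped. -/
theorem cartanForm_vec_le (hN : 1 ≤ N) {q : ℝ} (hq : 0 < q) (hq1 : q < 1) (u : ℕ → ℝ) :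
    cartanForm N q (cartanVec N q u) (cartanVec N q u) ≤
      ∑ j ∈ Icc 1 N, q * (q ^ (2 * j))⁻¹ * (u j * u j) := by
  rw [cartanForm_vec_vec hN hq hq1.ne]
  have := mul_nonneg (cartanWeight_nonneg (N := N) hq hq1) (mul_self_nonneg (∑ j ∈ Icc 1 N, u j))
  linarith

theorem cartanForm_dual_le (hN : 1 ≤ N) {q : ℝ} (hq : 0 < q) (hq1 : q < 1) (u : ℕ → ℝ) :
    cartanForm N q (cartanVec N q⁻¹ u) (cartanVec N q⁻¹ u) ≤
      ∑ j ∈ Icc 1 N, q⁻¹ * q ^ (2 * j) * (u j * u j) := by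
  rw [cartanForm_dual_dual hN hq hq1.ne]
  have := mul_nonneg (mul_nonneg (pow_pos hq (2 * N)).le (cartanWeight_nonneg (N := N) hq hq1))
    (mul_self_nonneg (∑ j ∈ Icc 1 N, u j))
  linarith

theorem bracket_mul_bracket {q : ℝ} (hq : 0 < q) (s t : ℝ) :
    q ^ (s + t) * (bracket q s * bracket q t) = (1 - q ^ (2 * s)) * (1 - q ^ (2 * t)) := by
  have h : ∀ s : ℝ, q ^ s * bracket q s = -(1 - q ^ (2 * s)) := fun s => by
    rw [bracket, mul_sub, ← Real.rpow_add hq, ← Real.rpow_add hq, add_neg_cancel, Real.rpow_zero,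
      two_mul]
    ring
  rw [Real.rpow_add hq, mul_mul_mul_comm, h, h, neg_mul_neg]

theorem one_sub_le {q s : ℝ} (hq : 0 < q) (hqx : q ≤ x) (hx1 : x < 1) (hs : 1 ≤ s) :
    1 - x ≤ 1 - q ^ s := by
  have := Real.rpow_le_rpow_of_exponent_ge hq (hqx.trans hx1.le) hs
  rw [Real.rpow_one] at this
  linarith

theorem inv_bracket_le {q : ℝ} (hr : 2 ≤ r) (hx1 : x < 1) (hq : 0 < q) (hqx : q ≤ x) :
    0 < bracket q r * bracket q (r - 1) ∧
      1 / (bracket q r * bracket q (r - 1)) ≤ 1 / (1 - x) ^ 2 * q ^ (2 * (r : ℝ) - 1) := by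
  have hr' : (2 : ℝ) ≤ r := by exact_mod_cast hr
  have h1 := one_sub_le (s := 2 * (r : ℝ)) hq hqx hx1 (by linarith)
  have h2 := one_sub_le (s := 2 * ((r : ℝ) - 1)) hq hqx hx1 (by linarith)
  have hp : 0 < 1 - x := by linarith
  have h := bracket_mul_bracket hq (r : ℝ) (r - 1)
  rw [show (r : ℝ) + (r - 1) = 2 * r - 1 by ring] at h
  have hpow := Real.rpow_pos_of_pos hq (2 * (r : ℝ) - 1)
  have hge : (1 - x) ^ 2 ≤ q ^ (2 * (r : ℝ) - 1) * (bracket q r * bracket q (r - 1)) := by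
    rw [h, pow_two]
    exact mul_le_mul h1 h2 hp.le (hp.le.trans h1)
  have hpos : 0 < bracket q r * bracket q (r - 1) :=
    pos_of_mul_pos_right ((pow_pos hp 2).trans_le hge) hpow.le
  refine ⟨hpos, ?_⟩
  rw [div_mul_eq_mul_div, one_mul, div_le_div_iff₀ hpos (pow_pos hp 2), one_mul]
  exact hge

theorem kap_mul_sq (hr : 2 ≤ r) (hx : 0 < x) (hx1 : x < 1) {m : ℕ} (hm : 1 ≤ m) :
    kap r x m * (1 / (m * bracket (x ^ m) (r - 1))) ^ 2 ≤
      1 / (1 - x) ^ 2 * (x ^ m) ^ (2 * (r : ℝ) - 1) := by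
  have hq : 0 < x ^ m := pow_pos hx m
  have hqx : x ^ m ≤ x := pow_le_of_one_le hx.le hx1 hm
  obtain ⟨h1, h2⟩ := inv_bracket_le hr hx1 hq hqx
  have hm' : (1 : ℝ) ≤ m := by exact_mod_cast hm
  have hS := left_ne_zero_of_mul h1.ne'
  have hR := right_ne_zero_of_mul h1.ne'
  refine le_trans ?_ h2
  rw [kap_eq hx hx1]
  have : m * (bracket (x ^ m) (r - 1) / bracket (x ^ m) r) * (1 / (m * bracket (x ^ m) (r - 1))) ^ 2
      = 1 / (bracket (x ^ m) r * bracket (x ^ m) (r - 1)) / m := by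
    field_simp
  rw [this]
  exact div_le_self (by positivity) hm'

/-- The prefactor is of size q^{2r-1}. Once it is included, every summand is a power q^E with E ≥
4c, which gives the geometric decay x^{4cm}. -/
theorem kap_mul_sum_le (hr : 2 ≤ r) (hx : 0 < x) (hx1 : x < 1) {m : ℕ} (hm : 1 ≤ m)
    {A : ℝ} {g : ℕ → ℝ} (hA : 0 ≤ A) (hg : ∀ j, 0 ≤ g j)
    (hE : ∀ j ∈ Icc 1 N, ∃ E, 4 * c ≤ E ∧ (x ^ m) ^ (2 * (r : ℝ) - 1) * (A * g j) = (x ^ m) ^ E) :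
    kap r x m * (1 / (m * bracket (x ^ m) (r - 1))) ^ 2 * (A * ∑ j ∈ Icc 1 N, g j) ≤
      N / (1 - x) ^ 2 * (x ^ (4 * c)) ^ m := by
  have hq : 0 < x ^ m := pow_pos hx m
  have hq1 : x ^ m ≤ 1 := pow_le_one₀ hx.le hx1.le
  have hp : 0 < 1 - x := by linarith
  have hterm : ∀ j ∈ Icc 1 N, (x ^ m) ^ (2 * (r : ℝ) - 1) * (A * g j) ≤ (x ^ (4 * c)) ^ m := by
    intro j hj
    obtain ⟨E, hE1, hE2⟩ := hE j hj
    rw [hE2, rpow_pow_comm hx.le]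
    exact Real.rpow_le_rpow_of_exponent_ge hq hq1 hE1
  calc kap r x m * (1 / (m * bracket (x ^ m) (r - 1))) ^ 2 * (A * ∑ j ∈ Icc 1 N, g j)
      ≤ 1 / (1 - x) ^ 2 * (x ^ m) ^ (2 * (r : ℝ) - 1) * (A * ∑ j ∈ Icc 1 N, g j) :=
        mul_le_mul_of_nonneg_right (kap_mul_sq hr hx hx1 hm)
          (mul_nonneg hA (sum_nonneg fun j _ => hg j))
    _ = 1 / (1 - x) ^ 2 * ∑ j ∈ Icc 1 N, (x ^ m) ^ (2 * (r : ℝ) - 1) * (A * g j) := by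
        rw [← mul_sum, ← mul_sum]
        ring
    _ ≤ 1 / (1 - x) ^ 2 * ∑ j ∈ Icc 1 N, (x ^ (4 * c)) ^ m :=
        mul_le_mul_of_nonneg_left (sum_le_sum hterm) (by positivity)
    _ = N / (1 - x) ^ 2 * (x ^ (4 * c)) ^ m := by
        rw [sum_const, Nat.card_Icc, nsmul_eq_mul, Nat.add_sub_cancel]
        ring

/-- Multiplying `cartanForm_theta` by Q^N only enlarges the form, and the terms on the right become
i(N-i)(1-Q²)² Q^{2(N-1-i)} ≤ N². -/
theorem cartanForm_theta_le (hN : 1 ≤ N) {Q : ℝ} (hQ : 0 < Q) (hQ1 : Q < 1) :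
    cartanForm N (Q ^ 2) (thetaVec N Q) (thetaVec N Q) ≤ (N : ℝ) ^ 3 := by
  have h := cartanForm_theta hN hQ hQ1
  have h0 := cartanForm_nonneg (N := N) (pow_pos hQ 2) (thetaVec_zero N Q) (thetaVec_self hQ)
  set F := cartanForm N (Q ^ 2) (thetaVec N Q) (thetaVec N Q)
  have hN0 := pow_pos hQ N
  have h1 : F ≤ Q ^ N * (F * (Q ^ N + (Q ^ N)⁻¹)) := by
    have : Q ^ N * (F * (Q ^ N + (Q ^ N)⁻¹)) = F + F * (Q ^ N) ^ 2 := by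
      field_simp
      ring
    rw [this]
    have := mul_nonneg h0 (sq_nonneg (Q ^ N))
    linarith
  refine h1.trans ?_
  rw [h]
  have hterm : ∀ i ∈ Icc 1 (N - 1), Q ^ N * ((Q - Q⁻¹) ^ 2 *
      ((i * (N - i) : ℝ) * (Q ^ N * (Q ^ (2 * i))⁻¹))) ≤ (N : ℝ) ^ 2 := by
    intro i hi
    obtain ⟨hi1, hi2⟩ := mem_Icc.1 hi
    have hi1' : (1 : ℝ) ≤ i := by exact_mod_cast hi1
    have hiN : (i : ℝ) ≤ N := by exact_mod_cast (show i ≤ N by omega)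
    have e : Q ^ N * ((Q - Q⁻¹) ^ 2 * ((i * (N - i) : ℝ) * (Q ^ N * (Q ^ (2 * i))⁻¹))) =
        (i * (N - i) : ℝ) * ((1 - Q ^ 2) ^ 2 * Q ^ (2 * (N - 1 - i))) := by
      obtain ⟨k, rfl⟩ : ∃ k, N = i + 1 + k := ⟨N - 1 - i, by omega⟩
      rw [show i + 1 + k - 1 - i = k by omega]
      field_simp
      ring
    rw [e, pow_two (N : ℝ)]
    have hQ2 : Q ^ 2 ≤ 1 := pow_le_one₀ hQ.le hQ1.le
    have hle : (1 - Q ^ 2) ^ 2 * Q ^ (2 * (N - 1 - i)) ≤ 1 :=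
      mul_le_one₀ (pow_le_one₀ (by linarith) (by linarith [sq_nonneg Q])) (by positivity)
        (pow_le_one₀ hQ.le hQ1.le)
    calc (i * (N - i) : ℝ) * ((1 - Q ^ 2) ^ 2 * Q ^ (2 * (N - 1 - i)))
        ≤ (i * (N - i) : ℝ) * 1 :=
          mul_le_mul_of_nonneg_left hle (mul_nonneg (by linarith) (by linarith))
      _ ≤ (N : ℝ) * N := by
          rw [mul_one]
          exact mul_le_mul hiN (by linarith) (by linarith) (by linarith)
  rw [mul_sum, mul_sum]
  refine (sum_le_sum hterm).trans ?_
  rw [sum_const, Nat.card_Icc, nsmul_eq_mul, Nat.add_sub_cancel]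
  have : ((N - 1 : ℕ) : ℝ) ≤ N := by exact_mod_cast Nat.sub_le N 1
  nlinarith [sq_nonneg (N : ℝ)]

/-- The quotient [r]^+[r-1]^+ / ([r][r-1]) is bounded but does not decay. The decay of the θ-part
comes from the factor q^{2N} that accompanies it. -/
theorem kap_mul_thetaWeight_le (hr : 2 ≤ r) (hx : 0 < x) (hx1 : x < 1) {m : ℕ} (hm : 1 ≤ m) :
    kap r x m * (thetaWeight r x m / m) ^ 2 ≤ 4 / (1 - x) ^ 2 := by
  have hp : 0 < 1 - x := by linarith
  rw [thetaWeight, theta]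
  split_ifs with he
  · obtain ⟨k, hk⟩ := he.two_dvd
    subst hk
    have hk1 : 1 ≤ k := by omega
    have hk0 : (1 : ℝ) ≤ k := by exact_mod_cast hk1
    rw [halfPow_two_mul, kap_eq hx hx1, show x ^ (2 * k) = (x ^ k) ^ 2 by rw [← pow_mul, mul_comm]]
    have hQ : 0 < x ^ k := pow_pos hx k
    have hQx : x ^ k ≤ x := pow_le_of_one_le hx.le hx1 hk1
    generalize x ^ k = Q at *
    obtain ⟨h1, -⟩ := inv_bracket_le hr hx1 hQ hQx
    have hB := left_ne_zero_of_mul h1.ne'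
    have hB' := right_ne_zero_of_mul h1.ne'
    have hr' : (2 : ℝ) ≤ r := by exact_mod_cast hr
    have hP : plusBracket Q r ≠ 0 := by
      rw [plusBracket]
      positivity
    rw [bracket_sq hQ, bracket_sq hQ]
    push_cast
    have e : (2 : ℝ) * k * (bracket Q (r - 1) * plusBracket Q (r - 1) /
        (bracket Q r * plusBracket Q r)) * (plusBracket Q r / bracket Q (r - 1) / (2 * k)) ^ 2 =
        plusBracket Q r * plusBracket Q (r - 1) / (bracket Q r * bracket Q (r - 1)) / (2 * k) := by
      field_simp
    have hpp : Q ^ (2 * (r : ℝ) - 1) * (plusBracket Q r * plusBracket Q (r - 1)) ≤ 4 := by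
      have h : ∀ s : ℝ, Q ^ s * plusBracket Q s = 1 + Q ^ (2 * s) := fun s => by
        rw [plusBracket, mul_add, ← Real.rpow_add hQ, ← Real.rpow_add hQ, add_neg_cancel,
          Real.rpow_zero, two_mul]
        ring
      rw [show 2 * (r : ℝ) - 1 = r + (r - 1) by ring, Real.rpow_add hQ, mul_mul_mul_comm, h, h]
      have b1 := Real.rpow_le_one hQ.le (hQx.trans hx1.le) (show 0 ≤ 2 * (r : ℝ) by linarith)
      have b2 := Real.rpow_le_one hQ.le (hQx.trans hx1.le)
        (show 0 ≤ 2 * ((r : ℝ) - 1) by linarith)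
      have b0 := Real.rpow_nonneg hQ.le (2 * (r : ℝ))
      have b0' := Real.rpow_nonneg hQ.le (2 * ((r : ℝ) - 1))
      nlinarith
    have hpp0 : 0 ≤ plusBracket Q r * plusBracket Q (r - 1) := by
      rw [plusBracket, plusBracket]
      positivity
    obtain ⟨-, h2⟩ := inv_bracket_le hr hx1 hQ hQx
    rw [e]
    refine (div_le_self (by positivity) (by linarith)).trans ?_
    calc plusBracket Q r * plusBracket Q (r - 1) / (bracket Q r * bracket Q (r - 1))
        = plusBracket Q r * plusBracket Q (r - 1) * (1 / (bracket Q r * bracket Q (r - 1))) := by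
          rw [mul_one_div]
      _ ≤ plusBracket Q r * plusBracket Q (r - 1) * (1 / (1 - x) ^ 2 * Q ^ (2 * (r : ℝ) - 1)) :=
          mul_le_mul_of_nonneg_left h2 hpp0
      _ = 1 / (1 - x) ^ 2 * (Q ^ (2 * (r : ℝ) - 1) * (plusBracket Q r * plusBracket Q (r - 1))) := by
          ring
      _ ≤ 1 / (1 - x) ^ 2 * 4 := mul_le_mul_of_nonneg_left hpp (by positivity)
      _ = 4 / (1 - x) ^ 2 := by ring
  · simp only [zero_div, ne_eq, OfNat.ofNat_ne_zero, not_false_eq_true, zero_pow, mul_zero]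
    positivity

end Summability

/-! ### Summability of the quadratic terms over the modes. -/

section ModeBounds

set_option linter.unusedSimpArgs false

variable {N r : ℕ} {x c : ℝ} {p : ℕ → ℝ}

theorem kap_mul_stateVec_le (hN : 1 ≤ N) (hr : 2 ≤ r) (hx : 0 < x) (hx1 : x < 1) (hc1 : c < 1)
    (hp0 : ∀ j ∈ Icc 1 N, 0 ≤ p j) (hp1 : ∀ j ∈ Icc 1 N, p j ≤ r - 2 - N + j) {m : ℕ} (hm : 1 ≤ m) :
    kap r x m * (1 / (m * bracket (x ^ m) (r - 1))) ^ 2 * ((x ^ m) ^ (2 * N) * cartanForm N (x ^ m)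
      (stateVec N (x ^ m) (levPow r c p (x ^ m)) (levInv r c p (x ^ m)))
      (stateVec N (x ^ m) (levPow r c p (x ^ m)) (levInv r c p (x ^ m)))) ≤
      4 * (N / (1 - x) ^ 2 * (x ^ (4 * c)) ^ m) := by
  have hq : 0 < x ^ m := pow_pos hx m
  have hq1 : x ^ m < 1 := pow_lt_one₀ hx.le hx1 (by omega)
  have hN' : (1 : ℝ) ≤ N := by exact_mod_cast hN
  have hK0 : 0 ≤ kap r x m * (1 / (m * bracket (x ^ m) (r - 1))) ^ 2 :=
    mul_nonneg (kap_pos hr hx hx1 hm).le (sq_nonneg _)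
  have b1 := kap_mul_sum_le (N := N) (c := c) hr hx hx1 hm
    (A := (x ^ m) ^ (2 * N) * (x ^ m) ^ 2)
    (g := fun j => x ^ m * ((x ^ m) ^ (2 * j))⁻¹ *
      (levInv r c p (x ^ m) j * levInv r c p (x ^ m) j)) (by positivity)
    (fun j => mul_nonneg (by positivity) (mul_self_nonneg _)) (fun j hj => by
      -- The exponents add up from 2r - 1 of the prefactor, 2N + 2 of A, 1 - 2j of the form and -2(r
      -- - 2c - 2 p j) of the square of `levInv`.
      refine ⟨2 * N + 2 - 2 * j + 4 * c + 4 * p j, ?_, ?_⟩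
      · have := hp0 j hj
        have : (j : ℝ) ≤ N := by exact_mod_cast (mem_Icc.1 hj).2
        linarith
      · rw [levInv]
        generalize x ^ m = q at *
        obtain ⟨L, rfl⟩ : ∃ L, q = Real.exp L := ⟨_, (Real.exp_log hq).symm⟩
        simp only [← Real.exp_mul, ← Real.exp_nat_mul, ← Real.exp_neg, ← Real.exp_add]
        congr 1
        push_cast
        ring)
  have b2 := kap_mul_sum_le (N := N) (c := c) hr hx hx1 hm
    (A := (x ^ m) ^ (2 * N) * ((x ^ m)⁻¹) ^ 2)
    (g := fun j => (x ^ m)⁻¹ * (x ^ m) ^ (2 * j) *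
      (levPow r c p (x ^ m) j * levPow r c p (x ^ m) j)) (by positivity)
    (fun j => mul_nonneg (by positivity) (mul_self_nonneg _)) (fun j hj => by
      refine ⟨4 * r + 2 * N - 4 + 2 * j - 4 * c - 4 * p j, ?_, ?_⟩
      · have := hp1 j hj
        have : (j : ℝ) ≤ N := by exact_mod_cast (mem_Icc.1 hj).2
        linarith
      · rw [levPow]
        generalize x ^ m = q at *
        obtain ⟨L, rfl⟩ : ∃ L, q = Real.exp L := ⟨_, (Real.exp_log hq).symm⟩
        simp only [← Real.exp_mul, ← Real.exp_nat_mul, ← Real.exp_neg, ← Real.exp_add]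
        congr 1
        push_cast
        ring)
  have h := cartanForm_add_le (N := N) hq
    (cartanVec_zero (N := N) (q := x ^ m) (levInv r c p (x ^ m)))
    (cartanVec_self hN hq (levInv r c p (x ^ m)))
    (cartanVec_zero (N := N) (q := (x ^ m)⁻¹) (levPow r c p (x ^ m)))
    (cartanVec_self hN (inv_pos.2 hq) (levPow r c p (x ^ m))) (x ^ m) (-(x ^ m)⁻¹)
  have h1 := cartanForm_vec_le hN hq hq1 (levInv r c p (x ^ m))
  have h2 := cartanForm_dual_le hN hq hq1 (levPow r c p (x ^ m))
  change cartanForm N (x ^ m) (stateVec N (x ^ m) _ _) (stateVec N (x ^ m) _ _) ≤ _ at h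
  have h3 : cartanForm N (x ^ m)
      (stateVec N (x ^ m) (levPow r c p (x ^ m)) (levInv r c p (x ^ m)))
      (stateVec N (x ^ m) (levPow r c p (x ^ m)) (levInv r c p (x ^ m))) ≤
      2 * (x ^ m) ^ 2 * ∑ j ∈ Icc 1 N, x ^ m * ((x ^ m) ^ (2 * j))⁻¹ *
        (levInv r c p (x ^ m) j * levInv r c p (x ^ m) j) +
      2 * ((x ^ m)⁻¹) ^ 2 * ∑ j ∈ Icc 1 N, (x ^ m)⁻¹ * (x ^ m) ^ (2 * j) *
        (levPow r c p (x ^ m) j * levPow r c p (x ^ m) j) := by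
    refine h.trans (add_le_add (mul_le_mul_of_nonneg_left h1 (by positivity)) ?_)
    rw [neg_sq]
    exact mul_le_mul_of_nonneg_left h2 (by positivity)
  refine (mul_le_mul_of_nonneg_left (mul_le_mul_of_nonneg_left h3 (pow_pos hq (2 * N)).le)
    hK0).trans ?_
  linarith

theorem kap_mul_dualStateVec_le (hN : 1 ≤ N) (hr : 2 ≤ r) (hx : 0 < x) (hx1 : x < 1) (hc1 : c < 1)
    (hp0 : ∀ j ∈ Icc 1 N, 0 ≤ p j) (hp1 : ∀ j ∈ Icc 1 N, p j ≤ r - 2 - N + j) {m : ℕ} (hm : 1 ≤ m) :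
    kap r x m * (1 / (m * bracket (x ^ m) (r - 1))) ^ 2 * cartanForm N (x ^ m)
      (dualStateVec N (x ^ m) (levPow r c p (x ^ m)) (levInv r c p (x ^ m)))
      (dualStateVec N (x ^ m) (levPow r c p (x ^ m)) (levInv r c p (x ^ m))) ≤
      4 * (N / (1 - x) ^ 2 * (x ^ (4 * c)) ^ m) := by
  have hq : 0 < x ^ m := pow_pos hx m
  have hq1 : x ^ m < 1 := pow_lt_one₀ hx.le hx1 (by omega)
  have hN' : (1 : ℝ) ≤ N := by exact_mod_cast hN
  have hK0 : 0 ≤ kap r x m * (1 / (m * bracket (x ^ m) (r - 1))) ^ 2 :=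
    mul_nonneg (kap_pos hr hx hx1 hm).le (sq_nonneg _)
  have b1 := kap_mul_sum_le (N := N) (c := c) hr hx hx1 hm
    (A := (x ^ m) ^ 2)
    (g := fun j => (x ^ m)⁻¹ * (x ^ m) ^ (2 * j) *
      (levInv r c p (x ^ m) j * levInv r c p (x ^ m) j)) (by positivity)
    (fun j => mul_nonneg (by positivity) (mul_self_nonneg _)) (fun j hj => by
      refine ⟨2 * j + 4 * c + 4 * p j, ?_, ?_⟩
      · have := hp0 j hj
        have : (0 : ℝ) ≤ j := by positivity
        linarith
      · rw [levInv]
        generalize x ^ m = q at *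
        obtain ⟨L, rfl⟩ : ∃ L, q = Real.exp L := ⟨_, (Real.exp_log hq).symm⟩
        simp only [← Real.exp_mul, ← Real.exp_nat_mul, ← Real.exp_neg, ← Real.exp_add]
        congr 1
        push_cast
        ring)
  have b2 := kap_mul_sum_le (N := N) (c := c) hr hx hx1 hm
    (A := ((x ^ m) ^ (2 * N) * (x ^ m)⁻¹) ^ 2)
    (g := fun j => x ^ m * ((x ^ m) ^ (2 * j))⁻¹ *
      (levPow r c p (x ^ m) j * levPow r c p (x ^ m) j)) (by positivity)
    (fun j => mul_nonneg (by positivity) (mul_self_nonneg _)) (fun j hj => by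
      refine ⟨4 * r + 4 * N - 2 - 2 * j - 4 * c - 4 * p j, ?_, ?_⟩
      · have := hp1 j hj
        have : (j : ℝ) ≤ N := by exact_mod_cast (mem_Icc.1 hj).2
        linarith
      · rw [levPow]
        generalize x ^ m = q at *
        obtain ⟨L, rfl⟩ : ∃ L, q = Real.exp L := ⟨_, (Real.exp_log hq).symm⟩
        simp only [← Real.exp_mul, ← Real.exp_nat_mul, ← Real.exp_neg, ← Real.exp_add]
        congr 1
        push_cast
        ring)
  have h := cartanForm_add_le (N := N) hq
    (cartanVec_zero (N := N) (q := (x ^ m)⁻¹) (levInv r c p (x ^ m)))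
    (cartanVec_self hN (inv_pos.2 hq) (levInv r c p (x ^ m)))
    (cartanVec_zero (N := N) (q := x ^ m) (levPow r c p (x ^ m)))
    (cartanVec_self hN hq (levPow r c p (x ^ m))) (x ^ m) (-((x ^ m) ^ (2 * N) * (x ^ m)⁻¹))
  have h1 := cartanForm_dual_le hN hq hq1 (levInv r c p (x ^ m))
  have h2 := cartanForm_vec_le hN hq hq1 (levPow r c p (x ^ m))
  change cartanForm N (x ^ m) (dualStateVec N (x ^ m) _ _) (dualStateVec N (x ^ m) _ _) ≤ _ at h
  have h3 : cartanForm N (x ^ m)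
      (dualStateVec N (x ^ m) (levPow r c p (x ^ m)) (levInv r c p (x ^ m)))
      (dualStateVec N (x ^ m) (levPow r c p (x ^ m)) (levInv r c p (x ^ m))) ≤
      2 * (x ^ m) ^ 2 * ∑ j ∈ Icc 1 N, (x ^ m)⁻¹ * (x ^ m) ^ (2 * j) *
        (levInv r c p (x ^ m) j * levInv r c p (x ^ m) j) +
      2 * ((x ^ m) ^ (2 * N) * (x ^ m)⁻¹) ^ 2 * ∑ j ∈ Icc 1 N, x ^ m * ((x ^ m) ^ (2 * j))⁻¹ *
        (levPow r c p (x ^ m) j * levPow r c p (x ^ m) j) := by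
    refine h.trans (add_le_add (mul_le_mul_of_nonneg_left h1 (by positivity)) ?_)
    rw [neg_sq]
    exact mul_le_mul_of_nonneg_left h2 (by positivity)
  refine (mul_le_mul_of_nonneg_left h3 hK0).trans ?_
  linarith

/-- Both θ-contributions carry q^{2N}: for the state it is the explicit factor, for the dual it is
the square of q^N in its linear part. -/
theorem kap_mul_form_le (hN : 1 ≤ N) (hr : 2 ≤ r) (hx : 0 < x) (hx1 : x < 1) (hc1 : c < 1)
    (hp0 : ∀ j ∈ Icc 1 N, 0 ≤ p j) (hp1 : ∀ j ∈ Icc 1 N, p j ≤ r - 2 - N + j) {m : ℕ} (hm : 1 ≤ m) :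
    kap r x m * ((x ^ m) ^ (2 * N) *
        cartanForm N (x ^ m) (linPart N r x c p m) (linPart N r x c p m) +
      cartanForm N (x ^ m) (dualLinPart N r x c p m) (dualLinPart N r x c p m)) ≤
      16 * (N / (1 - x) ^ 2 * (x ^ (4 * c)) ^ m) + 16 * (N : ℝ) ^ 3 / (1 - x) ^ 2 * x ^ m := by
  have hq : 0 < x ^ m := pow_pos hx m
  have hQ := halfPow_pos hx m
  have hQ1 := halfPow_lt_one hx hx1 hm
  have hκ := kap_pos hr hx hx1 hm
  have hp : 0 < 1 - x := by linarith
  have h1 := cartanForm_add_le (N := N) hq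
    (stateVec_zero (N := N) (x ^ m) (levPow r c p (x ^ m)) (levInv r c p (x ^ m)))
    (stateVec_self hN hq (levPow r c p (x ^ m)) (levInv r c p (x ^ m)))
    (thetaVec_zero N (halfPow x m)) (thetaVec_self hQ)
    (1 / (m * bracket (x ^ m) (r - 1))) (-(thetaWeight r x m / m))
  have h2 := cartanForm_add_le (N := N) hq
    (dualStateVec_zero (N := N) (x ^ m) (levPow r c p (x ^ m)) (levInv r c p (x ^ m)))
    (dualStateVec_self hN hq (levPow r c p (x ^ m)) (levInv r c p (x ^ m)))
    (thetaVec_zero N (halfPow x m)) (thetaVec_self hQ)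
    (1 / (m * bracket (x ^ m) (r - 1))) ((x ^ m) ^ N * (thetaWeight r x m / m))
  change cartanForm N (x ^ m) (linPart N r x c p m) (linPart N r x c p m) ≤ _ at h1
  change cartanForm N (x ^ m) (dualLinPart N r x c p m) (dualLinPart N r x c p m) ≤ _ at h2
  have h3 := kap_mul_stateVec_le hN hr hx hx1 hc1 hp0 hp1 hm
  have h4 := kap_mul_dualStateVec_le hN hr hx hx1 hc1 hp0 hp1 hm
  have h5 := cartanForm_theta_le hN hQ hQ1
  have h6 := kap_mul_thetaWeight_le hr hx hx1 hm
  have h0 := cartanForm_nonneg (N := N) (pow_pos hQ 2) (thetaVec_zero N (halfPow x m))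
    (thetaVec_self hQ)
  rw [halfPow_sq hx] at h5 h0
  have hγ : (x ^ m) ^ (2 * N) ≤ x ^ m := pow_le_of_le_one hq.le (pow_le_one₀ hx.le hx1.le) (by omega)
  have h7 : kap r x m * (thetaWeight r x m / m) ^ 2 *
      cartanForm N (x ^ m) (thetaVec N (halfPow x m)) (thetaVec N (halfPow x m)) *
        (x ^ m) ^ (2 * N) ≤ 4 / (1 - x) ^ 2 * (N : ℝ) ^ 3 * x ^ m :=
    mul_le_mul (mul_le_mul h6 h5 h0 (by positivity)) hγ (by positivity) (by positivity)
  have h8 := mul_le_mul_of_nonneg_left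
    (add_le_add (mul_le_mul_of_nonneg_left h1 (pow_pos hq (2 * N)).le) h2) hκ.le
  refine h8.trans ?_
  rw [neg_sq, mul_pow ((x ^ m) ^ N), show ((x ^ m) ^ N) ^ 2 = (x ^ m) ^ (2 * N) by
    rw [← pow_mul, mul_comm N 2]]
  rw [show 16 * (N : ℝ) ^ 3 / (1 - x) ^ 2 * x ^ m = 4 * (4 / (1 - x) ^ 2 * (N : ℝ) ^ 3 * x ^ m) by ring]
  linarith

theorem summable_kap_mul_form (hN : 1 ≤ N) (hr : 2 ≤ r) (hx : 0 < x) (hx1 : x < 1) (hc0 : 0 < c)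
    (hc1 : c < 1)
    (hp0 : ∀ j ∈ Icc 1 N, 0 ≤ p j) (hp1 : ∀ j ∈ Icc 1 N, p j ≤ r - 2 - N + j) :
    Summable fun m => |kap r x m * ((x ^ m) ^ (2 * N) *
        cartanForm N (x ^ m) (linPart N r x c p m) (linPart N r x c p m) +
      cartanForm N (x ^ m) (dualLinPart N r x c p m) (dualLinPart N r x c p m))| := by
  have hp : 0 < 1 - x := by linarith
  have hg1 : Summable fun m : ℕ => 16 * (N / (1 - x) ^ 2 * (x ^ (4 * c)) ^ m) :=
    ((summable_geometric_of_lt_one (Real.rpow_nonneg hx.le _)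
      (Real.rpow_lt_one hx.le hx1 (by linarith))).mul_left _).mul_left _
  have hg2 : Summable fun m : ℕ => 16 * (N : ℝ) ^ 3 / (1 - x) ^ 2 * x ^ m :=
    (summable_geometric_of_lt_one hx.le hx1).mul_left _
  refine (hg1.add hg2).of_nonneg_of_le (fun m => abs_nonneg _) fun m => ?_
  rcases Nat.eq_zero_or_pos m with rfl | hm
  · simp only [kap, Nat.cast_zero, zero_mul, abs_zero]
    have := Real.rpow_nonneg hx.le (4 * c)
    positivity
  · have hq : 0 < x ^ m := pow_pos hx m
    have hQ := halfPow_pos hx m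
    rw [abs_of_nonneg]
    · exact kap_mul_form_le hN hr hx hx1 hc1 hp0 hp1 hm
    · refine mul_nonneg (kap_pos hr hx hx1 hm).le (add_nonneg (mul_nonneg (by positivity) ?_) ?_)
      · refine cartanForm_nonneg hq ?_ ?_
        · simp [linPart, stateVec_zero, thetaVec_zero]
        · simp [linPart, stateVec_self hN hq, thetaVec_self hQ]
      · refine cartanForm_nonneg hq ?_ ?_
        · simp [dualLinPart, dualStateVec_zero, thetaVec_zero]
        · simp [dualLinPart, dualStateVec_self hN hq, thetaVec_self hQ]

end ModeBounds

/-! ### Assembly of the norm. -/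

section Norm

variable {N r : ℕ} {x c : ℝ} {p : ℕ → ℝ}

theorem hasSum_even {f : ℕ → ℝ} {S : ℝ} (h : HasSum f S) :
    HasSum (fun m : ℕ => if Even m then f (m / 2) else 0) S := by
  have hinj : Function.Injective fun k : ℕ => 2 * k := fun a b hab => by
    simpa using hab
  refine (hinj.hasSum_iff fun m hm => if_neg fun he => hm ?_).1 ?_
  · obtain ⟨k, hk⟩ := he.two_dvd
    exact ⟨k, hk.symm⟩
  · simpa [Function.comp_def] using h

/-- The mode `m` part of the logarithm of the norm, without the logarithmic term. -/
def modeSeries (N r : ℕ) (x c : ℝ) (p : ℕ → ℝ) (m : ℕ) : ℝ :=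
  squareSeries N r c p (x ^ m) / m +
    if Even m then curlySeries N r c p (x ^ (m / 2)) / (m / 2 : ℕ) else 0

theorem modeSeries_zero : modeSeries N r x c p 0 = 0 := by
  simp [modeSeries]

theorem hasSum_modeSeries (hN : 1 ≤ N) (hr : 2 ≤ r) (hx : 0 < x) (hx1 : x < 1) (hc0 : 0 < c)
    (hc1 : c < 1) (hp0 : ∀ j ∈ Icc 1 N, 0 ≤ p j) (hp1 : ∀ j ∈ Icc 1 N, p j ≤ r - 2 - N + j) :
    HasSum (modeSeries N r x c p)
      (Real.log (squareProduct N r x c p) + Real.log (curlyProduct N r x c p)) := by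
  have hcurly := hasSum_even (f := fun k => curlySeries N r c p (x ^ k) / k)
    (logSeries_curlyProduct hN hr hx hx1 hc0 hc1 hp0 hp1).2
  have h := (logSeries_squareProduct hN hr hx hx1 hc0 hc1 hp0 hp1).2.add hcurly
  have e : modeSeries N r x c p = fun m : ℕ => squareSeries N r c p (x ^ m) / m +
    if Even m then curlySeries N r c p (x ^ (m / 2)) / (m / 2 : ℕ) else 0 := rfl
  rw [e]
  exact h

theorem one_sub_pow_pos (hN : 1 ≤ N) (hx : 0 < x) (hx1 : x < 1) {m : ℕ} (hm : 1 ≤ m) :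
    0 < 1 - (x ^ m) ^ (2 * N) :=
  sub_pos.2 (pow_lt_one₀ (pow_pos hx m).le (pow_lt_one₀ hx.le hx1 (by omega)) (by omega))

theorem kap_mul_pairingForm_eq (hN : 1 ≤ N) (hr : 2 ≤ r) (hx : 0 < x) (hx1 : x < 1) (m : ℕ) :
    kap r x m * pairingForm N (x ^ m) (linPart N r x c p m) (dualLinPart N r x c p m) =
      (1 - (x ^ m) ^ (2 * N)) * modeSeries N r x c p m := by
  rcases Nat.eq_zero_or_pos m with rfl | hm
  · simp [kap]
  · rw [modeSeries, ← kap_mul_pairingForm hN hr hx hx1 hm,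
      mul_div_cancel₀ _ (one_sub_pow_pos hN hx hx1 hm).ne']

/-- The mixed term is the full exponent plus half the quadratic terms. The former is (1-γ) times a
series already summed through the logarithms of the products, so no separate estimate is needed. -/
theorem summable_kap_mul_cartanForm (hN : 1 ≤ N) (hr : 2 ≤ r) (hx : 0 < x) (hx1 : x < 1)
    (hc0 : 0 < c) (hc1 : c < 1) (hp0 : ∀ j ∈ Icc 1 N, 0 ≤ p j)
    (hp1 : ∀ j ∈ Icc 1 N, p j ≤ r - 2 - N + j) :
    Summable fun m =>
      |kap r x m * cartanForm N (x ^ m) (linPart N r x c p m) (dualLinPart N r x c p m)| := by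
  have h1 := (hasSum_modeSeries hN hr hx hx1 hc0 hc1 hp0 hp1).summable.abs
  have h2 := (summable_kap_mul_form hN hr hx hx1 hc0 hc1 hp0 hp1).div_const 2
  refine (h1.add h2).of_nonneg_of_le (fun m => abs_nonneg _) fun m => ?_
  have h := kap_mul_pairingForm_eq (c := c) (p := p) hN hr hx hx1 m
  rw [pairingForm] at h
  have hγ0 : 0 ≤ (x ^ m) ^ (2 * N) := by positivity
  have hγ1 : (x ^ m) ^ (2 * N) ≤ 1 := pow_le_one₀ (by positivity) (pow_le_one₀ hx.le hx1.le)
  have e : kap r x m * cartanForm N (x ^ m) (linPart N r x c p m) (dualLinPart N r x c p m) =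
      (1 - (x ^ m) ^ (2 * N)) * modeSeries N r x c p m + kap r x m * ((x ^ m) ^ (2 * N) *
        cartanForm N (x ^ m) (linPart N r x c p m) (linPart N r x c p m) +
      cartanForm N (x ^ m) (dualLinPart N r x c p m) (dualLinPart N r x c p m)) / 2 := by
    rw [← h]
    ring
  rw [e]
  refine (abs_add_le _ _).trans (add_le_add ?_ ?_)
  · rw [abs_mul]
    exact mul_le_of_le_one_left (abs_nonneg _) (abs_le.2 ⟨by linarith, by linarith⟩)
  · rw [abs_div, abs_two]

theorem normProduct_eq (N r : ℕ) (x c : ℝ) (p : ℕ → ℝ) : normProduct N r x c p =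
    1 / poch (x ^ (2 * N)) (x ^ (2 * N)) ^ (((N : ℝ) - 1) / 2) * curlyProduct N r x c p *
      squareProduct N r x c p := by
  rw [normProduct, curlyProduct, squareProduct, rpow_two_mul_natCast]
  ring

/-- The determinants sum to -(N-1)/2 times log (x^{2N}; x^{2N})_∞ and the exponents to the
logarithms of the two remaining products. All three products are positive, so exponentiating
recovers them. -/
theorem hasNorm_normProduct (hN : 1 ≤ N) (hr : 2 ≤ r) (hx : 0 < x) (hx1 : x < 1) (hc0 : 0 < c)
    (hc1 : c < 1) (hp0 : ∀ j ∈ Icc 1 N, 0 ≤ p j) (hp1 : ∀ j ∈ Icc 1 N, p j ≤ r - 2 - N + j) :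
    HasNorm N r x c p ((normProduct N r x c p : ℝ) : ℂ) := by
  obtain ⟨hP, hlog⟩ := hasSum_log_poch_self (pow_pos hx (2 * N))
    (pow_lt_one₀ hx.le hx1 (show 2 * N ≠ 0 by omega))
  have hN1 : ((N - 1 : ℕ) : ℝ) = N - 1 := by rw [Nat.cast_sub hN, Nat.cast_one]
  have hV := (hlog.mul_left (-((N - 1 : ℕ) / 2 : ℝ))).add
    (hasSum_modeSeries hN hr hx hx1 hc0 hc1 hp0 hp1)
  have hexp : normProduct N r x c p =
      Real.exp (-((N - 1 : ℕ) / 2 : ℝ) * Real.log (poch (x ^ (2 * N)) (x ^ (2 * N))) +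
        (Real.log (squareProduct N r x c p) + Real.log (curlyProduct N r x c p))) := by
    rw [normProduct_eq, Real.exp_add, Real.exp_add,
      Real.exp_log (logSeries_squareProduct hN hr hx hx1 hc0 hc1 hp0 hp1).1,
      Real.exp_log (logSeries_curlyProduct hN hr hx hx1 hc0 hc1 hp0 hp1).1, hN1,
      Real.rpow_def_of_pos hP, one_div, ← Real.exp_neg, neg_mul, mul_comm (((N : ℝ) - 1) / 2)]
    ring
  rw [hexp]
  refine hasNorm_of_hasSum hN hr hx hx1 (fun m hm => sum_coefD_smul_create hN hr hx hx1 hm)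
    (fun m hm => sum_coefE_smul_annih hN hr hx hx1 hm)
    (summable_kap_mul_cartanForm hN hr hx hx1 hc0 hc1 hp0 hp1)
    (summable_kap_mul_form hN hr hx hx1 hc0 hc1 hp0 hp1) ?_
  refine Eq.mpr (congrArg (fun f => HasSum f _) (funext fun m => ?_)) hV
  split_ifs with hm
  · rw [modeSeries, ← kap_mul_pairingForm hN hr hx hx1 hm, pairingForm, ← pow_mul, ← pow_mul,
      mul_comm m]
    ring
  -- At m = 0 both sides vanish, since `modeSeries` divides by the cast of 0.
  · obtain rfl : m = 0 := by omega
    rw [modeSeries_zero]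
    simp

end Norm

/-! ### The zero modes and the bounds on π_{1,j}. -/

section Weights

variable {N r : ℕ}

theorem eps_apply (μ i : ℕ) : eps μ i = if i = μ then 1 else 0 := by
  rw [eps, Pi.single_apply]

theorem omega_sub_omega {μ j : ℕ} (hN : 1 ≤ N) (hμ : 1 ≤ μ) (hj : j ∈ Icc 1 N) :
    omega N μ 1 - omega N μ j = if μ < j then 1 else 0 := by
  obtain ⟨hj1, hjN⟩ := mem_Icc.1 hj
  have h : ∀ i ∈ Icc 1 N, omega N μ i = (if i ≤ μ then 1 else 0) - μ / N := by
    intro i hi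
    have hi1 := (mem_Icc.1 hi).1
    have h1 : (∑ ν ∈ Icc 1 N, eps ν) i = 1 := by
      simp [Finset.sum_apply, eps_apply, hi1, (mem_Icc.1 hi).2]
    simp only [omega, epsBar, Finset.sum_apply, Pi.sub_apply, Pi.smul_apply, h1, eps_apply,
      sum_sub_distrib, smul_eq_mul] at h1 ⊢
    simp [hi1, div_eq_mul_inv]
  rw [h 1 (by simp [hN]), h j hj, if_pos hμ]
  split_ifs <;> first | omega | ring

theorem ip_epsBar_sub {k : ℕ → ℝ} (hN : 1 ≤ N) {j : ℕ} (hj : j ∈ Icc 1 N) :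
    ip N (epsBar N 1) k - ip N (epsBar N j) k = k 1 - k j := by
  have h1 : (1 : ℕ) ∈ Icc 1 N := by simp [hN]
  have e : ∀ i ∈ Icc 1 N, ∑ ν ∈ Icc 1 N, eps i ν * k ν = k i := by
    intro i hi
    simp only [eps_apply, ite_mul, one_mul, zero_mul]
    rw [sum_ite_eq' _ _ _, if_pos hi]
  simp only [ip, epsBar, Pi.sub_apply, sub_mul, sum_sub_distrib]
  rw [e 1 h1, e j hj]
  ring

/-- For l = k the two square roots in the momentum, multiplied by √(r(r-1)), are r and r - 1, and
their difference is 1. -/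
theorem piVal_eq (hr : 2 ≤ r) (hN : 1 ≤ N) (k : ℕ → ℝ) {j : ℕ} (hj : j ∈ Icc 1 N) :
    piVal N r k k 1 j = k 1 - k j := by
  have hr' : (2 : ℝ) ≤ r := by exact_mod_cast hr
  have hr0 : (r : ℝ) ≠ 0 := by linarith
  have hr1 : (r : ℝ) - 1 ≠ 0 := by linarith
  have hm : ∀ u, momentum N r k k u =
      (√((r : ℝ) / ((r : ℝ) - 1)) - √(((r : ℝ) - 1) / (r : ℝ))) * ip N u k := by
    intro u
    simp only [momentum, ip, mul_sum, Pi.sub_apply, Pi.smul_apply, smul_eq_mul]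
    exact sum_congr rfl fun _ _ => by ring
  have h0 : 0 ≤ (r : ℝ) * (r - 1) := mul_nonneg (by linarith) (by linarith)
  have s1 : √((r : ℝ) * ((r : ℝ) - 1)) * √((r : ℝ) / ((r : ℝ) - 1)) = r := by
    rw [← Real.sqrt_mul h0, show (r : ℝ) * (r - 1) * (r / (r - 1)) = r ^ 2 by field_simp,
      Real.sqrt_sq (by linarith)]
  have s2 : √((r : ℝ) * ((r : ℝ) - 1)) * √(((r : ℝ) - 1) / (r : ℝ)) = r - 1 := by
    rw [← Real.sqrt_mul h0, show (r : ℝ) * (r - 1) * ((r - 1) / r) = (r - 1 : ℝ) ^ 2 by field_simp,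
      Real.sqrt_sq (by linarith)]
  rw [piVal, hm, hm]
  have := ip_epsBar_sub (k := k) hN hj
  linear_combination (ip N (epsBar N 1) k - ip N (epsBar N j) k) * (s1 - s2) + this

theorem piVal_add_rho (hr : 2 ≤ r) (hN : 1 ≤ N) (n : ℕ → ℕ) {k : ℕ → ℝ}
    (hk : k = ∑ μ ∈ Icc 1 (N - 1), (n μ : ℝ) • omega N μ + rho N) {j : ℕ} (hj : j ∈ Icc 1 N) :
    piVal N r k k 1 j = ∑ μ ∈ Icc 1 (N - 1), ((n μ : ℝ) + 1) * if μ < j then 1 else 0 := by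
  rw [piVal_eq hr hN k hj, hk]
  simp only [rho, Pi.add_apply, Finset.sum_apply, Pi.smul_apply, smul_eq_mul]
  rw [← sum_add_distrib, ← sum_add_distrib, ← sum_sub_distrib]
  refine sum_congr rfl fun μ hμ => ?_
  rw [← omega_sub_omega hN (mem_Icc.1 hμ).1 hj]
  ring

/-- π_{1,j} is the sum of n_μ + 1 over μ < j. Enlarging the sum of the n_μ to all μ bounds it by (r
- 1 - N) + (j - 1). -/
theorem piVal_bounds (hr : 2 ≤ r) (hN : 1 ≤ N) {a k : ℕ → ℝ}
    (ha : a ∈ restrictedWeights N (r - 1)) (hk : k = a + rho N) {j : ℕ} (hj : j ∈ Icc 1 N) :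
    0 ≤ piVal N r k k 1 j ∧ piVal N r k k 1 j ≤ r - 2 - N + j := by
  obtain ⟨n, hn, rfl⟩ := ha
  rw [piVal_add_rho hr hN n hk hj]
  refine ⟨sum_nonneg fun μ _ => by split_ifs <;> positivity, ?_⟩
  have hn' : (∑ μ ∈ Icc 1 (N - 1), (n μ : ℝ)) + N + 1 ≤ r := by
    exact_mod_cast (show (∑ μ ∈ Icc 1 (N - 1), n μ) + N + 1 ≤ r by omega)
  have hcard : ∑ μ ∈ Icc 1 (N - 1), (if μ < j then (1 : ℝ) else 0) = j - 1 := by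
    obtain ⟨hj1, hjN⟩ := mem_Icc.1 hj
    rw [sum_ite, sum_const_zero, add_zero, sum_const, nsmul_eq_mul, mul_one,
      show filter (· < j) (Icc 1 (N - 1)) = Icc 1 (j - 1) by
        ext i
        simp only [mem_filter, mem_Icc]
        omega, Nat.card_Icc, Nat.add_sub_cancel, Nat.cast_sub hj1, Nat.cast_one]
  calc ∑ μ ∈ Icc 1 (N - 1), ((n μ : ℝ) + 1) * (if μ < j then (1 : ℝ) else 0)
      ≤ ∑ μ ∈ Icc 1 (N - 1), ((n μ : ℝ) + if μ < j then (1 : ℝ) else 0) := by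
        refine sum_le_sum fun μ _ => ?_
        split_ifs <;> simp
    _ = ∑ μ ∈ Icc 1 (N - 1), (n μ : ℝ) + (j - 1) := by rw [sum_add_distrib, hcard]
    _ ≤ r - 2 - N + j := by linarith

end Weights

end BoundaryFace

end

theorem theorem3 (N r : ℕ) (x c : ℝ) (a k : ℕ → ℝ) (hN : 2 ≤ N) (hr : N + 2 ≤ r)
    (hx0 : 0 < x) (hx1 : x < 1) (hc0 : 0 < c) (hc1 : c < 1)
    (ha : a ∈ BoundaryFace.restrictedWeights N (r - 1)) (hk : k = a + BoundaryFace.rho N) :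
    BoundaryFace.HasNorm N r x c (BoundaryFace.piVal N r k k 1)
      ((BoundaryFace.normProduct N r x c (BoundaryFace.piVal N r k k 1) : ℝ) : ℂ) := by
  refine BoundaryFace.hasNorm_normProduct (by omega) (by omega) hx0 hx1 hc0 hc1
    (fun j hj => (BoundaryFace.piVal_bounds (by omega) (by omega) ha hk hj).1)
    (fun j hj => (BoundaryFace.piVal_bounds (by omega) (by omega) ha hk hj).2)
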